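/- Fix $\gamma\in(1,2)$, $0<\alpha\le\beta<1$ and $T>0$. Let $c_\gamma=\big(\sum_{z\in\mathbb Z\setminus\{0\}}|z|^{-1-\gamma}\big)^{-1}$ and, for $u\in(0,1)$, $$V_1(u)=\tfrac{c_\gamma}{\gamma}\big(u^{-\gamma}+(1-u)^{-\gamma}\big),\qquad V_0(u)=\tfrac{c_\gamma}{\gamma}\big(\alpha u^{-\gamma}+\beta(1-u)^{-\gamma}\big),\qquad \bar\rho^\infty=\frac{V_0}{V_1}.$$ For $G\in C_c^\infty((0,1))$ let $\mathbb L G(u)=c_\gamma\lim_{\varepsilon\to0^+}\int_0^1 \mathbf 1_{\{|u-v|\ge\varepsilon\}}\frac{G(v)-G(u)}{|u-v|^{1+\gamma}}\,dv$ be the regional fractional Laplacian, and $\mathbb L_\kappa=\mathbb L-\kappa V_1$. Let $\mathcal H^{\gamma/2}$ be the space of $g\in L^2(0,1)$ with $\|g\|_{\mathcal H^{\gamma/2}}^2=\|g\|_{L^2}^2+\frac{c_\gamma}{2}\iint_{[0,1]^2}\frac{(g(u)-g(v))^2}{|u-v|^{1+\gamma}}\,du\,dv<\infty$ (its elements have continuous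 representatives on $[0,1]$), and let $L^2_{V_1}=L^2((0,1),V_1(u)\,du)$. Test functions are the functions $G$ on $[0,T]\times(0,1)$ with compact support in $[0,T]\times(0,1)$, once continuously differentiable in $t$ and infinitely differentiable in $u$ (with $G$, $\partial_tG$ and all $\partial_u^nG$ jointly continuous). Write $\langle\cdot,\cdot\rangle$ for the integral over $(0,1)$ of the product. For measurable $g:[0,1]\to[0,1]$ and $\kappa\ge0$, a measurable function $\rho:[0,T]\times[0,1]\to[0,1]$ is a weak solution of $$\partial_t\rho_t=\mathbb L_\kappa\rho_t+\kappa V_0,\qquad \rho_t(0)=\alpha,\ \rho_t(1)=\beta,\qquad \rho_0=g \tag{$D_\kappa$}$$ if (a) $\rho\in L^2(0,T;\mathcal H^{\gamma/2})$; (b) if $\kappa>0$, then $$\int_0^T\!\!\int_0^1\Big\{\frac{(\alpha-\rho_t(u))^2}{u^\gamma}+\frac{(\beta-\rho_t(u))^2}{(1-u)^\gamma}\Big\}\,du\,dt<\infty, \tag{B}$$ while if $\kappa=0$, then for almost every $t\in[0,T]$ the continuous representative of $\rho_t$ equals $\alpha$ at $0$ and $\beta$ at $1$; (c) for all $t\in[0,T]$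 and all test functions $G$, $$\langle\rho_t,G_t\rangle-\langle g,G_0\rangle-\int_0^t\langle\rho_s,(\partial_s+\mathbb L_\kappa)G_s\rangle\,ds-\kappa\int_0^t\langle G_s,V_0\rangle\,ds=0 .$$ It is a weak solution of the reaction equation $$\partial_t\rho_t=-V_1\rho_t+V_0,\qquad \rho_t(0)=\alpha,\ \rho_t(1)=\beta,\qquad \rho_0=g \tag{$R$}$$ if (B) holds and, for all $t\in[0,T]$ and all test functions $G$, $$\langle\rho_t,G_t\rangle-\langle g,G_0\rangle-\int_0^t\langle\rho_s,\partial_sG_s\rangle\,ds+\int_0^t\langle\rho_s,V_1G_s\rangle\,ds-\int_0^t\langle G_s,V_0\rangle\,ds=0 .$$ **Theorem.** Let $\rho_0:[0,1]\to[0,1]$ be measurable and, for every $\kappa>0$, let $\rho^\kappa$ be the weak solution of $(D_\kappa)$ with initial condition $\rho_0$ (the same for all $\kappa$). (i) There is a weak solution $\rho^0$ of $(D_0)$ with initial condition $\rho_0$; it is unique up to null sets of $u$, for each $t\in[0,T]$; and $\rho^\kappa\to\rho^0$ strongly in $L^2(0,T;\mathcal H^{\gamma/2})$ as $\kappa\to0^+$.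 (ii) If $\rho_0-\bar\rho^\infty\in\mathcal H^{\gamma/2}$, then $$\rho^\infty_t(u)=\bar\rho^\infty(u)+\big(\rho_0(u)-\bar\rho^\infty(u)\big)e^{-tV_1(u)}$$ is the weak solution of $(R)$ with initial condition $\rho_0$, unique up to null sets of $u$ for each $t\in[0,T]$, and $\hat\rho^\kappa_t:=\rho^\kappa_{t/\kappa}$ converges to $\rho^\infty$ in $L^2(0,T;L^2_{V_1})$ as $\kappa\to\infty$, that is, $\int_0^T\|\hat\rho^\kappa_t-\rho^\infty_t\|_{L^2_{V_1}}^2\,dt\to0$. -/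

import Mathlib

open Set Filter MeasureTheory Topology
open scoped ENNReal ContDiff

noncomputable section

namespace RegionalFractional

/-- The constant that makes `z ↦ c |z| ^ (-(1 + γ))`, `z ≠ 0`, a probability on the integers. -/
def cGamma (γ : ℝ) : ℝ :=
  (∑' z : ℤ, if z = 0 then (0 : ℝ) else 1 / |(z : ℝ)| ^ (γ + 1))⁻¹

/-- `r⁻(u) = c_γ γ⁻¹ u ^ (-γ)`. -/
def rMinus (γ u : ℝ) : ℝ := cGamma γ * γ⁻¹ * u ^ (-γ)

/-- `r⁺(u) = c_γ γ⁻¹ (1 - u) ^ (-γ)`. -/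
def rPlus (γ u : ℝ) : ℝ := cGamma γ * γ⁻¹ * (1 - u) ^ (-γ)

/-- `V₁ = r⁻ + r⁺`. -/
def V₁ (γ u : ℝ) : ℝ := rMinus γ u + rPlus γ u

/-- `V₀ = α r⁻ + β r⁺`. -/
def V₀ (γ α β u : ℝ) : ℝ := α * rMinus γ u + β * rPlus γ u

/-- `ρ̄^∞ = V₀ / V₁`. -/
def rhoBarInf (γ α β u : ℝ) : ℝ := V₀ γ α β u / V₁ γ u

/-- The regional fractional Laplacian on `(0,1)`, as a principal value. -/
def regLap (γ : ℝ) (G : ℝ → ℝ) (u : ℝ) : ℝ :=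
  cGamma γ * limUnder (𝓝[>] (0 : ℝ)) (fun ε : ℝ =>
    ∫ v in Ioo (0 : ℝ) 1 ∩ {v | ε ≤ |u - v|}, (G v - G u) / |u - v| ^ (1 + γ))

/-- `𝕃_κ = 𝕃 - κ V₁`. -/
def regLapKappa (γ κ : ℝ) (G : ℝ → ℝ) (u : ℝ) : ℝ :=
  regLap γ G u - κ * V₁ γ u * G u

/-- `‖g‖²` in `L²(0,1)`. -/
def l2NormSq (g : ℝ → ℝ) : ℝ≥0∞ :=
  ∫⁻ u in Ioo (0 : ℝ) 1, ENNReal.ofReal (g u ^ 2)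

/-- `‖g‖²_{V₁}`, the squared norm of `L²((0,1), V₁(u) du)`. -/
def l2V₁NormSq (γ : ℝ) (g : ℝ → ℝ) : ℝ≥0∞ :=
  ∫⁻ u in Ioo (0 : ℝ) 1, ENNReal.ofReal (g u ^ 2 * V₁ γ u)

/-- The squared seminorm `‖g‖²_{γ/2}`. -/
def seminormSq (γ : ℝ) (g : ℝ → ℝ) : ℝ≥0∞ :=
  ENNReal.ofReal (cGamma γ / 2) *
    ∫⁻ u in Ioo (0 : ℝ) 1, ∫⁻ v in Ioo (0 : ℝ) 1,
      ENNReal.ofReal ((g u - g v) ^ 2 / |u - v| ^ (1 + γ))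

/-- The squared norm of `H^{γ/2}`. -/
def sobolevNormSq (γ : ℝ) (g : ℝ → ℝ) : ℝ≥0∞ := l2NormSq g + seminormSq γ g

/-- `g ∈ H^{γ/2}`. -/
def MemSobolev (γ : ℝ) (g : ℝ → ℝ) : Prop :=
  AEMeasurable g (volume.restrict (Ioo (0 : ℝ) 1)) ∧ sobolevNormSq γ g < ⊤

/-- The squared norm of `L²(0,T; H^{γ/2})`. -/
def bochnerSobolevNormSq (γ T : ℝ) (f : ℝ → ℝ → ℝ) : ℝ≥0∞ :=
  ∫⁻ t in Icc (0 : ℝ) T, sobolevNormSq γ (f t)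

/-- The squared norm of `L²(0,T; L²_{V₁})`. -/
def bochnerV₁NormSq (γ T : ℝ) (f : ℝ → ℝ → ℝ) : ℝ≥0∞ :=
  ∫⁻ t in Icc (0 : ℝ) T, l2V₁NormSq γ (f t)

/-- The time derivative on `[0,T]` (one-sided at the end points). -/
def timeDeriv (T : ℝ) (G : ℝ → ℝ → ℝ) (t u : ℝ) : ℝ :=
  derivWithin (fun s => G s u) (Icc 0 T) t

/-- Test functions of class `C^{1,∞}` with compact support in `[0,T] × (0,1)`
(extended by zero in the space variable). -/
structure IsTestFunction (T : ℝ) (G : ℝ → ℝ → ℝ) : Prop where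
  compact_support : ∃ a b : ℝ, 0 < a ∧ b < 1 ∧
    ∀ t ∈ Icc (0 : ℝ) T, ∀ u, u ∉ Icc a b → G t u = 0
  smooth_space : ∀ t ∈ Icc (0 : ℝ) T, ContDiff ℝ ∞ (G t)
  continuous_space : ∀ n : ℕ,
    ContinuousOn (fun p : ℝ × ℝ => iteratedDeriv n (G p.1) p.2) (Icc (0 : ℝ) T ×ˢ univ)
  differentiable_time : ∀ u, DifferentiableOn ℝ (fun t => G t u) (Icc (0 : ℝ) T)
  continuous_time :
    ContinuousOn (fun p : ℝ × ℝ => timeDeriv T G p.1 p.2) (Icc (0 : ℝ) T ×ˢ univ)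

/-- `ρ : [0,T] × [0,1] → [0,1]` is (Lebesgue) measurable, and so is each of its time slices. -/
structure IsProfile (T : ℝ) (ρ : ℝ → ℝ → ℝ) : Prop where
  mem_Icc : ∀ t ∈ Icc (0 : ℝ) T, ∀ u ∈ Icc (0 : ℝ) 1, ρ t u ∈ Icc (0 : ℝ) 1
  aemeasurable : AEMeasurable (fun p : ℝ × ℝ => ρ p.1 p.2)
    ((volume.restrict (Icc (0 : ℝ) T)).prod (volume.restrict (Ioo (0 : ℝ) 1)))
  aemeasurable_slice : ∀ t ∈ Icc (0 : ℝ) T, AEMeasurable (ρ t) (volume.restrict (Ioo (0 : ℝ) 1))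

/-- `∫₀ᵀ ∫₀¹ (α - ρ_t(u))² / u^γ + (β - ρ_t(u))² / (1-u)^γ du dt`. -/
def boundaryEnergy (γ α β T : ℝ) (ρ : ℝ → ℝ → ℝ) : ℝ≥0∞ :=
  ∫⁻ t in Icc (0 : ℝ) T, ∫⁻ u in Ioo (0 : ℝ) 1,
    ENNReal.ofReal ((α - ρ t u) ^ 2 / u ^ γ + (β - ρ t u) ^ 2 / (1 - u) ^ γ)

/-- The continuous representative of `g` on `[0,1]` exists and takes the values `α` at `0` and
`β` at `1`. -/
def HasBoundaryValues (α β : ℝ) (g : ℝ → ℝ) : Prop :=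
  ∃ r : ℝ → ℝ, ContinuousOn r (Icc (0 : ℝ) 1) ∧
    g =ᵐ[volume.restrict (Ioo (0 : ℝ) 1)] r ∧ r 0 = α ∧ r 1 = β

/-- Weak solutions on `[0,T]`, with initial condition `g`, of
`∂ₜ ρ = 𝕃_κ ρ + κ V₀`, `ρ_t(0) = α`, `ρ_t(1) = β`. -/
structure IsWeakSolution (γ α β T κ : ℝ) (g : ℝ → ℝ) (ρ : ℝ → ℝ → ℝ) : Prop where
  profile : IsProfile T ρ
  finite_energy : bochnerSobolevNormSq γ T ρ < ⊤
  boundary_of_pos : 0 < κ → boundaryEnergy γ α β T ρ < ⊤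
  boundary_of_zero : κ = 0 →
    ∀ᵐ t ∂(volume.restrict (Icc (0 : ℝ) T)), HasBoundaryValues α β (ρ t)
  weak_form : ∀ t ∈ Icc (0 : ℝ) T, ∀ G : ℝ → ℝ → ℝ, IsTestFunction T G →
    (∫ u in Ioo (0 : ℝ) 1, ρ t u * G t u) - (∫ u in Ioo (0 : ℝ) 1, g u * G 0 u)
      - (∫ s in (0 : ℝ)..t, ∫ u in Ioo (0 : ℝ) 1,
          ρ s u * (timeDeriv T G s u + regLapKappa γ κ (G s) u))
      - κ * (∫ s in (0 : ℝ)..t, ∫ u in Ioo (0 : ℝ) 1, G s u * V₀ γ α β u) = 0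

/-- Weak solutions on `[0,T]`, with initial condition `g`, of
`∂ₜ ρ = -κ ρ V₁ + κ V₀`, `ρ_t(0) = α`, `ρ_t(1) = β`. -/
structure IsReactionWeakSolution (γ α β T κ : ℝ) (g : ℝ → ℝ) (ρ : ℝ → ℝ → ℝ) : Prop where
  profile : IsProfile T ρ
  boundary : boundaryEnergy γ α β T ρ < ⊤
  weak_form : ∀ t ∈ Icc (0 : ℝ) T, ∀ G : ℝ → ℝ → ℝ, IsTestFunction T G →
    (∫ u in Ioo (0 : ℝ) 1, ρ t u * G t u) - (∫ u in Ioo (0 : ℝ) 1, g u * G 0 u)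
      - (∫ s in (0 : ℝ)..t, ∫ u in Ioo (0 : ℝ) 1, ρ s u * timeDeriv T G s u)
      + κ * (∫ s in (0 : ℝ)..t, ∫ u in Ioo (0 : ℝ) 1, ρ s u * G s u * V₁ γ u)
      - κ * (∫ s in (0 : ℝ)..t, ∫ u in Ioo (0 : ℝ) 1, G s u * V₀ γ α β u) = 0

/-- The function `ρ̄^∞ + (g - ρ̄^∞) e^{-t V₁}`. -/
def rhoInf (γ α β : ℝ) (g : ℝ → ℝ) (t u : ℝ) : ℝ :=
  rhoBarInf γ α β u + (g u - rhoBarInf γ α β u) * Real.exp (-t * V₁ γ u)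

end RegionalFractional

end

/-! Write ρ̄ = V₀ / V₁, E(f) for the squared seminorm of order γ/2 and P(f) for the squared norm of
L²(V₁). Because V₀ = ρ̄ V₁, the equation with parameter κ reads ∂ₜρ = 𝕃ρ - κ V₁ (ρ - ρ̄). Every
difference of interest solves a linear equation ∂ₜw = 𝕃(w + σ) - κ V₁ w - δ V₁ z, which is
`IsEvolution`. Testing it with w itself, and using the fractional Hardy inequality P(w) ≤ C E(w) to
absorb the last term, gives formally ½‖w_t‖² + ½ ∫ E(w) + κ ∫ P(w) ≤ ½‖w_0‖² + ∫ E(σ) + C δ² ∫ P(z).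
Its rigorous consequences are `IsEvolution.energy` and, for w_0 = 0, `IsEvolution.energy_of_zero`.
Both limits and the uniqueness for κ ≥ 0 follow by choosing w, σ, z and δ.

Weak reservoirs. With w = ρ^κ - ρ̄, σ = ρ̄ and δ = 0 the inequality bounds ∫ P(ρ^κ - ρ̄) uniformly
in κ (`IsBumpSolution.a_priori`); ρ̄ has finite energy because it is C¹ up to the boundary. With w =
ρ^κ - ρ^κ', σ = 0, z = ρ^κ' - ρ̄ and δ = κ - κ' it bounds the difference of two solutions by a
multiple of |κ - κ'| (`IsBumpSolution.compare`). Hence ρ^κ is Cauchy as κ → 0, its limit solves the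
problem with κ = 0, equal parameters give uniqueness, and κ' = 0 gives convergence with squared
distance O(κ²).

Strong reservoirs. With w_s = ρ^κ_s - ρ^∞_{κs} on (0, T/κ), σ_s = ρ^∞_{κs} and δ = 0, the term κ ∫
P(w) is exactly the squared distance to be estimated after the change of time t = κs, and the right
side is κ⁻¹ ∫₀ᵀ E(ρ^∞_t) dt. It remains to see that this last integral is finite. The delicate
factor is e^{-tV₁}: integrating its squared increments in time gives an explicit rational function
of V₁(u) and V₁(v), dominated by the squared increments of u^{γ/2} and (1-u)^{γ/2}, which have
finite energy since γ < 2. The limit equation has no coupling in space; its uniqueness is a Picard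
iteration in which V₁ is bounded on the support of the test function.

The Hardy inequality and the boundary behaviour use γ > 1. Functions of finite energy have
continuous representatives (`exists_continuousOn_rep`), those that also lie in L²(V₁) vanish at the
end points because u^{-γ} is not integrable, and conversely continuous functions vanishing there
satisfy Hardy. Thus prescribed boundary values and finiteness of P(ρ - ρ̄) are interchangeable for
functions of finite energy.

Two regularisations justify testing with w. In time, w is replaced by its average over (t, t + h],
which is Lipschitz in t; Jensen's inequality controls the norms, and Fatou's lemma removes h. In
space, `exists_bump_approx` approximates by smooth compactly supported functions. There V₁/2 is the
mass that the jump kernel sends outside the interval, so E + P is the energy on the whole line of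
the extension by zero. This energy is translation invariant, so mollification does not increase it,
and pointwise convergence without gain of norm is strong convergence. -/

open Set Filter MeasureTheory Topology
open scoped ENNReal ContDiff

noncomputable section

namespace RegionalFractional

/-! ### Square integrals -/

section SquareIntegral

variable {Y : Type*} [MeasurableSpace Y] {ν : Measure Y}

/-- The squared `L²` norm, with values in `[0,∞]`. -/
def sqInt (ν : Measure Y) (f : Y → ℝ) : ℝ≥0∞ := ∫⁻ y, ENNReal.ofReal (f y ^ 2) ∂ν

lemma sqInt_congr_ae {f g : Y → ℝ} (h : f =ᵐ[ν] g) : sqInt ν f = sqInt ν g := by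
  refine lintegral_congr_ae ?_
  filter_upwards [h] with y hy
  rw [hy]

lemma sqInt_mono {f g : Y → ℝ} (h : ∀ᵐ y ∂ν, |f y| ≤ |g y|) : sqInt ν f ≤ sqInt ν g := by
  refine lintegral_mono_ae ?_
  filter_upwards [h] with y hy
  exact ENNReal.ofReal_le_ofReal (sq_le_sq.2 hy)

lemma sqInt_neg (f : Y → ℝ) : sqInt ν (fun y => -f y) = sqInt ν f := by
  simp [sqInt]

lemma sqInt_const_mul (a : ℝ) (f : Y → ℝ) :
    sqInt ν (fun y => a * f y) = ENNReal.ofReal (a ^ 2) * sqInt ν f := by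
  simp only [sqInt, mul_pow, ENNReal.ofReal_mul (sq_nonneg a)]
  rw [lintegral_const_mul' _ _ ENNReal.ofReal_ne_top]

lemma aemeasurable_ofReal_sq {f : Y → ℝ} (hf : AEMeasurable f ν) :
    AEMeasurable (fun y => ENNReal.ofReal (f y ^ 2)) ν :=
  (hf.pow_const 2).ennreal_ofReal

lemma sqInt_add_le {f g : Y → ℝ} (hf : AEMeasurable f ν) :
    sqInt ν (fun y => f y + g y) ≤ 2 * sqInt ν f + 2 * sqInt ν g := by
  unfold sqInt
  rw [← lintegral_const_mul' _ _ (by simp), ← lintegral_const_mul' _ _ (by simp),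
    ← lintegral_add_left' ((aemeasurable_ofReal_sq hf).const_mul 2)]
  refine lintegral_mono fun y => ?_
  have h2 : (2 : ℝ≥0∞) = ENNReal.ofReal 2 := by simp
  rw [h2, ← ENNReal.ofReal_mul (by norm_num), ← ENNReal.ofReal_mul (by norm_num),
    ← ENNReal.ofReal_add (by positivity) (by positivity)]
  exact ENNReal.ofReal_le_ofReal (by nlinarith [sq_nonneg (f y - g y)])

lemma sqInt_sub_le {f g : Y → ℝ} (hf : AEMeasurable f ν) :
    sqInt ν (fun y => f y - g y) ≤ 2 * sqInt ν f + 2 * sqInt ν g := by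
  have := sqInt_add_le (ν := ν) (g := fun y => -g y) hf
  rw [sqInt_neg] at this
  simpa [sub_eq_add_neg] using this

lemma integrable_sq_of_sqInt {f : Y → ℝ} (hf : AEMeasurable f ν) (h : sqInt ν f < ⊤) :
    Integrable (fun y => f y ^ 2) ν := by
  refine ⟨(hf.pow_const 2).aestronglyMeasurable, ?_⟩
  rw [hasFiniteIntegral_iff_ofReal (ae_of_all _ fun y => sq_nonneg _)]
  exact h

lemma integral_sq_eq_toReal {f : Y → ℝ} (hf : AEMeasurable f ν) :
    ∫ y, f y ^ 2 ∂ν = (sqInt ν f).toReal := by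
  rw [integral_eq_lintegral_of_nonneg_ae (ae_of_all _ fun y => sq_nonneg _)
    (hf.pow_const 2).aestronglyMeasurable]
  rfl

lemma integrable_mul_of_sqInt {f g : Y → ℝ} (hf : AEMeasurable f ν) (hg : AEMeasurable g ν)
    (h : sqInt ν f < ⊤) (h' : sqInt ν g < ⊤) : Integrable (fun y => f y * g y) ν := by
  refine Integrable.mono' ((integrable_sq_of_sqInt hf h).add (integrable_sq_of_sqInt hg h'))
    (hf.mul hg).aestronglyMeasurable (ae_of_all _ fun y => ?_)
  simp only [Pi.add_apply, Real.norm_eq_abs, abs_le]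
  constructor <;> nlinarith [sq_nonneg (f y + g y), sq_nonneg (f y - g y), sq_nonneg (f y),
    sq_nonneg (g y)]

/-- A weighted Cauchy–Schwarz inequality. -/
lemma abs_integral_mul_le {f g : Y → ℝ} (hf : AEMeasurable f ν) (hg : AEMeasurable g ν)
    (h : sqInt ν f < ⊤) (h' : sqInt ν g < ⊤) {a : ℝ} (ha : 0 < a) :
    |∫ y, f y * g y ∂ν| ≤ a / 2 * (sqInt ν f).toReal + 1 / (2 * a) * (sqInt ν g).toReal := by
  rw [← integral_sq_eq_toReal hf, ← integral_sq_eq_toReal hg, ← integral_const_mul,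
    ← integral_const_mul, ← integral_add ((integrable_sq_of_sqInt hf h).const_mul _)
      ((integrable_sq_of_sqInt hg h').const_mul _)]
  refine (abs_integral_le_integral_abs).trans (integral_mono
    (integrable_mul_of_sqInt hf hg h h').abs (((integrable_sq_of_sqInt hf h).const_mul _).add
      ((integrable_sq_of_sqInt hg h').const_mul _)) fun y => ?_)
  have key : ∀ x z : ℝ, x * z ≤ a / 2 * x ^ 2 + 1 / (2 * a) * z ^ 2 := by
    intro x z
    have : a / 2 * x ^ 2 + 1 / (2 * a) * z ^ 2 - x * z = (a * x - z) ^ 2 / (2 * a) := by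
      field_simp; ring
    have h3 : 0 ≤ (a * x - z) ^ 2 / (2 * a) := by positivity
    linarith
  rw [abs_le]
  exact ⟨by have := key (-f y) (g y); nlinarith, key _ _⟩

/-- Convergence in the square integral implies convergence of pairings. -/
lemma tendsto_integral_mul_of_sqInt {f g : Y → ℝ} {gn : ℕ → Y → ℝ} (hf : AEMeasurable f ν)
    (hg : AEMeasurable g ν) (hgn : ∀ n, AEMeasurable (gn n) ν) (h : sqInt ν f < ⊤)
    (h' : sqInt ν g < ⊤)
    (hlim : Tendsto (fun n => sqInt ν (fun y => gn n y - g y)) atTop (𝓝 0)) :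
    Tendsto (fun n => ∫ y, f y * gn n y ∂ν) atTop (𝓝 (∫ y, f y * g y ∂ν)) := by
  have hfin : ∀ᶠ n in atTop, sqInt ν (fun y => gn n y - g y) < ⊤ :=
    hlim.eventually (gt_mem_nhds (by simp))
  have hreal : Tendsto (fun n => (sqInt ν (fun y => gn n y - g y)).toReal) atTop (𝓝 0) := by
    have h0 := (ENNReal.tendsto_toReal ENNReal.zero_ne_top).comp hlim
    rw [ENNReal.toReal_zero] at h0
    exact h0
  rw [Metric.tendsto_atTop']
  intro ε hε
  set F := (sqInt ν f).toReal with hF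
  have hF0 : 0 ≤ F := ENNReal.toReal_nonneg
  -- The weight in Young's inequality makes the term with F smaller than ε/2 for every n; the
  -- remaining term tends to zero. The added 1 covers F = 0.
  set a : ℝ := ε / (2 * (F + 1)) with ha_def
  have ha : 0 < a := by positivity
  have hev : ∀ᶠ n in atTop, (sqInt ν (fun y => gn n y - g y)).toReal < a * ε :=
    hreal.eventually (gt_mem_nhds (by positivity))
  obtain ⟨N, hN⟩ := eventually_atTop.1 (hev.and hfin)
  refine ⟨N, fun n hn => ?_⟩
  obtain ⟨h1, h2⟩ := hN n hn.le
  have hd : AEMeasurable (fun y => gn n y - g y) ν := (hgn n).sub hg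
  have hgnfin : Integrable (fun y => f y * gn n y) ν := by
    have := (integrable_mul_of_sqInt hf hd h h2).add (integrable_mul_of_sqInt hf hg h h')
    refine this.congr (ae_of_all _ fun y => ?_)
    simp only [Pi.add_apply]; ring
  rw [Real.dist_eq, ← integral_sub hgnfin (integrable_mul_of_sqInt hf hg h h')]
  have := abs_integral_mul_le hf hd h h2 ha
  simp only [mul_sub] at this
  refine this.trans_lt ?_
  have e1 : a / 2 * F < ε / 2 := by
    rw [ha_def]; rw [div_div, div_mul_eq_mul_div, div_lt_iff₀ (by positivity)]
    nlinarith
  have e2 : 1 / (2 * a) * (sqInt ν (fun y => gn n y - g y)).toReal < ε / 2 := by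
    rw [div_mul_eq_mul_div, one_mul, div_lt_iff₀ (by positivity)]
    linarith
  linarith

/-- Fatou's lemma for square integrals. -/
lemma sqInt_le_liminf {f : Y → ℝ} {fn : ℕ → Y → ℝ} (hfn : ∀ n, AEMeasurable (fn n) ν)
    (h : ∀ᵐ y ∂ν, Tendsto (fun n => fn n y) atTop (𝓝 (f y))) :
    sqInt ν f ≤ liminf (fun n => sqInt ν (fn n)) atTop := by
  refine le_trans (lintegral_mono_ae ?_)
    (lintegral_liminf_le' fun n => aemeasurable_ofReal_sq (hfn n))
  filter_upwards [h] with y hy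
  exact ((ENNReal.continuous_ofReal.tendsto _).comp (hy.pow 2)).liminf_eq.ge

lemma sqInt_parallelogram {f g : Y → ℝ} (hf : AEMeasurable f ν) (hg : AEMeasurable g ν) :
    sqInt ν (fun y => f y + g y) + sqInt ν (fun y => f y - g y)
      = 2 * sqInt ν f + 2 * sqInt ν g := by
  unfold sqInt
  rw [← lintegral_const_mul' _ _ (by simp), ← lintegral_const_mul' _ _ (by simp),
    ← lintegral_add_left' ((aemeasurable_ofReal_sq hf).const_mul 2),
    ← lintegral_add_left' (f := fun y => ENNReal.ofReal ((f y + g y) ^ 2))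
      (aemeasurable_ofReal_sq (hf.add hg))]
  refine lintegral_congr fun y => ?_
  have h2 : (2 : ℝ≥0∞) = ENNReal.ofReal 2 := by simp
  rw [h2, ← ENNReal.ofReal_mul (by norm_num), ← ENNReal.ofReal_mul (by norm_num),
    ← ENNReal.ofReal_add (by positivity) (by positivity),
    ← ENNReal.ofReal_add (by positivity) (by positivity)]
  congr 1; ring

/-- Almost everywhere convergence without gain of norm is strong convergence. -/
lemma tendsto_sqInt_sub {f : Y → ℝ} {fn : ℕ → Y → ℝ} (hf : AEMeasurable f ν)
    (hfn : ∀ n, AEMeasurable (fn n) ν)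
    (h : ∀ᵐ y ∂ν, Tendsto (fun n => fn n y) atTop (𝓝 (f y)))
    (hle : ∀ n, sqInt ν (fn n) ≤ sqInt ν f) (hfin : sqInt ν f < ⊤) :
    Tendsto (fun n => sqInt ν (fun y => fn n y - f y)) atTop (𝓝 0) := by
  -- Fatou applied to f_n + f → 2f. The parallelogram identity and the absence of norm gain then
  -- give ‖f_n - f‖² ≤ 4‖f‖² - ‖f_n + f‖², whose limsup is nonpositive.
  have h4 : 4 * sqInt ν f ≤ liminf (fun n => sqInt ν (fun y => fn n y + f y)) atTop := by
    have := sqInt_le_liminf (f := fun y => 2 * f y) (fn := fun n y => fn n y + f y)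
      (fun n => (hfn n).add hf) (by
        filter_upwards [h] with y hy
        have := hy.add_const (f y)
        rwa [← two_mul] at this)
    rw [sqInt_const_mul] at this
    convert this using 2
    norm_num
  have hb : ∀ n, sqInt ν (fun y => fn n y - f y)
      ≤ 4 * sqInt ν f - sqInt ν (fun y => fn n y + f y) := by
    intro n
    have hp := sqInt_parallelogram (hfn n) hf
    have hle' : sqInt ν (fun y => fn n y + f y) + sqInt ν (fun y => fn n y - f y)
        ≤ 4 * sqInt ν f := by
      rw [hp]
      calc _ ≤ 2 * sqInt ν f + 2 * sqInt ν f := by gcongr; exact hle n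
        _ = 4 * sqInt ν f := by ring
    have hne : sqInt ν (fun y => fn n y + f y) ≠ ⊤ := by
      intro hcon
      rw [hcon, top_add, top_le_iff] at hle'
      exact (ENNReal.mul_lt_top (by simp) hfin).ne hle'
    exact ENNReal.le_sub_of_add_le_left hne hle'
  have hfin4 : 4 * sqInt ν f ≠ ⊤ := (ENNReal.mul_lt_top (by simp) hfin).ne
  refine ENNReal.tendsto_nhds_zero.2 fun ε hε => ?_
  rcases eq_or_ne (4 * sqInt ν f) 0 with h0 | h0
  · refine Eventually.of_forall fun n => (hb n).trans ?_
    rw [h0]; simp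
  have hlt : 4 * sqInt ν f - ε < liminf (fun n => sqInt ν (fun y => fn n y + f y)) atTop :=
    lt_of_lt_of_le (ENNReal.sub_lt_self hfin4 h0 hε.ne') h4
  filter_upwards [eventually_lt_of_lt_liminf hlt] with n hn
  refine (hb n).trans ?_
  rw [tsub_le_iff_left]
  exact (tsub_le_iff_right).1 hn.le

/-- Jensen's inequality for the square. -/
lemma ofReal_sq_integral_le {S : Type*} [MeasurableSpace S] {P : Measure S}
    [IsProbabilityMeasure P] {f : S → ℝ} (hf : AEMeasurable f P) :
    ENNReal.ofReal ((∫ s, f s ∂P) ^ 2) ≤ sqInt P f := by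
  rcases eq_or_ne (sqInt P f) ⊤ with h | h
  · rw [h]; exact le_top
  have hfin : sqInt P f < ⊤ := lt_top_iff_ne_top.2 h
  have hone : sqInt P (fun _ : S => (1 : ℝ)) = 1 := by simp [sqInt]
  have hint : Integrable f P := by
    simpa using integrable_mul_of_sqInt hf aemeasurable_const hfin
      (g := fun _ => (1 : ℝ)) (by rw [hone]; simp)
  refine ENNReal.ofReal_le_of_le_toReal ?_
  rw [← integral_sq_eq_toReal hf]
  set m := ∫ s, f s ∂P
  have : 0 ≤ ∫ s, (f s - m) ^ 2 ∂P := integral_nonneg fun s => sq_nonneg _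
  have e : ∫ s, (f s - m) ^ 2 ∂P = ∫ s, f s ^ 2 ∂P - m ^ 2 := by
    have : ∀ s, (f s - m) ^ 2 = f s ^ 2 - (2 * m * f s - m ^ 2) := fun s => by ring
    simp only [this]
    have hi : Integrable (fun s => 2 * m * f s) P := hint.const_mul _
    have hi' : Integrable (fun s => 2 * m * f s - m ^ 2) P := hi.sub (integrable_const _)
    rw [integral_sub (integrable_sq_of_sqInt hf hfin) hi', integral_sub hi (integrable_const _),
      integral_const_mul]
    simp [m]; ring
  linarith

/-- The square integral of an average is at most the average of the square integrals. -/
lemma sqInt_integral_le [SFinite ν] {S : Type*} [MeasurableSpace S] {P : Measure S}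
    [IsProbabilityMeasure P] {f : S → Y → ℝ} (hf : Measurable (Function.uncurry f)) :
    sqInt ν (fun y => ∫ s, f s y ∂P) ≤ ∫⁻ s, sqInt ν (f s) ∂P := by
  unfold sqInt
  rw [lintegral_lintegral_swap
    (f := fun s y => ENNReal.ofReal (f s y ^ 2)) (hf.pow_const 2).ennreal_ofReal.aemeasurable]
  refine lintegral_mono fun y => ?_
  exact ofReal_sq_integral_le (hf.comp (measurable_id.prodMk measurable_const)).aemeasurable

lemma measurable_sqInt [SFinite ν] {S : Type*} [MeasurableSpace S] {f : S → Y → ℝ}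
    (hf : Measurable (Function.uncurry f)) : Measurable fun s => sqInt ν (f s) :=
  Measurable.lintegral_prod_right' (f := fun p : S × Y => ENNReal.ofReal (f p.1 p.2 ^ 2))
    (hf.pow_const 2).ennreal_ofReal

end SquareIntegral

/-! ### The constant, the potentials and the two energy measures -/

lemma cGamma_pos {γ : ℝ} (hγ : 0 < γ) : 0 < cGamma γ := by
  unfold cGamma
  have hs : Summable (fun z : ℤ => if z = 0 then (0 : ℝ) else 1 / |(z : ℝ)| ^ (γ + 1)) := by
    refine Summable.of_nonneg_of_le (fun z => ?_) (fun z => ?_)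
      (Real.summable_abs_int_rpow (b := γ + 1) (by linarith))
    · split_ifs <;> positivity
    · split_ifs
      · positivity
      · rw [Real.rpow_neg (abs_nonneg _), one_div]
  refine inv_pos.2 (hs.tsum_pos (fun z => ?_) 1 ?_)
  · split_ifs <;> positivity
  · simp

/-- Lebesgue measure on the unit interval. -/
abbrev volI : Measure ℝ := volume.restrict (Ioo (0 : ℝ) 1)

instance isProbabilityMeasure_volI : IsProbabilityMeasure volI := ⟨by simp⟩

lemma ae_mem_volI : ∀ᵐ u ∂volI, u ∈ Ioo (0 : ℝ) 1 := ae_restrict_mem measurableSet_Ioo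

lemma measurable_rMinus (γ : ℝ) : Measurable (rMinus γ) := by
  unfold rMinus; fun_prop

lemma measurable_rPlus (γ : ℝ) : Measurable (rPlus γ) := by
  unfold rPlus; fun_prop

lemma measurable_V₁ (γ : ℝ) : Measurable (V₁ γ) :=
  (measurable_rMinus γ).add (measurable_rPlus γ)

lemma measurable_V₀ (γ α β : ℝ) : Measurable (V₀ γ α β) :=
  ((measurable_rMinus γ).const_mul α).add ((measurable_rPlus γ).const_mul β)

lemma rMinus_pos {γ : ℝ} (hγ : 0 < γ) {u : ℝ} (hu : 0 < u) : 0 < rMinus γ u := by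
  have := cGamma_pos hγ
  unfold rMinus; positivity

lemma rPlus_pos {γ : ℝ} (hγ : 0 < γ) {u : ℝ} (hu : u < 1) : 0 < rPlus γ u := by
  have := cGamma_pos hγ
  have : 0 < 1 - u := by linarith
  unfold rPlus; positivity

lemma V₁_pos {γ : ℝ} (hγ : 0 < γ) {u : ℝ} (hu : u ∈ Ioo (0 : ℝ) 1) : 0 < V₁ γ u :=
  add_pos (rMinus_pos hγ hu.1) (rPlus_pos hγ hu.2)

lemma le_V₁ {γ : ℝ} (hγ : 0 < γ) {u : ℝ} (hu : u ∈ Ioo (0 : ℝ) 1) : cGamma γ / γ ≤ V₁ γ u := by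
  have hc := cGamma_pos hγ
  have h1 : 1 ≤ u ^ (-γ) := Real.one_le_rpow_of_pos_of_le_one_of_nonpos hu.1 hu.2.le (by linarith)
  have h2 := rPlus_pos hγ hu.2
  have h3 : cGamma γ / γ * 1 ≤ cGamma γ / γ * u ^ (-γ) :=
    mul_le_mul_of_nonneg_left h1 (by positivity)
  have h4 : rMinus γ u = cGamma γ / γ * u ^ (-γ) := by rw [rMinus, div_eq_mul_inv]
  rw [V₁, h4]; linarith

/-- The increments of a function of one variable. -/
def gap (g : ℝ → ℝ) (p : ℝ × ℝ) : ℝ := g p.1 - g p.2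

lemma measurable_gap {g : ℝ → ℝ} (hg : Measurable g) : Measurable (gap g) :=
  (hg.comp measurable_fst).sub (hg.comp measurable_snd)

/-- The density of the jump measure. -/
def kerDens (γ : ℝ) (p : ℝ × ℝ) : ℝ := cGamma γ / 2 / |p.1 - p.2| ^ (1 + γ)

lemma measurable_kerDens (γ : ℝ) : Measurable (kerDens γ) := by
  unfold kerDens; fun_prop

lemma kerDens_nonneg {γ : ℝ} (hγ : 0 < γ) (p : ℝ × ℝ) : 0 ≤ kerDens γ p := by
  have := cGamma_pos hγ
  unfold kerDens; positivity

/-- The jump measure on the unit square. -/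
def kerMeas (γ : ℝ) : Measure (ℝ × ℝ) :=
  (volI.prod volI).withDensity fun p => ENNReal.ofReal (kerDens γ p)

/-- The measure `V₁(u) du` on the unit interval. -/
def potMeas (γ : ℝ) : Measure ℝ := volI.withDensity fun u => ENNReal.ofReal (V₁ γ u)

instance sigmaFinite_kerMeas (γ : ℝ) : SigmaFinite (kerMeas γ) :=
  SigmaFinite.withDensity_of_ne_top' fun _ => ENNReal.ofReal_ne_top

instance sigmaFinite_potMeas (γ : ℝ) : SigmaFinite (potMeas γ) :=
  SigmaFinite.withDensity_of_ne_top' fun _ => ENNReal.ofReal_ne_top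

lemma kerMeas_ac (γ : ℝ) : kerMeas γ ≪ volI.prod volI := withDensity_absolutelyContinuous _ _

lemma potMeas_ac (γ : ℝ) : potMeas γ ≪ volI := withDensity_absolutelyContinuous _ _

lemma gap_congr_ae {f g : ℝ → ℝ} (h : f =ᵐ[volI] g) : gap f =ᵐ[volI.prod volI] gap g := by
  filter_upwards [Measure.quasiMeasurePreserving_fst.ae_eq_comp h,
    Measure.quasiMeasurePreserving_snd.ae_eq_comp h] with p h1 h2
  simp only [Function.comp] at h1 h2
  rw [gap, gap, h1, h2]

lemma sqInt_kerMeas_congr (γ : ℝ) {f g : ℝ → ℝ} (h : f =ᵐ[volI] g) :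
    sqInt (kerMeas γ) (gap f) = sqInt (kerMeas γ) (gap g) :=
  sqInt_congr_ae ((kerMeas_ac γ).ae_eq (gap_congr_ae h))

lemma sqInt_potMeas_congr (γ : ℝ) {f g : ℝ → ℝ} (h : f =ᵐ[volI] g) :
    sqInt (potMeas γ) f = sqInt (potMeas γ) g :=
  sqInt_congr_ae ((potMeas_ac γ).ae_eq h)

lemma aemeasurable_gap {g : ℝ → ℝ} (hg : AEMeasurable g volI) :
    AEMeasurable (gap g) (volI.prod volI) :=
  (hg.comp_quasiMeasurePreserving Measure.quasiMeasurePreserving_fst).sub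
    (hg.comp_quasiMeasurePreserving Measure.quasiMeasurePreserving_snd)

lemma l2NormSq_eq (g : ℝ → ℝ) : l2NormSq g = sqInt volI g := rfl

lemma l2V₁NormSq_eq (γ : ℝ) (g : ℝ → ℝ) : l2V₁NormSq γ g = sqInt (potMeas γ) g := by
  unfold l2V₁NormSq sqInt potMeas
  rw [lintegral_withDensity_eq_lintegral_mul_non_measurable _
    (measurable_V₁ γ).ennreal_ofReal (ae_of_all _ fun _ => ENNReal.ofReal_lt_top)]
  refine lintegral_congr fun u => ?_
  simp only [Pi.mul_apply]
  rw [ENNReal.ofReal_mul (sq_nonneg _), mul_comm]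

lemma sqInt_kerMeas (γ : ℝ) (f : ℝ × ℝ → ℝ) : sqInt (kerMeas γ) f
    = ∫⁻ p, ENNReal.ofReal (kerDens γ p) * ENNReal.ofReal (f p ^ 2) ∂(volI.prod volI) := by
  unfold sqInt kerMeas
  rw [lintegral_withDensity_eq_lintegral_mul_non_measurable _
    (measurable_kerDens γ).ennreal_ofReal (ae_of_all _ fun _ => ENNReal.ofReal_lt_top)]
  rfl

lemma seminormSq_eq {γ : ℝ} (hγ : 0 < γ) {g : ℝ → ℝ} (hg : AEMeasurable g volI) :
    seminormSq γ g = sqInt (kerMeas γ) (gap g) := by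
  have hc := cGamma_pos hγ
  have hm : AEMeasurable (fun p => ENNReal.ofReal (kerDens γ p) * ENNReal.ofReal (gap g p ^ 2))
      (volI.prod volI) := ((measurable_kerDens γ).ennreal_ofReal.aemeasurable).mul
    ((aemeasurable_gap hg).pow_const 2).ennreal_ofReal
  rw [sqInt_kerMeas, lintegral_prod _ hm]
  unfold seminormSq
  rw [← lintegral_const_mul' _ _ ENNReal.ofReal_ne_top]
  refine lintegral_congr fun u => ?_
  rw [← lintegral_const_mul' _ _ ENNReal.ofReal_ne_top]
  refine lintegral_congr fun v => ?_
  rw [← ENNReal.ofReal_mul (by positivity), ← ENNReal.ofReal_mul (kerDens_nonneg hγ _)]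
  congr 1
  simp only [kerDens, gap]
  ring

lemma sqInt_volI_le {γ : ℝ} (hγ : 0 < γ) (g : ℝ → ℝ) :
    sqInt volI g ≤ ENNReal.ofReal (γ / cGamma γ) * sqInt (potMeas γ) g := by
  have hc := cGamma_pos hγ
  rw [← l2V₁NormSq_eq, l2V₁NormSq, sqInt, ← lintegral_const_mul' _ _ ENNReal.ofReal_ne_top]
  refine lintegral_mono_ae ?_
  filter_upwards [ae_mem_volI] with u hu
  rw [← ENNReal.ofReal_mul (by positivity)]
  refine ENNReal.ofReal_le_ofReal ?_
  have h1 : 1 ≤ γ / cGamma γ * V₁ γ u := by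
    calc (1 : ℝ) = γ / cGamma γ * (cGamma γ / γ) := by field_simp
      _ ≤ _ := mul_le_mul_of_nonneg_left (le_V₁ hγ hu) (by positivity)
  nlinarith [sq_nonneg (g u)]

lemma integral_potMeas {γ : ℝ} (hγ : 0 < γ) (f : ℝ → ℝ) :
    ∫ u, f u ∂(potMeas γ) = ∫ u, f u * V₁ γ u ∂volI := by
  unfold potMeas
  have : (fun u => ENNReal.ofReal (V₁ γ u)) = fun u => ((V₁ γ u).toNNReal : ℝ≥0∞) := rfl
  rw [this, integral_withDensity_eq_integral_smul (measurable_V₁ γ).real_toNNReal]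
  refine integral_congr_ae ?_
  filter_upwards [ae_mem_volI] with u hu
  rw [NNReal.smul_def, Real.coe_toNNReal _ (V₁_pos hγ hu).le, smul_eq_mul, mul_comm]

lemma integral_kerMeas {γ : ℝ} (hγ : 0 < γ) (f : ℝ × ℝ → ℝ) :
    ∫ p, f p ∂(kerMeas γ) = ∫ p, kerDens γ p * f p ∂(volI.prod volI) := by
  unfold kerMeas
  have : (fun p => ENNReal.ofReal (kerDens γ p)) = fun p => ((kerDens γ p).toNNReal : ℝ≥0∞) := rfl
  rw [this, integral_withDensity_eq_integral_smul (measurable_kerDens γ).real_toNNReal]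
  refine integral_congr_ae (ae_of_all _ fun p => ?_)
  simp only [NNReal.smul_def]
  rw [Real.coe_toNNReal _ (kerDens_nonneg hγ p), smul_eq_mul]

/-! ### The regional fractional Laplacian of a smooth function -/

lemma integrableOn_abs_rpow {r : ℝ} (hr : -1 < r) (δ : ℝ) :
    IntegrableOn (fun z : ℝ => |z| ^ r) (Ioo (-δ) δ) := by
  rcases le_or_gt δ 0 with hδ | hδ
  · rw [Ioo_eq_empty (by linarith)]; exact integrableOn_empty
  have h1 : IntegrableOn (fun z : ℝ => |z| ^ r) (Ioo 0 δ) := by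
    refine ((intervalIntegral.integrableOn_Ioo_rpow_iff hδ).2 hr).congr_fun (fun z hz => ?_)
      measurableSet_Ioo
    simp only [abs_of_pos hz.1]
  have h2 : IntegrableOn (fun z : ℝ => |z| ^ r) (Ioo (-δ) 0) := by
    have := (integrable_indicator_iff measurableSet_Ioo).2 h1
    have h3 := this.comp_neg
    rw [← integrable_indicator_iff measurableSet_Ioo]
    refine h3.congr (ae_of_all _ fun z => ?_)
    simp only [indicator, mem_Ioo, abs_neg]
    refine if_congr ⟨fun h => ⟨by linarith [h.2], by linarith [h.1]⟩,
      fun h => ⟨by linarith [h.2], by linarith [h.1]⟩⟩ rfl rfl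
  have h3 : IntegrableOn (fun z : ℝ => |z| ^ r) {0} := by
    rw [integrableOn_singleton_iff]; right; simp
  refine ((h1.union h2).union h3).mono_set fun z hz => ?_
  rcases lt_trichotomy z 0 with h | h | h
  · exact Or.inl (Or.inr ⟨hz.1, h⟩)
  · exact Or.inr h
  · exact Or.inl (Or.inl ⟨h, hz.2⟩)

/-- A function that is Lipschitz on the unit interval has finite energy. -/
lemma sqInt_gap_lt_top_of_lipschitz {γ : ℝ} (hγ : 0 < γ) (hγ' : γ < 2) {φ : ℝ → ℝ} {K : ℝ}
    (hK : ∀ u ∈ Ioo (0 : ℝ) 1, ∀ v ∈ Ioo (0 : ℝ) 1, |φ u - φ v| ≤ K * |u - v|) :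
    sqInt (kerMeas γ) (gap φ) < ⊤ := by
  have hc := cGamma_pos hγ
  -- The squared Lipschitz bound removes two powers from the kernel. The remaining exponent 1 - γ
  -- exceeds -1 exactly because γ < 2.
  set J : ℝ≥0∞ := ∫⁻ z in Ioo (-1 : ℝ) 1, ENNReal.ofReal (|z| ^ (1 - γ)) with hJ
  have hJfin : J < ⊤ := by
    have h := (integrableOn_abs_rpow (r := 1 - γ) (by linarith) 1).2
    rw [hasFiniteIntegral_iff_ofReal (ae_of_all _ fun z => by positivity)] at h
    exact h
  have hmeas : Measurable fun p : ℝ × ℝ =>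
      ENNReal.ofReal (cGamma γ / 2 * K ^ 2) * ENNReal.ofReal (|p.1 - p.2| ^ (1 - γ)) := by
    fun_prop
  calc sqInt (kerMeas γ) (gap φ)
      ≤ ∫⁻ p, ENNReal.ofReal (cGamma γ / 2 * K ^ 2) * ENNReal.ofReal (|p.1 - p.2| ^ (1 - γ))
          ∂(volI.prod volI) := by
        rw [sqInt_kerMeas]
        refine lintegral_mono_ae ?_
        filter_upwards [Measure.quasiMeasurePreserving_fst.ae ae_mem_volI,
          Measure.quasiMeasurePreserving_snd.ae ae_mem_volI] with p h1 h2
        rw [← ENNReal.ofReal_mul (kerDens_nonneg hγ p), ← ENNReal.ofReal_mul (by positivity)]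
        refine ENNReal.ofReal_le_ofReal ?_
        rcases eq_or_ne p.1 p.2 with h | h
        · simp only [gap, h, sub_self, ne_eq, OfNat.ofNat_ne_zero, not_false_eq_true, zero_pow,
            mul_zero]
          positivity
        have hpos : 0 < |p.1 - p.2| := abs_pos.2 (sub_ne_zero.2 h)
        have hg : gap φ p ^ 2 ≤ K ^ 2 * |p.1 - p.2| ^ (2 : ℕ) := by
          rw [← mul_pow]
          exact sq_le_sq.2 ((hK _ h1 _ h2).trans (le_abs_self _))
        have hpow : |p.1 - p.2| ^ (1 - γ) = |p.1 - p.2| ^ (2 : ℕ) / |p.1 - p.2| ^ (1 + γ) := by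
          rw [← Real.rpow_natCast, ← Real.rpow_sub hpos]; congr 1; push_cast; ring
        rw [hpow, kerDens]
        calc _ ≤ cGamma γ / 2 / |p.1 - p.2| ^ (1 + γ) * (K ^ 2 * |p.1 - p.2| ^ (2 : ℕ)) := by
              gcongr
          _ = _ := by ring
    _ = ∫⁻ u, ∫⁻ v, ENNReal.ofReal (cGamma γ / 2 * K ^ 2) * ENNReal.ofReal (|u - v| ^ (1 - γ))
          ∂volI ∂volI := lintegral_prod _ hmeas.aemeasurable
    _ ≤ ∫⁻ _u, ENNReal.ofReal (cGamma γ / 2 * K ^ 2) * J ∂volI := by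
        refine lintegral_mono_ae ?_
        filter_upwards [ae_mem_volI] with u hu
        rw [lintegral_const_mul' _ _ ENNReal.ofReal_ne_top]
        gcongr
        rw [hJ, ← lintegral_indicator measurableSet_Ioo, ← lintegral_indicator measurableSet_Ioo,
          ← lintegral_sub_left_eq_self
            ((Ioo (-1 : ℝ) 1).indicator fun z => ENNReal.ofReal (|z| ^ (1 - γ))) u]
        refine lintegral_mono fun v => ?_
        by_cases hv : v ∈ Ioo (0 : ℝ) 1
        · rw [indicator_of_mem hv, indicator_of_mem (show u - v ∈ Ioo (-1 : ℝ) 1 from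
            ⟨by linarith [hu.1, hv.2], by linarith [hu.2, hv.1]⟩)]
        · rw [indicator_of_notMem hv]; exact zero_le
    _ < ⊤ := by
        simp only [lintegral_const, measure_univ, mul_one]
        exact ENNReal.mul_lt_top ENNReal.ofReal_lt_top hJfin

/-- The truncated integral whose limit is the regional fractional Laplacian. -/
def truncLap (γ : ℝ) (φ : ℝ → ℝ) (ε u : ℝ) : ℝ :=
  ∫ v in Ioo (0 : ℝ) 1 ∩ {v | ε ≤ |u - v|}, (φ v - φ u) / |u - v| ^ (1 + γ)

/-- A continuous function supported in `[a,b]`, bounded by `C` and with a first order Taylor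
expansion with remainder `C z²`. -/
structure HasTaylorBound (a b C : ℝ) (φ : ℝ → ℝ) : Prop where
  support : ∀ u, u ∉ Icc a b → φ u = 0
  continuous : Continuous φ
  bound : ∀ u, |φ u| ≤ C
  taylor : ∃ d : ℝ → ℝ, ∀ u z, |φ (u + z) - φ u - d u * z| ≤ C * z ^ 2

lemma measurableSet_trunc (u ε : ℝ) : MeasurableSet (Ioo (0 : ℝ) 1 ∩ {v | ε ≤ |u - v|}) :=
  measurableSet_Ioo.inter (measurableSet_le measurable_const (by fun_prop))

lemma measurableSet_shell (ε δ : ℝ) : MeasurableSet {z : ℝ | ε ≤ |z| ∧ |z| < δ} :=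
  (by fun_prop : Measurable fun z : ℝ => |z|) (measurableSet_Ico (a := ε) (b := δ))

lemma volume_shell_lt_top (ε δ : ℝ) : volume {z : ℝ | ε ≤ |z| ∧ |z| < δ} < ⊤ := by
  refine lt_of_le_of_lt (measure_mono (t := Ioo (-δ) δ) fun z hz => abs_lt.1 hz.2) (by simp)

lemma div_abs_rpow_le {γ ε x C z : ℝ} (hγ : 0 < γ) (hε : 0 < ε) (hx : |x| ≤ C) (hz : ε ≤ |z|) :
    |x / |z| ^ (1 + γ)| ≤ C / ε ^ (1 + γ) := by
  rw [abs_div, abs_of_nonneg (by positivity : 0 ≤ |z| ^ (1 + γ))]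
  have : ε ^ (1 + γ) ≤ |z| ^ (1 + γ) := Real.rpow_le_rpow hε.le hz (by linarith)
  exact div_le_div₀ ((abs_nonneg _).trans hx) hx (by positivity) this

/-- The integrand is odd and the shell symmetric. Hence the first order Taylor term may be
subtracted near the diagonal at no cost, which is what makes the principal value converge. -/
lemma integral_shell_odd (γ ε δ : ℝ) :
    ∫ z in {z : ℝ | ε ≤ |z| ∧ |z| < δ}, z / |z| ^ (1 + γ) = 0 := by
  rw [← integral_indicator (measurableSet_shell ε δ)]
  set f := ({z : ℝ | ε ≤ |z| ∧ |z| < δ}).indicator fun z : ℝ => z / |z| ^ (1 + γ) with hf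
  have h := integral_neg_eq_self f volume
  have h2 : (fun z => f (-z)) = fun z => -f z := by
    funext z
    simp only [hf, indicator, mem_ofPred_eq, abs_neg]
    split_ifs <;> ring
  rw [h2, integral_neg] at h
  linarith

/-- Splitting of the truncated integral, the part close to the diagonal being symmetrised. -/
lemma truncLap_eq {γ : ℝ} (hγ : 0 < γ) {a b C : ℝ} (ha : 0 < a) (hb : b < 1) {φ : ℝ → ℝ}
    (hφ : HasTaylorBound a b C φ) (d : ℝ → ℝ) {ε δ : ℝ} (hε : 0 < ε) (hεδ : ε ≤ δ)
    (hδa : δ ≤ a) (hδb : δ ≤ 1 - b) (u : ℝ) :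
    truncLap γ φ ε u = truncLap γ φ δ u
      + ∫ z in {z : ℝ | ε ≤ |z| ∧ |z| < δ}, (φ (u + z) - φ u - d u * z) / |z| ^ (1 + γ) := by
  set S : Set ℝ := {z : ℝ | ε ≤ |z| ∧ |z| < δ} with hS
  have hSm : MeasurableSet S := measurableSet_shell ε δ
  set f : ℝ → ℝ := fun v => (φ v - φ u) / |u - v| ^ (1 + γ) with hf
  have hfm : Measurable f := by
    have := hφ.continuous.measurable
    fun_prop
  have hb2 : ∀ x y, |φ x - φ y| ≤ 2 * C := fun x y => by
    have h1 := hφ.bound x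
    have h2 := hφ.bound y
    rw [abs_le] at *
    constructor <;> linarith [h1.1, h1.2, h2.1, h2.2]
  set N : Set ℝ := {v | ε ≤ |u - v| ∧ |u - v| < δ} with hN
  have hNm : MeasurableSet N :=
    (by fun_prop : Measurable fun v : ℝ => |u - v|) (measurableSet_Ico (a := ε) (b := δ))
  have hint : ∀ A : Set ℝ, MeasurableSet A → volume A < ⊤ → (∀ v ∈ A, ε ≤ |u - v|) →
      IntegrableOn f A := by
    intro A hA hAfin h
    refine Measure.integrableOn_of_bounded (M := 2 * C / ε ^ (1 + γ)) hAfin.ne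
      hfm.aestronglyMeasurable ?_
    filter_upwards [ae_restrict_mem hA] with v hv
    exact div_abs_rpow_le hγ hε (hb2 v u) (h v hv)
  have hsplit : Ioo (0 : ℝ) 1 ∩ {v | ε ≤ |u - v|}
      = (Ioo (0 : ℝ) 1 ∩ {v | δ ≤ |u - v|}) ∪ (Ioo (0 : ℝ) 1 ∩ N) := by
    ext v
    simp only [hN, mem_inter_iff, mem_ofPred_eq, mem_union]
    constructor
    · rintro ⟨h1, h2⟩
      rcases le_or_gt δ |u - v| with h | h
      · exact Or.inl ⟨h1, h⟩
      · exact Or.inr ⟨h1, h2, h⟩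
    · rintro (⟨h1, h2⟩ | ⟨h1, h2, h3⟩)
      · exact ⟨h1, hεδ.trans h2⟩
      · exact ⟨h1, h2⟩
  have hIfin : ∀ B : Set ℝ, volume (Ioo (0 : ℝ) 1 ∩ B) < ⊤ := fun B =>
    lt_of_le_of_lt (measure_mono inter_subset_left) (by simp)
  have hNfin : volume N < ⊤ := by
    refine lt_of_le_of_lt (measure_mono (t := Ioo (u - δ) (u + δ)) fun v hv => ?_) (by simp)
    have := abs_lt.1 hv.2
    exact ⟨by linarith, by linarith⟩
  have h1 : truncLap γ φ ε u = truncLap γ φ δ u + ∫ v in Ioo (0 : ℝ) 1 ∩ N, f v := by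
    unfold truncLap
    rw [hsplit, setIntegral_union ?_ (measurableSet_Ioo.inter hNm)
      (hint _ (measurableSet_trunc u δ) (hIfin _) fun v hv => hεδ.trans hv.2)
      (hint _ (measurableSet_Ioo.inter hNm) (hIfin _) fun v hv => hv.2.1)]
    rw [disjoint_left]
    rintro v ⟨_, h⟩ ⟨_, _, h'⟩
    exact absurd h (not_le.2 h')
  -- The restriction to the unit interval can be dropped near u. If v lies outside it within
  -- distance δ of u, then u is outside [a, b], because δ ≤ a and δ ≤ 1 - b, so both values of φ
  -- vanish. The domain becomes symmetric about u.
  have h2 : ∫ v in Ioo (0 : ℝ) 1 ∩ N, f v = ∫ v in N, f v := by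
    refine (setIntegral_eq_of_subset_of_forall_sdiff_eq_zero hNm inter_subset_right ?_).symm
    rintro v ⟨hvN, hv⟩
    have hv' : v ∉ Ioo (0 : ℝ) 1 := fun h => hv ⟨h, hvN⟩
    have hd := abs_lt.1 hvN.2
    have e1 : φ v = 0 := hφ.support v fun h => hv' ⟨by linarith [h.1], by linarith [h.2]⟩
    have e2 : φ u = 0 := hφ.support u fun h => hv' ⟨by linarith [h.1], by linarith [h.2]⟩
    simp [hf, e1, e2]
  have h3 : ∫ v in N, f v = ∫ z in S, (φ (u + z) - φ u) / |z| ^ (1 + γ) := by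
    rw [← integral_indicator hNm, ← integral_indicator hSm,
      ← integral_add_left_eq_self _ u]
    congr 1
    funext z
    simp only [indicator, hN, hS, hf, mem_ofPred_eq, sub_add_cancel_left, abs_neg]
  have hSint : ∀ g : ℝ → ℝ, Measurable g → (∀ M, (∀ z ∈ S, |g z| ≤ M) →
      IntegrableOn (fun z => g z / |z| ^ (1 + γ)) S) := by
    intro g hg M hM
    refine Measure.integrableOn_of_bounded (M := M / ε ^ (1 + γ))
      (volume_shell_lt_top ε δ).ne (by fun_prop : Measurable _).aestronglyMeasurable ?_
    filter_upwards [ae_restrict_mem hSm] with z hz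
    exact div_abs_rpow_le hγ hε (hM z hz) hz.1
  have h4 : ∫ z in S, (φ (u + z) - φ u - d u * z) / |z| ^ (1 + γ)
      = ∫ z in S, (φ (u + z) - φ u) / |z| ^ (1 + γ) := by
    have hφm := hφ.continuous.measurable
    have e : ∀ z, (φ (u + z) - φ u - d u * z) / |z| ^ (1 + γ)
        = (φ (u + z) - φ u) / |z| ^ (1 + γ) - d u * (z / |z| ^ (1 + γ)) := fun z => by ring
    simp only [e]
    have i1 := hSint (fun z => φ (u + z) - φ u) (by fun_prop) (2 * C) fun z _ => hb2 _ _
    have i2 := (hSint (fun z => z) measurable_id δ fun z hz => hz.2.le).const_mul (d u)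
    rw [integral_sub i1 i2, integral_const_mul, integral_shell_odd, mul_zero, sub_zero]
  rw [h1, h2, h3, h4]

/-- The truncated integrals converge and are bounded, uniformly over functions with the same
support and Taylor bound. -/
lemma exists_truncLap_bound {γ : ℝ} (hγ : 0 < γ) (hγ' : γ < 2) {a b : ℝ} (ha : 0 < a)
    (hb : b < 1) (C : ℝ) : ∃ B δ : ℝ, 0 < δ ∧ ∀ φ : ℝ → ℝ, HasTaylorBound a b C φ →
      ∀ u, (∀ ε, 0 < ε → ε ≤ δ → |truncLap γ φ ε u| ≤ B) ∧
        ∃ L, Tendsto (fun ε => truncLap γ φ ε u) (𝓝[>] 0) (𝓝 L) := by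
  set δ : ℝ := min a (1 - b) with hδ
  have hδ0 : 0 < δ := lt_min ha (by linarith)
  set J : ℝ := ∫ z in Ioo (-δ) δ, |z| ^ (1 - γ) with hJ
  -- The first term bounds the part at distance at least δ from u, the second the Taylor remainder C
  -- z² against the kernel. Both depend only on γ, a, b and C, so the bound is uniform along a
  -- time-dependent test function.
  refine ⟨2 * C / δ ^ (1 + γ) + |C| * J, δ, hδ0, fun φ hφ u => ?_⟩
  obtain ⟨d, hd⟩ := hφ.taylor
  have hC : 0 ≤ C := (abs_nonneg _).trans (hφ.bound 0)
  have hφm := hφ.continuous.measurable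
  set F : ℝ → ℝ := fun z => (φ (u + z) - φ u - d u * z) / |z| ^ (1 + γ) with hF
  have hFm : Measurable F := by fun_prop
  have hFb : ∀ z, |F z| ≤ C * |z| ^ (1 - γ) := by
    intro z
    rcases eq_or_ne z 0 with rfl | hz
    · simp only [hF, add_zero, sub_self, mul_zero, zero_div, abs_zero]; positivity
    have hpos : 0 < |z| := abs_pos.2 hz
    have hpow : |z| ^ (1 - γ) = z ^ 2 / |z| ^ (1 + γ) := by
      rw [← sq_abs z, ← Real.rpow_natCast, ← Real.rpow_sub hpos]; congr 1; push_cast; ring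
    rw [hpow, hF]
    simp only
    rw [abs_div, abs_of_nonneg (by positivity : 0 ≤ |z| ^ (1 + γ)), ← mul_div_assoc]
    gcongr
    exact hd u z
  have hJi : IntegrableOn (fun z : ℝ => C * |z| ^ (1 - γ)) (Ioo (-δ) δ) :=
    (integrableOn_abs_rpow (by linarith) δ).const_mul C
  have hFi : IntegrableOn F (Ioo (-δ) δ) :=
    Integrable.mono' hJi hFm.aestronglyMeasurable (ae_of_all _ fun z => hFb z)
  have hsub : ∀ ε, {z : ℝ | ε ≤ |z| ∧ |z| < δ} ⊆ Ioo (-δ) δ := fun ε z hz => abs_lt.1 hz.2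
  constructor
  · intro ε hε hεδ
    rw [truncLap_eq hγ ha hb hφ d hε hεδ (min_le_left _ _) (min_le_right _ _) u]
    refine (abs_add_le _ _).trans (add_le_add ?_ ?_)
    · have := norm_setIntegral_le_of_norm_le_const
        (μ := volume) (s := Ioo (0 : ℝ) 1 ∩ {v | δ ≤ |u - v|})
        (f := fun v => (φ v - φ u) / |u - v| ^ (1 + γ)) (C := 2 * C / δ ^ (1 + γ))
        (lt_of_le_of_lt (measure_mono inter_subset_left) (by simp)) (fun v hv => ?_)
      · refine this.trans ?_
        refine mul_le_of_le_one_right (by positivity) ?_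
        calc volume.real (Ioo (0 : ℝ) 1 ∩ {v | δ ≤ |u - v|}) ≤ volume.real (Ioo (0 : ℝ) 1) :=
              measureReal_mono inter_subset_left (by simp)
          _ = 1 := by simp
      · refine div_abs_rpow_le hγ hδ0 ?_ hv.2
        have h1 := hφ.bound v
        have h2 := hφ.bound u
        rw [abs_le] at *
        constructor <;> linarith [h1.1, h1.2, h2.1, h2.2]
    · rw [abs_of_nonneg hC, hJ, ← integral_const_mul]
      refine (abs_integral_le_integral_abs).trans ?_
      refine (integral_mono (hFi.mono_set (hsub ε)).abs (hJi.mono_set (hsub ε)) hFb).trans ?_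
      exact setIntegral_mono_set hJi (ae_of_all _ fun z => by positivity)
        (LE.le.eventuallyLE (hsub ε))
  · refine ⟨truncLap γ φ δ u + ∫ z in Ioo (-δ) δ, F z, ?_⟩
    have hlim : Tendsto (fun ε => truncLap γ φ δ u + ∫ z in {z : ℝ | ε ≤ |z| ∧ |z| < δ}, F z)
        (𝓝[>] 0) (𝓝 (truncLap γ φ δ u + ∫ z in Ioo (-δ) δ, F z)) := by
      refine Tendsto.const_add _ ?_
      have e : ∀ ε, ∫ z in {z : ℝ | ε ≤ |z| ∧ |z| < δ}, F z
          = ∫ z in Ioo (-δ) δ, ({z : ℝ | ε ≤ |z|}).indicator F z := by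
        intro ε
        rw [setIntegral_indicator (measurableSet_le measurable_const (by fun_prop))]
        congr 2
        ext z
        simp only [mem_ofPred_eq, mem_inter_iff, mem_Ioo, abs_lt]
        tauto
      simp only [e]
      refine tendsto_integral_filter_of_dominated_convergence (fun z => C * |z| ^ (1 - γ))
        (Eventually.of_forall fun ε => (hFm.indicator
          (measurableSet_le measurable_const (by fun_prop))).aestronglyMeasurable)
        (Eventually.of_forall fun ε => ae_of_all _ fun z => ?_) hJi (ae_of_all _ fun z => ?_)
      · refine (norm_indicator_le_norm_self _ _).trans (hFb z)
      · rcases eq_or_ne z 0 with rfl | hz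
        · have h0 : F 0 = 0 := by simp [hF]
          refine tendsto_const_nhds.congr fun ε => ?_
          simp only [indicator]; split_ifs <;> simp [h0]
        · refine tendsto_const_nhds.congr' ?_
          have : ∀ᶠ ε in 𝓝[>] (0 : ℝ), ε < |z| :=
            nhdsWithin_le_nhds (gt_mem_nhds (abs_pos.2 hz))
          filter_upwards [this] with ε hε
          rw [indicator_of_mem]
          exact hε.le
    refine hlim.congr' ?_
    have h1 : ∀ᶠ ε in 𝓝[>] (0 : ℝ), ε < δ := nhdsWithin_le_nhds (gt_mem_nhds hδ0)
    filter_upwards [h1, self_mem_nhdsWithin] with ε hε hε0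
    exact (truncLap_eq hγ ha hb hφ d hε0 hε.le (min_le_left _ _) (min_le_right _ _) u).symm

/-- Smooth functions with compact support in the open unit interval. -/
structure IsBump (φ : ℝ → ℝ) : Prop where
  smooth : ContDiff ℝ ∞ φ
  support : ∃ a b : ℝ, 0 < a ∧ b < 1 ∧ ∀ u, u ∉ Icc a b → φ u = 0

/-- The mean value inequality is used twice: φ' is C-Lipschitz, so y ↦ φ y - φ'(u) y has derivative
at most C|z| between u and u + z. The optimal constant C/2 is not needed. -/
lemma abs_taylor_le {φ : ℝ → ℝ} (hφ : ContDiff ℝ ∞ φ) {C : ℝ}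
    (hC : ∀ u, |iteratedDeriv 2 φ u| ≤ C) (u z : ℝ) :
    |φ (u + z) - φ u - deriv φ u * z| ≤ C * z ^ 2 := by
  have hC0 : 0 ≤ C := (abs_nonneg _).trans (hC 0)
  have hd : Differentiable ℝ φ := hφ.differentiable (by simp)
  have hd' : Differentiable ℝ (deriv φ) := by
    have := hφ.differentiable_iteratedDeriv 1 (by exact_mod_cast WithTop.coe_lt_top _)
    rwa [iteratedDeriv_one] at this
  have h1 : ∀ y, |deriv φ y - deriv φ u| ≤ C * |y - u| := fun y => by
    refine Convex.norm_image_sub_le_of_norm_deriv_le (s := univ) (fun x _ => hd' x)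
      (fun x _ => ?_) convex_univ (mem_univ _) (mem_univ _)
    have := hC x
    rwa [iteratedDeriv_succ, iteratedDeriv_one] at this
  have h2 := Convex.norm_image_sub_le_of_norm_hasDerivWithin_le (𝕜 := ℝ)
    (f := fun y => φ y - deriv φ u * y)
    (f' := fun y => deriv φ y - deriv φ u) (s := uIcc u (u + z)) (C := C * |z|)
    (x := u) (y := u + z) (fun x _ => by
      have := ((hd x).hasDerivAt.sub ((hasDerivAt_id x).const_mul (deriv φ u))).hasDerivWithinAt
        (s := uIcc u (u + z))
      rw [mul_one] at this
      exact this) (fun x hx => by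
      refine (h1 x).trans (mul_le_mul_of_nonneg_left ?_ hC0)
      have := abs_sub_left_of_mem_uIcc hx
      simpa using this) (convex_uIcc _ _) left_mem_uIcc right_mem_uIcc
  rw [Real.norm_eq_abs, Real.norm_eq_abs, add_sub_cancel_left] at h2
  calc |φ (u + z) - φ u - deriv φ u * z|
      = |φ (u + z) - deriv φ u * (u + z) - (φ u - deriv φ u * u)| := by congr 1; ring
    _ ≤ C * |z| * |z| := h2
    _ = C * z ^ 2 := by rw [mul_assoc, ← sq, sq_abs]

lemma hasTaylorBound_of_smooth {φ : ℝ → ℝ} (hφ : ContDiff ℝ ∞ φ) {a b C : ℝ}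
    (hs : ∀ u, u ∉ Icc a b → φ u = 0) (hC : ∀ u, |φ u| ≤ C)
    (hC2 : ∀ u, |iteratedDeriv 2 φ u| ≤ C) : HasTaylorBound a b C φ :=
  ⟨hs, hφ.continuous, hC, _, abs_taylor_le hφ hC2⟩

lemma iteratedDeriv_eq_zero_of_notMem {φ : ℝ → ℝ} {a b : ℝ} (hs : ∀ u, u ∉ Icc a b → φ u = 0)
    (n : ℕ) {u : ℝ} (hu : u ∉ Icc a b) : iteratedDeriv n φ u = 0 := by
  have h : φ =ᶠ[𝓝 u] fun _ => 0 := by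
    filter_upwards [isClosed_Icc.isOpen_compl.mem_nhds hu] with v hv using hs v hv
  rw [h.iteratedDeriv_eq]
  simp

lemma IsBump.exists_hasTaylorBound {φ : ℝ → ℝ} (hφ : IsBump φ) :
    ∃ a b C : ℝ, 0 < a ∧ b < 1 ∧ HasTaylorBound a b C φ := by
  obtain ⟨a, b, ha, hb, hs⟩ := hφ.support
  have h0 : HasCompactSupport φ := HasCompactSupport.intro isCompact_Icc (fun u hu => hs u hu)
  have h2 : HasCompactSupport (iteratedDeriv 2 φ) := HasCompactSupport.intro isCompact_Icc
    (fun u hu => iteratedDeriv_eq_zero_of_notMem hs 2 hu)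
  have hc2 : Continuous (iteratedDeriv 2 φ) :=
    hφ.smooth.continuous_iteratedDeriv 2 (WithTop.coe_le_coe.2 le_top)
  obtain ⟨C₀, hC₀⟩ := h0.exists_bound_of_continuous hφ.smooth.continuous
  obtain ⟨C₂, hC₂⟩ := h2.exists_bound_of_continuous hc2
  exact ⟨a, b, max C₀ C₂, ha, hb, hasTaylorBound_of_smooth hφ.smooth hs
    (fun u => (hC₀ u).trans (le_max_left _ _)) (fun u => (hC₂ u).trans (le_max_right _ _))⟩

lemma IsBump.exists_bound {φ : ℝ → ℝ} (hφ : IsBump φ) : ∃ C : ℝ, ∀ u, |φ u| ≤ C := by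
  obtain ⟨a, b, C, -, -, h⟩ := hφ.exists_hasTaylorBound
  exact ⟨C, h.bound⟩

lemma IsBump.measurable {φ : ℝ → ℝ} (hφ : IsBump φ) : Measurable φ :=
  hφ.smooth.continuous.measurable

lemma IsBump.sqInt_gap_lt_top {γ : ℝ} (hγ : 0 < γ) (hγ' : γ < 2) {φ : ℝ → ℝ} (hφ : IsBump φ) :
    sqInt (kerMeas γ) (gap φ) < ⊤ := by
  obtain ⟨a, b, ha, hb, hs⟩ := hφ.support
  have h0 : HasCompactSupport φ := HasCompactSupport.intro isCompact_Icc (fun u hu => hs u hu)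
  obtain ⟨K, hK⟩ := (hφ.smooth.of_le (m := 1) (by exact_mod_cast le_top)).lipschitzWith_of_hasCompactSupport h0
    (by simp)
  refine sqInt_gap_lt_top_of_lipschitz hγ hγ' (K := K) fun u _ v _ => ?_
  have := hK.dist_le_mul u v
  rwa [Real.dist_eq, Real.dist_eq] at this

lemma truncLap_eq_integral_volI (γ : ℝ) (φ : ℝ → ℝ) (ε u : ℝ) : truncLap γ φ ε u
    = ∫ v, (if ε ≤ |u - v| then (φ v - φ u) / |u - v| ^ (1 + γ) else 0) ∂volI := by
  unfold truncLap
  rw [← setIntegral_indicator (measurableSet_le measurable_const (by fun_prop))]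
  rfl

/-- The parameter p.1 will be time. Joint measurability of the truncations passes to the limit along
a sequence, giving joint measurability of 𝕃G. -/
lemma measurable_truncLap (γ : ℝ) {g : ℝ → ℝ → ℝ} (hg : Measurable (Function.uncurry g)) (ε : ℝ) :
    Measurable fun p : ℝ × ℝ => truncLap γ (g p.1) ε p.2 := by
  simp only [truncLap_eq_integral_volI]
  have h1 : Measurable fun q : (ℝ × ℝ) × ℝ => g q.1.1 q.2 :=
    hg.comp (measurable_fst.fst.prodMk measurable_snd)
  have h2 : Measurable fun q : (ℝ × ℝ) × ℝ => g q.1.1 q.1.2 :=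
    hg.comp (measurable_fst.fst.prodMk measurable_fst.snd)
  have : Measurable fun q : (ℝ × ℝ) × ℝ => (if ε ≤ |q.1.2 - q.2| then
      (g q.1.1 q.2 - g q.1.1 q.1.2) / |q.1.2 - q.2| ^ (1 + γ) else 0) := by
    refine Measurable.ite (measurableSet_le measurable_const (by fun_prop)) (by fun_prop)
      measurable_const
  exact (this.stronglyMeasurable.integral_prod_right (ν := volI)).measurable

lemma tendsto_truncLap {γ : ℝ} {φ : ℝ → ℝ} {u L : ℝ}
    (h : Tendsto (fun ε => truncLap γ φ ε u) (𝓝[>] 0) (𝓝 L)) : regLap γ φ u = cGamma γ * L := by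
  unfold regLap
  rw [← h.limUnder_eq]
  rfl

lemma tendsto_div_succ {δ : ℝ} (hδ : 0 < δ) :
    Tendsto (fun n : ℕ => δ / ((n : ℝ) + 1)) atTop (𝓝[>] 0) := by
  refine tendsto_nhdsWithin_iff.2 ⟨?_, Eventually.of_forall fun n => ?_⟩
  · exact (tendsto_const_div_atTop_nhds_zero_nat δ).comp (tendsto_add_atTop_nat 1) |>.congr
      fun n => by simp
  · exact div_pos hδ (by positivity)

/-- Uniform bound on, and approximation of, the regional fractional Laplacian. -/
lemma exists_regLap_bound {γ : ℝ} (hγ : 0 < γ) (hγ' : γ < 2) {a b : ℝ} (ha : 0 < a)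
    (hb : b < 1) (C : ℝ) : ∃ B δ : ℝ, 0 < δ ∧ ∀ φ : ℝ → ℝ, HasTaylorBound a b C φ →
      ∀ u, |regLap γ φ u| ≤ B ∧
        (∀ n : ℕ, |cGamma γ * truncLap γ φ (δ / ((n : ℝ) + 1)) u| ≤ B) ∧
        Tendsto (fun n : ℕ => cGamma γ * truncLap γ φ (δ / ((n : ℝ) + 1)) u) atTop
          (𝓝 (regLap γ φ u)) := by
  have hc := cGamma_pos hγ
  obtain ⟨B, δ, hδ, h⟩ := exists_truncLap_bound hγ hγ' ha hb C
  refine ⟨cGamma γ * B, δ, hδ, fun φ hφ u => ?_⟩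
  obtain ⟨h1, L, hL⟩ := h φ hφ u
  have hlim : Tendsto (fun n : ℕ => cGamma γ * truncLap γ φ (δ / ((n : ℝ) + 1)) u) atTop
          (𝓝 (regLap γ φ u)) := by
    rw [tendsto_truncLap hL]
    exact (hL.comp (tendsto_div_succ hδ)).const_mul _
  have hbd : ∀ n : ℕ, |cGamma γ * truncLap γ φ (δ / ((n : ℝ) + 1)) u| ≤ cGamma γ * B := fun n => by
    rw [abs_mul, abs_of_pos hc]
    refine mul_le_mul_of_nonneg_left (h1 _ (by positivity) ?_) hc.le
    exact div_le_self hδ.le (by simp)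
  exact ⟨le_of_tendsto hlim.abs (Eventually.of_forall hbd), hbd, hlim⟩

lemma IsBump.exists_regLap_bound {γ : ℝ} (hγ : 0 < γ) (hγ' : γ < 2) {φ : ℝ → ℝ}
    (hφ : IsBump φ) : ∃ B : ℝ, ∀ u, |regLap γ φ u| ≤ B := by
  obtain ⟨a, b, C, ha, hb, h⟩ := hφ.exists_hasTaylorBound
  obtain ⟨B, δ, -, h2⟩ := RegionalFractional.exists_regLap_bound hγ hγ' ha hb C
  exact ⟨B, fun u => (h2 φ h u).1⟩

lemma IsBump.measurable_regLap {γ : ℝ} (hγ : 0 < γ) (hγ' : γ < 2) {φ : ℝ → ℝ}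
    (hφ : IsBump φ) : Measurable (regLap γ φ) := by
  obtain ⟨a, b, C, ha, hb, h⟩ := hφ.exists_hasTaylorBound
  obtain ⟨B, δ, -, h2⟩ := RegionalFractional.exists_regLap_bound hγ hγ' ha hb C
  refine measurable_of_tendsto_metrizable (f := fun n : ℕ => fun u =>
    cGamma γ * truncLap γ φ (δ / ((n : ℝ) + 1)) u) (fun n => ?_) ?_
  · have := measurable_truncLap γ (g := fun _ => φ) (hφ.measurable.comp measurable_snd)
      (δ / ((n : ℝ) + 1))
    exact ((this.comp (measurable_const (a := (0 : ℝ)) |>.prodMk measurable_id)).const_mul _)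
  · exact tendsto_pi_nhds.2 fun u => (h2 φ h u).2.2

/-- The symmetrised truncated pairing. -/
lemma integral_mul_truncLap {γ : ℝ} (hγ : 0 < γ) {φ x : ℝ → ℝ} (hφ : Measurable φ) {C : ℝ}
    (hC : ∀ u, |φ u| ≤ C) (hx : Measurable x) {M : ℝ} (hM : ∀ u, |x u| ≤ M) {ε : ℝ} (hε : 0 < ε) :
    ∫ u, x u * (cGamma γ * truncLap γ φ ε u) ∂volI
      = -∫ p, (if ε ≤ |p.1 - p.2| then kerDens γ p * (gap x p * gap φ p) else 0)
          ∂(volI.prod volI) := by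
  set K : ℝ × ℝ → ℝ := fun p => if ε ≤ |p.1 - p.2| then
    (φ p.2 - φ p.1) / |p.1 - p.2| ^ (1 + γ) else 0 with hK
  have hM0 : 0 ≤ M := (abs_nonneg _).trans (hM 0)
  have hC0 : 0 ≤ C := (abs_nonneg _).trans (hC 0)
  have hKm : Measurable K :=
    Measurable.ite (measurableSet_le measurable_const (by fun_prop)) (by fun_prop)
      measurable_const
  have hKb : ∀ p, |K p| ≤ 2 * C / ε ^ (1 + γ) := by
    intro p
    simp only [hK]
    split_ifs with h
    · refine div_abs_rpow_le hγ hε ?_ h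
      have h1 := hC p.1
      have h2 := hC p.2
      rw [abs_le] at *
      constructor <;> linarith [h1.1, h1.2, h2.1, h2.2]
    · rw [abs_zero]; positivity
  have hint : ∀ f : ℝ × ℝ → ℝ, Measurable f → (∀ p, |f p| ≤ M) →
      Integrable (fun p => f p * K p) (volI.prod volI) := by
    intro f hf hb
    refine Integrable.of_bound (hf.mul hKm).aestronglyMeasurable (M * (2 * C / ε ^ (1 + γ)))
      (ae_of_all _ fun p => ?_)
    rw [Real.norm_eq_abs, abs_mul]
    exact mul_le_mul (hb p) (hKb p) (abs_nonneg _) hM0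
  have hi1 := hint (fun p => x p.1) (by fun_prop) fun p => hM _
  have hi2 := hint (fun p => x p.2) (by fun_prop) fun p => hM _
  have e1 : ∫ u, x u * truncLap γ φ ε u ∂volI = ∫ p, x p.1 * K p ∂(volI.prod volI) := by
    rw [integral_prod _ hi1]
    refine integral_congr_ae (ae_of_all _ fun u => ?_)
    simp only [truncLap_eq_integral_volI, hK]
    rw [← integral_const_mul]
  -- K is antisymmetric under exchange of the coordinates. This turns the pairing with x into half
  -- of a pairing with the increments of x.
  have e2 : ∫ p, x p.1 * K p ∂(volI.prod volI) = -∫ p, x p.2 * K p ∂(volI.prod volI) := by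
    rw [← integral_prod_swap (fun p => x p.1 * K p), ← integral_neg]
    refine integral_congr_ae (ae_of_all _ fun p => ?_)
    simp only [Prod.swap, hK]
    rw [abs_sub_comm]
    split_ifs <;> ring
  have e3 : ∫ p, (if ε ≤ |p.1 - p.2| then kerDens γ p * (gap x p * gap φ p) else 0)
      ∂(volI.prod volI) = -(cGamma γ / 2) * (∫ p, x p.1 * K p ∂(volI.prod volI)
        - ∫ p, x p.2 * K p ∂(volI.prod volI)) := by
    rw [← integral_sub hi1 hi2, ← integral_const_mul]
    refine integral_congr_ae (ae_of_all _ fun p => ?_)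
    simp only [hK, kerDens, gap]
    split_ifs <;> ring
  have e0 : ∀ u, x u * (cGamma γ * truncLap γ φ ε u) = cGamma γ * (x u * truncLap γ φ ε u) :=
    fun u => by ring
  simp only [e0]
  rw [integral_const_mul, e1, e3]
  rw [e2]; ring

/-- Integration by parts: the regional fractional Laplacian of a smooth compactly supported
function represents the energy form. -/
lemma integral_mul_regLap {γ : ℝ} (hγ : 0 < γ) (hγ' : γ < 2) {φ x : ℝ → ℝ} (hφ : IsBump φ)
    (hx : Measurable x) {M : ℝ} (hM : ∀ u, |x u| ≤ M) (hE : sqInt (kerMeas γ) (gap x) < ⊤) :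
    ∫ u, x u * regLap γ φ u ∂volI = -∫ p, gap x p * gap φ p ∂(kerMeas γ) := by
  have hM0 : 0 ≤ M := (abs_nonneg _).trans (hM 0)
  obtain ⟨a, b, C, ha, hb, h⟩ := hφ.exists_hasTaylorBound
  obtain ⟨B, δ, hδ, h2⟩ := RegionalFractional.exists_regLap_bound hγ hγ' ha hb C
  have lim1 : Tendsto (fun n : ℕ => ∫ u, x u * (cGamma γ * truncLap γ φ (δ / ((n : ℝ) + 1)) u) ∂volI)
      atTop (𝓝 (∫ u, x u * regLap γ φ u ∂volI)) := by
    refine tendsto_integral_of_dominated_convergence (fun _ => M * B) (fun n => ?_)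
      (integrable_const _) (fun n => ?_) ?_
    · have := measurable_truncLap γ (g := fun _ => φ) (hφ.measurable.comp measurable_snd)
        (δ / ((n : ℝ) + 1))
      exact (hx.mul ((this.comp (measurable_const (a := (0 : ℝ)) |>.prodMk measurable_id)).const_mul
        _)).aestronglyMeasurable
    · refine ae_of_all _ fun u => ?_
      rw [Real.norm_eq_abs, abs_mul]
      exact mul_le_mul (hM u) ((h2 φ h u).2.1 n) (abs_nonneg _) hM0
    · exact ae_of_all _ fun u => ((h2 φ h u).2.2).const_mul _
  -- By Cauchy–Schwarz for the jump measure the product of increments is integrable. It dominates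
  -- all its truncations.
  have hI : Integrable (fun p => kerDens γ p * (gap x p * gap φ p)) (volI.prod volI) := by
    have h1 : Integrable (fun p => gap x p * gap φ p) (kerMeas γ) :=
      integrable_mul_of_sqInt (measurable_gap hx).aemeasurable
        (measurable_gap hφ.measurable).aemeasurable hE (hφ.sqInt_gap_lt_top hγ hγ')
    have h3 := (integrable_withDensity_iff_integrable_smul₀' (μ := volI.prod volI)
      (measurable_kerDens γ).ennreal_ofReal.aemeasurable
      (ae_of_all _ fun _ => ENNReal.ofReal_lt_top)).1 h1
    refine h3.congr (ae_of_all _ fun p => ?_)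
    simp only [smul_eq_mul, ENNReal.toReal_ofReal (kerDens_nonneg hγ p)]
  have lim2 : Tendsto (fun n : ℕ => ∫ p, (if δ / ((n : ℝ) + 1) ≤ |p.1 - p.2| then
      kerDens γ p * (gap x p * gap φ p) else 0) ∂(volI.prod volI)) atTop
      (𝓝 (∫ p, kerDens γ p * (gap x p * gap φ p) ∂(volI.prod volI))) := by
    refine tendsto_integral_of_dominated_convergence
      (fun p => |kerDens γ p * (gap x p * gap φ p)|) (fun n => ?_) hI.abs (fun n => ?_) ?_
    · exact (Measurable.ite (measurableSet_le measurable_const (by fun_prop))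
        ((measurable_kerDens γ).mul ((measurable_gap hx).mul (measurable_gap hφ.measurable)))
        measurable_const).aestronglyMeasurable
    · refine ae_of_all _ fun p => ?_
      split_ifs
      · exact le_rfl
      · rw [norm_zero]; exact abs_nonneg _
    · refine ae_of_all _ fun p => ?_
      rcases eq_or_ne p.1 p.2 with hp | hp
      · have : gap x p = 0 := by simp [gap, hp]
        simp [this]
      · refine tendsto_const_nhds.congr' ?_
        have : ∀ᶠ n : ℕ in atTop, δ / ((n : ℝ) + 1) < |p.1 - p.2| :=
          (tendsto_nhdsWithin_iff.1 (tendsto_div_succ hδ)).1.eventually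
            (gt_mem_nhds (abs_pos.2 (sub_ne_zero.2 hp)))
        filter_upwards [this] with n hn
        rw [if_pos hn.le]
  rw [integral_kerMeas hγ]
  refine tendsto_nhds_unique lim1 (lim2.neg.congr fun n => ?_)
  rw [integral_mul_truncLap hγ hφ.measurable h.bound hx hM (by positivity)]

/-! ### Averages over intervals, and continuous representatives -/

/-- The uniform probability measure on `(t, t + h]`. -/
def avgMeas (t h : ℝ) : Measure ℝ := ENNReal.ofReal h⁻¹ • volume.restrict (Ioc t (t + h))

lemma isProbabilityMeasure_avgMeas (t : ℝ) {h : ℝ} (hh : 0 < h) :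
    IsProbabilityMeasure (avgMeas t h) := ⟨by
  simp only [avgMeas, Measure.smul_apply, Measure.restrict_apply_univ, Real.volume_Ioc,
    add_sub_cancel_left, smul_eq_mul]
  rw [← ENNReal.ofReal_mul (by positivity), inv_mul_cancel₀ hh.ne', ENNReal.ofReal_one]⟩

lemma integral_avgMeas (t : ℝ) {h : ℝ} (hh : 0 < h) (f : ℝ → ℝ) :
    ∫ s, f s ∂(avgMeas t h) = h⁻¹ * ∫ s in t..(t + h), f s := by
  rw [avgMeas, integral_smul_measure, ENNReal.toReal_ofReal (by positivity), smul_eq_mul,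
    intervalIntegral.integral_of_le (by linarith)]

lemma restrict_le_volI {t h : ℝ} (ht : 0 ≤ t) (hth : t + h ≤ 1) :
    volume.restrict (Ioc t (t + h)) ≤ volI := by
  rw [volI, Measure.restrict_congr_set Ioo_ae_eq_Ioc]
  exact Measure.restrict_mono (Ioc_subset_Ioc ht hth) le_rfl

/-- The second interval is contained in the first, so |u - v| ≤ h on their product and the kernel
density there is at least (c_γ/2) h^{-1-γ}. Multiplying by its inverse compares Lebesgue measure
with the jump measure. -/
lemma sqInt_gap_avgMeas_le {γ : ℝ} (hγ : 0 < γ) {g : ℝ → ℝ} (hg : Measurable g) {t h t' h' : ℝ}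
    (hh : 0 < h) (hh' : 0 < h') (ht : 0 ≤ t) (hth : t + h ≤ 1) (htt' : t ≤ t')
    (hth' : t' + h' ≤ t + h) :
    sqInt ((avgMeas t h).prod (avgMeas t' h')) (gap g)
      ≤ ENNReal.ofReal (h⁻¹ * h'⁻¹ * (2 / cGamma γ * h ^ (1 + γ))) * sqInt (kerMeas γ) (gap g) := by
  have hc := cGamma_pos hγ
  have := isProbabilityMeasure_avgMeas t hh
  have := isProbabilityMeasure_avgMeas t' hh'
  have hm : Measurable fun p => ENNReal.ofReal (gap g p ^ 2) :=
    ((measurable_gap hg).pow_const 2).ennreal_ofReal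
  set D : ℝ := 2 / cGamma γ * h ^ (1 + γ) with hD
  have hD0 : 0 ≤ D := by positivity
  have key : ∀ u ∈ Ioc t (t + h), ∀ v ∈ Ioc t' (t' + h'), ENNReal.ofReal (gap g (u, v) ^ 2)
      ≤ ENNReal.ofReal D *
        (ENNReal.ofReal (kerDens γ (u, v)) * ENNReal.ofReal (gap g (u, v) ^ 2)) := by
    intro u hu v hv
    rw [← ENNReal.ofReal_mul (kerDens_nonneg hγ _), ← ENNReal.ofReal_mul hD0]
    refine ENNReal.ofReal_le_ofReal ?_
    rcases eq_or_ne u v with rfl | huv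
    · simp [gap]
    have hpos : 0 < |u - v| := abs_pos.2 (sub_ne_zero.2 huv)
    have hle : |u - v| ≤ h := by
      rw [abs_le]
      constructor <;> linarith [hu.1, hu.2, hv.1, hv.2]
    have h1 : |u - v| ^ (1 + γ) ≤ h ^ (1 + γ) := Real.rpow_le_rpow hpos.le hle (by linarith)
    have h2 : 1 ≤ D * kerDens γ (u, v) := by
      have : D * kerDens γ (u, v) = h ^ (1 + γ) / |u - v| ^ (1 + γ) := by
        simp only [hD, kerDens]; field_simp
      rw [this, one_le_div (by positivity)]
      exact h1
    calc gap g (u, v) ^ 2 = 1 * gap g (u, v) ^ 2 := (one_mul _).symm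
      _ ≤ D * kerDens γ (u, v) * gap g (u, v) ^ 2 := by gcongr
      _ = _ := by ring
  calc sqInt ((avgMeas t h).prod (avgMeas t' h')) (gap g)
      = ENNReal.ofReal h⁻¹ * (ENNReal.ofReal h'⁻¹ * ∫⁻ u in Ioc t (t + h),
          ∫⁻ v in Ioc t' (t' + h'), ENNReal.ofReal (gap g (u, v) ^ 2)) := by
        rw [sqInt, lintegral_prod _ hm.aemeasurable]
        simp only [avgMeas, lintegral_smul_measure, smul_eq_mul]
        rw [lintegral_const_mul' _ _ ENNReal.ofReal_ne_top]
    _ ≤ ENNReal.ofReal h⁻¹ * (ENNReal.ofReal h'⁻¹ * ∫⁻ u in Ioc t (t + h),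
          ∫⁻ v in Ioc t' (t' + h'), ENNReal.ofReal D *
        (ENNReal.ofReal (kerDens γ (u, v)) * ENNReal.ofReal (gap g (u, v) ^ 2))) := by
        gcongr 2
        refine lintegral_mono_ae ?_
        filter_upwards [ae_restrict_mem measurableSet_Ioc] with u hu
        refine lintegral_mono_ae ?_
        filter_upwards [ae_restrict_mem measurableSet_Ioc] with v hv using key u hu v hv
    _ ≤ ENNReal.ofReal h⁻¹ * (ENNReal.ofReal h'⁻¹ * ∫⁻ u, ∫⁻ v, ENNReal.ofReal D *
        (ENNReal.ofReal (kerDens γ (u, v)) * ENNReal.ofReal (gap g (u, v) ^ 2)) ∂volI ∂volI) := by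
        gcongr 2
        refine lintegral_mono' (restrict_le_volI ht hth) fun u => ?_
        exact lintegral_mono' (restrict_le_volI (ht.trans htt') (hth'.trans hth)) fun v => le_rfl
    _ = _ := by
        simp only [lintegral_const_mul' _ _ (ENNReal.ofReal_ne_top (r := D))]
        have hm' : Measurable fun p =>
            ENNReal.ofReal (kerDens γ p) * ENNReal.ofReal (gap g p ^ 2) :=
          (measurable_kerDens γ).ennreal_ofReal.mul hm
        rw [sqInt_kerMeas, lintegral_prod _ hm'.aemeasurable,
          ENNReal.ofReal_mul (p := h⁻¹ * h'⁻¹) (by positivity),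
          ENNReal.ofReal_mul (p := h⁻¹) (by positivity), mul_assoc, mul_assoc]

/-- The difference of two averages is the mean of the increments under the product of the averaging
measures, and Jensen's inequality brings in the energy. -/
lemma abs_avg_sub_avg_sq_le {γ : ℝ} (hγ : 0 < γ) {g : ℝ → ℝ} (hg : Measurable g) {M : ℝ}
    (hM : ∀ u, |g u| ≤ M) (hE : sqInt (kerMeas γ) (gap g) < ⊤) {t h t' h' : ℝ}
    (hh : 0 < h) (hh' : 0 < h') (ht : 0 ≤ t) (hth : t + h ≤ 1) (htt' : t ≤ t')
    (hth' : t' + h' ≤ t + h) :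
    (∫ s, g s ∂(avgMeas t h) - ∫ s, g s ∂(avgMeas t' h')) ^ 2
      ≤ h⁻¹ * h'⁻¹ * (2 / cGamma γ * h ^ (1 + γ)) * (sqInt (kerMeas γ) (gap g)).toReal := by
  have hc := cGamma_pos hγ
  have := isProbabilityMeasure_avgMeas t hh
  have := isProbabilityMeasure_avgMeas t' hh'
  have hi : ∀ (P : Measure ℝ) [IsProbabilityMeasure P], Integrable g P := fun P _ =>
    Integrable.of_bound hg.aestronglyMeasurable M (ae_of_all _ hM)
  have e : ∫ p, gap g p ∂((avgMeas t h).prod (avgMeas t' h'))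
      = ∫ s, g s ∂(avgMeas t h) - ∫ s, g s ∂(avgMeas t' h') := by
    simp only [gap]
    rw [integral_sub ((hi _).comp_fst _) ((hi _).comp_snd _), integral_fun_fst, integral_fun_snd]
    simp
  have h1 := (ofReal_sq_integral_le (P := (avgMeas t h).prod (avgMeas t' h'))
    (measurable_gap hg).aemeasurable).trans
    (sqInt_gap_avgMeas_le hγ hg hh hh' ht hth htt' hth')
  rw [e] at h1
  have h2 := ENNReal.toReal_mono (ENNReal.mul_lt_top ENNReal.ofReal_lt_top hE).ne h1
  rwa [ENNReal.toReal_ofReal (sq_nonneg _), ENNReal.toReal_mul,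
    ENNReal.toReal_ofReal (by positivity)] at h2

/-- Functions of finite energy have continuous representatives when `γ > 1`. -/
theorem exists_continuousOn_rep {γ : ℝ} (hγ : 1 < γ) {g : ℝ → ℝ} (hg : Measurable g) {M : ℝ}
    (hM : ∀ u, |g u| ≤ M) (hE : sqInt (kerMeas γ) (gap g) < ⊤) :
    ∃ r : ℝ → ℝ, ContinuousOn r (Icc (0 : ℝ) 1) ∧ g =ᵐ[volI] r := by
  have hγ0 : 0 < γ := by linarith
  have hc := cGamma_pos hγ0
  set h : ℕ → ℝ := fun n => (1 / 2 : ℝ) ^ n with hh_def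
  have hh : ∀ n, 0 < h n := fun n => by positivity
  have hh1 : ∀ n, h n ≤ 1 := fun n => pow_le_one₀ (by norm_num) (by norm_num)
  have hhs : ∀ n, h (n + 1) = h n / 2 := fun n => by simp only [hh_def, pow_succ]; ring
  -- The interval of length h n that starts at (1 - h n) x contains x in its closure and stays
  -- inside [0,1] for every x in [0,1], end points included. These intervals decrease with n.
  set A : ℕ → ℝ → ℝ := fun n x => ∫ s, g s ∂(avgMeas ((1 - h n) * x) (h n)) with hA
  -- Successive averages over intervals of length h = 2^{-n} and h/2 differ by at most a multiple of
  -- h^{(γ-1)/2} = qⁿ. The ratio q is less than 1 because γ > 1.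
  set q : ℝ := (1 / 2 : ℝ) ^ ((γ - 1) / 2) with hq
  have hq0 : 0 < q := by positivity
  have hq1 : q < 1 := Real.rpow_lt_one (by norm_num) (by norm_num) (by linarith)
  set E : ℝ := (sqInt (kerMeas γ) (gap g)).toReal with hEdef
  have hE0 : 0 ≤ E := ENNReal.toReal_nonneg
  have hstep : ∀ x ∈ Icc (0 : ℝ) 1, ∀ n, dist (A n x) (A (n + 1) x)
      ≤ √(4 / cGamma γ * E) * q ^ n := by
    intro x hx n
    have hsq := abs_avg_sub_avg_sq_le hγ0 hg hM hE (t := (1 - h n) * x) (h := h n)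
      (t' := (1 - h (n + 1)) * x) (h' := h (n + 1)) (hh n) (hh (n + 1))
      (mul_nonneg (by linarith [hh1 n]) hx.1) (by nlinarith [hh n, hh1 n, hx.2])
      (by rw [hhs]; nlinarith [hh n, hx.1]) (by rw [hhs]; nlinarith [hh n, hx.2])
    have hpow : (h n)⁻¹ * (h (n + 1))⁻¹ * (2 / cGamma γ * h n ^ (1 + γ))
        = 4 / cGamma γ * (q ^ n) ^ 2 := by
      have e1 : h n ^ (1 + γ) = h n ^ 2 * (q ^ n) ^ 2 := by
        have e2 : (q ^ n) ^ 2 = h n ^ (γ - 1) := by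
          simp only [hq, hh_def]
          rw [← pow_mul, ← Real.rpow_natCast, ← Real.rpow_natCast, ← Real.rpow_mul
            (by norm_num), ← Real.rpow_mul (by norm_num)]
          congr 1; push_cast; ring
        rw [e2, ← Real.rpow_natCast (h n) 2, ← Real.rpow_add (hh n)]
        congr 1; push_cast; ring
      rw [hhs, e1]
      have := (hh n).ne'
      field_simp
      norm_num
    rw [hpow] at hsq
    rw [Real.dist_eq]
    refine abs_le_of_sq_le_sq ?_ (by positivity)
    rw [mul_pow, Real.sq_sqrt (by positivity)]
    calc _ ≤ _ := hsq
      _ = _ := by ring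
  have hcau : ∀ x ∈ Icc (0 : ℝ) 1, ∃ l, Tendsto (fun n => A n x) atTop (𝓝 l) := fun x hx =>
    cauchySeq_tendsto_of_complete (cauchySeq_of_le_geometric q _ hq1 (hstep x hx))
  choose! r hr using hcau
  have hdist : ∀ x ∈ Icc (0 : ℝ) 1, ∀ n, dist (A n x) (r x)
      ≤ √(4 / cGamma γ * E) * q ^ n / (1 - q) := fun x hx n =>
    dist_le_of_le_geometric_of_tendsto q _ hq1 (hstep x hx) (hr x hx) n
  have hAcont : ∀ n, Continuous (A n) := by
    intro n
    have hint : ∀ a b : ℝ, IntervalIntegrable g volume a b := fun a b => by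
      refine (intervalIntegrable_const (c := M)).mono_fun' hg.aestronglyMeasurable
        (ae_of_all _ hM)
    have e : A n = fun x => (h n)⁻¹ * ((∫ s in (0 : ℝ)..((1 - h n) * x + h n), g s)
        - ∫ s in (0 : ℝ)..((1 - h n) * x), g s) := by
      funext x
      simp only [hA]
      rw [integral_avgMeas _ (hh n), intervalIntegral.integral_interval_sub_left (hint _ _)
        (hint _ _)]
    have hp := intervalIntegral.continuous_primitive hint 0
    rw [e]
    exact continuous_const.mul ((hp.comp (by fun_prop)).sub (hp.comp (by fun_prop)))
  refine ⟨r, ?_, ?_⟩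
  · refine TendstoUniformlyOn.continuousOn (F := A) (p := atTop) ?_
      (Frequently.of_forall fun n => (hAcont n).continuousOn)
    rw [Metric.tendstoUniformlyOn_iff]
    intro ε hε
    have hlim : Tendsto (fun n => √(4 / cGamma γ * E) * q ^ n / (1 - q)) atTop (𝓝 0) := by
      have := ((tendsto_pow_atTop_nhds_zero_of_lt_one hq0.le hq1).const_mul
        (√(4 / cGamma γ * E))).div_const (1 - q)
      simpa using this
    filter_upwards [hlim.eventually (gt_mem_nhds hε)] with n hn x hx
    rw [dist_comm]
    exact (hdist x hx n).trans_lt hn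
  · have hloc : LocallyIntegrable g volume := by
      rw [locallyIntegrable_iff]
      intro k hk
      exact Measure.integrableOn_of_bounded hk.measure_lt_top.ne hg.aestronglyMeasurable
        (ae_of_all _ hM)
    have hleb := IsUnifLocDoublingMeasure.ae_tendsto_average volume hloc 1
    filter_upwards [ae_restrict_of_ae hleb, ae_mem_volI] with x hx hxI
    have hxI' : x ∈ Icc (0 : ℝ) 1 := Ioo_subset_Icc_self hxI
    refine tendsto_nhds_unique ?_ (hr x hxI')
    -- The averaging interval is a ball centred at its midpoint, not at x, with x at distance at
    -- most its radius. The uncentred form of Lebesgue differentiation with dilation 1 covers this.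
    have := hx (fun n : ℕ => (1 - h n) * x + h n / 2) (fun n => h n / 2) (l := atTop) ?_ ?_
    · refine this.congr fun n => ?_
      rw [Real.closedBall_eq_Icc, setAverage_eq, integral_Icc_eq_integral_Ioc]
      simp only [hA]
      rw [integral_avgMeas _ (hh n), intervalIntegral.integral_of_le (by linarith [hh n])]
      simp only [smul_eq_mul]
      rw [show (1 - h n) * x + h n / 2 - h n / 2 = (1 - h n) * x by ring,
        show (1 - h n) * x + h n / 2 + h n / 2 = (1 - h n) * x + h n by ring]
      congr 2
      rw [Real.volume_real_Icc_of_le (by linarith [hh n])]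
      ring
    · refine tendsto_nhdsWithin_iff.2 ⟨?_, Eventually.of_forall fun n => half_pos (hh n)⟩
      have := (tendsto_pow_atTop_nhds_zero_of_lt_one (r := (1 / 2 : ℝ)) (by norm_num)
        (by norm_num)).div_const 2
      rwa [zero_div] at this
    · refine Eventually.of_forall fun n => ?_
      rw [Real.closedBall_eq_Icc]
      constructor
      · nlinarith [hh n, hxI.1]
      · nlinarith [hh n, hxI.2]

/-! ### Reflection of the unit interval -/

lemma measurePreserving_reflect : MeasurePreserving (fun u : ℝ => 1 - u) volI volI := by
  have h := (Measure.measurePreserving_sub_left (volume : Measure ℝ) 1).restrict_preimage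
    (measurableSet_Ioo (a := (0 : ℝ)) (b := 1))
  have e : (fun u : ℝ => 1 - u) ⁻¹' Ioo (0 : ℝ) 1 = Ioo 0 1 := by
    ext u
    simp only [mem_preimage, mem_Ioo]
    constructor <;> rintro ⟨h1, h2⟩ <;> constructor <;> linarith
  rwa [e] at h

lemma V₁_reflect (γ u : ℝ) : V₁ γ (1 - u) = V₁ γ u := by
  simp only [V₁, rMinus, rPlus, sub_sub_cancel]; ring

lemma sqInt_potMeas_reflect (γ : ℝ) {g : ℝ → ℝ} (hg : Measurable g) :
    sqInt (potMeas γ) (fun u => g (1 - u)) = sqInt (potMeas γ) g := by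
  rw [← l2V₁NormSq_eq, ← l2V₁NormSq_eq]
  unfold l2V₁NormSq
  have h := measurePreserving_reflect.lintegral_comp
    (f := fun u => ENNReal.ofReal (g u ^ 2 * V₁ γ u))
    (((hg.pow_const 2).mul (measurable_V₁ γ)).ennreal_ofReal)
  simp only [V₁_reflect] at h
  exact h

lemma sqInt_kerMeas_reflect (γ : ℝ) {g : ℝ → ℝ} (hg : Measurable g) :
    sqInt (kerMeas γ) (gap fun u => g (1 - u)) = sqInt (kerMeas γ) (gap g) := by
  rw [sqInt_kerMeas, sqInt_kerMeas]
  have h := (measurePreserving_reflect.prod measurePreserving_reflect).lintegral_comp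
    (f := fun p => ENNReal.ofReal (kerDens γ p) * ENNReal.ofReal (gap g p ^ 2))
    ((measurable_kerDens γ).ennreal_ofReal.mul
      ((measurable_gap hg).pow_const 2).ennreal_ofReal)
  rw [← h]
  refine lintegral_congr fun p => ?_
  simp only [kerDens, gap, Prod.map]
  rw [show 1 - p.1 - (1 - p.2) = -(p.1 - p.2) by ring, abs_neg]

/-! ### Vanishing of the boundary values -/

/-- If r(0) ≠ 0, then r² V₁ is at least a positive multiple of u^{-γ} near 0, which is not
integrable for γ > 1. -/
lemma rep_zero_of_sqInt_potMeas {γ : ℝ} (hγ : 1 < γ) {r : ℝ → ℝ}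
    (hr : ContinuousOn r (Icc (0 : ℝ) 1)) (hV : sqInt (potMeas γ) r < ⊤) : r 0 = 0 := by
  have hγ0 : 0 < γ := by linarith
  have hc := cGamma_pos hγ0
  by_contra hne
  have hpos : 0 < |r 0| := abs_pos.2 hne
  have hcw : ContinuousWithinAt (fun u => |r u|) (Icc (0 : ℝ) 1) 0 :=
    (hr 0 (by simp)).abs
  have hev : ∀ᶠ u in 𝓝[Icc (0 : ℝ) 1] 0, |r 0| / 2 < |r u| :=
    hcw.eventually (lt_mem_nhds (by linarith))
  obtain ⟨η, hη, hball⟩ := Metric.mem_nhdsWithin_iff.1 hev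
  set δ := min η 1 with hδ
  have hδ0 : 0 < δ := lt_min hη one_pos
  have hbig : ∀ u ∈ Ioo (0 : ℝ) δ, |r 0| / 2 < |r u| := by
    intro u hu
    refine hball ⟨?_, ⟨hu.1.le, hu.2.le.trans (min_le_right _ _)⟩⟩
    rw [Metric.mem_ball, Real.dist_eq, sub_zero, abs_of_pos hu.1]
    exact hu.2.trans_le (min_le_left _ _)
  have hni : ¬ IntegrableOn (fun u : ℝ => u ^ (-γ)) (Ioo 0 δ) := by
    rw [intervalIntegral.integrableOn_Ioo_rpow_iff hδ0]; linarith
  apply hni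
  refine ⟨(by fun_prop : Measurable _).aestronglyMeasurable, ?_⟩
  rw [hasFiniteIntegral_iff_ofReal (by
    filter_upwards [ae_restrict_mem measurableSet_Ioo] with u hu
    exact Real.rpow_nonneg hu.1.le _)]
  set D : ℝ := (|r 0| / 2) ^ 2 * (cGamma γ * γ⁻¹) with hD
  have hD0 : 0 < D := by positivity
  have h1 : ENNReal.ofReal D * ∫⁻ u in Ioo 0 δ, ENNReal.ofReal (u ^ (-γ))
      ≤ sqInt (potMeas γ) r := by
    rw [← l2V₁NormSq_eq, l2V₁NormSq, ← lintegral_const_mul' _ _ ENNReal.ofReal_ne_top]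
    refine le_trans ?_ (lintegral_mono_set (Ioo_subset_Ioo le_rfl (min_le_right η 1)))
    refine lintegral_mono_ae ?_
    filter_upwards [ae_restrict_mem measurableSet_Ioo] with u hu
    rw [← ENNReal.ofReal_mul hD0.le]
    refine ENNReal.ofReal_le_ofReal ?_
    have h2 : (|r 0| / 2) ^ 2 ≤ r u ^ 2 := by
      rw [← sq_abs (r u)]
      exact pow_le_pow_left₀ (by positivity) (hbig u hu).le 2
    have h3 : rMinus γ u ≤ V₁ γ u := by
      have := rPlus_pos hγ0 (hu.2.trans_le (min_le_right η 1))
      rw [V₁]; linarith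
    have h4 := rMinus_pos hγ0 hu.1
    calc D * u ^ (-γ) = (|r 0| / 2) ^ 2 * rMinus γ u := by rw [hD, rMinus]; ring
      _ ≤ r u ^ 2 * V₁ γ u := mul_le_mul h2 h3 h4.le (sq_nonneg _)
  by_contra hcon
  rw [not_lt, top_le_iff] at hcon
  rw [hcon, ENNReal.mul_top (by simpa using hD0), top_le_iff] at h1
  exact hV.ne h1

/-- A function of finite energy in `L²(V₁)` has a continuous representative on the line that
vanishes outside of the open unit interval. -/
theorem exists_continuous_rep {γ : ℝ} (hγ : 1 < γ) {g : ℝ → ℝ} (hg : Measurable g) {M : ℝ}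
    (hM : ∀ u, |g u| ≤ M) (hE : sqInt (kerMeas γ) (gap g) < ⊤)
    (hV : sqInt (potMeas γ) g < ⊤) :
    ∃ r : ℝ → ℝ, Continuous r ∧ (∀ u, u ∉ Ioo (0 : ℝ) 1 → r u = 0) ∧ g =ᵐ[volI] r := by
  obtain ⟨r, hr, hgr⟩ := exists_continuousOn_rep hγ hg hM hE
  have h0 : r 0 = 0 := rep_zero_of_sqInt_potMeas hγ hr (by rwa [← sqInt_potMeas_congr γ hgr])
  have h1 : r 1 = 0 := by
    have hcont : ContinuousOn (fun u => r (1 - u)) (Icc (0 : ℝ) 1) :=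
      hr.comp (by fun_prop) fun u hu => ⟨by linarith [hu.2], by linarith [hu.1]⟩
    have hae : (fun u => g (1 - u)) =ᵐ[volI] fun u => r (1 - u) :=
      measurePreserving_reflect.quasiMeasurePreserving.ae_eq_comp hgr
    have := rep_zero_of_sqInt_potMeas hγ hcont (by
      rw [← sqInt_potMeas_congr γ hae, sqInt_potMeas_reflect γ hg]; exact hV)
    simpa using this
  refine ⟨fun u => r (max 0 (min u 1)), ?_, fun u hu => ?_, ?_⟩
  · exact hr.comp_continuous (by fun_prop) fun u =>
      ⟨le_max_left _ _, max_le zero_le_one (min_le_right _ _)⟩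
  · simp only [mem_Ioo, not_and_or, not_lt] at hu
    rcases hu with hu | hu <;> beta_reduce
    · rw [min_eq_left (by linarith), max_eq_left hu, h0]
    · rw [min_eq_right hu, max_eq_right zero_le_one, h1]
  · filter_upwards [hgr, ae_mem_volI] with u hu huI
    rw [hu, min_eq_left huI.2.le, max_eq_right huI.1.le]

/-! ### The fractional Hardy inequality -/

/-- The one-sided Hardy integral. -/
def hardyInt (γ : ℝ) (v : ℝ → ℝ) : ℝ≥0∞ := ∫⁻ u, ENNReal.ofReal (v u ^ 2 * u ^ (-γ)) ∂volI

lemma sqInt_potMeas_eq_hardyInt {γ : ℝ} (hγ : 0 < γ) {v : ℝ → ℝ} (hv : Measurable v) :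
    sqInt (potMeas γ) v = ENNReal.ofReal (cGamma γ / γ) *
      (hardyInt γ v + hardyInt γ fun u => v (1 - u)) := by
  have hc := cGamma_pos hγ
  have e : hardyInt γ (fun u => v (1 - u)) =
      ∫⁻ u, ENNReal.ofReal (v u ^ 2 * (1 - u) ^ (-γ)) ∂volI := by
    rw [hardyInt, ← measurePreserving_reflect.lintegral_comp
      (f := fun u => ENNReal.ofReal (v u ^ 2 * (1 - u) ^ (-γ))) (by fun_prop)]
    simp
  rw [e, hardyInt, ← lintegral_add_left (by fun_prop), ← l2V₁NormSq_eq, l2V₁NormSq,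
    ← lintegral_const_mul' _ _ ENNReal.ofReal_ne_top]
  refine lintegral_congr_ae ?_
  filter_upwards [ae_mem_volI] with u hu
  have h1 : 0 < 1 - u := by linarith [hu.2]
  have h2 := hu.1
  rw [← ENNReal.ofReal_add (by positivity) (by positivity), ← ENNReal.ofReal_mul (by positivity)]
  congr 1
  rw [V₁, rMinus, rPlus]; ring

/-- The constant in front of y² can be taken as close to 1 as desired. The Hardy argument cannot
afford the usual factor 2. -/
lemma sq_le_add_sq {s : ℝ} (hs : 0 < s) (x y : ℝ) :
    x ^ 2 ≤ (1 + s) * y ^ 2 + (1 + 1 / s) * (x - y) ^ 2 := by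
  have : (1 + s) * y ^ 2 + (1 + 1 / s) * (x - y) ^ 2 - x ^ 2 = (s * y - (x - y)) ^ 2 / s := by
    field_simp; ring
  have h2 : 0 ≤ (s * y - (x - y)) ^ 2 / s := by positivity
  linarith

/-- The value v(u) is compared with v(w) for w in the window (u/(2b), u/2). Averaging v(w)² u^{-γ}
over the window and exchanging the integrals reproduces the Hardy integral of v: the dilation by 2
gains 2^{1-γ}, while Young's inequality and the width of the window lose a factor b each. With b =
2^{(γ-1)/4} the total factor θ = 2^{-(γ-1)/2} is below 1, and the term is absorbed because the
integral is assumed finite. The error terms v(u) - v(w) are controlled by the energy, since |u - w|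
≤ u on the window. -/
lemma exists_hardyInt_le {γ : ℝ} (hγ : 1 < γ) : ∃ C : ℝ, 0 < C ∧ ∀ v : ℝ → ℝ, Measurable v →
    hardyInt γ v < ⊤ → hardyInt γ v ≤ ENNReal.ofReal C * sqInt (kerMeas γ) (gap v) := by
  have hγ0 : 0 < γ := by linarith
  have hc := cGamma_pos hγ0
  set b : ℝ := (2 : ℝ) ^ ((γ - 1) / 4) with hb
  have hb1 : 1 < b := Real.one_lt_rpow (by norm_num) (by linarith)
  set s : ℝ := b - 1 with hs
  have hs0 : 0 < s := by linarith
  set θ : ℝ := (2 : ℝ) ^ (-((γ - 1) / 2)) with hθ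
  have hθ0 : 0 < θ := by positivity
  have hθ1 : θ < 1 := Real.rpow_lt_one_of_one_lt_of_neg (by norm_num) (by linarith)
  -- The window at u has length u/k, so k/u normalises its uniform measure.
  set k : ℝ := 2 * b / s with hk
  have hk0 : 0 < k := by positivity
  set C₁ : ℝ := (1 + 1 / s) * k * (2 / cGamma γ) with hC₁
  have hC₁0 : 0 < C₁ := by positivity
  refine ⟨C₁ / (1 - θ), div_pos hC₁0 (by linarith), fun v hv hfin => ?_⟩
  set W : Set (ℝ × ℝ) := {p | p.1 / (2 * b) < p.2 ∧ p.2 < p.1 / 2} with hW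
  have hWm : MeasurableSet W :=
    MeasurableSet.inter (s₁ := {p : ℝ × ℝ | p.1 / (2 * b) < p.2}) (s₂ := {p | p.2 < p.1 / 2})
      (measurableSet_lt (by fun_prop) (by fun_prop))
      (measurableSet_lt (by fun_prop) (by fun_prop))
  set F : ℝ × ℝ → ℝ≥0∞ := W.indicator fun p => ENNReal.ofReal (k * p.1 ^ (-1 - γ) * v p.2 ^ 2)
    with hF
  set H : ℝ × ℝ → ℝ≥0∞ := W.indicator fun p => ENNReal.ofReal (k * p.1 ^ (-1 - γ) * gap v p ^ 2)
    with hH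
  have hFm : Measurable F := Measurable.indicator (by fun_prop) hWm
  have hHm : Measurable H := Measurable.indicator
    (by have := measurable_gap hv; fun_prop) hWm
  have hpowu : ∀ u : ℝ, 0 < u → u ^ (-1 - γ) * u = u ^ (-γ) := fun u hu => by
    rw [← Real.rpow_add_one hu.ne']; congr 1; ring
  have step1 : hardyInt γ v ≤ ENNReal.ofReal (1 + s) * ∫⁻ u, ∫⁻ w, F (u, w) ∂volI ∂volI
      + ENNReal.ofReal (1 + 1 / s) * ∫⁻ u, ∫⁻ w, H (u, w) ∂volI ∂volI := by
    rw [← lintegral_const_mul' _ _ ENNReal.ofReal_ne_top,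
      ← lintegral_const_mul' _ _ ENNReal.ofReal_ne_top,
      ← lintegral_add_left (hFm.lintegral_prod_right'.const_mul _)]
    refine lintegral_mono_ae ?_
    filter_upwards [ae_mem_volI] with u hu
    have hu0 := hu.1
    have hslice : MeasurableSet {w | (u, w) ∈ W} := hWm.preimage measurable_prodMk_left
    have hvol : volI {w | (u, w) ∈ W} = ENNReal.ofReal (u / 2 - u / (2 * b)) := by
      have e : {w | (u, w) ∈ W} = Ioo (u / (2 * b)) (u / 2) := rfl
      have h1 : 0 < u / (2 * b) := by positivity
      rw [e, volI, Measure.restrict_apply measurableSet_Ioo,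
        inter_eq_left.2 (Ioo_subset_Ioo h1.le (by linarith [hu.2])), Real.volume_Ioo]
    calc ENNReal.ofReal (v u ^ 2 * u ^ (-γ))
        = ENNReal.ofReal (k * u ^ (-1 - γ) * v u ^ 2) * volI {w | (u, w) ∈ W} := by
          rw [hvol, ← ENNReal.ofReal_mul (by positivity)]
          congr 1
          rw [← hpowu u hu0, hk, hs]
          have : b - 1 ≠ 0 := by linarith
          field_simp
      _ = ∫⁻ w, ({w | (u, w) ∈ W}).indicator
            (fun _ => ENNReal.ofReal (k * u ^ (-1 - γ) * v u ^ 2)) w ∂volI := by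
          rw [lintegral_indicator_const hslice]
      _ ≤ ∫⁻ w, (ENNReal.ofReal (1 + s) * F (u, w) + ENNReal.ofReal (1 + 1 / s) * H (u, w))
            ∂volI := by
          refine lintegral_mono fun w => ?_
          by_cases hw : (u, w) ∈ W
          · rw [indicator_of_mem (show w ∈ {w | (u, w) ∈ W} from hw)]
            simp only [hF, hH]
            rw [indicator_of_mem hw, indicator_of_mem hw, ← ENNReal.ofReal_mul (by positivity),
              ← ENNReal.ofReal_mul (by positivity), ← ENNReal.ofReal_add (by positivity)
              (by positivity)]
            refine ENNReal.ofReal_le_ofReal ?_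
            have := sq_le_add_sq hs0 (v u) (v w)
            have h3 : 0 ≤ k * u ^ (-1 - γ) := by positivity
            calc _ ≤ k * u ^ (-1 - γ) * ((1 + s) * v w ^ 2 + (1 + 1 / s) * (v u - v w) ^ 2) := by
                  gcongr
              _ = _ := by simp only [gap]; ring
          · rw [indicator_of_notMem (show w ∉ {w | (u, w) ∈ W} from hw)]; exact zero_le
      _ = _ := by
          have hFu : Measurable fun w => ENNReal.ofReal (1 + s) * F (u, w) :=
            (hFm.comp measurable_prodMk_left).const_mul _
          rw [lintegral_add_left hFu,
            lintegral_const_mul' _ _ ENNReal.ofReal_ne_top,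
            lintegral_const_mul' _ _ ENNReal.ofReal_ne_top]
  have step2 : ENNReal.ofReal (1 + s) * ∫⁻ u, ∫⁻ w, F (u, w) ∂volI ∂volI
      ≤ ENNReal.ofReal θ * hardyInt γ v := by
    rw [lintegral_lintegral_swap (f := fun u w => F (u, w)) hFm.aemeasurable, hardyInt,
      ← lintegral_const_mul' _ _ ENNReal.ofReal_ne_top,
      ← lintegral_const_mul' _ _ ENNReal.ofReal_ne_top]
    refine lintegral_mono_ae ?_
    filter_upwards [ae_mem_volI] with w hw
    have hw0 := hw.1
    have hbnd : ∀ u, F (u, w) ≤ (Ioo (2 * w) (2 * b * w)).indicator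
        (fun _ => ENNReal.ofReal (k * (2 * w) ^ (-1 - γ) * v w ^ 2)) u := by
      intro u
      by_cases h : (u, w) ∈ W
      · have h1 : u / (2 * b) < w := h.1
        have h2 : w < u / 2 := h.2
        have hu1 : 2 * w < u := by linarith
        have hu2 : u < 2 * b * w := by
          rw [div_lt_iff₀ (by positivity)] at h1; linarith
        simp only [hF]
        rw [indicator_of_mem h, indicator_of_mem (show u ∈ Ioo (2 * w) (2 * b * w) from
          ⟨hu1, hu2⟩)]
        refine ENNReal.ofReal_le_ofReal ?_
        gcongr ?_ * _
        refine mul_le_mul_of_nonneg_left ?_ hk0.le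
        exact Real.rpow_le_rpow_of_nonpos (by positivity) hu1.le (by linarith)
      · simp only [hF]; rw [indicator_of_notMem h]; exact zero_le
    have hbnd' : ∫⁻ u, F (u, w) ∂volI ≤ ∫⁻ u, (Ioo (2 * w) (2 * b * w)).indicator
        (fun _ => ENNReal.ofReal (k * (2 * w) ^ (-1 - γ) * v w ^ 2)) u :=
      lintegral_mono' Measure.restrict_le_self hbnd
    refine (mul_le_mul_right hbnd' _).trans_eq ?_
    calc ENNReal.ofReal (1 + s) * ∫⁻ u, (Ioo (2 * w) (2 * b * w)).indicator
          (fun _ => ENNReal.ofReal (k * (2 * w) ^ (-1 - γ) * v w ^ 2)) u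
        = ENNReal.ofReal (θ * (v w ^ 2 * w ^ (-γ))) := by
          rw [lintegral_indicator_const measurableSet_Ioo, Real.volume_Ioo,
            ← ENNReal.ofReal_mul (by positivity), ← ENNReal.ofReal_mul (by positivity)]
          congr 1
          have e1 : (2 * w) ^ (-1 - γ) = 2 ^ (-1 - γ) * w ^ (-1 - γ) :=
            Real.mul_rpow (by norm_num) hw0.le
          have e2 : θ = b * b * (2 * 2 * 2 ^ (-1 - γ)) := by
            simp only [hθ, hb]
            rw [← Real.rpow_add (by norm_num)]
            have : (2 : ℝ) * 2 = 2 ^ (2 : ℝ) := by norm_num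
            rw [this, ← Real.rpow_add (by norm_num), ← Real.rpow_add (by norm_num)]
            congr 1; ring
          rw [e1, e2, ← hpowu w hw0, hk]
          have hs1 : 1 + s = b := by rw [hs]; ring
          rw [hs1, show 2 * b * w - 2 * w = 2 * s * w by rw [hs]; ring]
          field_simp
      _ = _ := ENNReal.ofReal_mul hθ0.le
  have step3 : ENNReal.ofReal (1 + 1 / s) * ∫⁻ u, ∫⁻ w, H (u, w) ∂volI ∂volI
      ≤ ENNReal.ofReal C₁ * sqInt (kerMeas γ) (gap v) := by
    rw [sqInt_kerMeas, ← lintegral_prod _ hHm.aemeasurable,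
      ← lintegral_const_mul' _ _ ENNReal.ofReal_ne_top,
      ← lintegral_const_mul' _ _ ENNReal.ofReal_ne_top]
    refine lintegral_mono_ae ?_
    filter_upwards [Measure.quasiMeasurePreserving_fst.ae ae_mem_volI,
      Measure.quasiMeasurePreserving_snd.ae ae_mem_volI] with p hp1 hp2
    by_cases h : p ∈ W
    · simp only [hH]
      rw [indicator_of_mem h, ← ENNReal.ofReal_mul (kerDens_nonneg hγ0 _),
        ← ENNReal.ofReal_mul hC₁0.le, ← ENNReal.ofReal_mul (by positivity)]
      refine ENNReal.ofReal_le_ofReal ?_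
      have h2 : p.2 < p.1 / 2 := h.2
      have hp0 : 0 < p.1 := hp1.1
      have hpos : 0 < |p.1 - p.2| := abs_pos.2 (by linarith)
      have hle : |p.1 - p.2| ≤ p.1 := by
        rw [abs_of_pos (by linarith)]; linarith [hp2.1]
      have h3 : p.1 ^ (-1 - γ) ≤ 1 / |p.1 - p.2| ^ (1 + γ) := by
        rw [one_div, ← Real.rpow_neg hpos.le, show -(1 + γ) = -1 - γ by ring]
        exact Real.rpow_le_rpow_of_nonpos hpos hle (by linarith)
      calc (1 + 1 / s) * (k * p.1 ^ (-1 - γ) * gap v p ^ 2)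
          ≤ (1 + 1 / s) * (k * (1 / |p.1 - p.2| ^ (1 + γ)) * gap v p ^ 2) := by gcongr
        _ = _ := by rw [hC₁, kerDens]; field_simp
    · simp only [hH]; rw [indicator_of_notMem h, mul_zero]; exact zero_le
  have hall : hardyInt γ v ≤ ENNReal.ofReal θ * hardyInt γ v
      + ENNReal.ofReal C₁ * sqInt (kerMeas γ) (gap v) :=
    step1.trans (add_le_add step2 step3)
  rcases eq_or_ne (sqInt (kerMeas γ) (gap v)) ⊤ with htop | htop
  · rw [htop, ENNReal.mul_top (by simpa using div_pos hC₁0 (by linarith))]; exact le_top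
  have hr := ENNReal.toReal_mono (ENNReal.add_lt_top.2
    ⟨ENNReal.mul_lt_top ENNReal.ofReal_lt_top hfin,
      ENNReal.mul_lt_top ENNReal.ofReal_lt_top (lt_top_iff_ne_top.2 htop)⟩).ne hall
  rw [ENNReal.toReal_add (ENNReal.mul_lt_top ENNReal.ofReal_lt_top hfin).ne
    (ENNReal.mul_lt_top ENNReal.ofReal_lt_top (lt_top_iff_ne_top.2 htop)).ne, ENNReal.toReal_mul,
    ENNReal.toReal_mul, ENNReal.toReal_ofReal hθ0.le, ENNReal.toReal_ofReal hC₁0.le] at hr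
  rw [← ENNReal.ofReal_toReal hfin.ne, ← ENNReal.ofReal_toReal htop,
    ← ENNReal.ofReal_mul (div_pos hC₁0 (by linarith)).le]
  refine ENNReal.ofReal_le_ofReal ?_
  rw [div_mul_eq_mul_div, le_div_iff₀ (by linarith)]
  linarith

/-- The fractional Hardy inequality for functions in `L²(V₁)`. -/
theorem exists_hardy {γ : ℝ} (hγ : 1 < γ) : ∃ C : ℝ, 0 < C ∧ ∀ v : ℝ → ℝ, Measurable v →
    sqInt (potMeas γ) v < ⊤ →
      sqInt (potMeas γ) v ≤ ENNReal.ofReal C * sqInt (kerMeas γ) (gap v) := by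
  have hγ0 : 0 < γ := by linarith
  have hc := cGamma_pos hγ0
  obtain ⟨C, hC, h⟩ := exists_hardyInt_le hγ
  refine ⟨cGamma γ / γ * (C + C), by positivity, fun v hv hfin => ?_⟩
  have hv' : Measurable fun u => v (1 - u) := by fun_prop
  have hne : ENNReal.ofReal (cGamma γ / γ) ≠ 0 := by
    simp only [ne_eq, ENNReal.ofReal_eq_zero, not_le]; positivity
  rw [sqInt_potMeas_eq_hardyInt hγ0 hv] at hfin ⊢
  have hsum : hardyInt γ v + hardyInt γ (fun u => v (1 - u)) < ⊤ := by
    by_contra hcon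
    rw [not_lt, top_le_iff] at hcon
    rw [hcon, ENNReal.mul_top hne] at hfin
    exact lt_irrefl _ hfin
  obtain ⟨h1, h2⟩ := ENNReal.add_lt_top.1 hsum
  have h3 := h v hv h1
  have h4 := h _ hv' h2
  rw [sqInt_kerMeas_reflect γ hv] at h4
  calc _ ≤ ENNReal.ofReal (cGamma γ / γ) * (ENNReal.ofReal C * sqInt (kerMeas γ) (gap v)
        + ENNReal.ofReal C * sqInt (kerMeas γ) (gap v)) := by gcongr
    _ = _ := by
      rw [ENNReal.ofReal_mul (by positivity), ENNReal.ofReal_add hC.le hC.le]; ring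

/-! ### Truncation near zero -/

/-- `x` minus its truncation to `[-ε, ε]`. -/
def shrink (ε x : ℝ) : ℝ := x - max (-ε) (min x ε)

lemma continuous_shrink (ε : ℝ) : Continuous (shrink ε) := by
  unfold shrink; fun_prop

lemma abs_shrink_sub_le {ε : ℝ} (hε : 0 ≤ ε) (x y : ℝ) : |shrink ε x - shrink ε y| ≤ |x - y| := by
  unfold shrink
  rcases le_total x ε with h1 | h1 <;> rcases le_total y ε with h2 | h2 <;>
  rcases le_total x (-ε) with h3 | h3 <;> rcases le_total y (-ε) with h4 | h4 <;>
  simp only [h1, h2, h3, h4, min_eq_left, min_eq_right, max_eq_left, max_eq_right,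
    max_eq_right (by linarith : -ε ≤ ε)] <;>
  rw [abs_le] <;> constructor <;>
  rcases abs_cases (x - y) with ⟨h, _⟩ | ⟨h, _⟩ <;> linarith

lemma shrink_eq_zero {ε x : ℝ} (h : |x| ≤ ε) : shrink ε x = 0 := by
  obtain ⟨h1, h2⟩ := abs_le.1 h
  rw [shrink, min_eq_left h2, max_eq_right h1, sub_self]

lemma abs_shrink_sub_self_le {ε : ℝ} (hε : 0 ≤ ε) (x : ℝ) : |shrink ε x - x| ≤ ε := by
  unfold shrink
  rw [sub_sub_cancel_left, abs_neg, abs_le]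
  exact ⟨le_max_left _ _, max_le (by linarith) (min_le_right _ _)⟩

lemma tendsto_shrink {ι : Type*} {l : Filter ι} {ε : ι → ℝ} (h0 : ∀ i, 0 ≤ ε i)
    (hε : Tendsto ε l (𝓝 0)) (x : ℝ) : Tendsto (fun i => shrink (ε i) x) l (𝓝 x) := by
  rw [tendsto_iff_dist_tendsto_zero]
  exact squeeze_zero (fun _ => dist_nonneg) (fun i => abs_shrink_sub_self_le (h0 i) x) hε

/-- Truncating a continuous function that vanishes outside of the open unit interval gives a
function with compact support in the open unit interval. -/
lemma exists_support_shrink {r : ℝ → ℝ} (hr : Continuous r)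
    (h0 : ∀ u, u ∉ Ioo (0 : ℝ) 1 → r u = 0) {ε : ℝ} (hε : 0 < ε) :
    ∃ a b : ℝ, 0 < a ∧ b < 1 ∧ ∀ u, u ∉ Icc a b → shrink ε (r u) = 0 := by
  have near : ∀ x : ℝ, r x = 0 → ∃ δ > 0, ∀ u, |u - x| < δ → |r u| ≤ ε := fun x hx => by
    obtain ⟨δ, hδ, h⟩ := Metric.continuous_iff.1 hr x ε hε
    refine ⟨δ, hδ, fun u hu => ?_⟩
    have := h u hu
    rw [hx, Real.dist_eq, sub_zero] at this
    exact this.le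
  obtain ⟨a, ha, ha'⟩ := near 0 (h0 0 (by simp))
  obtain ⟨b, hb, hb'⟩ := near 1 (h0 1 (by simp))
  refine ⟨a, 1 - b, ha, by linarith, fun u hu => ?_⟩
  refine shrink_eq_zero ?_
  by_cases huI : u ∈ Ioo (0 : ℝ) 1
  · simp only [mem_Icc, not_and_or, not_le] at hu
    rcases hu with hu | hu
    · exact ha' u (by rw [abs_lt]; constructor <;> linarith [huI.1])
    · exact hb' u (by rw [abs_lt]; constructor <;> linarith [huI.2])
  · rw [h0 u huI, abs_zero]; exact hε.le

lemma sqInt_potMeas_lt_top_of_support {γ : ℝ} (hγ : 0 < γ) {v : ℝ → ℝ} {a b M : ℝ} (ha : 0 < a)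
    (hb : b < 1) (hs : ∀ u, u ∉ Icc a b → v u = 0) (hM : ∀ u, |v u| ≤ M) :
    sqInt (potMeas γ) v < ⊤ := by
  have hc := cGamma_pos hγ
  have hV : ∀ u ∈ Icc a b, V₁ γ u ≤ cGamma γ * γ⁻¹ * (a ^ (-γ) + (1 - b) ^ (-γ)) := by
    intro u hu
    have h1 : u ^ (-γ) ≤ a ^ (-γ) := Real.rpow_le_rpow_of_nonpos ha hu.1 (by linarith)
    have h2 : (1 - u) ^ (-γ) ≤ (1 - b) ^ (-γ) :=
      Real.rpow_le_rpow_of_nonpos (by linarith) (by linarith [hu.2]) (by linarith)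
    rw [V₁, rMinus, rPlus, ← mul_add]
    gcongr
  rw [← l2V₁NormSq_eq, l2V₁NormSq]
  calc _ ≤ ∫⁻ _u in Ioo (0 : ℝ) 1,
        ENNReal.ofReal (M ^ 2 * (cGamma γ * γ⁻¹ * (a ^ (-γ) + (1 - b) ^ (-γ)))) := by
        refine lintegral_mono_ae ?_
        filter_upwards [ae_mem_volI] with u hu
        refine ENNReal.ofReal_le_ofReal ?_
        have h1 : 0 < 1 - b := by linarith
        by_cases h : u ∈ Icc a b
        · refine mul_le_mul ?_ (hV u h) (V₁_pos hγ hu).le (sq_nonneg _)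
          rw [← sq_abs]
          exact pow_le_pow_left₀ (abs_nonneg _) (hM u) 2
        · rw [hs u h]; simp only [ne_eq, OfNat.ofNat_ne_zero, not_false_eq_true, zero_pow, zero_mul]
          positivity
    _ < ⊤ := by simp

/-- The Hardy inequality for continuous functions that vanish at the boundary. -/
lemma sqInt_potMeas_lt_top_of_continuous {γ : ℝ} (hγ : 1 < γ) {r : ℝ → ℝ} (hr : Continuous r)
    (h0 : ∀ u, u ∉ Ioo (0 : ℝ) 1 → r u = 0) {C : ℝ}
    (hC : ∀ v : ℝ → ℝ, Measurable v → sqInt (potMeas γ) v < ⊤ →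
      sqInt (potMeas γ) v ≤ ENNReal.ofReal C * sqInt (kerMeas γ) (gap v)) :
    sqInt (potMeas γ) r ≤ ENNReal.ofReal C * sqInt (kerMeas γ) (gap r) := by
  have hγ0 : 0 < γ := by linarith
  set ε : ℕ → ℝ := fun n => 1 / ((n : ℝ) + 1) with hε
  have hε0 : ∀ n, 0 < ε n := fun n => by positivity
  have hmeas : ∀ n, Measurable fun u => shrink (ε n) (r u) := fun n =>
    ((continuous_shrink _).comp hr).measurable
  obtain ⟨M, hM⟩ : ∃ M, ∀ u, |r u| ≤ M :=
    (HasCompactSupport.intro (isCompact_Icc (a := (0 : ℝ)) (b := 1)) fun u hu =>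
      h0 u fun h => hu (Ioo_subset_Icc_self h)).exists_bound_of_continuous hr
  -- The functions `shrink (ε n) ∘ r` have compact support in the open interval, so the finiteness
  -- that `hC` requires is automatic for them, and their energy is at most that of r. Fatou's lemma
  -- then removes the truncation, and finiteness becomes a conclusion when r has finite energy.
  refine (sqInt_le_liminf (fn := fun n u => shrink (ε n) (r u))
    (fun n => (hmeas n).aemeasurable) (ae_of_all _ fun u =>
      tendsto_shrink (fun n => (hε0 n).le) tendsto_one_div_add_atTop_nhds_zero_nat (r u))).trans ?_
  refine liminf_le_of_le (by isBoundedDefault) fun x hx => ?_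
  obtain ⟨n, hn⟩ := hx.exists
  refine hn.trans ?_
  obtain ⟨a, b, ha, hb, hs⟩ := exists_support_shrink hr h0 (hε0 n)
  have hfin : sqInt (potMeas γ) (fun u => shrink (ε n) (r u)) < ⊤ := by
    refine sqInt_potMeas_lt_top_of_support hγ0 (M := M) ha hb hs fun u => ?_
    have := abs_shrink_sub_le (hε0 n).le (r u) 0
    rw [shrink_eq_zero (x := 0) (by simpa using (hε0 n).le), sub_zero, sub_zero] at this
    exact this.trans (hM u)
  refine (hC _ (hmeas n) hfin).trans ?_
  gcongr
  exact sqInt_mono (ae_of_all _ fun p => abs_shrink_sub_le (hε0 n).le _ _)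

/-! ### The energy of the extension by zero -/

/-- The jump measure on the plane. -/
def kerFull (γ : ℝ) : Measure (ℝ × ℝ) :=
  (volume : Measure (ℝ × ℝ)).withDensity fun p => ENNReal.ofReal (kerDens γ p)

instance sigmaFinite_kerFull (γ : ℝ) : SigmaFinite (kerFull γ) :=
  SigmaFinite.withDensity_of_ne_top' fun _ => ENNReal.ofReal_ne_top

lemma sqInt_kerFull (γ : ℝ) (f : ℝ × ℝ → ℝ) : sqInt (kerFull γ) f
    = ∫⁻ p, ENNReal.ofReal (kerDens γ p) * ENNReal.ofReal (f p ^ 2) := by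
  unfold sqInt kerFull
  rw [lintegral_withDensity_eq_lintegral_mul_non_measurable _
    (measurable_kerDens γ).ennreal_ofReal (ae_of_all _ fun _ => ENNReal.ofReal_lt_top)]
  rfl

lemma lintegral_Ici_rpow {γ u : ℝ} (hγ : 0 < γ) (hu : 0 < u) :
    ∫⁻ z in Ici u, ENNReal.ofReal (cGamma γ / 2 / |z| ^ (1 + γ))
      = ENNReal.ofReal (cGamma γ / 2 * (u ^ (-γ) / γ)) := by
  have hc := cGamma_pos hγ
  rw [setLIntegral_congr Ioi_ae_eq_Ici.symm]
  have h1 : ∫⁻ z in Ioi u, ENNReal.ofReal (cGamma γ / 2 / |z| ^ (1 + γ))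
      = ∫⁻ z in Ioi u, ENNReal.ofReal (cGamma γ / 2 * z ^ (-(1 + γ))) := by
    refine setLIntegral_congr_fun measurableSet_Ioi fun z hz => ?_
    have hz0 : 0 < z := hu.trans hz
    rw [abs_of_pos hz0, Real.rpow_neg hz0.le, div_eq_mul_inv]
  rw [h1, ← ofReal_integral_eq_lintegral_ofReal
    ((integrableOn_Ioi_rpow_of_lt (by linarith) hu).const_mul _), integral_const_mul,
    integral_Ioi_rpow_of_lt (by linarith) hu]
  · congr 2
    rw [show -(1 + γ) + 1 = -γ by ring, neg_div_neg_eq]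
  · filter_upwards [ae_restrict_mem measurableSet_Ioi] with z hz
    have hz0 : 0 < z := hu.trans hz
    positivity

/-- On each side the mass is a tail integral of z^{-1-γ}, giving u^{-γ}/γ and (1-u)^{-γ}/γ. The half
is the one in the density of the jump measure. This identifies V₁ as the rate at which jumps on the
line leave the interval. -/
lemma lintegral_compl_kerDens {γ u : ℝ} (hγ : 0 < γ) (hu : u ∈ Ioo (0 : ℝ) 1) :
    ∫⁻ w in (Ioo (0 : ℝ) 1)ᶜ, ENNReal.ofReal (kerDens γ (u, w)) = ENNReal.ofReal (V₁ γ u / 2) := by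
  have hc := cGamma_pos hγ
  have hu0 := hu.1
  have hu1 : 0 < 1 - u := by linarith [hu.2]
  have e : (Ioo (0 : ℝ) 1)ᶜ = Iic 0 ∪ Ici 1 := by
    ext w; simp only [mem_compl_iff, mem_Ioo, mem_union, mem_Iic, mem_Ici, not_and_or, not_lt]
  have hd : Disjoint (Iic (0 : ℝ)) (Ici 1) := by
    rw [disjoint_left]; intro w h1 h2; simp only [mem_Iic, mem_Ici] at h1 h2; linarith
  rw [e, lintegral_union measurableSet_Ici hd]
  have h1 : ∫⁻ w in Iic (0 : ℝ), ENNReal.ofReal (kerDens γ (u, w))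
      = ENNReal.ofReal (cGamma γ / 2 * (u ^ (-γ) / γ)) := by
    rw [← lintegral_Ici_rpow hγ hu0, ← lintegral_indicator measurableSet_Iic,
      ← lintegral_indicator measurableSet_Ici, ← lintegral_sub_left_eq_self
        ((Ici u).indicator fun z => ENNReal.ofReal (cGamma γ / 2 / |z| ^ (1 + γ))) u]
    refine lintegral_congr fun w => ?_
    simp only [indicator, mem_Iic, mem_Ici, le_sub_self_iff, kerDens]
  have h2 : ∫⁻ w in Ici (1 : ℝ), ENNReal.ofReal (kerDens γ (u, w))
      = ENNReal.ofReal (cGamma γ / 2 * ((1 - u) ^ (-γ) / γ)) := by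
    rw [← lintegral_Ici_rpow hγ hu1, ← lintegral_indicator measurableSet_Ici,
      ← lintegral_indicator measurableSet_Ici, ← lintegral_sub_right_eq_self
        ((Ici (1 - u)).indicator fun z => ENNReal.ofReal (cGamma γ / 2 / |z| ^ (1 + γ))) u]
    refine lintegral_congr fun w => ?_
    simp only [indicator, mem_Ici, sub_le_sub_iff_right, kerDens, abs_sub_comm u w]
  rw [h1, h2, ← ENNReal.ofReal_add (by positivity) (by positivity)]
  congr 1
  rw [V₁, rMinus, rPlus]; ring

lemma kerDens_swap (γ u w : ℝ) : kerDens γ (u, w) = kerDens γ (w, u) := by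
  simp only [kerDens, abs_sub_comm]

/-- The energy on the line of the extension by zero is the regional energy plus the square norm
of `L²(V₁)`. -/
theorem sqInt_kerFull_eq {γ : ℝ} (hγ : 0 < γ) {v : ℝ → ℝ} (hv : Measurable v)
    (h0 : ∀ u, u ∉ Ioo (0 : ℝ) 1 → v u = 0) :
    sqInt (kerFull γ) (gap v) = sqInt (kerMeas γ) (gap v) + sqInt (potMeas γ) v := by
  set f : ℝ → ℝ → ℝ≥0∞ := fun u w =>
    ENNReal.ofReal (kerDens γ (u, w)) * ENNReal.ofReal (gap v (u, w) ^ 2) with hf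
  have hfm : Measurable (Function.uncurry f) := (measurable_kerDens γ).ennreal_ofReal.mul
    ((measurable_gap hv).pow_const 2).ennreal_ofReal
  have hfs : ∀ u w, f u w = f w u := fun u w => by
    simp only [hf, gap]; rw [kerDens_swap, ← neg_sub (v w), neg_sq]
  have hI : MeasurableSet (Ioo (0 : ℝ) 1) := measurableSet_Ioo
  -- Jumps from the inside to the outside and those in the opposite direction contribute P(v)/2
  -- each. There is no contribution from pairs of outside points.
  have hcross : ∫⁻ u in Ioo (0 : ℝ) 1, ∫⁻ w in (Ioo (0 : ℝ) 1)ᶜ, f u w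
      = 2⁻¹ * sqInt (potMeas γ) v := by
    rw [← l2V₁NormSq_eq, l2V₁NormSq, ← lintegral_const_mul' _ _ (by simp)]
    refine setLIntegral_congr_fun hI fun u hu => ?_
    have : ∀ w ∈ (Ioo (0 : ℝ) 1)ᶜ, f u w
        = ENNReal.ofReal (v u ^ 2) * ENNReal.ofReal (kerDens γ (u, w)) := fun w hw => by
      simp only [hf, gap]; rw [h0 w hw, sub_zero, mul_comm]
    rw [setLIntegral_congr_fun hI.compl this, lintegral_const_mul' _ _ ENNReal.ofReal_ne_top,
      lintegral_compl_kerDens hγ hu, ← ENNReal.ofReal_mul (sq_nonneg _)]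
    have h2 : (2⁻¹ : ℝ≥0∞) = ENNReal.ofReal 2⁻¹ := by
      rw [ENNReal.ofReal_inv_of_pos (by norm_num)]; simp
    rw [h2, ← ENNReal.ofReal_mul (by norm_num)]
    congr 1; ring
  have hcross' : ∫⁻ u in (Ioo (0 : ℝ) 1)ᶜ, ∫⁻ w in Ioo (0 : ℝ) 1, f u w
      = 2⁻¹ * sqInt (potMeas γ) v := by
    rw [lintegral_lintegral_swap hfm.aemeasurable, ← hcross]
    refine lintegral_congr fun u => lintegral_congr fun w => hfs w u
  have hout : ∫⁻ u in (Ioo (0 : ℝ) 1)ᶜ, ∫⁻ w in (Ioo (0 : ℝ) 1)ᶜ, f u w = 0 := by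
    rw [setLIntegral_congr_fun hI.compl (g := fun _ => 0) fun u hu => ?_]
    · simp
    · simp only
      rw [setLIntegral_congr_fun hI.compl (g := fun _ => 0) fun w hw => ?_]
      · simp
      · simp [hf, gap, h0 u hu, h0 w hw]
  have hmI : ∀ S : Set ℝ, Measurable fun u => ∫⁻ w in S, f u w := fun S =>
    hfm.lintegral_prod_right'
  have hin : ∫⁻ u in Ioo (0 : ℝ) 1, ∫⁻ w in Ioo (0 : ℝ) 1, f u w
      = sqInt (kerMeas γ) (gap v) := by
    rw [sqInt_kerMeas]
    exact (lintegral_prod (Function.uncurry f) hfm.aemeasurable).symm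
  calc sqInt (kerFull γ) (gap v) = ∫⁻ u, ∫⁻ w, f u w := by
        rw [sqInt_kerFull, Measure.volume_eq_prod]
        exact lintegral_prod (Function.uncurry f) hfm.aemeasurable
    _ = ∫⁻ u, ((∫⁻ w in Ioo (0 : ℝ) 1, f u w) + ∫⁻ w in (Ioo (0 : ℝ) 1)ᶜ, f u w) := by
        refine lintegral_congr fun u => ?_
        rw [lintegral_add_compl _ hI]
    _ = _ := by
        rw [lintegral_add_left (hmI _), ← lintegral_add_compl
          (fun u => ∫⁻ w in Ioo (0 : ℝ) 1, f u w) hI, ← lintegral_add_compl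
          (fun u => ∫⁻ w in (Ioo (0 : ℝ) 1)ᶜ, f u w) hI, hcross, hcross', hout, hin, add_zero,
          add_assoc, ← add_mul, ENNReal.inv_two_add_inv_two, one_mul]

/-! ### Mollification -/

/-- The kernel depends on differences only. The regional energy lacks this invariance, which is why
density is proved on the line. -/
lemma sqInt_kerFull_translate (γ : ℝ) (v : ℝ → ℝ) (y : ℝ) :
    sqInt (kerFull γ) (gap fun u => v (u - y)) = sqInt (kerFull γ) (gap v) := by
  rw [sqInt_kerFull, sqInt_kerFull, ← lintegral_sub_right_eq_self
    (fun p => ENNReal.ofReal (kerDens γ p) * ENNReal.ofReal (gap v p ^ 2)) ((y, y) : ℝ × ℝ)]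
  refine lintegral_congr fun p => ?_
  simp only [kerDens, gap, Prod.fst_sub, Prod.snd_sub, sub_sub_sub_cancel_right]

/-- The increments of the mollified function are averages of the increments of translates, so
Jensen's inequality and translation invariance suffice. -/
lemma sqInt_kerFull_mollify_le (γ : ℝ) {v : ℝ → ℝ} (hv : Measurable v) {M : ℝ}
    (hM : ∀ u, |v u| ≤ M) (P : Measure ℝ) [IsProbabilityMeasure P] :
    sqInt (kerFull γ) (gap fun u => ∫ y, v (u - y) ∂P) ≤ sqInt (kerFull γ) (gap v) := by
  have hi : ∀ u, Integrable (fun y => v (u - y)) P := fun u =>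
    Integrable.of_bound (by fun_prop : Measurable _).aestronglyMeasurable M
      (ae_of_all _ fun y => hM _)
  have e : (gap fun u => ∫ y, v (u - y) ∂P) = fun p => ∫ y, (gap fun u => v (u - y)) p ∂P := by
    funext p
    simp only [gap]
    rw [integral_sub (hi _) (hi _)]
  rw [e]
  refine (sqInt_integral_le (f := fun y p => (gap fun u => v (u - y)) p) ?_).trans ?_
  · simp only [gap, Function.uncurry_def]; fun_prop
  · simp only [sqInt_kerFull_translate γ v, lintegral_const, measure_univ, mul_one]
    exact le_rfl

/-- Mollification of a bounded continuous function with compact support. -/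
lemma exists_mollify {v : ℝ → ℝ} (hv : Continuous v) {M : ℝ} (hM : ∀ u, |v u| ≤ M) {a b : ℝ}
    (ha : 0 < a) (hb : b < 1) (hs : ∀ u, u ∉ Icc a b → v u = 0) {δ ε : ℝ} (hδ : 0 < δ)
    (hδε : ∀ u w, |u - w| < δ → |v u - v w| ≤ ε) (γ : ℝ) :
    ∃ φ : ℝ → ℝ, IsBump φ ∧ (∀ u, |φ u - v u| ≤ ε) ∧
      sqInt (kerFull γ) (gap φ) ≤ sqInt (kerFull γ) (gap v) := by
  -- The radius respects the modulus of continuity and is at most half of each margin a and 1 - b,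
  -- so that the enlarged support stays inside the open interval.
  set δ' : ℝ := min δ (min (a / 2) ((1 - b) / 2)) with hδ'
  have hδ'0 : 0 < δ' := lt_min hδ (lt_min (by linarith) (by linarith))
  have hδa : δ' ≤ a / 2 := (min_le_right _ _).trans (min_le_left _ _)
  have hδb : δ' ≤ (1 - b) / 2 := (min_le_right _ _).trans (min_le_right _ _)
  let ψ : ContDiffBump (0 : ℝ) := ⟨δ' / 2, δ', by linarith, by linarith⟩
  have hψout : ψ.rOut = δ' := rfl
  set η : ℝ → ℝ := ψ.normed volume with hη
  set φ : ℝ → ℝ := MeasureTheory.convolution η v (ContinuousLinearMap.lsmul ℝ ℝ) volume with hφ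
  have hloc : LocallyIntegrable v volume := hv.locallyIntegrable
  have hηc : Continuous η := ψ.continuous_normed
  have hη0 : ∀ y, 0 ≤ η y := ψ.nonneg_normed
  set P : Measure ℝ := volume.withDensity fun y => ENNReal.ofReal (η y) with hP
  have hPp : IsProbabilityMeasure P := ⟨by
    rw [hP, withDensity_apply _ MeasurableSet.univ, Measure.restrict_univ,
      ← ofReal_integral_eq_lintegral_ofReal ψ.integrable_normed (ae_of_all _ hη0),
      ψ.integral_normed, ENNReal.ofReal_one]⟩
  have hφP : φ = fun u => ∫ y, v (u - y) ∂P := by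
    funext u
    have : (fun y => ENNReal.ofReal (η y)) = fun y => ((η y).toNNReal : ℝ≥0∞) := rfl
    rw [hφ, convolution_def, hP, this, integral_withDensity_eq_integral_smul
      hηc.measurable.real_toNNReal]
    refine integral_congr_ae (ae_of_all _ fun y => ?_)
    simp only [ContinuousLinearMap.lsmul_apply, NNReal.smul_def, Real.coe_toNNReal _ (hη0 y)]
  refine ⟨φ, ⟨?_, a - δ', b + δ', by linarith, by linarith, fun u hu => ?_⟩, fun u => ?_, ?_⟩
  · exact ψ.hasCompactSupport_normed.contDiff_convolution_left _ (n := ⊤) ψ.contDiff_normed hloc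
  · rw [hφ, convolution_def]
    refine integral_eq_zero_of_ae (ae_of_all _ fun y => ?_)
    simp only [ContinuousLinearMap.lsmul_apply, Pi.zero_apply, smul_eq_mul]
    by_cases hy : |y| < δ'
    · rw [hs (u - y) fun h => hu ?_, mul_zero]
      have := abs_lt.1 hy
      exact ⟨by linarith [h.1], by linarith [h.2]⟩
    · have : η y = 0 := by
        rw [← Function.notMem_support, hη, ψ.support_normed_eq, Metric.mem_ball, dist_zero_right]
        exact hy
      rw [this, zero_mul]
  · have := ψ.dist_normed_convolution_le (μ := volume) (g := v) (x₀ := u) (ε := ε)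
      hv.aestronglyMeasurable fun x hx => by
        rw [Real.dist_eq]
        refine hδε x u (lt_of_lt_of_le ?_ (min_le_left δ (min (a / 2) ((1 - b) / 2))))
        rw [Metric.mem_ball, Real.dist_eq] at hx
        exact hx
    rwa [Real.dist_eq] at this
  · rw [hφP]; exact sqInt_kerFull_mollify_le γ hv.measurable hM P

/-- Density of the smooth functions with compact support. -/
theorem exists_bump_approx {γ : ℝ} (hγ : 1 < γ) {v : ℝ → ℝ} (hv : Measurable v) {M : ℝ}
    (hM : ∀ u, |v u| ≤ M) (hE : sqInt (kerMeas γ) (gap v) < ⊤) (hV : sqInt (potMeas γ) v < ⊤) :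
    ∃ φ : ℕ → ℝ → ℝ, (∀ n, IsBump (φ n)) ∧
      Tendsto (fun n => sqInt (kerMeas γ) fun p => gap (φ n) p - gap v p) atTop (𝓝 0) ∧
      Tendsto (fun n => sqInt (potMeas γ) fun u => φ n u - v u) atTop (𝓝 0) := by
  have hγ0 : 0 < γ := by linarith
  obtain ⟨r, hr, h0, hvr⟩ := exists_continuous_rep hγ hv hM hE hV
  have hcomp : HasCompactSupport r := HasCompactSupport.intro
    (isCompact_Icc (a := (0 : ℝ)) (b := 1)) fun u hu => h0 u fun h => hu (Ioo_subset_Icc_self h)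
  obtain ⟨M', hM'⟩ : ∃ M, ∀ u, |r u| ≤ M := hcomp.exists_bound_of_continuous hr
  have huc : UniformContinuous r := hcomp.uniformContinuous_of_continuous hr
  set ε : ℕ → ℝ := fun n => 1 / ((n : ℝ) + 1) with hε
  have hε0 : ∀ n, 0 < ε n := fun n => by positivity
  have hex : ∀ n, ∃ φ : ℝ → ℝ, IsBump φ ∧ (∀ u, |φ u - r u| ≤ 2 * ε n) ∧
      sqInt (kerFull γ) (gap φ) ≤ sqInt (kerFull γ) (gap r) := by
    intro n
    obtain ⟨δ, hδ, h⟩ := Metric.uniformContinuous_iff.1 huc (ε n) (hε0 n)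
    obtain ⟨a, b, ha, hb, hs⟩ := exists_support_shrink hr h0 (hε0 n)
    have hcs : Continuous fun u => shrink (ε n) (r u) := (continuous_shrink _).comp hr
    have hbs : ∀ u, |shrink (ε n) (r u)| ≤ M' := fun u => by
      have := abs_shrink_sub_le (hε0 n).le (r u) 0
      rw [shrink_eq_zero (x := 0) (by simpa using (hε0 n).le), sub_zero, sub_zero] at this
      exact this.trans (hM' u)
    obtain ⟨φ, h1, h2, h3⟩ := exists_mollify hcs hbs ha hb hs hδ (ε := ε n) (fun u w huw =>
      (abs_shrink_sub_le (hε0 n).le _ _).trans (h huw).le) γ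
    refine ⟨φ, h1, fun u => ?_, h3.trans ?_⟩
    · have e1 := h2 u
      have e2 := abs_shrink_sub_self_le (hε0 n).le (r u)
      calc |φ u - r u| ≤ |φ u - shrink (ε n) (r u)| + |shrink (ε n) (r u) - r u| :=
            abs_sub_le _ _ _
        _ ≤ 2 * ε n := by linarith
    · exact sqInt_mono (ae_of_all _ fun p => abs_shrink_sub_le (hε0 n).le _ _)
  choose φ hφ1 hφ2 hφ3 using hex
  have hfull : sqInt (kerFull γ) (gap r) < ⊤ := by
    rw [sqInt_kerFull_eq hγ0 hr.measurable h0, ← sqInt_kerMeas_congr γ hvr,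
      ← sqInt_potMeas_congr γ hvr]
    exact ENNReal.add_lt_top.2 ⟨hE, hV⟩
  have hpt : ∀ u, Tendsto (fun n => φ n u) atTop (𝓝 (r u)) := fun u => by
    rw [tendsto_iff_dist_tendsto_zero]
    refine squeeze_zero (fun _ => dist_nonneg) (fun n => hφ2 n u) ?_
    have : Tendsto (fun n => 2 * ε n) atTop (𝓝 (2 * 0)) :=
      tendsto_one_div_add_atTop_nhds_zero_nat.const_mul 2
    rwa [mul_zero] at this
  -- The energies on the line do not exceed that of r and the convergence is pointwise, so it is
  -- strong. The energy on the line is the sum of E and P, so both converge.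
  have hlim := tendsto_sqInt_sub (ν := kerFull γ) (f := gap r) (fn := fun n => gap (φ n))
    (measurable_gap hr.measurable).aemeasurable
    (fun n => (measurable_gap (hφ1 n).measurable).aemeasurable)
    (ae_of_all _ fun p => (hpt _).sub (hpt _)) hφ3 hfull
  have hsum : ∀ n, sqInt (kerFull γ) (fun p => gap (φ n) p - gap r p)
      = sqInt (kerMeas γ) (fun p => gap (φ n) p - gap v p)
        + sqInt (potMeas γ) (fun u => φ n u - v u) := by
    intro n
    have e1 : (fun p => gap (φ n) p - gap r p) = gap fun u => φ n u - r u := by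
      funext p; simp only [gap]; ring
    have e2 : (fun p => gap (φ n) p - gap v p) = gap fun u => φ n u - v u := by
      funext p; simp only [gap]; ring
    have hae : (fun u => φ n u - r u) =ᵐ[volI] fun u => φ n u - v u := by
      filter_upwards [hvr] with u hu
      rw [hu]
    have hm : Measurable fun u => φ n u - r u := (hφ1 n).measurable.sub hr.measurable
    rw [e1, e2, sqInt_kerFull_eq hγ0 hm ?_,
      sqInt_kerMeas_congr γ hae, sqInt_potMeas_congr γ hae]
    intro u hu
    obtain ⟨a, b, ha, hb, hs⟩ := (hφ1 n).support
    rw [h0 u hu, hs u fun h => hu ⟨by linarith [h.1], by linarith [h.2]⟩, sub_zero]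
  refine ⟨φ, hφ1, ?_, ?_⟩
  · exact tendsto_of_tendsto_of_tendsto_of_le_of_le tendsto_const_nhds hlim (fun _ => zero_le)
      fun n => by rw [hsum]; exact le_self_add
  · exact tendsto_of_tendsto_of_tendsto_of_le_of_le tendsto_const_nhds hlim (fun _ => zero_le)
      fun n => by rw [hsum]; exact le_add_self

/-! ### Averages in time -/

/-- The average of `f` over `(t, t + h]`. -/
def stek (h : ℝ) (f : ℝ → ℝ → ℝ) (t u : ℝ) : ℝ := ∫ s, f (t + s) u ∂(avgMeas 0 h)

section OneVariable

variable {f : ℝ → ℝ} {M h : ℝ}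

lemma intervalIntegrable_of_bounded (hf : Measurable f) (hM : ∀ t, |f t| ≤ M) (a b : ℝ) :
    IntervalIntegrable f volume a b :=
  (intervalIntegrable_const (c := M)).mono_fun' hf.aestronglyMeasurable (ae_of_all _ hM)

lemma integral_avgMeas_shift (hh : 0 < h) (f : ℝ → ℝ) (t : ℝ) :
    ∫ s, f (t + s) ∂(avgMeas 0 h) = h⁻¹ * ∫ s in t..(t + h), f s := by
  rw [integral_avgMeas _ hh, zero_add, intervalIntegral.integral_comp_add_left, add_zero]

lemma avg_eq_primitive (hf : Measurable f) (hM : ∀ t, |f t| ≤ M) (hh : 0 < h) (t : ℝ) :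
    ∫ s, f (t + s) ∂(avgMeas 0 h)
      = h⁻¹ * ((∫ s in (0 : ℝ)..(t + h), f s) - ∫ s in (0 : ℝ)..t, f s) := by
  have hi := intervalIntegrable_of_bounded hf hM
  rw [integral_avgMeas_shift hh, intervalIntegral.integral_interval_sub_left (hi _ _) (hi _ _)]

lemma locallyIntegrable_of_bounded (hf : Measurable f) (hM : ∀ t, |f t| ≤ M) :
    LocallyIntegrable f volume := by
  rw [locallyIntegrable_iff]
  intro k hk
  exact Measure.integrableOn_of_bounded hk.measure_lt_top.ne hf.aestronglyMeasurable
    (ae_of_all _ hM)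

lemma ae_hasDerivAt_avg (hf : Measurable f) (hM : ∀ t, |f t| ≤ M) (hh : 0 < h) :
    ∀ᵐ t, HasDerivAt (fun t => ∫ s, f (t + s) ∂(avgMeas 0 h)) (h⁻¹ * (f (t + h) - f t)) t := by
  have hd := LocallyIntegrable.ae_hasDerivAt_integral (locallyIntegrable_of_bounded hf hM)
  have hd' := (quasiMeasurePreserving_add_right volume h).ae hd
  filter_upwards [hd, hd'] with t h1 h2
  simp only [avg_eq_primitive hf hM hh]
  exact (((h2 0).comp_add_const t h).sub (h1 0)).const_mul _

lemma lipschitz_avg (hf : Measurable f) (hM : ∀ t, |f t| ≤ M) (hh : 0 < h) :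
    LipschitzWith (h⁻¹ * (2 * M)).toNNReal fun t => ∫ s, f (t + s) ∂(avgMeas 0 h) := by
  have hM0 : 0 ≤ M := (abs_nonneg _).trans (hM 0)
  have hi := intervalIntegrable_of_bounded hf hM
  refine LipschitzWith.of_dist_le_mul fun t t' => ?_
  rw [Real.coe_toNNReal _ (by positivity), Real.dist_eq, Real.dist_eq, avg_eq_primitive hf hM hh,
    avg_eq_primitive hf hM hh, ← mul_sub, abs_mul, abs_of_pos (inv_pos.2 hh), mul_assoc]
  refine mul_le_mul_of_nonneg_left ?_ (inv_pos.2 hh).le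
  have key : ∀ x y : ℝ, |(∫ s in (0 : ℝ)..x, f s) - ∫ s in (0 : ℝ)..y, f s| ≤ M * |x - y| := by
    intro x y
    rw [intervalIntegral.integral_interval_sub_left (hi _ _) (hi _ _)]
    exact intervalIntegral.norm_integral_le_of_norm_le_const (f := f) (C := M) fun s _ => hM s
  have h1 := key (t + h) (t' + h)
  have h2 := key t t'
  rw [add_sub_add_right_eq_sub] at h1
  calc |(∫ s in (0 : ℝ)..(t + h), f s) - (∫ s in (0 : ℝ)..t, f s)
        - ((∫ s in (0 : ℝ)..(t' + h), f s) - ∫ s in (0 : ℝ)..t', f s)|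
      = |((∫ s in (0 : ℝ)..(t + h), f s) - ∫ s in (0 : ℝ)..(t' + h), f s)
        - ((∫ s in (0 : ℝ)..t, f s) - ∫ s in (0 : ℝ)..t', f s)| := by congr 1; ring
    _ ≤ _ := abs_sub _ _
    _ ≤ 2 * M * |t - t'| := by linarith

/-- The average is Lipschitz in t, hence absolutely continuous, and by Lebesgue differentiation its
derivative is almost everywhere the difference quotient h⁻¹ (f(t+h) - f(t)). The fundamental theorem
of calculus applies to its square. -/
lemma integral_avg_mul_deriv (hf : Measurable f) (hM : ∀ t, |f t| ≤ M) (hh : 0 < h) (a b : ℝ) :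
    ∫ t in a..b, h⁻¹ * (f (t + h) - f t) * ∫ s, f (t + s) ∂(avgMeas 0 h)
      = 2⁻¹ * (∫ s, f (b + s) ∂(avgMeas 0 h)) ^ 2 - 2⁻¹ * (∫ s, f (a + s) ∂(avgMeas 0 h)) ^ 2 := by
  have hac := ((lipschitz_avg hf hM hh).lipschitzOnWith
    (s := uIcc a b)).absolutelyContinuousOnInterval
  have h1 := hac.integral_deriv_mul_eq_sub hac
  have h2 : ∫ t in a..b, h⁻¹ * (f (t + h) - f t) * ∫ s, f (t + s) ∂(avgMeas 0 h)
      = 2⁻¹ * ∫ t in a..b, (deriv (fun t => ∫ s, f (t + s) ∂(avgMeas 0 h)) t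
          * (∫ s, f (t + s) ∂(avgMeas 0 h)) + (∫ s, f (t + s) ∂(avgMeas 0 h))
          * deriv (fun t => ∫ s, f (t + s) ∂(avgMeas 0 h)) t) := by
    rw [← intervalIntegral.integral_const_mul]
    refine intervalIntegral.integral_congr_ae ?_
    filter_upwards [ae_hasDerivAt_avg hf hM hh] with t ht _
    rw [ht.deriv]; ring
  rw [h2, h1]; ring

lemma ae_tendsto_avg (hf : Measurable f) (hM : ∀ t, |f t| ≤ M) {hn : ℕ → ℝ}
    (hlim : Tendsto hn atTop (𝓝[>] 0)) :
    ∀ᵐ t, Tendsto (fun n => ∫ s, f (t + s) ∂(avgMeas 0 (hn n))) atTop (𝓝 (f t)) := by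
  filter_upwards [LocallyIntegrable.ae_hasDerivAt_integral
    (locallyIntegrable_of_bounded hf hM)] with t ht
  have h1 := (hasDerivAt_iff_tendsto_slope_zero.1 (ht 0))
  have h2 := h1.comp (hlim.mono_right (nhdsWithin_mono _ fun x (hx : 0 < x) => hx.ne'))
  refine h2.congr' ?_
  filter_upwards [(tendsto_nhdsWithin_iff.1 hlim).2] with n hn0
  rw [avg_eq_primitive hf hM hn0]
  rfl

end OneVariable

section TwoVariables

variable {f : ℝ → ℝ → ℝ} {M h : ℝ}

lemma measurable_section (hf : Measurable (Function.uncurry f)) (u : ℝ) :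
    Measurable fun t => f t u :=
  hf.comp (measurable_id.prodMk measurable_const)

lemma measurable_slice (hf : Measurable (Function.uncurry f)) (t : ℝ) : Measurable (f t) :=
  hf.comp (measurable_const.prodMk measurable_id)

lemma measurable_stek (hf : Measurable (Function.uncurry f)) (hh : 0 < h) :
    Measurable (Function.uncurry (stek h f)) := by
  have := isProbabilityMeasure_avgMeas 0 hh
  have : Measurable fun q : (ℝ × ℝ) × ℝ => f (q.1.1 + q.2) q.1.2 :=
    hf.comp ((measurable_fst.fst.add measurable_snd).prodMk measurable_fst.snd)
  exact (this.stronglyMeasurable.integral_prod_right (ν := avgMeas 0 h)).measurable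

lemma abs_stek_le (hM : ∀ t u, |f t u| ≤ M) (hh : 0 < h) (t u : ℝ) : |stek h f t u| ≤ M := by
  have := isProbabilityMeasure_avgMeas 0 hh
  have h1 := norm_integral_le_of_norm_le_const (μ := avgMeas 0 h) (f := fun s => f (t + s) u)
    (C := M) (ae_of_all _ fun s => hM _ _)
  rwa [probReal_univ, mul_one] at h1

lemma integrable_shift (hf : Measurable (Function.uncurry f)) (hM : ∀ t u, |f t u| ≤ M)
    (hh : 0 < h) (t u : ℝ) : Integrable (fun s => f (t + s) u) (avgMeas 0 h) := by
  have := isProbabilityMeasure_avgMeas 0 hh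
  exact Integrable.of_bound ((measurable_section hf u).comp
    (measurable_const_add t)).aestronglyMeasurable M (ae_of_all _ fun s => hM _ _)

lemma stek_add {g : ℝ → ℝ → ℝ} (hf : Measurable (Function.uncurry f)) (hM : ∀ t u, |f t u| ≤ M)
    (hg : Measurable (Function.uncurry g)) (hM' : ∀ t u, |g t u| ≤ M) (hh : 0 < h) (t u : ℝ) :
    stek h (fun t u => f t u + g t u) t u = stek h f t u + stek h g t u :=
  integral_add (integrable_shift hf hM hh t u) (integrable_shift hg hM' hh t u)

lemma gap_stek (hf : Measurable (Function.uncurry f)) (hM : ∀ t u, |f t u| ≤ M) (hh : 0 < h)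
    (t : ℝ) : gap (stek h f t) = fun p => ∫ s, gap (f (t + s)) p ∂(avgMeas 0 h) := by
  funext p
  simp only [gap, stek]
  rw [integral_sub (integrable_shift hf hM hh t _) (integrable_shift hf hM hh t _)]

lemma sqInt_stek_le {ν : Measure ℝ} [SFinite ν] (hf : Measurable (Function.uncurry f))
    (hh : 0 < h) (t : ℝ) :
    sqInt ν (stek h f t) ≤ ∫⁻ s, sqInt ν (f (t + s)) ∂(avgMeas 0 h) := by
  have := isProbabilityMeasure_avgMeas 0 hh
  exact sqInt_integral_le (f := fun s u => f (t + s) u)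
    (hf.comp ((measurable_const.add measurable_fst).prodMk measurable_snd))

lemma measurable_gap_uncurry (hf : Measurable (Function.uncurry f)) :
    Measurable (Function.uncurry fun t => gap (f t)) :=
  (hf.comp (measurable_fst.prodMk measurable_snd.fst)).sub
    (hf.comp (measurable_fst.prodMk measurable_snd.snd))

lemma sqInt_gap_stek_le (γ : ℝ) (hf : Measurable (Function.uncurry f)) (hM : ∀ t u, |f t u| ≤ M)
    (hh : 0 < h) (t : ℝ) : sqInt (kerMeas γ) (gap (stek h f t))
      ≤ ∫⁻ s, sqInt (kerMeas γ) (gap (f (t + s))) ∂(avgMeas 0 h) := by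
  have := isProbabilityMeasure_avgMeas 0 hh
  rw [gap_stek hf hM hh]
  exact sqInt_integral_le (f := fun s => gap (f (t + s))) ((measurable_gap_uncurry hf).comp
    ((measurable_const.add measurable_fst).prodMk measurable_snd))

/-- Average of a nonnegative function over a window that moves inside of `(a, c)`. -/
lemma lintegral_avg_le {q : ℝ → ℝ≥0∞} (hq : Measurable q) {a b c : ℝ} (hh : 0 < h)
    (hbc : b + h ≤ c) : ∫⁻ t in Ioo a b, ∫⁻ s, q (t + s) ∂(avgMeas 0 h)
      ≤ ∫⁻ t in Ioo a c, q t := by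
  have := isProbabilityMeasure_avgMeas 0 hh
  rw [lintegral_lintegral_swap (f := fun t s => q (t + s))
    (hq.comp (measurable_fst.add measurable_snd)).aemeasurable]
  have hmem : ∀ᵐ s ∂(avgMeas 0 h), s ∈ Ioc 0 h := by
    unfold avgMeas
    refine Measure.ae_smul_measure ?_ _
    rw [zero_add]
    exact ae_restrict_mem measurableSet_Ioc
  calc _ ≤ ∫⁻ _s, (∫⁻ t in Ioo a c, q t) ∂(avgMeas 0 h) := by
        refine lintegral_mono_ae ?_
        filter_upwards [hmem] with s hs
        rw [← lintegral_indicator measurableSet_Ioo, ← lintegral_indicator measurableSet_Ioo,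
          ← lintegral_add_right_eq_self ((Ioo a c).indicator q) s]
        refine lintegral_mono fun t => ?_
        by_cases ht : t ∈ Ioo a b
        · rw [indicator_of_mem ht, indicator_of_mem (show t + s ∈ Ioo a c from
            ⟨by linarith [ht.1, hs.1], by linarith [ht.2, hs.2]⟩)]
        · rw [indicator_of_notMem ht]; exact zero_le
    _ = _ := by simp

/-- Average at a single time. -/
lemma lintegral_avg_le_inv_mul {q : ℝ → ℝ≥0∞} {a c t : ℝ}
    (hat : a ≤ t) (htc : t + h < c) :
    ∫⁻ s, q (t + s) ∂(avgMeas 0 h) ≤ ENNReal.ofReal h⁻¹ * ∫⁻ t in Ioo a c, q t := by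
  unfold avgMeas
  rw [lintegral_smul_measure, smul_eq_mul, zero_add]
  refine mul_le_mul_right ?_ _
  rw [← lintegral_indicator measurableSet_Ioo, ← lintegral_indicator measurableSet_Ioc,
    ← lintegral_add_left_eq_self ((Ioo a c).indicator q) t]
  refine lintegral_mono fun s => ?_
  by_cases hs : s ∈ Ioc 0 h
  · rw [indicator_of_mem hs, indicator_of_mem (show t + s ∈ Ioo a c from
      ⟨by linarith [hs.1], by linarith [hs.2]⟩)]
  · rw [indicator_of_notMem hs]; exact zero_le

/-- Pairing with a fixed function commutes with averaging. -/
lemma integral_stek_mul (hf : Measurable (Function.uncurry f)) (hM : ∀ t u, |f t u| ≤ M)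
    (hh : 0 < h) {ψ : ℝ → ℝ} (hψ : Measurable ψ) {B : ℝ} (hB : ∀ u, |ψ u| ≤ B) (t : ℝ) :
    ∫ u, stek h f t u * ψ u ∂volI
      = h⁻¹ * ∫ r in t..(t + h), ∫ u, f r u * ψ u ∂volI := by
  have := isProbabilityMeasure_avgMeas 0 hh
  rw [← integral_avgMeas_shift hh fun r => ∫ u, f r u * ψ u ∂volI]
  have hM0 : 0 ≤ M := (abs_nonneg _).trans (hM 0 0)
  have hint : Integrable (Function.uncurry fun s u => f (t + s) u * ψ u)
      ((avgMeas 0 h).prod volI) := by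
    have hm : Measurable (Function.uncurry fun s u => f (t + s) u * ψ u) :=
      (hf.comp ((measurable_const.add measurable_fst).prodMk measurable_snd)).mul
        (hψ.comp measurable_snd)
    refine Integrable.of_bound hm.aestronglyMeasurable (M * B) (ae_of_all _ fun p => ?_)
    simp only [Function.uncurry, Real.norm_eq_abs, abs_mul]
    exact mul_le_mul (hM _ _) (hB _) (abs_nonneg _) hM0
  rw [integral_integral_swap hint]
  refine integral_congr_ae (ae_of_all _ fun u => ?_)
  simp only [stek]
  rw [integral_mul_const]

/-- The time derivative of the square norm of the average. -/
lemma integral_deriv_stek (hf : Measurable (Function.uncurry f)) (hM : ∀ t u, |f t u| ≤ M)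
    (hh : 0 < h) {a b : ℝ} (hab : a ≤ b) :
    ∫ t in Ioo a b, (∫ u, h⁻¹ * (f (t + h) u - f t u) * stek h f t u ∂volI)
      = 2⁻¹ * (sqInt volI (stek h f b)).toReal - 2⁻¹ * (sqInt volI (stek h f a)).toReal := by
  have hM0 : 0 ≤ M := (abs_nonneg _).trans (hM 0 0)
  have hsm := measurable_stek hf hh
  have hm : Measurable (Function.uncurry fun t u => h⁻¹ * (f (t + h) u - f t u) * stek h f t u) :=
    (((hf.comp ((measurable_fst.add_const h).prodMk measurable_snd)).sub hf).const_mul _).mul hsm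
  have hint : Integrable (Function.uncurry fun t u => h⁻¹ * (f (t + h) u - f t u) * stek h f t u)
      ((volume.restrict (Ioo a b)).prod volI) := by
    refine Integrable.of_bound hm.aestronglyMeasurable (h⁻¹ * (M + M) * M) (ae_of_all _ fun p => ?_)
    simp only [Function.uncurry, Real.norm_eq_abs, abs_mul, abs_of_pos (inv_pos.2 hh)]
    gcongr
    · exact (abs_sub _ _).trans (add_le_add (hM _ _) (hM _ _))
    · exact abs_stek_le hM hh _ _
  have hsq : ∀ t, Integrable (fun u => stek h f t u ^ 2) volI := fun t => by
    refine Integrable.of_bound ((measurable_slice hsm t).pow_const 2).aestronglyMeasurable (M ^ 2)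
      (ae_of_all _ fun u => ?_)
    rw [Real.norm_eq_abs, abs_pow]
    exact pow_le_pow_left₀ (abs_nonneg _) (abs_stek_le hM hh _ _) 2
  rw [integral_integral_swap hint, ← integral_sq_eq_toReal (measurable_slice hsm b).aemeasurable,
    ← integral_sq_eq_toReal (measurable_slice hsm a).aemeasurable, ← integral_const_mul,
    ← integral_const_mul, ← integral_sub ((hsq b).const_mul _) ((hsq a).const_mul _)]
  refine integral_congr_ae (ae_of_all _ fun u => ?_)
  simp only
  rw [← integral_Ioc_eq_integral_Ioo, ← intervalIntegral.integral_of_le hab]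
  exact integral_avg_mul_deriv (measurable_section hf u) (fun t => hM t u) hh a b

/-- Almost everywhere convergence of the averages. -/
lemma ae_ae_tendsto_stek (hf : Measurable (Function.uncurry f)) (hM : ∀ t u, |f t u| ≤ M)
    {hn : ℕ → ℝ} (h0 : ∀ n, 0 < hn n) (hlim : Tendsto hn atTop (𝓝[>] 0)) :
    ∀ᵐ t, ∀ᵐ u ∂volI, Tendsto (fun n => stek (hn n) f t u) atTop (𝓝 (f t u)) := by
  have hms : MeasurableSet {p : ℝ × ℝ | Tendsto (fun n => stek (hn n) f p.1 p.2) atTop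
      (𝓝 (f p.1 p.2))} :=
    measurableSet_tendsto_fun (f := fun n (p : ℝ × ℝ) => stek (hn n) f p.1 p.2)
      (g := fun p : ℝ × ℝ => f p.1 p.2) (fun n => measurable_stek hf (h0 n)) hf
  have h1 : ∀ᵐ p ∂((volume : Measure ℝ).prod volI),
      Tendsto (fun n => stek (hn n) f p.1 p.2) atTop (𝓝 (f p.1 p.2)) := by
    -- Lebesgue differentiation gives, for each u, almost every t. The order of the quantifiers is
    -- exchanged through the product measure, which is where joint measurability is needed.
    rw [← Measure.prod_swap, ae_map_iff measurable_swap.aemeasurable hms]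
    refine (Measure.ae_prod_iff_ae_ae (measurable_swap hms)).2 (ae_of_all _ fun u => ?_)
    exact ae_tendsto_avg (measurable_section hf u) (fun t => hM t u) hlim
  exact Measure.ae_ae_of_ae_prod h1

end TwoVariables

/-! ### The energy inequality -/

/-- Weak solutions on `(a, c)`, tested against functions of the space variable only, of
`∂ₜ w = 𝕃 (w + σ) - κ V₁ w - δ V₁ z`. -/
structure IsEvolution (γ κ δ a c M : ℝ) (w σ z : ℝ → ℝ → ℝ) (m : (ℝ → ℝ) → ℝ) : Prop where
  meas_w : Measurable (Function.uncurry w)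
  meas_σ : Measurable (Function.uncurry σ)
  meas_z : Measurable (Function.uncurry z)
  bound_w : ∀ t u, |w t u| ≤ M
  bound_σ : ∀ t u, |σ t u| ≤ M
  bound_z : ∀ t u, |z t u| ≤ M
  energy_w : ∫⁻ t in Ioo a c, sqInt (kerMeas γ) (gap (w t)) < ⊤
  pot_w : ∫⁻ t in Ioo a c, sqInt (potMeas γ) (w t) < ⊤
  energy_σ : ∫⁻ t in Ioo a c, sqInt (kerMeas γ) (gap (σ t)) < ⊤
  pot_z : ∫⁻ t in Ioo a c, sqInt (potMeas γ) (z t) < ⊤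
  weak : ∀ᵐ t, t ∈ Ioo a c → ∀ φ : ℝ → ℝ, IsBump φ →
    ∫ u, w t u * φ u ∂volI = m φ + ∫ r in a..t,
      ((∫ u, (w r u + σ r u) * regLap γ φ u ∂volI) - κ * (∫ u, w r u * (φ u * V₁ γ u) ∂volI)
        - δ * ∫ u, z r u * (φ u * V₁ γ u) ∂volI)

lemma IsBump.measurable_mul_V₁ {φ : ℝ → ℝ} (hφ : IsBump φ) (γ : ℝ) :
    Measurable fun u => φ u * V₁ γ u := hφ.measurable.mul (measurable_V₁ γ)

lemma V₁_le_of_mem_Icc {γ : ℝ} (hγ : 0 < γ) {a b : ℝ} (ha : 0 < a) (hb : b < 1) :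
    ∃ B : ℝ, 0 < B ∧ ∀ u ∈ Icc a b, 0 < V₁ γ u ∧ V₁ γ u ≤ B := by
  have hc := cGamma_pos hγ
  have h1b : 0 < 1 - b := by linarith
  refine ⟨cGamma γ * γ⁻¹ * (a ^ (-γ) + (1 - b) ^ (-γ)), by positivity, fun u hu =>
    ⟨V₁_pos hγ ⟨ha.trans_le hu.1, hu.2.trans_lt hb⟩, ?_⟩⟩
  have h1 : u ^ (-γ) ≤ a ^ (-γ) := Real.rpow_le_rpow_of_nonpos ha hu.1 (by linarith)
  have h2 : (1 - u) ^ (-γ) ≤ (1 - b) ^ (-γ) :=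
    Real.rpow_le_rpow_of_nonpos h1b (by linarith [hu.2]) (by linarith)
  rw [V₁, rMinus, rPlus, ← mul_add]
  gcongr

lemma IsBump.exists_bound_mul_V₁ {γ : ℝ} (hγ : 0 < γ) {φ : ℝ → ℝ} (hφ : IsBump φ) :
    ∃ B : ℝ, ∀ u, |φ u * V₁ γ u| ≤ B := by
  obtain ⟨a, b, ha, hb, hs⟩ := hφ.support
  obtain ⟨C, hC⟩ := hφ.exists_bound
  obtain ⟨B, hB0, hB⟩ := V₁_le_of_mem_Icc hγ ha hb
  have hC0 : 0 ≤ C := (abs_nonneg _).trans (hC 0)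
  refine ⟨C * B, fun u => ?_⟩
  by_cases hu : u ∈ Icc a b
  · rw [abs_mul, abs_of_pos (hB u hu).1]
    exact mul_le_mul (hC u) (hB u hu).2 (hB u hu).1.le hC0
  · rw [hs u hu, zero_mul, abs_zero]; positivity

lemma intervalIntegrable_pairing {f : ℝ → ℝ → ℝ} {M : ℝ} (hf : Measurable (Function.uncurry f))
    (hM : ∀ t u, |f t u| ≤ M) {ψ : ℝ → ℝ} (hψ : Measurable ψ) {B : ℝ} (hB : ∀ u, |ψ u| ≤ B)
    (a b : ℝ) : IntervalIntegrable (fun r => ∫ u, f r u * ψ u ∂volI) volume a b := by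
  have hM0 : 0 ≤ M := (abs_nonneg _).trans (hM 0 0)
  refine intervalIntegrable_of_bounded (M := M * B) ?_ (fun t => ?_) a b
  · have : Measurable fun p : ℝ × ℝ => f p.1 p.2 * ψ p.2 := hf.mul (hψ.comp measurable_snd)
    exact (this.stronglyMeasurable.integral_prod_right (ν := volI)).measurable
  · have := norm_integral_le_of_norm_le_const (μ := volI) (f := fun u => f t u * ψ u)
      (C := M * B) (ae_of_all _ fun u => by
        rw [Real.norm_eq_abs, abs_mul]
        exact mul_le_mul (hM _ _) (hB _) (abs_nonneg _) hM0)
    rwa [probReal_univ, mul_one] at this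

lemma integral_mul_mul_V₁ {γ : ℝ} (hγ : 0 < γ) (f φ : ℝ → ℝ) :
    ∫ u, f u * (φ u * V₁ γ u) ∂volI = ∫ u, f u * φ u ∂(potMeas γ) := by
  rw [integral_potMeas hγ]
  simp only [mul_assoc]

namespace IsEvolution

variable {γ κ δ a c M : ℝ} {w σ z : ℝ → ℝ → ℝ} {m : (ℝ → ℝ) → ℝ}

/-- The equation satisfied by the time averages. -/
lemma stek_eq (H : IsEvolution γ κ δ a c M w σ z m) (hγ : 0 < γ) (hγ' : γ < 2) {h : ℝ}
    (hh : 0 < h) : ∀ᵐ t, t ∈ Ioo a (c - h) → ∀ φ : ℝ → ℝ, IsBump φ →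
      ∫ u, h⁻¹ * (w (t + h) u - w t u) * φ u ∂volI
        = (∫ u, (stek h w t u + stek h σ t u) * regLap γ φ u ∂volI)
          - κ * (∫ u, stek h w t u * φ u ∂(potMeas γ))
          - δ * ∫ u, stek h z t u * φ u ∂(potMeas γ) := by
  have hw' := (quasiMeasurePreserving_add_right volume h).ae H.weak
  filter_upwards [H.weak, hw'] with t h1 h2 ht φ hφ
  have e1 := h1 ⟨ht.1, by linarith [ht.2]⟩ φ hφ
  have e2 := h2 ⟨by linarith [ht.1], by linarith [ht.2]⟩ φ hφ
  obtain ⟨B₁, hB₁⟩ := hφ.exists_regLap_bound hγ hγ'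
  obtain ⟨B₂, hB₂⟩ := hφ.exists_bound_mul_V₁ hγ
  obtain ⟨B₃, hB₃⟩ := hφ.exists_bound
  have hm1 := hφ.measurable_regLap hγ hγ'
  have hm2 := hφ.measurable_mul_V₁ γ
  have hws : Measurable (Function.uncurry fun t u => w t u + σ t u) := H.meas_w.add H.meas_σ
  have hwsb : ∀ t u, |w t u + σ t u| ≤ M + M := fun t u =>
    (abs_add_le _ _).trans (add_le_add (H.bound_w t u) (H.bound_σ t u))
  have i1 := intervalIntegrable_pairing hws hwsb hm1 hB₁
  have i2 := fun x y => (intervalIntegrable_pairing H.meas_w H.bound_w hm2 hB₂ x y).const_mul κ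
  have i3 := fun x y => (intervalIntegrable_pairing H.meas_z H.bound_z hm2 hB₂ x y).const_mul δ
  have iall := fun x y => ((i1 x y).sub (i2 x y)).sub (i3 x y)
  have hpair : ∀ s, Integrable (fun u => w s u * φ u) volI := fun s => by
    refine Integrable.of_bound ((measurable_slice H.meas_w s).mul
      hφ.measurable).aestronglyMeasurable (M * B₃) (ae_of_all _ fun u => ?_)
    rw [Real.norm_eq_abs, abs_mul]
    exact mul_le_mul (H.bound_w _ _) (hB₃ _) (abs_nonneg _)
      ((abs_nonneg _).trans (H.bound_w 0 0))
  have e3 : ∫ u, h⁻¹ * (w (t + h) u - w t u) * φ u ∂volI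
      = h⁻¹ * ((∫ u, w (t + h) u * φ u ∂volI) - ∫ u, w t u * φ u ∂volI) := by
    rw [← integral_sub (hpair _) (hpair _), ← integral_const_mul]
    refine integral_congr_ae (ae_of_all _ fun u => ?_)
    simp only; ring
  -- Subtracting the equations at times t + h and t cancels the initial term `m φ`, whose form is
  -- therefore irrelevant.
  rw [e3, e1, e2, add_sub_add_left_eq_sub,
    intervalIntegral.integral_interval_sub_left (iall _ _) (iall _ _),
    intervalIntegral.integral_sub ((i1 _ _).sub (i2 _ _)) (i3 _ _),
    intervalIntegral.integral_sub (i1 _ _) (i2 _ _), intervalIntegral.integral_const_mul,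
    intervalIntegral.integral_const_mul, ← integral_mul_mul_V₁ hγ, ← integral_mul_mul_V₁ hγ,
    integral_stek_mul H.meas_w H.bound_w hh hm2 hB₂, integral_stek_mul H.meas_z H.bound_z hh hm2
    hB₂]
  have e4 := integral_stek_mul hws hwsb hh hm1 hB₁ t
  have hM0 : 0 ≤ M := (abs_nonneg _).trans (H.bound_w 0 0)
  simp only [stek_add H.meas_w H.bound_w H.meas_σ H.bound_σ hh] at e4
  rw [e4]
  ring

/-- Only time integrals of the energies are known to be finite. Averaging over a window of length h
makes them finite at each time, at the cost of a factor h⁻¹ that never enters the final estimates.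
-/
lemma finite_stek (H : IsEvolution γ κ δ a c M w σ z m) {h : ℝ} (hh : 0 < h) {t : ℝ}
    (ht : t ∈ Ioo a (c - h)) :
    sqInt (kerMeas γ) (gap (stek h w t)) < ⊤ ∧ sqInt (potMeas γ) (stek h w t) < ⊤ ∧
      sqInt (kerMeas γ) (gap (stek h σ t)) < ⊤ ∧ sqInt (potMeas γ) (stek h z t) < ⊤ := by
  have key : ∀ q : ℝ → ℝ≥0∞, ∫⁻ t in Ioo a c, q t < ⊤ →
      ∫⁻ s, q (t + s) ∂(avgMeas 0 h) < ⊤ := fun q hq =>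
    (lintegral_avg_le_inv_mul ht.1.le (by linarith [ht.2])).trans_lt
      (ENNReal.mul_lt_top ENNReal.ofReal_lt_top hq)
  exact ⟨(sqInt_gap_stek_le γ H.meas_w H.bound_w hh t).trans_lt (key _ H.energy_w),
    (sqInt_stek_le H.meas_w hh t).trans_lt (key (fun t => sqInt (potMeas γ) (w t)) H.pot_w),
    (sqInt_gap_stek_le γ H.meas_σ H.bound_σ hh t).trans_lt (key _ H.energy_σ),
    (sqInt_stek_le H.meas_z hh t).trans_lt (key (fun t => sqInt (potMeas γ) (z t)) H.pot_z)⟩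

/-- The equation for the averages, tested against the averages themselves. -/
lemma stek_energy_eq (H : IsEvolution γ κ δ a c M w σ z m) (hγ : 1 < γ) (hγ' : γ < 2) {h : ℝ}
    (hh : 0 < h) : ∀ᵐ t, t ∈ Ioo a (c - h) →
      ∫ u, h⁻¹ * (w (t + h) u - w t u) * stek h w t u ∂volI
        = -(∫ p, (gap (stek h w t) p + gap (stek h σ t) p) * gap (stek h w t) p ∂(kerMeas γ))
          - κ * (∫ u, stek h w t u * stek h w t u ∂(potMeas γ))
          - δ * ∫ u, stek h z t u * stek h w t u ∂(potMeas γ) := by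
  have hγ0 : 0 < γ := by linarith
  have hM0 : 0 ≤ M := (abs_nonneg _).trans (H.bound_w 0 0)
  filter_upwards [H.stek_eq hγ0 hγ' hh] with t heq ht
  obtain ⟨f1, f2, f3, f4⟩ := H.finite_stek hh ht
  have mW : Measurable (stek h w t) := measurable_slice (measurable_stek H.meas_w hh) t
  have mS : Measurable (stek h σ t) := measurable_slice (measurable_stek H.meas_σ hh) t
  have mZ : Measurable (stek h z t) := measurable_slice (measurable_stek H.meas_z hh) t
  have bW := abs_stek_le H.bound_w hh t
  have bS := abs_stek_le H.bound_σ hh t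
  -- At fixed t the average has finite energy and finite norm in L²(V₁). It is thus a limit of
  -- admissible test functions in both norms, hence in L² too, and every pairing in the equation
  -- passes to the limit.
  obtain ⟨φ, hφ, hl1, hl2⟩ := exists_bump_approx hγ mW bW f1 f2
  have hl3 : Tendsto (fun n => sqInt volI fun u => φ n u - stek h w t u) atTop (𝓝 0) := by
    have := ENNReal.Tendsto.const_mul (a := ENNReal.ofReal (γ / cGamma γ)) hl2
      (Or.inr ENNReal.ofReal_ne_top)
    rw [mul_zero] at this
    exact tendsto_of_tendsto_of_tendsto_of_le_of_le tendsto_const_nhds this (fun _ => zero_le)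
      fun n => sqInt_volI_le hγ0 _
  have hgapadd : ∀ p, gap (fun u => stek h w t u + stek h σ t u) p
      = gap (stek h w t) p + gap (stek h σ t) p := fun p => by simp only [gap]; ring
  have fWS : sqInt (kerMeas γ) (fun p => gap (stek h w t) p + gap (stek h σ t) p) < ⊤ :=
    (sqInt_add_le (measurable_gap mW).aemeasurable).trans_lt (ENNReal.add_lt_top.2
      ⟨ENNReal.mul_lt_top (by simp) f1, ENNReal.mul_lt_top (by simp) f3⟩)
  have bounded_fin : ∀ (g : ℝ → ℝ) (B : ℝ), (∀ u, |g u| ≤ B) → sqInt volI g < ⊤ := by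
    intro g B hB
    refine (lintegral_mono fun u => ENNReal.ofReal_le_ofReal
      (show g u ^ 2 ≤ B ^ 2 from ?_)).trans_lt (by simp)
    rw [← sq_abs]
    exact pow_le_pow_left₀ (abs_nonneg _) (hB u) 2
  have L0 := tendsto_integral_mul_of_sqInt (ν := volI)
    (f := fun u => h⁻¹ * (w (t + h) u - w t u)) (g := stek h w t) (gn := φ)
    (((measurable_slice H.meas_w _).sub (measurable_slice H.meas_w _)).const_mul _).aemeasurable
    mW.aemeasurable (fun n => (hφ n).measurable.aemeasurable)
    (bounded_fin _ (h⁻¹ * (M + M)) fun u => by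
      rw [abs_mul, abs_of_pos (inv_pos.2 hh)]
      gcongr
      exact (abs_sub _ _).trans (add_le_add (H.bound_w _ _) (H.bound_w _ _)))
    (bounded_fin _ M bW) hl3
  have L1 := tendsto_integral_mul_of_sqInt (ν := kerMeas γ)
    (f := fun p => gap (stek h w t) p + gap (stek h σ t) p) (g := gap (stek h w t))
    (gn := fun n => gap (φ n)) ((measurable_gap mW).add (measurable_gap mS)).aemeasurable
    (measurable_gap mW).aemeasurable (fun n => (measurable_gap (hφ n).measurable).aemeasurable)
    fWS f1 hl1
  have L2 := tendsto_integral_mul_of_sqInt (ν := potMeas γ) mW.aemeasurable mW.aemeasurable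
    (fun n => (hφ n).measurable.aemeasurable) f2 f2 hl2
  have L3 := tendsto_integral_mul_of_sqInt (ν := potMeas γ) mZ.aemeasurable mW.aemeasurable
    (fun n => (hφ n).measurable.aemeasurable) f4 f2 hl2
  refine tendsto_nhds_unique L0 ((((L1.neg).sub (L2.const_mul κ)).sub (L3.const_mul δ)).congr
    fun n => ?_)
  rw [heq ht (φ n) (hφ n), integral_mul_regLap hγ0 hγ' (hφ n)
    (x := fun u => stek h w t u + stek h σ t u) (mW.add mS) (M := M + M)
    (fun u => (abs_add_le _ _).trans (add_le_add (bW u) (bS u))) ?_]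
  · simp only [hgapadd]
  · rw [show gap (fun u => stek h w t u + stek h σ t u)
      = fun p => gap (stek h w t) p + gap (stek h σ t) p from funext hgapadd]
    exact fWS

/-- The differential form of the energy inequality for the averages. -/
lemma stek_energy_le (H : IsEvolution γ κ δ a c M w σ z m) (hγ : 1 < γ) (hγ' : γ < 2) {h : ℝ}
    (hh : 0 < h) {C : ℝ} (hC0 : 0 < C) (hC : ∀ v : ℝ → ℝ, Measurable v →
      sqInt (potMeas γ) v < ⊤ →
      sqInt (potMeas γ) v ≤ ENNReal.ofReal C * sqInt (kerMeas γ) (gap v)) :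
    ∀ᵐ t, t ∈ Ioo a (c - h) →
      (∫ u, h⁻¹ * (w (t + h) u - w t u) * stek h w t u ∂volI)
        + (2⁻¹ * (sqInt (kerMeas γ) (gap (stek h w t))).toReal
          + κ * (sqInt (potMeas γ) (stek h w t)).toReal)
        ≤ (sqInt (kerMeas γ) (gap (stek h σ t))).toReal
          + δ ^ 2 * C * (sqInt (potMeas γ) (stek h z t)).toReal := by
  filter_upwards [H.stek_energy_eq hγ hγ' hh] with t heq ht
  obtain ⟨f1, f2, f3, f4⟩ := H.finite_stek hh ht
  have mW : Measurable (stek h w t) := measurable_slice (measurable_stek H.meas_w hh) t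
  have mS : Measurable (stek h σ t) := measurable_slice (measurable_stek H.meas_σ hh) t
  have mZ : Measurable (stek h z t) := measurable_slice (measurable_stek H.meas_z hh) t
  have gW := (measurable_gap mW).aemeasurable (μ := kerMeas γ)
  have gS := (measurable_gap mS).aemeasurable (μ := kerMeas γ)
  have e1 : ∫ p, (gap (stek h w t) p + gap (stek h σ t) p) * gap (stek h w t) p ∂(kerMeas γ)
      = (sqInt (kerMeas γ) (gap (stek h w t))).toReal
        + ∫ p, gap (stek h σ t) p * gap (stek h w t) p ∂(kerMeas γ) := by
    rw [← integral_sq_eq_toReal gW, ← integral_add (integrable_sq_of_sqInt gW f1)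
      (integrable_mul_of_sqInt gS gW f3 f1)]
    refine integral_congr_ae (ae_of_all _ fun p => ?_)
    simp only; ring
  have e2 : ∫ u, stek h w t u * stek h w t u ∂(potMeas γ)
      = (sqInt (potMeas γ) (stek h w t)).toReal := by
    rw [← integral_sq_eq_toReal mW.aemeasurable]
    simp only [sq]
  -- The weight 2 splits the source term into E(S) + E(W)/4, where S and W denote the averages of σ
  -- and w.
  have e3 := abs_integral_mul_le gS gW f3 f1 (a := 2) (by norm_num)
  have hdz : sqInt (potMeas γ) (fun u => δ * stek h z t u) < ⊤ := by
    rw [sqInt_const_mul]; exact ENNReal.mul_lt_top ENNReal.ofReal_lt_top f4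
  -- The weight 2C splits this term into C δ² P(Z) + P(W)/(4C), Z being the average of z; the last
  -- term is at most E(W)/4 by Hardy. With the previous quarter, half of the dissipation E(W)
  -- survives. The term κ P(W) is left untouched.
  have e4 := abs_integral_mul_le (ν := potMeas γ) (mZ.const_mul δ).aemeasurable mW.aemeasurable
    hdz f2 (a := 2 * C) (by positivity)
  have e5 : ∫ u, δ * stek h z t u * stek h w t u ∂(potMeas γ)
      = δ * ∫ u, stek h z t u * stek h w t u ∂(potMeas γ) := by
    rw [← integral_const_mul]; simp only [mul_assoc]
  rw [e5, sqInt_const_mul, ENNReal.toReal_mul, ENNReal.toReal_ofReal (sq_nonneg _)] at e4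
  have e6 := ENNReal.toReal_mono (ENNReal.mul_lt_top ENNReal.ofReal_lt_top f1).ne (hC _ mW f2)
  rw [ENNReal.toReal_mul, ENNReal.toReal_ofReal hC0.le] at e6
  rw [heq ht, e1, e2]
  set EW := (sqInt (kerMeas γ) (gap (stek h w t))).toReal
  set PW := (sqInt (potMeas γ) (stek h w t)).toReal
  set ES := (sqInt (kerMeas γ) (gap (stek h σ t))).toReal
  set PZ := (sqInt (potMeas γ) (stek h z t)).toReal
  have e7 : 1 / (2 * (2 * C)) * PW ≤ 1 / 4 * EW := by
    rw [div_mul_eq_mul_div, div_le_iff₀ (by positivity)]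
    linarith
  have e8 := (abs_le.1 e3).1
  have e9 := (abs_le.1 e4).1
  nlinarith

end IsEvolution

/-- Integration of a differential inequality whose dissipation may be infinite a priori. -/
lemma add_lintegral_le_of_integral_eq {S : Type*} [MeasurableSpace S] {μ : Measure S} {D : S → ℝ}
    {e r : S → ℝ≥0∞} {x y : ℝ} (hD : Integrable D μ) (hr : Measurable r)
    (hfe : ∀ᵐ t ∂μ, e t < ⊤) (hfr : ∫⁻ t, r t ∂μ < ⊤)
    (hle : ∀ᵐ t ∂μ, D t + (e t).toReal ≤ (r t).toReal) (hx : 0 ≤ x) (hy : 0 ≤ y)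
    (hxy : ∫ t, D t ∂μ = x - y) :
    ENNReal.ofReal x + ∫⁻ t, e t ∂μ ≤ ENNReal.ofReal y + ∫⁻ t, r t ∂μ := by
  have hri : Integrable (fun t => (r t).toReal) μ :=
    integrable_toReal_of_lintegral_ne_top hr.aemeasurable hfr.ne
  have hi : Integrable (fun t => (r t).toReal - D t) μ := hri.sub hD
  have hnn : 0 ≤ᵐ[μ] fun t => (r t).toReal - D t := by
    filter_upwards [hle] with t ht
    have := (e t).toReal_nonneg
    simp only [Pi.zero_apply]; linarith
  have hR : ∫⁻ t, r t ∂μ = ENNReal.ofReal (∫ t, (r t).toReal ∂μ) := by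
    rw [integral_toReal hr.aemeasurable (ae_lt_top hr hfr.ne), ENNReal.ofReal_toReal hfr.ne]
  -- The dissipation is dominated pointwise by the integrable function r - D, so its finite integral
  -- is a conclusion, and no measurability of e is needed.
  have hE : ∫⁻ t, e t ∂μ ≤ ENNReal.ofReal (∫ t, ((r t).toReal - D t) ∂μ) := by
    rw [ofReal_integral_eq_lintegral_ofReal hi hnn]
    refine lintegral_mono_ae ?_
    filter_upwards [hle, hfe] with t ht h1
    rw [← ENNReal.ofReal_toReal h1.ne]
    exact ENNReal.ofReal_le_ofReal (by linarith)
  have h0 : 0 ≤ ∫ t, ((r t).toReal - D t) ∂μ := integral_nonneg_of_ae hnn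
  have h1 : 0 ≤ ∫ t, (r t).toReal ∂μ := integral_nonneg fun t => ENNReal.toReal_nonneg
  calc _ ≤ ENNReal.ofReal x + ENNReal.ofReal (∫ t, ((r t).toReal - D t) ∂μ) := by gcongr
    _ = ENNReal.ofReal (y + ∫ t, (r t).toReal ∂μ) := by
        rw [← ENNReal.ofReal_add hx h0, integral_sub hri hD, hxy]
        congr 1; ring
    _ = _ := by rw [ENNReal.ofReal_add hy h1, hR]

/-- Fatou's lemma in time and space on growing time intervals. -/
lemma lintegral_sqInt_le_of_tendsto {Y : Type*} [MeasurableSpace Y] {ν : Measure Y} [SFinite ν]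
    {F : ℝ → Y → ℝ} {Fn : ℕ → ℝ → Y → ℝ} (hFn : ∀ n, Measurable (Function.uncurry (Fn n)))
    (hlim : ∀ᵐ t, ∀ᵐ y ∂ν, Tendsto (fun n => Fn n t y) atTop (𝓝 (F t y))) {a c : ℝ}
    {hn : ℕ → ℝ} (h0 : Tendsto hn atTop (𝓝 0)) {K : ℝ≥0∞}
    (hK : ∀ᶠ n in atTop, ∫⁻ t in Ioo a (c - hn n), sqInt ν (Fn n t) ≤ K) :
    ∫⁻ t in Ioo a c, sqInt ν (F t) ≤ K := by
  have hm : ∀ n, Measurable fun t => (Ioo a (c - hn n)).indicator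
      (fun t => sqInt ν (Fn n t)) t := fun n =>
    (measurable_sqInt (hFn n)).indicator measurableSet_Ioo
  calc ∫⁻ t in Ioo a c, sqInt ν (F t)
      ≤ ∫⁻ t in Ioo a c, liminf (fun n => (Ioo a (c - hn n)).indicator
          (fun t => sqInt ν (Fn n t)) t) atTop := by
        refine lintegral_mono_ae ?_
        filter_upwards [ae_restrict_mem measurableSet_Ioo, ae_restrict_of_ae hlim] with t ht hl
        refine (sqInt_le_liminf (fun n => (hFn n).of_uncurry_left.aemeasurable) hl).trans
          (le_of_eq (liminf_congr ?_))
        -- A fixed time t < c eventually belongs to the truncated interval, so the indicator does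
        -- not change the lower limit.
        have : ∀ᶠ n in atTop, hn n < c - t := h0.eventually (gt_mem_nhds (by linarith [ht.2]))
        filter_upwards [this] with n hn
        rw [indicator_of_mem (show t ∈ Ioo a (c - _) from ⟨ht.1, by linarith⟩)]
    _ ≤ liminf (fun n => ∫⁻ t in Ioo a c, (Ioo a (c - hn n)).indicator
          (fun t => sqInt ν (Fn n t)) t) atTop := lintegral_liminf_le hm
    _ ≤ K := by
        refine liminf_le_of_frequently_le' (Eventually.frequently ?_)
        filter_upwards [hK] with n hn
        refine le_trans ?_ hn
        rw [lintegral_indicator measurableSet_Ioo, Measure.restrict_restrict measurableSet_Ioo]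
        exact lintegral_mono_set inter_subset_left

/-- Fatou's lemma in time and space. -/
lemma lintegral_sqInt_le_of_tendsto_Ioo {Y : Type*} [MeasurableSpace Y] {ν : Measure Y} [SFinite ν]
    {F : ℝ → Y → ℝ} {Fn : ℕ → ℝ → Y → ℝ} (hFn : ∀ n, Measurable (Function.uncurry (Fn n)))
    {a c : ℝ} (hlim : ∀ᵐ t, t ∈ Ioo a c → ∀ᵐ y ∂ν, Tendsto (fun n => Fn n t y) atTop (𝓝 (F t y)))
    {K : ℝ≥0∞} (hK : ∀ n, ∫⁻ t in Ioo a c, sqInt ν (Fn n t) ≤ K) :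
    ∫⁻ t in Ioo a c, sqInt ν (F t) ≤ K := by
  calc ∫⁻ t in Ioo a c, sqInt ν (F t)
      ≤ ∫⁻ t in Ioo a c, liminf (fun n => sqInt ν (Fn n t)) atTop := by
        refine lintegral_mono_ae ?_
        filter_upwards [ae_restrict_mem measurableSet_Ioo, ae_restrict_of_ae hlim] with t ht hl
        exact sqInt_le_liminf (fun n => (hFn n).of_uncurry_left.aemeasurable) (hl ht)
    _ ≤ liminf (fun n => ∫⁻ t in Ioo a c, sqInt ν (Fn n t)) atTop :=
        lintegral_liminf_le fun n => measurable_sqInt (hFn n)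
    _ ≤ K := liminf_le_of_frequently_le' (Frequently.of_forall hK)

namespace IsEvolution

variable {γ κ δ a c M : ℝ} {w σ z : ℝ → ℝ → ℝ} {m : (ℝ → ℝ) → ℝ}

/-- The energy inequality for the averages. -/
lemma stek_energy (H : IsEvolution γ κ δ a c M w σ z m) (hγ : 1 < γ) (hγ' : γ < 2)
    (hκ : 0 ≤ κ) {h : ℝ} (hh : 0 < h) {C : ℝ} (hC0 : 0 < C) (hC : ∀ v : ℝ → ℝ, Measurable v →
      sqInt (potMeas γ) v < ⊤ →
      sqInt (potMeas γ) v ≤ ENNReal.ofReal C * sqInt (kerMeas γ) (gap v))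
    {b : ℝ} (hab : a ≤ b) (hbc : b + h ≤ c) :
    ENNReal.ofReal 2⁻¹ * sqInt volI (stek h w b)
      + ∫⁻ t in Ioo a b, (ENNReal.ofReal 2⁻¹ * sqInt (kerMeas γ) (gap (stek h w t))
          + ENNReal.ofReal κ * sqInt (potMeas γ) (stek h w t))
      ≤ ENNReal.ofReal 2⁻¹ * sqInt volI (stek h w a)
        + ((∫⁻ t in Ioo a c, sqInt (kerMeas γ) (gap (σ t)))
          + ENNReal.ofReal (δ ^ 2 * C) * ∫⁻ t in Ioo a c, sqInt (potMeas γ) (z t)) := by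
  have hM0 : 0 ≤ M := (abs_nonneg _).trans (H.bound_w 0 0)
  have hsm := measurable_stek H.meas_w hh
  have hmσ : Measurable fun t => sqInt (kerMeas γ) (gap (stek h σ t)) :=
    measurable_sqInt (measurable_gap_uncurry (measurable_stek H.meas_σ hh))
  have hmz : Measurable fun t => sqInt (potMeas γ) (stek h z t) :=
    measurable_sqInt (measurable_stek H.meas_z hh)
  have hmσ' : Measurable fun t => sqInt (kerMeas γ) (gap (σ t)) :=
    measurable_sqInt (measurable_gap_uncurry H.meas_σ)
  have hmz' : Measurable fun t => sqInt (potMeas γ) (z t) := measurable_sqInt H.meas_z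
  have hm : Measurable (Function.uncurry fun t u => h⁻¹ * (w (t + h) u - w t u) * stek h w t u) :=
    (((H.meas_w.comp ((measurable_fst.add_const h).prodMk measurable_snd)).sub
      H.meas_w).const_mul _).mul hsm
  have hD : Integrable (fun t => ∫ u, h⁻¹ * (w (t + h) u - w t u) * stek h w t u ∂volI)
      (volume.restrict (Ioo a b)) := by
    refine Integrable.of_bound
      (hm.stronglyMeasurable.integral_prod_right (ν := volI)).aestronglyMeasurable
      (h⁻¹ * (M + M) * M) (ae_of_all _ fun t => ?_)
    have := norm_integral_le_of_norm_le_const (μ := volI)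
      (f := fun u => h⁻¹ * (w (t + h) u - w t u) * stek h w t u) (C := h⁻¹ * (M + M) * M)
      (ae_of_all _ fun u => by
        simp only [Real.norm_eq_abs, abs_mul, abs_of_pos (inv_pos.2 hh)]
        gcongr
        · exact (abs_sub _ _).trans (add_le_add (H.bound_w _ _) (H.bound_w _ _))
        · exact abs_stek_le H.bound_w hh _ _)
    rwa [probReal_univ, mul_one] at this
  have hfin : ∀ t, sqInt volI (stek h w t) < ⊤ := fun t => by
    refine (lintegral_mono fun u => ENNReal.ofReal_le_ofReal
      (show stek h w t u ^ 2 ≤ M ^ 2 from ?_)).trans_lt (by simp)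
    rw [← sq_abs]
    exact pow_le_pow_left₀ (abs_nonneg _) (abs_stek_le H.bound_w hh _ _) 2
  -- By Jensen and Tonelli, averaging does not increase the time integrals as long as the window
  -- stays inside (a, c); this is the role of b + h ≤ c. The right side is then independent of h.
  have hR : ∫⁻ t in Ioo a b, (sqInt (kerMeas γ) (gap (stek h σ t))
        + ENNReal.ofReal (δ ^ 2 * C) * sqInt (potMeas γ) (stek h z t))
      ≤ (∫⁻ t in Ioo a c, sqInt (kerMeas γ) (gap (σ t)))
        + ENNReal.ofReal (δ ^ 2 * C) * ∫⁻ t in Ioo a c, sqInt (potMeas γ) (z t) := by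
    rw [lintegral_add_left hmσ, lintegral_const_mul' _ _ ENNReal.ofReal_ne_top]
    refine add_le_add ?_ (mul_le_mul_right ?_ _)
    · exact (lintegral_mono fun t => sqInt_gap_stek_le γ H.meas_σ H.bound_σ hh t).trans
        (lintegral_avg_le hmσ' hh hbc)
    · exact (lintegral_mono fun t => sqInt_stek_le H.meas_z hh t).trans
        (lintegral_avg_le hmz' hh hbc)
  have hRfin := ENNReal.add_lt_top.2 ⟨H.energy_σ,
    ENNReal.mul_lt_top (a := ENNReal.ofReal (δ ^ 2 * C)) ENNReal.ofReal_lt_top H.pot_z⟩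
  have hmem : ∀ t ∈ Ioo a b, t ∈ Ioo a (c - h) := fun t ht => ⟨ht.1, by linarith [ht.2]⟩
  have key := add_lintegral_le_of_integral_eq (μ := volume.restrict (Ioo a b)) hD
    (e := fun t => ENNReal.ofReal 2⁻¹ * sqInt (kerMeas γ) (gap (stek h w t))
      + ENNReal.ofReal κ * sqInt (potMeas γ) (stek h w t))
    (r := fun t => sqInt (kerMeas γ) (gap (stek h σ t))
      + ENNReal.ofReal (δ ^ 2 * C) * sqInt (potMeas γ) (stek h z t))
    (x := 2⁻¹ * (sqInt volI (stek h w b)).toReal) (y := 2⁻¹ * (sqInt volI (stek h w a)).toReal)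
    (hmσ.add (hmz.const_mul _))
    (by
      filter_upwards [ae_restrict_mem measurableSet_Ioo] with t ht
      obtain ⟨f1, f2, -, -⟩ := H.finite_stek hh (hmem t ht)
      exact ENNReal.add_lt_top.2 ⟨ENNReal.mul_lt_top ENNReal.ofReal_lt_top f1,
        ENNReal.mul_lt_top ENNReal.ofReal_lt_top f2⟩)
    (hR.trans_lt hRfin)
    (by
      filter_upwards [ae_restrict_mem measurableSet_Ioo,
        ae_restrict_of_ae (H.stek_energy_le hγ hγ' hh hC0 hC)] with t ht hle
      obtain ⟨f1, f2, f3, f4⟩ := H.finite_stek hh (hmem t ht)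
      rw [ENNReal.toReal_add (ENNReal.mul_lt_top ENNReal.ofReal_lt_top f1).ne
        (ENNReal.mul_lt_top ENNReal.ofReal_lt_top f2).ne, ENNReal.toReal_add f3.ne
        (ENNReal.mul_lt_top ENNReal.ofReal_lt_top f4).ne, ENNReal.toReal_mul, ENNReal.toReal_mul,
        ENNReal.toReal_mul, ENNReal.toReal_ofReal (by norm_num), ENNReal.toReal_ofReal hκ,
        ENNReal.toReal_ofReal (by positivity)]
      exact hle (hmem t ht))
    (by positivity) (by positivity) (integral_deriv_stek H.meas_w H.bound_w hh hab)
  rw [ENNReal.ofReal_mul (by norm_num), ENNReal.ofReal_mul (by norm_num),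
    ENNReal.ofReal_toReal (hfin _).ne, ENNReal.ofReal_toReal (hfin _).ne] at key
  exact key.trans (add_le_add le_rfl hR)

/-- The energy inequality. -/
theorem energy (H : IsEvolution γ κ δ a c M w σ z m) (hγ : 1 < γ) (hγ' : γ < 2)
    (hκ : 0 ≤ κ) {C : ℝ} (hC0 : 0 < C) (hC : ∀ v : ℝ → ℝ, Measurable v →
      sqInt (potMeas γ) v < ⊤ →
      sqInt (potMeas γ) v ≤ ENNReal.ofReal C * sqInt (kerMeas γ) (gap v))
    (hac : a < c) {η : ℝ} (hη : 0 < η) {A : ℝ≥0∞}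
    (hA : ∀ t ∈ Ioo a (a + η), sqInt volI (w t) ≤ A) {K : ℝ≥0∞}
    (hK : ENNReal.ofReal 2⁻¹ * A + ((∫⁻ t in Ioo a c, sqInt (kerMeas γ) (gap (σ t)))
          + ENNReal.ofReal (δ ^ 2 * C) * ∫⁻ t in Ioo a c, sqInt (potMeas γ) (z t)) ≤ K) :
    (∀ᵐ t, t ∈ Ioo a c → sqInt volI (w t) ≤ 2 * K) ∧
    ∫⁻ t in Ioo a c, sqInt (kerMeas γ) (gap (w t)) ≤ 2 * K ∧
    ENNReal.ofReal κ * ∫⁻ t in Ioo a c, sqInt (potMeas γ) (w t) ≤ K := by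
  set hn : ℕ → ℝ := fun n => 1 / ((n : ℝ) + 1)
  have hn0 : ∀ n, 0 < hn n := fun n => by positivity
  have hlim0 : Tendsto hn atTop (𝓝 0) := tendsto_one_div_add_atTop_nhds_zero_nat
  have hlim : Tendsto hn atTop (𝓝[>] 0) :=
    tendsto_nhdsWithin_iff.2 ⟨hlim0, Eventually.of_forall hn0⟩
  -- The average at time a involves only times in (a, a + h], where `hA` applies once h < η. No
  -- trace of w at time a is needed.
  have hA' : ∀ᶠ n in atTop, sqInt volI (stek (hn n) w a) ≤ A := by
    filter_upwards [hlim0.eventually (gt_mem_nhds hη)] with n hnη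
    have := isProbabilityMeasure_avgMeas 0 (hn0 n)
    refine (sqInt_stek_le H.meas_w (hn0 n) a).trans ?_
    have hmem : ∀ᵐ s ∂(avgMeas 0 (hn n)), s ∈ Ioc 0 (hn n) := by
      unfold avgMeas
      refine Measure.ae_smul_measure ?_ _
      rw [zero_add]
      exact ae_restrict_mem measurableSet_Ioc
    refine (lintegral_mono_ae (g := fun _ => A) ?_).trans (by simp)
    filter_upwards [hmem] with s hs
    exact hA _ ⟨by linarith [hs.1], by linarith [hs.2]⟩
  have hmain : ∀ᶠ n in atTop, ∀ b, a ≤ b → b + hn n ≤ c →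
      ENNReal.ofReal 2⁻¹ * sqInt volI (stek (hn n) w b)
      + ∫⁻ t in Ioo a b, (ENNReal.ofReal 2⁻¹ * sqInt (kerMeas γ) (gap (stek (hn n) w t))
          + ENNReal.ofReal κ * sqInt (potMeas γ) (stek (hn n) w t)) ≤ K := by
    filter_upwards [hA'] with n hA b hab hbc
    refine ((H.stek_energy hγ hγ' hκ (hn0 n) hC0 hC hab hbc).trans ?_).trans hK
    gcongr
  have h2 : ∀ x : ℝ≥0∞, ENNReal.ofReal 2⁻¹ * x ≤ K → x ≤ 2 * K := fun x hx => by
    have h3 : (2 : ℝ≥0∞) * ENNReal.ofReal 2⁻¹ = 1 := by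
      rw [show (2 : ℝ≥0∞) = ENNReal.ofReal 2 by simp, ← ENNReal.ofReal_mul (by norm_num)]
      norm_num
    calc x = 2 * (ENNReal.ofReal 2⁻¹ * x) := by rw [← mul_assoc, h3, one_mul]
      _ ≤ _ := by gcongr
  have hE : ∀ n, Measurable fun t => sqInt (kerMeas γ) (gap (stek (hn n) w t)) := fun n =>
    measurable_sqInt (measurable_gap_uncurry (measurable_stek H.meas_w (hn0 n)))
  have hae := ae_ae_tendsto_stek H.meas_w H.bound_w hn0 hlim
  have hsplit : ∀ᶠ n in atTop,
      ENNReal.ofReal 2⁻¹ * (∫⁻ t in Ioo a (c - hn n), sqInt (kerMeas γ) (gap (stek (hn n) w t)))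
      + ENNReal.ofReal κ * (∫⁻ t in Ioo a (c - hn n), sqInt (potMeas γ) (stek (hn n) w t))
        ≤ K := by
    filter_upwards [hmain, hlim0.eventually (gt_mem_nhds (sub_pos.2 hac))] with n h3 h4
    have h5 := le_add_self.trans (h3 (c - hn n) (by linarith) (by linarith))
    rwa [lintegral_add_left ((hE n).const_mul _), lintegral_const_mul' _ _ ENNReal.ofReal_ne_top,
      lintegral_const_mul' _ _ ENNReal.ofReal_ne_top] at h5
  -- All three bounds follow from Fatou's lemma as the averages converge almost everywhere. The
  -- first one is obtained at almost every time only.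
  refine ⟨?_, ?_, ?_⟩
  · filter_upwards [hae] with t hl ht
    refine (sqInt_le_liminf (fun n => (measurable_slice (measurable_stek H.meas_w
      (hn0 n)) t).aemeasurable) hl).trans ?_
    refine liminf_le_of_frequently_le' (Eventually.frequently ?_)
    filter_upwards [hmain, hlim0.eventually (gt_mem_nhds (sub_pos.2 ht.2))] with n h3 h4
    exact h2 _ (le_self_add.trans (h3 t ht.1.le (by linarith)))
  · refine lintegral_sqInt_le_of_tendsto
      (fun n => measurable_gap_uncurry (measurable_stek H.meas_w (hn0 n))) ?_ hlim0
      (hsplit.mono fun n h3 => h2 _ (le_self_add.trans h3))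
    filter_upwards [hae] with t hl
    refine (kerMeas_ac γ).ae_le ?_
    filter_upwards [Measure.quasiMeasurePreserving_fst.ae hl,
      Measure.quasiMeasurePreserving_snd.ae hl] with p h3 h4
    exact h3.sub h4
  · rcases hκ.eq_or_lt with rfl | hκ0
    · simp
    rw [mul_comm, ← ENNReal.le_div_iff_mul_le (Or.inl (by simpa using hκ0)) (Or.inl ENNReal.ofReal_ne_top)]
    refine lintegral_sqInt_le_of_tendsto (fun n => measurable_stek H.meas_w (hn0 n)) ?_ hlim0
      (hsplit.mono fun n h3 => ?_)
    · filter_upwards [hae] with t hl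
      exact (potMeas_ac γ).ae_le hl
    · rw [ENNReal.le_div_iff_mul_le (Or.inl (by simpa using hκ0)) (Or.inl ENNReal.ofReal_ne_top),
        mul_comm]
      exact le_add_self.trans h3

end IsEvolution

/-! ### Vanishing initial data -/

/-- Extension by zero to negative times. -/
def posExt (f : ℝ → ℝ → ℝ) (t u : ℝ) : ℝ := if 0 < t then f t u else 0

lemma posExt_of_pos (f : ℝ → ℝ → ℝ) {t : ℝ} (ht : 0 < t) : posExt f t = f t := by
  funext u; simp [posExt, ht]

lemma posExt_of_nonpos (f : ℝ → ℝ → ℝ) {t : ℝ} (ht : t ≤ 0) : posExt f t = fun _ => 0 := by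
  funext u; simp [posExt, ht.not_gt]

lemma measurable_posExt {f : ℝ → ℝ → ℝ} (hf : Measurable (Function.uncurry f)) :
    Measurable (Function.uncurry (posExt f)) :=
  Measurable.ite (measurableSet_lt measurable_const measurable_fst) hf measurable_const

lemma abs_posExt_le {f : ℝ → ℝ → ℝ} {M : ℝ} (hM : ∀ t u, |f t u| ≤ M) (t u : ℝ) :
    |posExt f t u| ≤ M := by
  unfold posExt
  split_ifs
  · exact hM t u
  · rw [abs_zero]; exact (abs_nonneg _).trans (hM t u)

lemma lintegral_posExt (F : (ℝ → ℝ) → ℝ≥0∞) (hF : F (fun _ => 0) = 0) (f : ℝ → ℝ → ℝ) (c : ℝ) :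
    ∫⁻ t in Ioo (-1 : ℝ) c, F (posExt f t) = ∫⁻ t in Ioo (0 : ℝ) c, F (f t) := by
  rw [← lintegral_indicator measurableSet_Ioo, ← lintegral_indicator measurableSet_Ioo]
  refine lintegral_congr fun t => ?_
  simp only [indicator, mem_Ioo]
  rcases lt_or_ge 0 t with ht | ht
  · rw [posExt_of_pos f ht]
    simp [ht, (show (-1 : ℝ) < t by linarith)]
  · rw [posExt_of_nonpos f ht, hF]
    simp [ht.not_gt]

lemma sqInt_zero {Y : Type*} [MeasurableSpace Y] (ν : Measure Y) : sqInt ν (fun _ => 0) = 0 := by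
  simp [sqInt]

lemma gap_zero : gap (fun _ => 0) = fun _ => 0 := by
  funext p; simp [gap]

lemma lintegral_gap_posExt (γ : ℝ) (f : ℝ → ℝ → ℝ) (c : ℝ) :
    ∫⁻ t in Ioo (-1 : ℝ) c, sqInt (kerMeas γ) (gap (posExt f t))
      = ∫⁻ t in Ioo (0 : ℝ) c, sqInt (kerMeas γ) (gap (f t)) :=
  lintegral_posExt (fun g => sqInt (kerMeas γ) (gap g)) (by simp only [gap_zero, sqInt_zero]) f c

lemma lintegral_pot_posExt (γ : ℝ) (f : ℝ → ℝ → ℝ) (c : ℝ) :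
    ∫⁻ t in Ioo (-1 : ℝ) c, sqInt (potMeas γ) (posExt f t)
      = ∫⁻ t in Ioo (0 : ℝ) c, sqInt (potMeas γ) (f t) :=
  lintegral_posExt (sqInt (potMeas γ)) (sqInt_zero _) f c

/-- With zero initial pairing, the extension by zero solves the same equation on (-1, c). It
vanishes on (-1, 0), so the energy inequality started at -1 has zero initial term. This avoids any
continuity of w at time 0 in L². -/
lemma IsEvolution.posExt {γ κ δ c M : ℝ} {w σ z : ℝ → ℝ → ℝ}
    (H : IsEvolution γ κ δ 0 c M w σ z fun _ => 0) :
    IsEvolution γ κ δ (-1) c M (posExt w) (posExt σ) (posExt z) fun _ => 0 := by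
  refine ⟨measurable_posExt H.meas_w, measurable_posExt H.meas_σ, measurable_posExt H.meas_z,
    abs_posExt_le H.bound_w, abs_posExt_le H.bound_σ, abs_posExt_le H.bound_z, ?_, ?_, ?_, ?_, ?_⟩
  · rw [lintegral_gap_posExt]; exact H.energy_w
  · rw [lintegral_pot_posExt]; exact H.pot_w
  · rw [lintegral_gap_posExt]; exact H.energy_σ
  · rw [lintegral_pot_posExt]; exact H.pot_z
  · filter_upwards [H.weak] with t h ht φ hφ
    rw [intervalIntegral.integral_of_le ht.1.le]
    rcases lt_or_ge 0 t with ht0 | ht0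
    · rw [posExt_of_pos w ht0, h ⟨ht0, ht.2⟩ φ hφ, intervalIntegral.integral_of_le ht0.le,
        setIntegral_eq_of_subset_of_forall_sdiff_eq_zero (s := Ioc 0 t) (t := Ioc (-1) t)
          measurableSet_Ioc (Ioc_subset_Ioc_left (by norm_num))]
      · congr 1
        refine setIntegral_congr_fun measurableSet_Ioc fun r hr => ?_
        simp only [posExt_of_pos _ hr.1]
      · intro r hr
        have hr0 : r ≤ 0 := by
          by_contra h'
          exact hr.2 ⟨not_le.1 h', hr.1.2⟩
        simp only [posExt_of_nonpos _ hr0]; simp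
    · have e : ∀ r ∈ Ioc (-1) t, ((∫ u, (RegionalFractional.posExt w r u
          + RegionalFractional.posExt σ r u) * regLap γ φ u ∂volI)
          - κ * (∫ u, RegionalFractional.posExt w r u * (φ u * V₁ γ u) ∂volI)
          - δ * ∫ u, RegionalFractional.posExt z r u * (φ u * V₁ γ u) ∂volI) = 0 := fun r hr => by
        simp only [posExt_of_nonpos _ (hr.2.trans ht0)]; simp
      rw [setIntegral_congr_fun measurableSet_Ioc e]
      simp only [posExt_of_nonpos _ ht0]; simp

/-- The energy inequality for a vanishing initial datum. -/
theorem IsEvolution.energy_of_zero {γ κ δ c M : ℝ} {w σ z : ℝ → ℝ → ℝ}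
    (H : IsEvolution γ κ δ 0 c M w σ z fun _ => 0) (hγ : 1 < γ) (hγ' : γ < 2)
    (hκ : 0 ≤ κ) {C : ℝ} (hC0 : 0 < C) (hC : ∀ v : ℝ → ℝ, Measurable v →
      sqInt (potMeas γ) v < ⊤ →
      sqInt (potMeas γ) v ≤ ENNReal.ofReal C * sqInt (kerMeas γ) (gap v))
    (hc : 0 < c) {K : ℝ≥0∞}
    (hK : (∫⁻ t in Ioo 0 c, sqInt (kerMeas γ) (gap (σ t)))
          + ENNReal.ofReal (δ ^ 2 * C) * ∫⁻ t in Ioo 0 c, sqInt (potMeas γ) (z t) ≤ K) :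
    (∀ᵐ t, t ∈ Ioo 0 c → sqInt volI (w t) ≤ 2 * K) ∧
    ∫⁻ t in Ioo 0 c, sqInt (kerMeas γ) (gap (w t)) ≤ 2 * K ∧
    ENNReal.ofReal κ * ∫⁻ t in Ioo 0 c, sqInt (potMeas γ) (w t) ≤ K := by
  obtain ⟨h1, h2, h3⟩ := H.posExt.energy hγ hγ' hκ hC0 hC (by linarith) one_pos (A := 0)
    (fun t ht => by
      rw [posExt_of_nonpos w (by linarith [ht.2]), sqInt_zero]) (K := K) (by
      rw [lintegral_gap_posExt, lintegral_pot_posExt, mul_zero, zero_add]; exact hK)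
  rw [lintegral_gap_posExt] at h2
  rw [lintegral_pot_posExt] at h3
  refine ⟨?_, h2, h3⟩
  filter_upwards [h1] with t ht ht'
  have := ht ⟨by linarith [ht'.1], ht'.2⟩
  rwa [posExt_of_pos w ht'.1] at this

/-! ### Testing against smooth functions -/

lemma exists_bump_cutoff : ∃ χ : ℕ → ℝ → ℝ, (∀ n, IsBump (χ n)) ∧ (∀ n u, |χ n u| ≤ 1) ∧
    ∀ u ∈ Ioo (0 : ℝ) 1, Tendsto (fun n => χ n u) atTop (𝓝 1) := by
  have hlin : ∀ x : ℝ, 0 < x → ∀ᶠ n : ℕ in atTop, 1 ≤ ((n : ℝ) + 1) * x - 1 := fun x hx => by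
    filter_upwards [eventually_ge_atTop ⌈2 / x⌉₊] with n hn
    have : 2 / x ≤ (n : ℝ) + 1 := (Nat.le_ceil _).trans ((Nat.cast_le.2 hn).trans (by linarith))
    rw [div_le_iff₀ hx] at this
    linarith
  -- Each factor vanishes within 1/(n+1) of its end point and equals 1 beyond 2/(n+1).
  refine ⟨fun n u => Real.smoothTransition (((n : ℝ) + 1) * u - 1)
    * Real.smoothTransition (((n : ℝ) + 1) * (1 - u) - 1), fun n => ⟨?_, ?_⟩, fun n u => ?_,
    fun u hu => ?_⟩
  · exact (Real.smoothTransition.contDiff.comp (by fun_prop)).mul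
      (Real.smoothTransition.contDiff.comp (by fun_prop))
  · have hn : (0 : ℝ) < (n : ℝ) + 1 := by positivity
    refine ⟨1 / ((n : ℝ) + 1), 1 - 1 / ((n : ℝ) + 1), by positivity, ?_, fun u hu => ?_⟩
    · have : 0 < 1 / ((n : ℝ) + 1) := by positivity
      linarith
    · rcases lt_or_ge u (1 / ((n : ℝ) + 1)) with h | h
      · rw [lt_div_iff₀ hn] at h
        simp only
        rw [Real.smoothTransition.zero_of_nonpos (by linarith), zero_mul]
      · have h' : 1 - u < 1 / ((n : ℝ) + 1) := by
          by_contra h'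
          exact hu ⟨h, by linarith⟩
        rw [lt_div_iff₀ hn] at h'
        simp only
        rw [Real.smoothTransition.zero_of_nonpos (x := ((n : ℝ) + 1) * (1 - u) - 1) (by linarith),
          mul_zero]
  · rw [abs_of_nonneg (mul_nonneg (Real.smoothTransition.nonneg _)
      (Real.smoothTransition.nonneg _))]
    exact mul_le_one₀ (Real.smoothTransition.le_one _) (Real.smoothTransition.nonneg _)
      (Real.smoothTransition.le_one _)
  · refine tendsto_const_nhds.congr' ?_
    filter_upwards [hlin u hu.1, hlin (1 - u) (by linarith [hu.2])] with n h1 h2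
    rw [Real.smoothTransition.one_of_one_le h1, Real.smoothTransition.one_of_one_le h2, one_mul]

lemma IsBump.mul_smooth {χ g : ℝ → ℝ} (hχ : IsBump χ) (hg : ContDiff ℝ ∞ g) :
    IsBump fun u => χ u * g u := by
  obtain ⟨a, b, ha, hb, hs⟩ := hχ.support
  exact ⟨hχ.smooth.mul hg, a, b, ha, hb, fun u hu => by rw [hs u hu, zero_mul]⟩

lemma sqInt_volI_le_of_abs_le {f : ℝ → ℝ} {M : ℝ} (hM : ∀ᵐ u ∂volI, |f u| ≤ M) :
    sqInt volI f ≤ ENNReal.ofReal (M ^ 2) := by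
  refine (lintegral_mono_ae (g := fun _ => ENNReal.ofReal (M ^ 2)) ?_).trans (by simp)
  filter_upwards [hM] with u hu
  refine ENNReal.ofReal_le_ofReal ?_
  rw [← sq_abs]
  exact pow_le_pow_left₀ (abs_nonneg _) hu 2

/-- Density of the smooth functions with compact support in `L²(0,1)`. -/
lemma exists_bump_sqInt_sub_le {f : ℝ → ℝ} (hf : AEMeasurable f volI) (hfin : sqInt volI f < ⊤)
    {ε : ℝ} (hε : 0 < ε) : ∃ φ : ℝ → ℝ, IsBump φ ∧
      sqInt volI (fun u => f u - φ u) ≤ ENNReal.ofReal ε := by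
  have hmem : MemLp f 2 volI :=
    (memLp_two_iff_integrable_sq hf.aestronglyMeasurable).2 (integrable_sq_of_sqInt hf hfin)
  -- The smooth approximation g lives on the line; its support is pushed inside the open interval by
  -- the cutoffs. Each step has squared error at most ε/4, because squares of sums cost a factor 2.
  obtain ⟨g, hgc, hg, hfg⟩ := hmem.exist_eLpNorm_sub_le (by simp) (by norm_num)
    (ε := Real.sqrt (ε / 4)) (by positivity)
  have hfg' : sqInt volI (fun u => f u - g u) ≤ ENNReal.ofReal (ε / 4) := by
    have h1 : eLpNorm (f - g) 2 volI ^ (2 : ℝ) = sqInt volI (fun u => f u - g u) := by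
      rw [eLpNorm_eq_lintegral_rpow_enorm_toReal (by simp) (by simp), ← ENNReal.rpow_mul]
      simp only [ENNReal.toReal_ofNat, one_div, ne_eq, OfNat.ofNat_ne_zero, not_false_eq_true,
        inv_mul_cancel₀, ENNReal.rpow_one, sqInt]
      refine lintegral_congr fun u => ?_
      rw [← ofReal_norm, ENNReal.ofReal_rpow_of_nonneg (norm_nonneg _) (by norm_num)]
      congr 1
      rw [Real.rpow_two, Real.norm_eq_abs, sq_abs]
      rfl
    rw [← h1]
    calc _ ≤ ENNReal.ofReal (Real.sqrt (ε / 4)) ^ (2 : ℝ) := by gcongr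
      _ = _ := by
        rw [ENNReal.ofReal_rpow_of_nonneg (Real.sqrt_nonneg _) (by norm_num), Real.rpow_two,
          Real.sq_sqrt (by positivity)]
  obtain ⟨χ, hχ1, hχ2, hχ3⟩ := exists_bump_cutoff
  obtain ⟨B, hB⟩ := hgc.exists_bound_of_continuous hg.continuous
  have hgm : Measurable g := hg.continuous.measurable
  have hgfin : sqInt volI g < ⊤ :=
    (sqInt_volI_le_of_abs_le (ae_of_all _ hB)).trans_lt ENNReal.ofReal_lt_top
  have hlim := tendsto_sqInt_sub (ν := volI) (f := g) (fn := fun n u => χ n u * g u)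
    hgm.aemeasurable (fun n => ((hχ1 n).measurable.mul hgm).aemeasurable)
    (by
      filter_upwards [ae_mem_volI] with u hu
      simpa using (hχ3 u hu).mul_const (g u))
    (fun n => sqInt_mono (ae_of_all _ fun u => by
      rw [abs_mul]
      exact mul_le_of_le_one_left (abs_nonneg _) (hχ2 n u))) hgfin
  obtain ⟨n, hn⟩ := (hlim.eventually (gt_mem_nhds (show (0 : ℝ≥0∞)
    < ENNReal.ofReal (ε / 4) by simpa using hε))).exists
  refine ⟨fun u => χ n u * g u, (hχ1 n).mul_smooth hg, ?_⟩
  have h1 := sqInt_sub_le (ν := volI) (f := fun u => f u - g u)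
    (g := fun u => χ n u * g u - g u) (hf.sub hgm.aemeasurable)
  simp only [sub_sub_sub_cancel_right] at h1
  refine h1.trans ?_
  calc _ ≤ 2 * ENNReal.ofReal (ε / 4) + 2 * ENNReal.ofReal (ε / 4) := by gcongr
    _ = ENNReal.ofReal ε := by
      rw [← add_mul, show (2 + 2 : ℝ≥0∞) = ENNReal.ofReal 4 by norm_num,
        ← ENNReal.ofReal_mul (by norm_num)]
      congr 1; ring

/-- A bound on the `L²` norm by duality. -/
lemma sqInt_le_of_forall_bump {f : ℝ → ℝ} (hf : AEMeasurable f volI) (hfin : sqInt volI f < ⊤)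
    {K : ℝ} (hK : ∀ φ, IsBump φ →
      ∫ u, f u * φ u ∂volI ≤ 2⁻¹ * K + 2⁻¹ * (sqInt volI φ).toReal) :
    sqInt volI f ≤ ENNReal.ofReal K := by
  rw [← ENNReal.ofReal_toReal hfin.ne]
  refine ENNReal.ofReal_le_ofReal (le_of_forall_pos_le_add fun ε hε => ?_)
  obtain ⟨φ, hφ, h1⟩ := exists_bump_sqInt_sub_le hf hfin hε
  obtain ⟨B, hB⟩ := hφ.exists_bound
  have hφfin : sqInt volI φ < ⊤ :=
    (sqInt_volI_le_of_abs_le (ae_of_all _ hB)).trans_lt ENNReal.ofReal_lt_top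
  have hm := hφ.measurable.aemeasurable (μ := volI)
  have h2 : (sqInt volI (fun u => f u - φ u)).toReal ≤ ε := by
    have := ENNReal.toReal_mono ENNReal.ofReal_ne_top h1
    rwa [ENNReal.toReal_ofReal hε.le] at this
  have i1 : Integrable (fun u => 2 * (f u * φ u)) volI :=
    (integrable_mul_of_sqInt hf hm hfin hφfin).const_mul 2
  have i2 := integrable_sq_of_sqInt hf hfin
  have i3 := integrable_sq_of_sqInt hm hφfin
  have hfm : AEMeasurable (fun u => f u - φ u) volI := hf.sub hm
  -- Since ‖f - φ‖² ≤ ε, the expansion gives ‖f‖² + ‖φ‖² ≤ 2⟨f, φ⟩ + ε. With the assumed bound on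
  -- the pairing, ‖φ‖² cancels.
  have h3 : (sqInt volI (fun u => f u - φ u)).toReal = (sqInt volI f).toReal
      - 2 * (∫ u, f u * φ u ∂volI) + (sqInt volI φ).toReal := by
    rw [← integral_sq_eq_toReal hf, ← integral_sq_eq_toReal hm,
      ← integral_sq_eq_toReal hfm, ← integral_const_mul, ← integral_sub i2 i1]
    have i4 : Integrable (fun u => f u ^ 2 - 2 * (f u * φ u)) volI := i2.sub i1
    rw [← integral_add i4 i3]
    refine integral_congr_ae (ae_of_all _ fun u => ?_)
    simp only; ring
  linarith [hK φ hφ]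

lemma ae_eq_of_sqInt_sub_eq_zero {f g : ℝ → ℝ} (hf : AEMeasurable f volI)
    (hg : AEMeasurable g volI) (h0 : sqInt volI (fun u => f u - g u) = 0) : f =ᵐ[volI] g := by
  have hm : AEMeasurable (fun u => f u - g u) volI := hf.sub hg
  rw [sqInt, lintegral_eq_zero_iff' (aemeasurable_ofReal_sq hm)] at h0
  filter_upwards [h0] with u hu
  simp only [Pi.zero_apply, ENNReal.ofReal_eq_zero] at hu
  have := pow_eq_zero_iff (two_ne_zero) |>.1 (le_antisymm hu (sq_nonneg _))
  linarith

lemma ae_eq_of_forall_bump {f g : ℝ → ℝ} (hf : AEMeasurable f volI) (hg : AEMeasurable g volI)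
    (hfin : sqInt volI f < ⊤) (hgfin : sqInt volI g < ⊤)
    (h : ∀ φ, IsBump φ → ∫ u, f u * φ u ∂volI = ∫ u, g u * φ u ∂volI) : f =ᵐ[volI] g := by
  have hm : AEMeasurable (fun u => f u - g u) volI := hf.sub hg
  have hfg : sqInt volI (fun u => f u - g u) < ⊤ := (sqInt_sub_le hf).trans_lt
    (ENNReal.add_lt_top.2 ⟨ENNReal.mul_lt_top (by simp) hfin, ENNReal.mul_lt_top (by simp) hgfin⟩)
  have h0 := sqInt_le_of_forall_bump hm hfg (K := 0) fun φ hφ => by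
    obtain ⟨B, hB⟩ := hφ.exists_bound
    have hφfin : sqInt volI φ < ⊤ :=
      (sqInt_volI_le_of_abs_le (ae_of_all _ hB)).trans_lt ENNReal.ofReal_lt_top
    have hmφ := hφ.measurable.aemeasurable (μ := volI)
    have e : ∫ u, (f u - g u) * φ u ∂volI = 0 := by
      simp only [sub_mul]
      rw [integral_sub (integrable_mul_of_sqInt hf hmφ hfin hφfin)
        (integrable_mul_of_sqInt hg hmφ hgfin hφfin), h φ hφ, sub_self]
    rw [e]; positivity
  rw [ENNReal.ofReal_zero, nonpos_iff_eq_zero] at h0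
  exact ae_eq_of_sqInt_sub_eq_zero hf hg h0

/-! ### The stationary profile of the reaction equation -/

/-- The profile `V₀ / V₁` on the unit interval, extended by zero. -/
def rbar (γ α β : ℝ) : ℝ → ℝ := (Ioo (0 : ℝ) 1).indicator (rhoBarInf γ α β)

/-- The continuous extension of `V₀ / V₁` to the closed interval. -/
def rcont (γ α β u : ℝ) : ℝ := (α * (1 - u) ^ γ + β * u ^ γ) / ((1 - u) ^ γ + u ^ γ)

section Rbar

variable {γ α β : ℝ}

lemma measurable_rhoBarInf (γ α β : ℝ) : Measurable (rhoBarInf γ α β) :=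
  (measurable_V₀ γ α β).div (measurable_V₁ γ)

lemma measurable_rbar (γ α β : ℝ) : Measurable (rbar γ α β) :=
  (measurable_rhoBarInf γ α β).indicator measurableSet_Ioo

lemma rbar_of_mem {u : ℝ} (hu : u ∈ Ioo (0 : ℝ) 1) : rbar γ α β u = rhoBarInf γ α β u :=
  indicator_of_mem hu _

lemma rbar_mul_V₁ (hγ : 0 < γ) {u : ℝ} (hu : u ∈ Ioo (0 : ℝ) 1) :
    rbar γ α β u * V₁ γ u = V₀ γ α β u := by
  rw [rbar_of_mem hu, rhoBarInf, div_mul_cancel₀ _ (V₁_pos hγ hu).ne']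

lemma rhoBarInf_mem_Icc (hγ : 0 < γ) (hα : 0 ≤ α) (hα' : α ≤ 1) (hβ : 0 ≤ β) (hβ' : β ≤ 1) {u : ℝ}
    (hu : u ∈ Ioo (0 : ℝ) 1) : rhoBarInf γ α β u ∈ Icc (0 : ℝ) 1 := by
  have h1 := rMinus_pos hγ hu.1
  have h2 := rPlus_pos hγ hu.2
  have h3 := V₁_pos hγ hu
  refine ⟨div_nonneg (by unfold V₀; positivity) h3.le, ?_⟩
  rw [rhoBarInf, div_le_one h3, V₀, V₁]
  nlinarith

lemma rbar_mem_Icc (hγ : 0 < γ) (hα : 0 ≤ α) (hα' : α ≤ 1) (hβ : 0 ≤ β) (hβ' : β ≤ 1) (u : ℝ) :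
    rbar γ α β u ∈ Icc (0 : ℝ) 1 := by
  by_cases hu : u ∈ Ioo (0 : ℝ) 1
  · rw [rbar_of_mem hu]; exact rhoBarInf_mem_Icc hγ hα hα' hβ hβ' hu
  · rw [rbar, indicator_of_notMem hu]; simp

lemma denom_pos (hγ : 0 < γ) {u : ℝ} (hu : u ∈ Icc (0 : ℝ) 1) : 0 < (1 - u) ^ γ + u ^ γ := by
  rcases hu.1.eq_or_lt with h | h
  · rw [← h, Real.zero_rpow hγ.ne']; simp
  · have := Real.rpow_pos_of_pos h γ
    have h2 : 0 ≤ 1 - u := by linarith [hu.2]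
    positivity

lemma rbar_eq_rcont (hγ : 0 < γ) {u : ℝ} (hu : u ∈ Ioo (0 : ℝ) 1) :
    rbar γ α β u = rcont γ α β u := by
  have hc := cGamma_pos hγ
  have h1 := Real.rpow_pos_of_pos hu.1 γ
  have h2 : 0 < (1 - u) ^ γ := Real.rpow_pos_of_pos (by linarith [hu.2]) γ
  rw [rbar_of_mem hu, rhoBarInf, rcont, V₀, V₁, rMinus, rPlus, Real.rpow_neg hu.1.le,
    Real.rpow_neg (by linarith [hu.2])]
  rw [div_eq_div_iff (by positivity) (by positivity)]
  field_simp

lemma rcont_zero (hγ : 0 < γ) : rcont γ α β 0 = α := by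
  simp [rcont, Real.zero_rpow hγ.ne']

lemma rcont_one (hγ : 0 < γ) : rcont γ α β 1 = β := by
  simp [rcont, Real.zero_rpow hγ.ne']

/-- Multiplying V₀ and V₁ by (u(1-u))^γ clears the singularities, and x ↦ x^γ is C¹ up to 0 for γ >
1. The stationary profile is therefore Lipschitz, hence of finite energy. -/
lemma contDiffAt_rcont (hγ : 1 < γ) {u : ℝ} (hu : u ∈ Icc (0 : ℝ) 1) :
    ContDiffAt ℝ 1 (rcont γ α β) u := by
  have h1 : ContDiff ℝ 1 fun x : ℝ => x ^ γ :=
    Real.contDiff_rpow_const_of_le (n := 1) (by simpa using hγ.le)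
  have h2 : ContDiff ℝ 1 fun x : ℝ => (1 - x) ^ γ := h1.comp (by fun_prop)
  exact (((contDiff_const.mul h2).add (contDiff_const.mul h1)).contDiffAt).div
    (h2.add h1).contDiffAt (denom_pos (by linarith) hu).ne'

lemma continuousOn_rcont (hγ : 1 < γ) : ContinuousOn (rcont γ α β) (Icc 0 1) := fun _ hu =>
  (contDiffAt_rcont hγ hu).continuousAt.continuousWithinAt

lemma sqInt_gap_rbar_lt_top (hγ : 1 < γ) (hγ' : γ < 2) :
    sqInt (kerMeas γ) (gap (rbar γ α β)) < ⊤ := by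
  have hl : LocallyLipschitzOn (Icc (0 : ℝ) 1) (rcont γ α β) := fun u hu => by
    obtain ⟨K, t, ht, h⟩ := (contDiffAt_rcont (α := α) (β := β) hγ hu).exists_lipschitzOnWith
    exact ⟨K, t, mem_nhdsWithin_of_mem_nhds ht, h⟩
  obtain ⟨K, hK⟩ := hl.exists_lipschitzOnWith_of_compact isCompact_Icc
  refine sqInt_gap_lt_top_of_lipschitz (by linarith) hγ' (K := K) fun u hu v hv => ?_
  rw [rbar_eq_rcont (by linarith) hu, rbar_eq_rcont (by linarith) hv]
  exact hK.dist_le_mul u (Ioo_subset_Icc_self hu) v (Ioo_subset_Icc_self hv)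

/-- The boundary energy density is the `V₁`-weighted distance to the stationary profile plus
a bounded function. -/
lemma boundary_density_eq (hγ : 0 < γ) {u : ℝ} (hu : u ∈ Ioo (0 : ℝ) 1) (x : ℝ) :
    cGamma γ / γ * ((α - x) ^ 2 / u ^ γ + (β - x) ^ 2 / (1 - u) ^ γ)
      = (x - rbar γ α β u) ^ 2 * V₁ γ u
        + cGamma γ / γ * ((β - α) ^ 2 / ((1 - u) ^ γ + u ^ γ)) := by
  have hc := cGamma_pos hγ
  have h1 := Real.rpow_pos_of_pos hu.1 γ
  have h2 : 0 < (1 - u) ^ γ := Real.rpow_pos_of_pos (by linarith [hu.2]) γ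
  rw [rbar_eq_rcont hγ hu, rcont, V₁, rMinus, rPlus, Real.rpow_neg hu.1.le,
    Real.rpow_neg (by linarith [hu.2])]
  -- With weights 1/p and 1/q on the values α and β, whose weighted mean is the stationary profile,
  -- the claim is the decomposition of a second moment into squared bias and variance. The variance
  -- part is (β - α)²/(p + q).
  generalize u ^ γ = p at *
  generalize (1 - u) ^ γ = q at *
  field_simp
  ring

end Rbar

/-! ### Weak solutions tested against functions of space -/

/-- A jointly Borel version, clamped to [0,1] everywhere, makes the tools for integrals and averages
applicable. It agrees with ρ only at almost every time, so statements at every time must keep ρ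
itself; this is why `IsBumpSolution` carries both functions. -/
lemma IsProfile.exists_version {T : ℝ} {ρ : ℝ → ℝ → ℝ} (hρ : IsProfile T ρ) :
    ∃ ρ' : ℝ → ℝ → ℝ, Measurable (Function.uncurry ρ') ∧ (∀ t u, ρ' t u ∈ Icc (0 : ℝ) 1) ∧
      ∀ᵐ t ∂(volume.restrict (Icc (0 : ℝ) T)), ρ t =ᵐ[volI] ρ' t := by
  set f := hρ.aemeasurable.mk
  have hf : Measurable f := hρ.aemeasurable.measurable_mk
  refine ⟨fun t u => max 0 (min 1 (f (t, u))), ?_, fun t u => ⟨le_max_left _ _,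
    max_le zero_le_one (min_le_left _ _)⟩, ?_⟩
  · exact measurable_const.max (measurable_const.min hf)
  · filter_upwards [Measure.ae_ae_of_ae_prod hρ.aemeasurable.ae_eq_mk,
      ae_restrict_mem measurableSet_Icc] with t ht htT
    filter_upwards [ht, ae_mem_volI] with u hu huI
    have h1 := hρ.mem_Icc t htT u (Ioo_subset_Icc_self huI)
    rw [hu] at h1 ⊢
    rw [min_eq_right h1.2, max_eq_right h1.1]

lemma IsBump.isTestFunction {φ : ℝ → ℝ} (hφ : IsBump φ) (T : ℝ) :
    IsTestFunction T fun _ => φ where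
  compact_support := by
    obtain ⟨a, b, ha, hb, hs⟩ := hφ.support
    exact ⟨a, b, ha, hb, fun _ _ u hu => hs u hu⟩
  smooth_space _ _ := hφ.smooth
  continuous_space n := ((hφ.smooth.continuous_iteratedDeriv n
    (WithTop.coe_le_coe.2 le_top)).comp continuous_snd).continuousOn
  differentiable_time _ := differentiableOn_const _
  continuous_time := by
    simp only [timeDeriv, derivWithin_fun_const]
    exact continuousOn_const

/-- Weak solutions of `∂ₜ ρ = 𝕃 ρ - κ V₁ (ρ - ρ̄)` tested against functions of the space variable,
together with a jointly measurable version. -/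
structure IsBumpSolution (γ α β T κ : ℝ) (g : ℝ → ℝ) (ρ ρ' : ℝ → ℝ → ℝ) : Prop where
  profile : IsProfile T ρ
  meas : Measurable (Function.uncurry ρ')
  mem_Icc : ∀ t u, ρ' t u ∈ Icc (0 : ℝ) 1
  version : ∀ᵐ t ∂(volume.restrict (Icc (0 : ℝ) T)), ρ t =ᵐ[volI] ρ' t
  energy : ∫⁻ t in Ioo 0 T, sqInt (kerMeas γ) (gap (ρ' t)) < ⊤
  pot : ∫⁻ t in Ioo 0 T, sqInt (potMeas γ) (fun u => ρ' t u - rbar γ α β u) < ⊤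
  weak : ∀ t ∈ Icc (0 : ℝ) T, ∀ φ, IsBump φ → ∫ u, ρ t u * φ u ∂volI = (∫ u, g u * φ u ∂volI)
    + ∫ r in (0 : ℝ)..t, ((∫ u, ρ' r u * regLap γ φ u ∂volI)
      - κ * ∫ u, (ρ' r u - rbar γ α β u) * (φ u * V₁ γ u) ∂volI)

lemma lintegral_Icc_eq_Ioo (f : ℝ → ℝ≥0∞) (a b : ℝ) :
    ∫⁻ t in Icc a b, f t = ∫⁻ t in Ioo a b, f t :=
  setLIntegral_congr Ioo_ae_eq_Icc.symm

lemma sqInt_gap_sub_le (γ : ℝ) {f g : ℝ → ℝ} (hf : Measurable f) :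
    sqInt (kerMeas γ) (gap fun u => f u - g u)
      ≤ 2 * sqInt (kerMeas γ) (gap f) + 2 * sqInt (kerMeas γ) (gap g) := by
  have e : (gap fun u => f u - g u) = fun p => gap f p - gap g p := by
    funext p; simp only [gap]; ring
  rw [e]
  exact sqInt_sub_le (measurable_gap hf).aemeasurable

lemma sqInt_gap_add_le (γ : ℝ) {f g : ℝ → ℝ} (hf : Measurable f) :
    sqInt (kerMeas γ) (gap fun u => f u + g u)
      ≤ 2 * sqInt (kerMeas γ) (gap f) + 2 * sqInt (kerMeas γ) (gap g) := by
  have e : (gap fun u => f u + g u) = fun p => gap f p + gap g p := by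
    funext p; simp only [gap]; ring
  rw [e]
  exact sqInt_add_le (measurable_gap hf).aemeasurable

/-- A function with the right boundary values is close to the stationary profile. -/
lemma sqInt_potMeas_sub_rbar_le {γ α β C : ℝ} (hγ : 1 < γ) (hC : ∀ v : ℝ → ℝ, Measurable v →
      sqInt (potMeas γ) v < ⊤ →
      sqInt (potMeas γ) v ≤ ENNReal.ofReal C * sqInt (kerMeas γ) (gap v)) {f : ℝ → ℝ}
    (hf : HasBoundaryValues α β f) : sqInt (potMeas γ) (fun u => f u - rbar γ α β u)
      ≤ ENNReal.ofReal C * sqInt (kerMeas γ) (gap fun u => f u - rbar γ α β u) := by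
  have hγ0 : 0 < γ := by linarith
  obtain ⟨r, hr, hfr, h0, h1⟩ := hf
  set q : ℝ → ℝ := fun u => r (max 0 (min u 1)) - rcont γ α β (max 0 (min u 1)) with hq
  have hqc : Continuous q := (hr.sub (continuousOn_rcont hγ)).comp_continuous
    (f := fun u : ℝ => max 0 (min u 1)) (by fun_prop) fun u =>
      ⟨le_max_left _ _, max_le zero_le_one (min_le_right _ _)⟩
  have hq0 : ∀ u, u ∉ Ioo (0 : ℝ) 1 → q u = 0 := fun u hu => by
    simp only [mem_Ioo, not_and_or, not_lt] at hu
    rcases hu with hu | hu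
    · simp only [hq]
      rw [min_eq_left (by linarith), max_eq_left hu, h0, rcont_zero hγ0, sub_self]
    · simp only [hq]
      rw [min_eq_right hu, max_eq_right zero_le_one, h1, rcont_one hγ0, sub_self]
  have hae : (fun u => f u - rbar γ α β u) =ᵐ[volI] q := by
    filter_upwards [hfr, ae_mem_volI] with u hu huI
    simp only [hq]
    rw [min_eq_left huI.2.le, max_eq_right huI.1.le, hu, rbar_eq_rcont hγ0 huI]
  rw [sqInt_potMeas_congr γ hae, sqInt_kerMeas_congr γ hae]
  exact sqInt_potMeas_lt_top_of_continuous hγ hqc hq0 hC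

lemma IsWeakSolution.lintegral_energy_lt_top {γ α β T κ : ℝ} {g : ℝ → ℝ} {ρ ρ' : ℝ → ℝ → ℝ}
    (hγ : 0 < γ) (H : IsWeakSolution γ α β T κ g ρ)
    (hver : ∀ᵐ t ∂(volume.restrict (Icc (0 : ℝ) T)), ρ t =ᵐ[volI] ρ' t) :
    ∫⁻ t in Ioo 0 T, sqInt (kerMeas γ) (gap (ρ' t)) < ⊤ := by
  rw [← lintegral_Icc_eq_Ioo]
  refine lt_of_le_of_lt (lintegral_mono_ae ?_) H.finite_energy
  filter_upwards [hver, ae_restrict_mem measurableSet_Icc] with t ht htT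
  rw [sobolevNormSq, seminormSq_eq hγ (H.profile.aemeasurable_slice t htT),
    sqInt_kerMeas_congr γ ht]
  exact le_add_self

/-- For κ > 0 the integrand is the boundary energy density up to a constant and a nonnegative term.
For κ = 0 the boundary values make ρ - ρ̄ vanish at the end points, and Hardy bounds its L²(V₁) norm
by its energy. Both boundary conditions thus become one condition. -/
lemma IsWeakSolution.lintegral_pot_lt_top {γ α β T κ : ℝ} {g : ℝ → ℝ} {ρ ρ' : ℝ → ℝ → ℝ}
    (hγ : 1 < γ) (hγ' : γ < 2) (hκ : 0 ≤ κ) (H : IsWeakSolution γ α β T κ g ρ)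
    (hm : Measurable (Function.uncurry ρ'))
    (hver : ∀ᵐ t ∂(volume.restrict (Icc (0 : ℝ) T)), ρ t =ᵐ[volI] ρ' t) :
    ∫⁻ t in Ioo 0 T, sqInt (potMeas γ) (fun u => ρ' t u - rbar γ α β u) < ⊤ := by
  have hγ0 : 0 < γ := by linarith
  have hc := cGamma_pos hγ0
  have hE := H.lintegral_energy_lt_top hγ0 hver
  rw [← lintegral_Icc_eq_Ioo] at hE ⊢
  rcases hκ.eq_or_lt with h0 | h0
  · obtain ⟨C, hC0, hC⟩ := exists_hardy hγ
    have hfin := sqInt_gap_rbar_lt_top (α := α) (β := β) hγ hγ'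
    refine lt_of_le_of_lt (lintegral_mono_ae (g := fun t => ENNReal.ofReal C *
      (2 * sqInt (kerMeas γ) (gap (ρ' t)) + 2 * sqInt (kerMeas γ) (gap (rbar γ α β)))) ?_) ?_
    · filter_upwards [hver, H.boundary_of_zero h0.symm] with t ht hb
      have hb' : HasBoundaryValues α β (ρ' t) := by
        obtain ⟨r, h1, h2, h3⟩ := hb
        exact ⟨r, h1, ht.symm.trans h2, h3⟩
      refine (sqInt_potMeas_sub_rbar_le hγ hC hb').trans (mul_le_mul_right ?_ _)
      exact sqInt_gap_sub_le γ (measurable_slice hm t)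
    · rw [lintegral_const_mul' _ _ ENNReal.ofReal_ne_top, lintegral_add_right _ measurable_const,
        lintegral_const_mul' _ _ (by simp), lintegral_const]
      refine ENNReal.mul_lt_top ENNReal.ofReal_lt_top (ENNReal.add_lt_top.2
        ⟨ENNReal.mul_lt_top (by simp) hE, ENNReal.mul_lt_top (ENNReal.mul_lt_top (by simp) hfin) ?_⟩)
      simp
  · have hB := H.boundary_of_pos h0
    refine lt_of_le_of_lt ?_ (ENNReal.mul_lt_top
      (ENNReal.ofReal_lt_top (r := cGamma γ / γ)) hB)
    rw [boundaryEnergy, ← lintegral_const_mul' _ _ ENNReal.ofReal_ne_top]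
    refine lintegral_mono_ae ?_
    filter_upwards [hver] with t ht
    rw [← l2V₁NormSq_eq, l2V₁NormSq, ← lintegral_const_mul' _ _ ENNReal.ofReal_ne_top]
    refine lintegral_mono_ae ?_
    filter_upwards [ht, ae_mem_volI] with u hu huI
    rw [← ENNReal.ofReal_mul (by positivity), boundary_density_eq hγ0 huI, ← hu]
    refine ENNReal.ofReal_le_ofReal (le_add_of_nonneg_right ?_)
    have := denom_pos hγ0 (Ioo_subset_Icc_self huI)
    positivity

lemma abs_le_one_of_mem_Icc {x : ℝ} (hx : x ∈ Icc (0 : ℝ) 1) : |x| ≤ 1 :=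
  abs_le.2 ⟨by linarith [hx.1], hx.2⟩

lemma abs_sub_le_one_of_mem_Icc {x y : ℝ} (hx : x ∈ Icc (0 : ℝ) 1) (hy : y ∈ Icc (0 : ℝ) 1) :
    |x - y| ≤ 1 :=
  abs_le.2 ⟨by linarith [hx.1, hy.2], by linarith [hx.2, hy.1]⟩

lemma integrable_mul_of_bounded {f ψ : ℝ → ℝ} {M B : ℝ} (hf : Measurable f)
    (hM : ∀ u, |f u| ≤ M) (hψ : Measurable ψ) (hB : ∀ u, |ψ u| ≤ B) :
    Integrable (fun u => f u * ψ u) volI := by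
  refine Integrable.of_bound (hf.mul hψ).aestronglyMeasurable (M * B) (ae_of_all _ fun u => ?_)
  rw [Real.norm_eq_abs, abs_mul]
  exact mul_le_mul (hM u) (hB u) (abs_nonneg _) ((abs_nonneg _).trans (hM 0))

/-- Since V₀ = ρ̄ V₁, the source and the killing term combine into -κ V₁ (ρ - ρ̄). Test functions
that do not depend on time carry all the information needed for the comparison. -/
theorem IsWeakSolution.exists_isBumpSolution {γ α β T κ : ℝ} (hγ : 1 < γ) (hγ' : γ < 2)
    (hα : 0 ≤ α) (hα' : α ≤ 1) (hβ : 0 ≤ β) (hβ' : β ≤ 1) (hκ : 0 ≤ κ)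
    {g : ℝ → ℝ} {ρ : ℝ → ℝ → ℝ} (H : IsWeakSolution γ α β T κ g ρ) :
    ∃ ρ', IsBumpSolution γ α β T κ g ρ ρ' := by
  have hγ0 : 0 < γ := by linarith
  obtain ⟨ρ', hm, hmem, hver⟩ := H.profile.exists_version
  refine ⟨ρ', H.profile, hm, hmem, hver, H.lintegral_energy_lt_top hγ0 hver,
    H.lintegral_pot_lt_top hγ hγ' hκ hm hver, fun t ht φ hφ => ?_⟩
  have h1 := H.weak_form t ht (fun _ => φ) (hφ.isTestFunction T)
  obtain ⟨B₁, hB₁⟩ := hφ.exists_regLap_bound hγ0 hγ'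
  obtain ⟨B₂, hB₂⟩ := hφ.exists_bound_mul_V₁ hγ0
  have hm1 := hφ.measurable_regLap hγ0 hγ'
  have hm2 := hφ.measurable_mul_V₁ γ
  have hb : ∀ t u, |ρ' t u| ≤ 1 := fun t u => abs_le_one_of_mem_Icc (hmem t u)
  have hbr : ∀ u, |rbar γ α β u| ≤ 1 := fun u =>
    abs_le_one_of_mem_Icc (rbar_mem_Icc hγ0 hα hα' hβ hβ' u)
  have i1 := intervalIntegrable_pairing hm hb hm1 hB₁ 0 t
  have i2 := (intervalIntegrable_pairing hm hb hm2 hB₂ 0 t).const_mul κ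
  have e0 : ∫ u in Ioo (0 : ℝ) 1, φ u * V₀ γ α β u = ∫ u, rbar γ α β u * (φ u * V₁ γ u) ∂volI := by
    refine integral_congr_ae ?_
    filter_upwards [ae_mem_volI] with u hu
    rw [← rbar_mul_V₁ hγ0 hu]; ring
  have e1 : ∫ s in (0 : ℝ)..t, ∫ u in Ioo (0 : ℝ) 1,
        ρ s u * (timeDeriv T (fun _ => φ) s u + regLapKappa γ κ φ u)
      = ∫ s in (0 : ℝ)..t, ((∫ u, ρ' s u * regLap γ φ u ∂volI)
        - κ * ∫ u, ρ' s u * (φ u * V₁ γ u) ∂volI) := by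
    refine intervalIntegral.integral_congr_ae ?_
    have hver' := (ae_restrict_iff' measurableSet_Icc).1 hver
    filter_upwards [hver'] with s hs hst
    rw [uIoc_of_le ht.1] at hst
    have hs' := hs ⟨hst.1.le, hst.2.trans ht.2⟩
    rw [← integral_const_mul, ← integral_sub (integrable_mul_of_bounded (measurable_slice hm s)
      (hb s) hm1 hB₁) ((integrable_mul_of_bounded (measurable_slice hm s) (hb s) hm2
      hB₂).const_mul κ)]
    refine integral_congr_ae ?_
    filter_upwards [hs'] with u hu
    simp only [timeDeriv, derivWithin_fun_const, regLapKappa, hu, Pi.zero_apply]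
    ring
  have e2 : ∀ r, ∫ u, (ρ' r u - rbar γ α β u) * (φ u * V₁ γ u) ∂volI
      = (∫ u, ρ' r u * (φ u * V₁ γ u) ∂volI) - ∫ u, rbar γ α β u * (φ u * V₁ γ u) ∂volI :=
    fun r => by
      simp only [sub_mul]
      exact integral_sub (integrable_mul_of_bounded (measurable_slice hm r) (hb r) hm2 hB₂)
        (integrable_mul_of_bounded (measurable_rbar γ α β) hbr hm2 hB₂)
  simp only [e2, e1, e0] at h1 ⊢
  have e3 : ∀ r, (∫ u, ρ' r u * regLap γ φ u ∂volI) - κ * ((∫ u, ρ' r u * (φ u * V₁ γ u) ∂volI)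
      - ∫ u, rbar γ α β u * (φ u * V₁ γ u) ∂volI)
      = ((∫ u, ρ' r u * regLap γ φ u ∂volI) - κ * (∫ u, ρ' r u * (φ u * V₁ γ u) ∂volI))
        + κ * ∫ u, rbar γ α β u * (φ u * V₁ γ u) ∂volI := fun r => by ring
  simp only [e3]
  rw [intervalIntegral.integral_add (i1.sub i2) intervalIntegrable_const,
    intervalIntegral.integral_const_mul]
  linarith

/-! ### Comparison of weak solutions -/

/-- A continuous function that is almost everywhere at most `c` is at most `c`. -/
lemma le_on_Icc_of_ae_le {F : ℝ → ℝ} {a b c : ℝ} (hab : a < b) (hF : Continuous F)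
    (h : ∀ᵐ t, t ∈ Ioo a b → F t ≤ c) : ∀ t ∈ Icc a b, F t ≤ c := by
  have h1 : (fun t => max (F t) c) =ᵐ[volume.restrict (Icc a b)] fun _ => c := by
    rw [← Measure.restrict_congr_set Ioo_ae_eq_Icc]
    filter_upwards [ae_restrict_of_ae h, ae_restrict_mem measurableSet_Ioo] with t ht ht'
    exact max_eq_right (ht ht')
  have h2 := Measure.eqOn_Icc_of_ae_eq volume hab.ne h1
    (hF.max continuous_const).continuousOn continuousOn_const
  intro t ht
  have := h2 ht
  simp only at this
  rw [← this]
  exact le_max_left _ _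

lemma measurable_const_uncurry {f : ℝ → ℝ} (hf : Measurable f) :
    Measurable (Function.uncurry fun _ : ℝ => f) := hf.comp measurable_snd

namespace IsBumpSolution

variable {γ α β T κ κ' : ℝ} {g : ℝ → ℝ} {ρ ρ' r r' : ℝ → ℝ → ℝ}

lemma version_Ioo (H : IsBumpSolution γ α β T κ g ρ ρ') :
    ∀ᵐ t, t ∈ Ioo 0 T → ρ t =ᵐ[volI] ρ' t := by
  filter_upwards [(ae_restrict_iff' measurableSet_Icc).1 H.version] with t ht ht'
  exact ht (Ioo_subset_Icc_self ht')

lemma abs_le_one (H : IsBumpSolution γ α β T κ g ρ ρ') (t u : ℝ) : |ρ' t u| ≤ 1 :=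
  abs_le_one_of_mem_Icc (H.mem_Icc t u)

lemma measurable_sub_rbar (H : IsBumpSolution γ α β T κ g ρ ρ') :
    Measurable (Function.uncurry fun t u => ρ' t u - rbar γ α β u) :=
  H.meas.sub ((measurable_rbar γ α β).comp measurable_snd)

/-- The difference of the right hand sides of two equations. -/
lemma integral_sub_eq (hγ : 1 < γ) (hγ' : γ < 2)
    (hα : 0 ≤ α) (hα' : α ≤ 1) (hβ : 0 ≤ β) (hβ' : β ≤ 1)
    (H : IsBumpSolution γ α β T κ g ρ ρ') (H' : IsBumpSolution γ α β T κ' g r r') {t : ℝ}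
    (ht : t ∈ Icc 0 T) {φ : ℝ → ℝ} (hφ : IsBump φ) :
    ∫ u, (ρ t u - r t u) * φ u ∂volI
      = ∫ s in (0 : ℝ)..t, ((∫ u, (ρ' s u - r' s u) * regLap γ φ u ∂volI)
        - κ * (∫ u, (ρ' s u - r' s u) * (φ u * V₁ γ u) ∂volI)
        - (κ - κ') * ∫ u, (r' s u - rbar γ α β u) * (φ u * V₁ γ u) ∂volI) := by
  have hγ0 : 0 < γ := by linarith
  obtain ⟨B₁, hB₁⟩ := hφ.exists_regLap_bound hγ0 hγ'
  obtain ⟨B₂, hB₂⟩ := hφ.exists_bound_mul_V₁ hγ0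
  obtain ⟨B₃, hB₃⟩ := hφ.exists_bound
  have hm1 := hφ.measurable_regLap hγ0 hγ'
  have hm2 := hφ.measurable_mul_V₁ γ
  have hbr : ∀ u, rbar γ α β u ∈ Icc (0 : ℝ) 1 := rbar_mem_Icc hγ0 hα hα' hβ hβ'
  have hb1 : ∀ t u, |ρ' t u - rbar γ α β u| ≤ 1 := fun t u =>
    abs_sub_le_one_of_mem_Icc (H.mem_Icc t u) (hbr u)
  have hb2 : ∀ t u, |r' t u - rbar γ α β u| ≤ 1 := fun t u =>
    abs_sub_le_one_of_mem_Icc (H'.mem_Icc t u) (hbr u)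
  have hsl : ∀ {f : ℝ → ℝ → ℝ}, IsProfile T f → Integrable (fun u => f t u * φ u) volI := by
    intro f hf
    refine Integrable.of_bound ((hf.aemeasurable_slice t ht).mul
      hφ.measurable.aemeasurable).aestronglyMeasurable B₃ ?_
    filter_upwards [ae_mem_volI] with u hu
    rw [Real.norm_eq_abs, abs_mul]
    calc _ ≤ 1 * B₃ := mul_le_mul (abs_le_one_of_mem_Icc (hf.mem_Icc t ht u
            (Ioo_subset_Icc_self hu))) (hB₃ u) (abs_nonneg _) zero_le_one
      _ = B₃ := one_mul _
  simp only [sub_mul (ρ t _)]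
  rw [integral_sub (hsl H.profile) (hsl H'.profile), H.weak t ht φ hφ, H'.weak t ht φ hφ,
    add_sub_add_left_eq_sub, ← intervalIntegral.integral_sub]
  · refine intervalIntegral.integral_congr fun s _ => ?_
    have j1 := integrable_mul_of_bounded (measurable_slice H.meas s) (H.abs_le_one s) hm1 hB₁
    have j2 := integrable_mul_of_bounded (measurable_slice H'.meas s) (H'.abs_le_one s) hm1 hB₁
    have j3 := integrable_mul_of_bounded (measurable_slice H.measurable_sub_rbar s) (hb1 s) hm2 hB₂
    have j4 := integrable_mul_of_bounded (measurable_slice H'.measurable_sub_rbar s) (hb2 s) hm2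
      hB₂
    have e1 : ∫ u, (ρ' s u - r' s u) * regLap γ φ u ∂volI
        = (∫ u, ρ' s u * regLap γ φ u ∂volI) - ∫ u, r' s u * regLap γ φ u ∂volI := by
      simp only [sub_mul]; exact integral_sub j1 j2
    have e2 : ∫ u, (ρ' s u - r' s u) * (φ u * V₁ γ u) ∂volI
        = (∫ u, (ρ' s u - rbar γ α β u) * (φ u * V₁ γ u) ∂volI)
          - ∫ u, (r' s u - rbar γ α β u) * (φ u * V₁ γ u) ∂volI := by
      rw [← integral_sub j3 j4]
      refine integral_congr_ae (ae_of_all _ fun u => ?_)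
      simp only; ring
    rw [e1, e2]; ring
  · exact (intervalIntegrable_pairing H.meas H.abs_le_one hm1 hB₁ 0 t).sub
      ((intervalIntegrable_pairing H.measurable_sub_rbar hb1 hm2 hB₂ 0 t).const_mul κ)
  · exact (intervalIntegrable_pairing H'.meas H'.abs_le_one hm1 hB₁ 0 t).sub
      ((intervalIntegrable_pairing H'.measurable_sub_rbar hb2 hm2 hB₂ 0 t).const_mul κ')

/-- The reaction terms differ by κ(ρ - ρ̄) - κ'(r - ρ̄) = κ(ρ - r) + (κ - κ')(r - ρ̄). The first
part is dissipative, and the second is the source with δ = κ - κ' and z = r - ρ̄. The common initial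
datum cancels. -/
lemma isEvolution_sub (hγ : 1 < γ) (hγ' : γ < 2)
    (hα : 0 ≤ α) (hα' : α ≤ 1) (hβ : 0 ≤ β) (hβ' : β ≤ 1)
    (H : IsBumpSolution γ α β T κ g ρ ρ') (H' : IsBumpSolution γ α β T κ' g r r') :
    IsEvolution γ κ (κ - κ') 0 T 1 (fun t u => ρ' t u - r' t u) (fun _ _ => 0)
      (fun t u => r' t u - rbar γ α β u) fun _ => 0 := by
  have hγ0 : 0 < γ := by linarith
  refine ⟨H.meas.sub H'.meas, measurable_const, H'.measurable_sub_rbar,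
    fun t u => abs_sub_le_one_of_mem_Icc (H.mem_Icc t u) (H'.mem_Icc t u), fun _ _ => by simp,
    fun t u => abs_sub_le_one_of_mem_Icc (H'.mem_Icc t u) (rbar_mem_Icc hγ0 hα hα' hβ hβ' u),
    ?_, ?_, ?_, H'.pot, ?_⟩
  · refine lt_of_le_of_lt (lintegral_mono fun t => sqInt_gap_sub_le γ (measurable_slice H.meas t))
      ?_
    rw [lintegral_add_left ((measurable_sqInt (measurable_gap_uncurry H.meas)).const_mul 2),
      lintegral_const_mul' _ _ (by simp), lintegral_const_mul' _ _ (by simp)]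
    exact ENNReal.add_lt_top.2 ⟨ENNReal.mul_lt_top (by simp) H.energy,
      ENNReal.mul_lt_top (by simp) H'.energy⟩
  · have : ∀ t, sqInt (potMeas γ) (fun u => ρ' t u - r' t u)
        ≤ 2 * sqInt (potMeas γ) (fun u => ρ' t u - rbar γ α β u)
          + 2 * sqInt (potMeas γ) (fun u => r' t u - rbar γ α β u) := fun t => by
      have := sqInt_sub_le (ν := potMeas γ) (f := fun u => ρ' t u - rbar γ α β u)
        (g := fun u => r' t u - rbar γ α β u) (measurable_slice H.measurable_sub_rbar t).aemeasurable
      simpa only [sub_sub_sub_cancel_right] using this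
    refine lt_of_le_of_lt (lintegral_mono this) ?_
    rw [lintegral_add_left ((measurable_sqInt H.measurable_sub_rbar).const_mul 2),
      lintegral_const_mul' _ _ (by simp), lintegral_const_mul' _ _ (by simp)]
    exact ENNReal.add_lt_top.2 ⟨ENNReal.mul_lt_top (by simp) H.pot,
      ENNReal.mul_lt_top (by simp) H'.pot⟩
  · simp [gap_zero, sqInt_zero]
  · filter_upwards [H.version_Ioo, H'.version_Ioo] with t h1 h2 ht φ hφ
    have h3 := integral_sub_eq hγ hγ' hα hα' hβ hβ' H H' (Ioo_subset_Icc_self ht) hφ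
    simp only [add_zero, zero_add]
    rw [← h3]
    refine integral_congr_ae ?_
    filter_upwards [h1 ht, h2 ht] with u hu hu'
    rw [hu, hu']

/-- Two weak solutions with the same initial datum are close when their parameters are. -/
theorem compare (hγ : 1 < γ) (hγ' : γ < 2)
    (hα : 0 ≤ α) (hα' : α ≤ 1) (hβ : 0 ≤ β) (hβ' : β ≤ 1) (hT : 0 < T) (hκ : 0 ≤ κ) {C : ℝ}
    (hC0 : 0 < C) (hC : ∀ v : ℝ → ℝ, Measurable v → sqInt (potMeas γ) v < ⊤ →
      sqInt (potMeas γ) v ≤ ENNReal.ofReal C * sqInt (kerMeas γ) (gap v))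
    (H : IsBumpSolution γ α β T κ g ρ ρ') (H' : IsBumpSolution γ α β T κ' g r r') {K : ℝ≥0∞}
    (hK : ENNReal.ofReal ((κ - κ') ^ 2 * C)
      * ∫⁻ t in Ioo 0 T, sqInt (potMeas γ) (fun u => r' t u - rbar γ α β u) ≤ K) (hKt : K < ⊤) :
    ∫⁻ t in Ioo 0 T, sqInt (kerMeas γ) (gap fun u => ρ' t u - r' t u) ≤ 2 * K ∧
      ∀ t ∈ Icc 0 T, sqInt volI (fun u => ρ t u - r t u) ≤ 2 * K := by
  have hγ0 : 0 < γ := by linarith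
  obtain ⟨h1, h2, -⟩ := (isEvolution_sub hγ hγ' hα hα' hβ hβ' H H').energy_of_zero hγ hγ' hκ hC0 hC
    hT (K := K) (by simpa [gap_zero, sqInt_zero] using hK)
  refine ⟨h2, fun t ht => ?_⟩
  have h2K : 2 * K < ⊤ := ENNReal.mul_lt_top (by simp) hKt
  rw [← ENNReal.ofReal_toReal h2K.ne]
  have hmd : ∀ s ∈ Icc 0 T, AEMeasurable (fun u => ρ s u - r s u) volI := fun s hs =>
    (H.profile.aemeasurable_slice s hs).sub (H'.profile.aemeasurable_slice s hs)
  have hfin : ∀ s ∈ Icc 0 T, sqInt volI (fun u => ρ s u - r s u) < ⊤ := fun s hs => by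
    refine (sqInt_volI_le_of_abs_le (M := 1) ?_).trans_lt ENNReal.ofReal_lt_top
    filter_upwards [ae_mem_volI] with u hu
    exact abs_sub_le_one_of_mem_Icc (H.profile.mem_Icc s hs u (Ioo_subset_Icc_self hu))
      (H'.profile.mem_Icc s hs u (Ioo_subset_Icc_self hu))
  -- The energy inequality bounds the L² norm at almost every time. By the weak formulation the
  -- pairing with a fixed test function equals, at every time of [0, T], a continuous function of t;
  -- so its bound extends to all times, and duality recovers the norm.
  refine sqInt_le_of_forall_bump (hmd t ht) (hfin t ht) fun φ hφ => ?_
  obtain ⟨B₁, hB₁⟩ := hφ.exists_regLap_bound hγ0 hγ'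
  obtain ⟨B₂, hB₂⟩ := hφ.exists_bound_mul_V₁ hγ0
  obtain ⟨B₃, hB₃⟩ := hφ.exists_bound
  have hm1 := hφ.measurable_regLap hγ0 hγ'
  have hm2 := hφ.measurable_mul_V₁ γ
  have hφfin : sqInt volI φ < ⊤ :=
    (sqInt_volI_le_of_abs_le (ae_of_all _ hB₃)).trans_lt ENNReal.ofReal_lt_top
  have hb : ∀ t u, |ρ' t u - r' t u| ≤ 1 := fun t u =>
    abs_sub_le_one_of_mem_Icc (H.mem_Icc t u) (H'.mem_Icc t u)
  have hb2 : ∀ t u, |r' t u - rbar γ α β u| ≤ 1 := fun t u =>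
    abs_sub_le_one_of_mem_Icc (H'.mem_Icc t u) (rbar_mem_Icc hγ0 hα hα' hβ hβ' u)
  have hmw : Measurable (Function.uncurry fun t u => ρ' t u - r' t u) := H.meas.sub H'.meas
  have hcont := intervalIntegral.continuous_primitive (μ := volume)
    (fun x y => ((intervalIntegrable_pairing hmw hb hm1 hB₁ x y).sub
      ((intervalIntegrable_pairing hmw hb hm2 hB₂ x y).const_mul κ)).sub
      ((intervalIntegrable_pairing H'.measurable_sub_rbar hb2 hm2 hB₂ x y).const_mul (κ - κ'))) 0
  rw [integral_sub_eq hγ hγ' hα hα' hβ hβ' H H' ht hφ]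
  refine le_on_Icc_of_ae_le hT hcont ?_ t ht
  filter_upwards [h1, H.version_Ioo, H'.version_Ioo] with s hs hv hv' hsT
  have hsT' := Ioo_subset_Icc_self hsT
  have e := integral_sub_eq hγ hγ' hα hα' hβ hβ' H H' hsT' hφ
  have hle : sqInt volI (fun u => ρ s u - r s u) ≤ 2 * K := by
    refine le_trans (le_of_eq (sqInt_congr_ae ?_)) (hs hsT)
    filter_upwards [hv hsT, hv' hsT] with u hu hu'
    rw [hu, hu']
  have h3 := abs_integral_mul_le (hmd s hsT') hφ.measurable.aemeasurable (hfin s hsT') hφfin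
    one_pos
  have h4 := ENNReal.toReal_mono h2K.ne hle
  have h5 := (le_abs_self _).trans h3
  refine e.symm.le.trans (h5.trans ?_)
  rw [one_div, mul_one, one_div]
  linarith

/-- The a priori estimate, uniform in the parameter. -/
theorem a_priori (hγ : 1 < γ) (hγ' : γ < 2)
    (hα : 0 ≤ α) (hα' : α ≤ 1) (hβ : 0 ≤ β) (hβ' : β ≤ 1) (hT : 0 < T) (hκ : 0 ≤ κ) {C : ℝ}
    (hC0 : 0 < C) (hC : ∀ v : ℝ → ℝ, Measurable v → sqInt (potMeas γ) v < ⊤ →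
      sqInt (potMeas γ) v ≤ ENNReal.ofReal C * sqInt (kerMeas γ) (gap v))
    (H : IsBumpSolution γ α β T κ g ρ ρ') {K : ℝ≥0∞} (hK : 2 * (ENNReal.ofReal 2⁻¹
        + ENNReal.ofReal T * sqInt (kerMeas γ) (gap (rbar γ α β))) = K) :
    ∫⁻ t in Ioo 0 T, sqInt (kerMeas γ) (gap fun u => ρ' t u - rbar γ α β u) ≤ K ∧
    ∫⁻ t in Ioo 0 T, sqInt (potMeas γ) (fun u => ρ' t u - rbar γ α β u)
      ≤ ENNReal.ofReal C * K := by
  have hγ0 : 0 < γ := by linarith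
  have hEr := sqInt_gap_rbar_lt_top (α := α) (β := β) hγ hγ'
  have hmr := measurable_const_uncurry (measurable_rbar γ α β)
  have hbr : ∀ u, rbar γ α β u ∈ Icc (0 : ℝ) 1 := rbar_mem_Icc hγ0 hα hα' hβ hβ'
  have hb1 : ∀ t u, |ρ' t u - rbar γ α β u| ≤ 1 := fun t u =>
    abs_sub_le_one_of_mem_Icc (H.mem_Icc t u) (hbr u)
  have hlr : ∫⁻ _t in Ioo 0 T, sqInt (kerMeas γ) (gap (rbar γ α β))
      = ENNReal.ofReal T * sqInt (kerMeas γ) (gap (rbar γ α β)) := by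
    rw [setLIntegral_const, Real.volume_Ioo, sub_zero, mul_comm]
  -- The profile ρ̄ annihilates the reaction term but not 𝕃, so ρ - ρ̄ solves the equation with σ =
  -- ρ̄ and no second source.
  have hev : IsEvolution γ κ 0 0 T 1 (fun t u => ρ' t u - rbar γ α β u) (fun _ => rbar γ α β)
      (fun _ _ => 0) fun φ => (∫ u, g u * φ u ∂volI) - ∫ u, rbar γ α β u * φ u ∂volI := by
    refine ⟨H.measurable_sub_rbar, hmr, measurable_const, hb1,
      fun t u => abs_le_one_of_mem_Icc (hbr u), fun _ _ => by simp, ?_, H.pot, ?_, ?_, ?_⟩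
    · refine lt_of_le_of_lt (lintegral_mono fun t =>
        sqInt_gap_sub_le γ (measurable_slice H.meas t)) ?_
      rw [lintegral_add_right _ measurable_const, lintegral_const_mul' _ _ (by simp),
        lintegral_const_mul' _ _ (by simp), hlr]
      exact ENNReal.add_lt_top.2 ⟨ENNReal.mul_lt_top (by simp) H.energy,
        ENNReal.mul_lt_top (by simp) (ENNReal.mul_lt_top ENNReal.ofReal_lt_top hEr)⟩
    · rw [hlr]; exact ENNReal.mul_lt_top ENNReal.ofReal_lt_top hEr
    · simp [sqInt_zero]
    · filter_upwards [H.version_Ioo] with t h1 ht φ hφ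
      obtain ⟨B₃, hB₃⟩ := hφ.exists_bound
      have e1 := H.weak t (Ioo_subset_Icc_self ht) φ hφ
      have e2 : ∫ u, ρ t u * φ u ∂volI = ∫ u, ρ' t u * φ u ∂volI := by
        refine integral_congr_ae ?_
        filter_upwards [h1 ht] with u hu
        rw [hu]
      simp only [sub_add_cancel, zero_mul, sub_zero]
      simp only [sub_mul (ρ' t _)]
      rw [integral_sub (integrable_mul_of_bounded (measurable_slice H.meas t) (H.abs_le_one t)
          hφ.measurable hB₃) (integrable_mul_of_bounded (measurable_rbar γ α β)
          (fun u => abs_le_one_of_mem_Icc (hbr u)) hφ.measurable hB₃), ← e2, e1]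
      ring
  -- The initial bound A = 1 holds because both profiles take values in [0,1]; no regularity of the
  -- initial datum is used.
  obtain ⟨-, h2, -⟩ := hev.energy hγ hγ' hκ hC0 hC hT one_pos (A := 1) (fun t _ => by
    have := sqInt_volI_le_of_abs_le (M := 1) (ae_of_all _ (hb1 t))
    simpa using this) (K := ENNReal.ofReal 2⁻¹
        + ENNReal.ofReal T * sqInt (kerMeas γ) (gap (rbar γ α β))) (by
      rw [hlr]; simp)
  rw [hK] at h2
  -- Hardy requires each slice to lie in L²(V₁), which holds for almost every t. Applied to the
  -- energy bound it yields an estimate of P uniform in κ, whereas the bound on κ ∫ P degenerates as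
  -- κ → 0.
  have hfin : ∀ᵐ t ∂(volume.restrict (Ioo 0 T)),
      sqInt (potMeas γ) (fun u => ρ' t u - rbar γ α β u) < ⊤ :=
    ae_lt_top (measurable_sqInt H.measurable_sub_rbar) H.pot.ne
  refine ⟨h2, (lintegral_mono_ae (hfin.mono fun t ht =>
    hC _ (measurable_slice H.measurable_sub_rbar t) ht)).trans ?_⟩
  rw [lintegral_const_mul' _ _ ENNReal.ofReal_ne_top]
  exact mul_le_mul_right h2 _

end IsBumpSolution

/-! ### Test functions -/

lemma clamp_mem {T : ℝ} (hT : 0 ≤ T) (t : ℝ) : max 0 (min t T) ∈ Icc (0 : ℝ) T :=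
  ⟨le_max_left _ _, max_le hT (min_le_right _ _)⟩

lemma clamp_of_mem {T t : ℝ} (ht : t ∈ Icc (0 : ℝ) T) : max 0 (min t T) = t := by
  rw [min_eq_left ht.2, max_eq_right ht.1]

/-- Test functions are controlled on [0, T] only. Clamping the time gives a function continuous on
the plane, hence Borel, that is unchanged on [0, T]. -/
lemma continuous_clamp_comp {T : ℝ} (hT : 0 ≤ T) {F : ℝ × ℝ → ℝ}
    (hF : ContinuousOn F (Icc (0 : ℝ) T ×ˢ univ)) :
    Continuous fun p : ℝ × ℝ => F (max 0 (min p.1 T), p.2) :=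
  hF.comp_continuous (f := fun p : ℝ × ℝ => (max 0 (min p.1 T), p.2)) (by fun_prop)
    fun p => ⟨clamp_mem hT p.1, mem_univ _⟩

lemma exists_bound_of_continuousOn {T : ℝ} {F : ℝ × ℝ → ℝ}
    (hF : ContinuousOn F (Icc (0 : ℝ) T ×ˢ univ)) {a b : ℝ}
    (hs : ∀ t ∈ Icc (0 : ℝ) T, ∀ u, u ∉ Icc a b → F (t, u) = 0) :
    ∃ B : ℝ, ∀ t ∈ Icc (0 : ℝ) T, ∀ u, |F (t, u)| ≤ B := by
  obtain ⟨B, hB⟩ := (isCompact_Icc.prod isCompact_Icc).exists_bound_of_continuousOn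
    (hF.mono (show Icc (0 : ℝ) T ×ˢ Icc a b ⊆ Icc (0 : ℝ) T ×ˢ univ from
      Set.prod_mono le_rfl (subset_univ _)))
  refine ⟨max B 0, fun t ht u => ?_⟩
  by_cases hu : u ∈ Icc a b
  · exact (hB (t, u) ⟨ht, hu⟩).trans (le_max_left _ _)
  · rw [hs t ht u hu, abs_zero]; exact le_max_right _ _

namespace IsTestFunction

variable {T : ℝ} {G : ℝ → ℝ → ℝ}

lemma continuousOn (hG : IsTestFunction T G) :
    ContinuousOn (fun p : ℝ × ℝ => G p.1 p.2) (Icc (0 : ℝ) T ×ˢ univ) := by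
  simpa using hG.continuous_space 0

lemma isBump (hG : IsTestFunction T G) {t : ℝ} (ht : t ∈ Icc (0 : ℝ) T) : IsBump (G t) := by
  obtain ⟨a, b, ha, hb, hs⟩ := hG.compact_support
  exact ⟨hG.smooth_space t ht, a, b, ha, hb, hs t ht⟩

lemma exists_bound (hG : IsTestFunction T G) :
    ∃ B : ℝ, ∀ t ∈ Icc (0 : ℝ) T, ∀ u, |G t u| ≤ B := by
  obtain ⟨a, b, ha, hb, hs⟩ := hG.compact_support
  exact exists_bound_of_continuousOn hG.continuousOn hs

lemma timeDeriv_eq_zero {a b : ℝ} (hs : ∀ t ∈ Icc (0 : ℝ) T, ∀ u, u ∉ Icc a b → G t u = 0) {t : ℝ}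
    (ht : t ∈ Icc (0 : ℝ) T) {u : ℝ} (hu : u ∉ Icc a b) : timeDeriv T G t u = 0 := by
  rw [timeDeriv, derivWithin_congr (f := fun _ => 0) (fun s hs' => hs s hs' u hu) (hs t ht u hu)]
  simp

lemma exists_bound_timeDeriv (hG : IsTestFunction T G) :
    ∃ B : ℝ, ∀ t ∈ Icc (0 : ℝ) T, ∀ u, |timeDeriv T G t u| ≤ B := by
  obtain ⟨a, b, ha, hb, hs⟩ := hG.compact_support
  exact exists_bound_of_continuousOn hG.continuous_time fun t ht u hu => timeDeriv_eq_zero hs ht hu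

lemma exists_bound_mul_V₁ {γ : ℝ} (hγ : 0 < γ) (hG : IsTestFunction T G) :
    ∃ B : ℝ, ∀ t ∈ Icc (0 : ℝ) T, ∀ u, |G t u * V₁ γ u| ≤ B := by
  obtain ⟨a, b, ha, hb, hs⟩ := hG.compact_support
  obtain ⟨C, hC⟩ := hG.exists_bound
  obtain ⟨B, hB0, hB⟩ := V₁_le_of_mem_Icc hγ ha hb
  refine ⟨|C| * B, fun t ht u => ?_⟩
  by_cases hu : u ∈ Icc a b
  · rw [abs_mul, abs_of_pos (hB u hu).1]
    exact mul_le_mul ((hC t ht u).trans (le_abs_self _)) (hB u hu).2 (hB u hu).1.le (abs_nonneg _)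
  · rw [hs t ht u hu, zero_mul, abs_zero]; positivity

lemma exists_measurable (hT : 0 ≤ T) (hG : IsTestFunction T G) :
    ∃ F : ℝ × ℝ → ℝ, Measurable F ∧ ∀ t ∈ Icc (0 : ℝ) T, ∀ u, G t u = F (t, u) :=
  ⟨_, (continuous_clamp_comp hT hG.continuousOn).measurable, fun t ht u => by
    simp only [clamp_of_mem ht]⟩

lemma exists_measurable_timeDeriv (hT : 0 ≤ T) (hG : IsTestFunction T G) :
    ∃ F : ℝ × ℝ → ℝ, Measurable F ∧ ∀ t ∈ Icc (0 : ℝ) T, ∀ u, timeDeriv T G t u = F (t, u) :=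
  ⟨_, (continuous_clamp_comp hT hG.continuous_time).measurable, fun t ht u => by
    simp only [clamp_of_mem ht]⟩

/-- All slices share one support and one Taylor constant, so the uniform bound on 𝕃 applies, and 𝕃G
is a pointwise limit of jointly measurable truncations. -/
lemma exists_regLap {γ : ℝ} (hγ : 0 < γ) (hγ' : γ < 2) (hT : 0 ≤ T) (hG : IsTestFunction T G) :
    (∃ F : ℝ × ℝ → ℝ, Measurable F ∧ ∀ t ∈ Icc (0 : ℝ) T, ∀ u, regLap γ (G t) u = F (t, u)) ∧
      ∃ B : ℝ, ∀ t ∈ Icc (0 : ℝ) T, ∀ u, |regLap γ (G t) u| ≤ B := by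
  obtain ⟨a, b, ha, hb, hs⟩ := hG.compact_support
  obtain ⟨C₀, hC₀⟩ := hG.exists_bound
  obtain ⟨C₂, hC₂⟩ := exists_bound_of_continuousOn (hG.continuous_space 2)
    fun t ht u hu => iteratedDeriv_eq_zero_of_notMem (hs t ht) 2 hu
  have htb : ∀ t ∈ Icc (0 : ℝ) T, HasTaylorBound a b (max C₀ C₂) (G t) := fun t ht =>
    hasTaylorBound_of_smooth (hG.smooth_space t ht) (hs t ht)
      (fun u => (hC₀ t ht u).trans (le_max_left _ _))
      (fun u => (hC₂ t ht u).trans (le_max_right _ _))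
  obtain ⟨B, δ, -, h⟩ := exists_regLap_bound hγ hγ' ha hb (max C₀ C₂)
  refine ⟨⟨fun p => regLap γ (G (max 0 (min p.1 T))) p.2, ?_, fun t ht u => by
    simp only [clamp_of_mem ht]⟩, B, fun t ht u => (h _ (htb t ht) u).1⟩
  refine measurable_of_tendsto_metrizable (f := fun n : ℕ => fun p : ℝ × ℝ =>
    cGamma γ * truncLap γ (G (max 0 (min p.1 T))) (δ / ((n : ℝ) + 1)) p.2) (fun n => ?_) ?_
  · exact (measurable_truncLap γ (g := fun t => G (max 0 (min t T)))
      (continuous_clamp_comp hT hG.continuousOn).measurable _).const_mul _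
  · exact tendsto_pi_nhds.2 fun p => (h _ (htb _ (clamp_mem hT p.1)) p.2).2.2

end IsTestFunction

/-! ### Limits of weak solutions -/

lemma limsup_mem_Icc {x : ℕ → ℝ} (hx : ∀ n, x n ∈ Icc (0 : ℝ) 1) :
    limsup x atTop ∈ Icc (0 : ℝ) 1 := by
  have hb : IsBoundedUnder (· ≤ ·) atTop x := isBoundedUnder_of ⟨1, fun n => (hx n).2⟩
  have hb' : IsBoundedUnder (· ≥ ·) atTop x := isBoundedUnder_of ⟨0, fun n => (hx n).1⟩
  exact ⟨le_limsup_of_frequently_le (Frequently.of_forall fun n => (hx n).1) hb,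
    limsup_le_of_le hb'.isCoboundedUnder_le (Eventually.of_forall fun n => (hx n).2)⟩

lemma aemeasurable_limsup {S : Type*} [MeasurableSpace S] {μ : Measure S} {f : ℕ → S → ℝ}
    (hf : ∀ n, AEMeasurable (f n) μ) : AEMeasurable (fun x => limsup (fun n => f n x) atTop) μ := by
  refine ⟨fun x => limsup (fun n => (hf n).mk (f n) x) atTop,
    Measurable.limsup fun n => (hf n).measurable_mk, ?_⟩
  filter_upwards [ae_all_iff.2 fun n => (hf n).ae_eq_mk] with x hx
  simp only [hx]

/-- Geometric convergence in mean square implies convergence almost everywhere. -/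
lemma ae_tendsto_limsup {f : ℕ → ℝ → ℝ} (hf : ∀ n, AEMeasurable (f n) volI) {B : ℝ≥0∞}
    (hB : B < ⊤) (hd : ∀ n, sqInt volI (fun u => f n u - f (n + 1) u)
      ≤ ENNReal.ofReal ((1 / 4 : ℝ) ^ n) * B) :
    ∀ᵐ u ∂volI, Tendsto (fun n => f n u) atTop (𝓝 (limsup (fun n => f n u) atTop)) := by
  have hm : ∀ n, AEMeasurable (fun u => edist (f n u) (f (n + 1) u)) volI := fun n =>
    (hf n).edist (hf (n + 1))
  -- From |d| ≤ 2^{-n} + 2ⁿ d², the rate 4^{-n} in mean square becomes the summable rate 2^{-n} in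
  -- L¹.
  have h1 : ∀ n, ∫⁻ u, edist (f n u) (f (n + 1) u) ∂volI
      ≤ ENNReal.ofReal ((1 / 2 : ℝ) ^ n) * (1 + B) := fun n => by
    calc _ ≤ ∫⁻ u, (ENNReal.ofReal ((1 / 2 : ℝ) ^ n) + ENNReal.ofReal ((2 : ℝ) ^ n)
            * ENNReal.ofReal ((f n u - f (n + 1) u) ^ 2)) ∂volI := by
          refine lintegral_mono fun u => ?_
          rw [edist_dist, Real.dist_eq, ← ENNReal.ofReal_mul (by positivity),
            ← ENNReal.ofReal_add (by positivity) (by positivity)]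
          refine ENNReal.ofReal_le_ofReal ?_
          set d := f n u - f (n + 1) u
          have h2 : (2 : ℝ) ^ n * (1 / 2) ^ n = 1 := by
            rw [← mul_pow]; norm_num
          have h3 : (0 : ℝ) < 2 ^ n := by positivity
          have h4 : (0 : ℝ) < (1 / 2) ^ n := by positivity
          have h5 : 0 ≤ 2 ^ n * (|d| - (1 / 2) ^ n) ^ 2 := by positivity
          have h6 : (2 : ℝ) ^ n * (|d| - (1 / 2) ^ n) ^ 2
              = 2 ^ n * d ^ 2 - 2 * (2 ^ n * (1 / 2) ^ n) * |d|
                + (2 ^ n * (1 / 2) ^ n) * (1 / 2) ^ n := by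
            rw [← sq_abs d]; ring
          rw [h2] at h6
          have h7 := abs_nonneg d
          linarith
      _ ≤ ENNReal.ofReal ((1 / 2 : ℝ) ^ n) + ENNReal.ofReal ((2 : ℝ) ^ n)
            * (ENNReal.ofReal ((1 / 4 : ℝ) ^ n) * B) := by
          rw [lintegral_add_left measurable_const, lintegral_const_mul' _ _ ENNReal.ofReal_ne_top]
          refine add_le_add (by simp) (mul_le_mul_right (hd n) _)
      _ = _ := by
          rw [← mul_assoc, ← ENNReal.ofReal_mul (by positivity), ← mul_pow, mul_add, mul_one]
          norm_num
  have h2 : ∫⁻ u, ∑' n, edist (f n u) (f (n + 1) u) ∂volI < ⊤ := by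
    rw [lintegral_tsum hm]
    refine lt_of_le_of_lt (ENNReal.tsum_le_tsum h1) ?_
    rw [ENNReal.tsum_mul_right, ← ENNReal.ofReal_tsum_of_nonneg (fun n => by positivity)
      (summable_geometric_of_lt_one (by norm_num) (by norm_num))]
    exact ENNReal.mul_lt_top ENNReal.ofReal_lt_top (ENNReal.add_lt_top.2 ⟨by simp, hB⟩)
  filter_upwards [ae_lt_top' (AEMeasurable.tsum hm) h2.ne] with u hu
  have hc : CauchySeq fun n => f n u :=
    cauchySeq_of_edist_le_of_tsum_ne_top _ (fun n => le_rfl) hu.ne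
  obtain ⟨l, hl⟩ := cauchySeq_tendsto_of_complete hc
  rwa [hl.limsup_eq]

/-- Passage to the limit in the weak formulation as the parameter vanishes. -/
lemma weak_form_zero_of_tendsto {γ α β T : ℝ} (hγ : 0 < γ) (hγ' : γ < 2) (hT : 0 ≤ T)
    {g : ℝ → ℝ} {κ : ℕ → ℝ} (hκ0 : ∀ n, κ n ∈ Icc (0 : ℝ) 1) (hκ : Tendsto κ atTop (𝓝 0))
    {f : ℕ → ℝ → ℝ → ℝ} {r : ℝ → ℝ → ℝ} (hf : ∀ n, IsWeakSolution γ α β T (κ n) g (f n))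
    (hlim : ∀ t ∈ Icc (0 : ℝ) T, ∀ᵐ u ∂volI, Tendsto (fun n => f n t u) atTop (𝓝 (r t u)))
    {t : ℝ} (ht : t ∈ Icc (0 : ℝ) T) {G : ℝ → ℝ → ℝ} (hG : IsTestFunction T G) :
    (∫ u in Ioo (0 : ℝ) 1, r t u * G t u) - (∫ u in Ioo (0 : ℝ) 1, g u * G 0 u)
      - (∫ s in (0 : ℝ)..t, ∫ u in Ioo (0 : ℝ) 1,
          r s u * (timeDeriv T G s u + regLapKappa γ 0 (G s) u))
      - 0 * (∫ s in (0 : ℝ)..t, ∫ u in Ioo (0 : ℝ) 1, G s u * V₀ γ α β u) = 0 := by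
  obtain ⟨B₀, hB₀⟩ := hG.exists_bound
  obtain ⟨B₁, hB₁⟩ := hG.exists_bound_timeDeriv
  obtain ⟨B₂, hB₂⟩ := hG.exists_bound_mul_V₁ hγ
  obtain ⟨⟨L, hL, hLG⟩, B₃, hB₃⟩ := hG.exists_regLap hγ hγ' hT
  obtain ⟨D, hD, hDG⟩ := hG.exists_measurable_timeDeriv hT
  obtain ⟨F, hF, hFG⟩ := hG.exists_measurable hT
  have hf1 : ∀ n, ∀ s ∈ Icc (0 : ℝ) T, ∀ u ∈ Ioo (0 : ℝ) 1, |f n s u| ≤ 1 := fun n s hs u hu =>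
    abs_le_one_of_mem_Icc ((hf n).profile.mem_Icc s hs u (Ioo_subset_Icc_self hu))
  have hsub : Ioc 0 t ⊆ Icc 0 T := fun s hs => ⟨hs.1.le, hs.2.trans ht.2⟩
  have l1 : Tendsto (fun n => ∫ u in Ioo (0 : ℝ) 1, f n t u * G t u) atTop
      (𝓝 (∫ u in Ioo (0 : ℝ) 1, r t u * G t u)) := by
    refine tendsto_integral_of_dominated_convergence (fun _ => 1 * B₀) (fun n => ?_)
      (integrable_const _) (fun n => ?_) ?_
    · exact (((hf n).profile.aemeasurable_slice t ht).mul
        (hG.isBump ht).measurable.aemeasurable).aestronglyMeasurable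
    · filter_upwards [ae_mem_volI] with u hu
      rw [Real.norm_eq_abs, abs_mul]
      exact mul_le_mul (hf1 n t ht u hu) (hB₀ t ht u) (abs_nonneg _) zero_le_one
    · filter_upwards [hlim t ht] with u hu using hu.mul_const _
  -- One constant dominates all integrands because κ_n ≤ 1 and the test function, 𝕃G and G V₁ are
  -- bounded uniformly in time.
  have hbd : ∀ n, ∀ s ∈ Icc (0 : ℝ) T, ∀ u ∈ Ioo (0 : ℝ) 1,
      ‖f n s u * (timeDeriv T G s u + regLapKappa γ (κ n) (G s) u)‖ ≤ B₁ + (B₃ + B₂) := by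
    intro n s hs u hu
    have h1 := hB₁ s hs u
    have h2 := hB₂ s hs u
    have h3 := hB₃ s hs u
    have h4 : |timeDeriv T G s u + regLapKappa γ (κ n) (G s) u| ≤ B₁ + (B₃ + B₂) := by
      rw [regLapKappa]
      refine (abs_add_le _ _).trans (add_le_add h1 ((abs_sub _ _).trans (add_le_add h3 ?_)))
      rw [mul_assoc, abs_mul, abs_of_nonneg (hκ0 n).1, mul_comm (V₁ γ u)]
      exact (mul_le_of_le_one_left (abs_nonneg _) (hκ0 n).2).trans h2
    rw [Real.norm_eq_abs, abs_mul]
    calc _ ≤ 1 * (B₁ + (B₃ + B₂)) :=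
          mul_le_mul (hf1 n s hs u hu) h4 (abs_nonneg _) zero_le_one
      _ = _ := one_mul _
  have hms : ∀ n, ∀ s ∈ Icc (0 : ℝ) T, AEMeasurable (fun u => f n s u
      * (timeDeriv T G s u + regLapKappa γ (κ n) (G s) u)) volI := by
    intro n s hs
    refine ((hf n).profile.aemeasurable_slice s hs).mul (AEMeasurable.add ?_ ?_)
    · exact (show Measurable (timeDeriv T G s) from
        (funext fun u => hDG s hs u : timeDeriv T G s = fun u => D (s, u)) ▸
          hD.comp (measurable_const.prodMk measurable_id)).aemeasurable
    · exact (((hG.isBump hs).measurable_regLap hγ hγ').sub (((measurable_V₁ γ).const_mul _).mul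
        (hG.isBump hs).measurable)).aemeasurable
  have l2 : Tendsto (fun n => ∫ s in (0 : ℝ)..t, ∫ u in Ioo (0 : ℝ) 1,
        f n s u * (timeDeriv T G s u + regLapKappa γ (κ n) (G s) u)) atTop
      (𝓝 (∫ s in (0 : ℝ)..t, ∫ u in Ioo (0 : ℝ) 1,
        r s u * (timeDeriv T G s u + regLapKappa γ 0 (G s) u))) := by
    simp only [intervalIntegral.integral_of_le ht.1]
    refine tendsto_integral_of_dominated_convergence (fun _ => B₁ + (B₃ + B₂)) (fun n => ?_)
      (integrable_const _) (fun n => ?_) ?_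
    · have hle : (volume.restrict (Ioc 0 t)).prod volI
          ≤ (volume.restrict (Icc (0 : ℝ) T)).prod volI :=
        Measure.prod_mono (Measure.restrict_mono hsub le_rfl) le_rfl
      have hV : Measurable fun p : ℝ × ℝ => V₁ γ p.2 := (measurable_V₁ γ).comp measurable_snd
      have hj : AEMeasurable (fun p : ℝ × ℝ => f n p.1 p.2
          * (timeDeriv T G p.1 p.2 + regLapKappa γ (κ n) (G p.1) p.2))
          ((volume.restrict (Ioc 0 t)).prod volI) := by
        refine ((hf n).profile.aemeasurable.mono_measure hle).mul ?_
        refine ⟨fun p => D p + (L p - κ n * V₁ γ p.2 * F p),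
          hD.add (hL.sub ((hV.const_mul _).mul hF)), ?_⟩
        have : ∀ᵐ p ∂((volume.restrict (Ioc 0 t)).prod volI), p.1 ∈ Ioc 0 t :=
          Measure.quasiMeasurePreserving_fst.ae (ae_restrict_mem measurableSet_Ioc)
        filter_upwards [this] with p hp
        rw [regLapKappa, hDG _ (hsub hp), hLG _ (hsub hp), hFG _ (hsub hp)]
      exact hj.aestronglyMeasurable.integral_prod_right'
    · filter_upwards [ae_restrict_mem measurableSet_Ioc] with s hs
      have := norm_integral_le_of_norm_le_const (μ := volI) (C := B₁ + (B₃ + B₂))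
        (f := fun u => f n s u * (timeDeriv T G s u + regLapKappa γ (κ n) (G s) u)) (by
          filter_upwards [ae_mem_volI] with u hu using hbd n s (hsub hs) u hu)
      rwa [probReal_univ, mul_one] at this
    · filter_upwards [ae_restrict_mem measurableSet_Ioc] with s hs
      refine tendsto_integral_of_dominated_convergence (fun _ => B₁ + (B₃ + B₂)) (fun n => ?_)
        (integrable_const _) (fun n => ?_) ?_
      · exact (hms n s (hsub hs)).aestronglyMeasurable
      · filter_upwards [ae_mem_volI] with u hu using hbd n s (hsub hs) u hu
      · filter_upwards [hlim s (hsub hs)] with u hu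
        simp only [regLapKappa]
        exact hu.mul (tendsto_const_nhds.add (tendsto_const_nhds.sub
          ((hκ.mul_const _).mul_const _)))
  have l3 := hκ.mul_const (∫ s in (0 : ℝ)..t, ∫ u in Ioo (0 : ℝ) 1, G s u * V₀ γ α β u)
  have l4 := ((l1.sub_const (∫ u in Ioo (0 : ℝ) 1, g u * G 0 u)).sub l2).sub l3
  refine tendsto_nhds_unique l4 (tendsto_const_nhds.congr fun n => ?_)
  exact ((hf n).weak_form t ht G hG).symm

/-- A profile that stays close to the stationary one has the right boundary values. -/
lemma hasBoundaryValues_of_finite {γ α β : ℝ} (hγ : 1 < γ) (hα : 0 ≤ α) (hα' : α ≤ 1) (hβ : 0 ≤ β)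
    (hβ' : β ≤ 1) {f : ℝ → ℝ} (hf : Measurable f) (hf1 : ∀ u, f u ∈ Icc (0 : ℝ) 1)
    (hE : sqInt (kerMeas γ) (gap fun u => f u - rbar γ α β u) < ⊤)
    (hV : sqInt (potMeas γ) (fun u => f u - rbar γ α β u) < ⊤) : HasBoundaryValues α β f := by
  have hγ0 : 0 < γ := by linarith
  obtain ⟨q, hq, hq0, hfq⟩ := exists_continuous_rep hγ (hf.sub (measurable_rbar γ α β))
    (fun u => abs_sub_le_one_of_mem_Icc (hf1 u) (rbar_mem_Icc hγ0 hα hα' hβ hβ' u)) hE hV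
  refine ⟨fun u => q u + rcont γ α β u, hq.continuousOn.add (continuousOn_rcont hγ), ?_, ?_, ?_⟩
  · filter_upwards [hfq, ae_mem_volI] with u hu huI
    simp only [Pi.sub_apply] at hu
    rw [← hu, rbar_eq_rcont hγ0 huI]; ring
  · simp only [hq0 0 (by simp), rcont_zero hγ0, zero_add]
  · simp only [hq0 1 (by simp), rcont_one hγ0, zero_add]

section ZeroLimit

variable {γ α β T : ℝ} {g : ℝ → ℝ} {ρ : ℝ → ℝ → ℝ → ℝ}

/-- Along κ_n = 2^{-n} the comparison estimate gives geometric convergence in L²(0,1) at every time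
of [0, T], hence convergence almost everywhere in u. Dominated convergence passes to the limit in
the weak form, Fatou's lemma transfers the uniform bounds on E and P, and the finiteness of P(r_t -
ρ̄) for almost every t forces the boundary values. -/
theorem exists_isWeakSolution_zero (hγ : 1 < γ) (hγ' : γ < 2)
    (hα : 0 ≤ α) (hα' : α ≤ 1) (hβ : 0 ≤ β) (hβ' : β ≤ 1) (hT : 0 < T)
    (hρ : ∀ κ : ℝ, 0 < κ → IsWeakSolution γ α β T κ g (ρ κ)) :
    ∃ r, IsWeakSolution γ α β T 0 g r := by
  have hγ0 : 0 < γ := by linarith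
  obtain ⟨C, hC0, hC⟩ := exists_hardy hγ
  set κ : ℕ → ℝ := fun n => (1 / 2 : ℝ) ^ n with hκ
  have hκ0 : ∀ n, 0 < κ n := fun n => by positivity
  have hκ1 : ∀ n, κ n ∈ Icc (0 : ℝ) 1 := fun n =>
    ⟨(hκ0 n).le, pow_le_one₀ (by norm_num) (by norm_num)⟩
  have hκlim : Tendsto κ atTop (𝓝 0) :=
    tendsto_pow_atTop_nhds_zero_of_lt_one (by norm_num) (by norm_num)
  have hsol := fun n => (hρ (κ n) (hκ0 n)).exists_isBumpSolution hγ hγ' hα hα' hβ hβ' (hκ0 n).le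
  choose f hf using hsol
  obtain ⟨K, hK⟩ : ∃ K, 2 * (ENNReal.ofReal 2⁻¹
        + ENNReal.ofReal T * sqInt (kerMeas γ) (gap (rbar γ α β))) = K := ⟨_, rfl⟩
  have hKt : K < ⊤ := by
    rw [← hK]
    exact ENNReal.mul_lt_top (by simp) (ENNReal.add_lt_top.2 ⟨ENNReal.ofReal_lt_top,
      ENNReal.mul_lt_top ENNReal.ofReal_lt_top (sqInt_gap_rbar_lt_top hγ hγ')⟩)
  have hCK : ENNReal.ofReal C * K < ⊤ := ENNReal.mul_lt_top ENNReal.ofReal_lt_top hKt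
  have hap := fun n => (hf n).a_priori hγ hγ' hα hα' hβ hβ' hT (hκ0 n).le hC0 hC hK
  -- The upper limit is a limit candidate defined at every point, measurable, and with values in
  -- [0,1], even where the sequence does not converge.
  set r : ℝ → ℝ → ℝ := fun t u => limsup (fun n => ρ (κ n) t u) atTop with hr
  set r' : ℝ → ℝ → ℝ := fun t u => limsup (fun n => f n t u) atTop with hr'
  have hr'm : Measurable (Function.uncurry r') := Measurable.limsup fun n => (hf n).meas
  have hr'mem : ∀ t u, r' t u ∈ Icc (0 : ℝ) 1 := fun t u => limsup_mem_Icc fun n =>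
    (hf n).mem_Icc t u
  have hver : ∀ᵐ t ∂(volume.restrict (Icc (0 : ℝ) T)), ∀ᵐ u ∂volI, ∀ n, ρ (κ n) t u = f n t u := by
    filter_upwards [ae_all_iff.2 fun n => (hf n).version] with t ht using ae_all_iff.2 ht
  have hlim : ∀ t ∈ Icc (0 : ℝ) T, ∀ᵐ u ∂volI,
      Tendsto (fun n => ρ (κ n) t u) atTop (𝓝 (r t u)) := by
    intro t ht
    refine ae_tendsto_limsup (f := fun n => ρ (κ n) t)
      (fun n => (hf n).profile.aemeasurable_slice t ht)
      (B := 2 * (ENNReal.ofReal C * (ENNReal.ofReal C * K)))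
      (ENNReal.mul_lt_top (by simp) (ENNReal.mul_lt_top ENNReal.ofReal_lt_top hCK)) fun n => ?_
    -- Here (κ_n - κ_{n+1})² = 4^{-n}/4, and the last quarter is discarded. The a priori estimate
    -- bounds the integral uniformly in n.
    have hKn : ENNReal.ofReal ((κ n - κ (n + 1)) ^ 2 * C) * ∫⁻ t in Ioo 0 T,
        sqInt (potMeas γ) (fun u => f (n + 1) t u - rbar γ α β u)
        ≤ ENNReal.ofReal ((1 / 4 : ℝ) ^ n) * (ENNReal.ofReal C * (ENNReal.ofReal C * K)) := by
      rw [← mul_assoc, ← ENNReal.ofReal_mul (by positivity)]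
      refine mul_le_mul' (ENNReal.ofReal_le_ofReal (mul_le_mul_of_nonneg_right ?_ hC0.le))
        (hap (n + 1)).2
      have e1 : κ n - κ (n + 1) = (1 / 2 : ℝ) ^ n * (1 / 2) := by
        simp only [hκ, pow_succ]; ring
      have e2 : ((1 / 2 : ℝ) ^ n * (1 / 2)) ^ 2 = (1 / 4 : ℝ) ^ n * (1 / 4) := by
        rw [mul_pow, ← pow_mul, mul_comm n 2, pow_mul]; norm_num
      rw [e1, e2]
      have : (0 : ℝ) < (1 / 4) ^ n := by positivity
      linarith
    have := ((hf n).compare hγ hγ' hα hα' hβ hβ' hT (hκ0 n).le hC0 hC (hf (n + 1)) hKn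
      (ENNReal.mul_lt_top ENNReal.ofReal_lt_top
        (ENNReal.mul_lt_top ENNReal.ofReal_lt_top hCK))).2 t ht
    refine this.trans (le_of_eq ?_)
    ring
  have hrr' : ∀ᵐ t ∂(volume.restrict (Icc (0 : ℝ) T)), r t =ᵐ[volI] r' t := by
    filter_upwards [hver] with t ht
    filter_upwards [ht] with u hu
    simp only [hr, hr', hu]
  have hlim' : ∀ᵐ t ∂(volume.restrict (Icc (0 : ℝ) T)), ∀ᵐ u ∂volI,
      Tendsto (fun n => f n t u) atTop (𝓝 (r' t u)) := by
    filter_upwards [hver, hrr', ae_restrict_mem measurableSet_Icc] with t h1 h2 h3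
    filter_upwards [h1, h2, hlim t h3] with u h1 h2 h3
    simpa only [h1, h2] using h3
  have hprof : IsProfile T r := by
    refine ⟨fun t ht u hu => limsup_mem_Icc fun n => (hf n).profile.mem_Icc t ht u hu,
      aemeasurable_limsup fun n => (hf n).profile.aemeasurable,
      fun t ht => aemeasurable_limsup fun n => (hf n).profile.aemeasurable_slice t ht⟩
  have hmsub : Measurable (Function.uncurry fun t u => r' t u - rbar γ α β u) :=
    hr'm.sub ((measurable_rbar γ α β).comp measurable_snd)
  have hlim'' : ∀ᵐ t, t ∈ Ioo 0 T → ∀ᵐ u ∂volI,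
      Tendsto (fun n => f n t u) atTop (𝓝 (r' t u)) := by
    filter_upwards [(ae_restrict_iff' measurableSet_Icc).1 hlim'] with t ht ht'
    exact ht (Ioo_subset_Icc_self ht')
  have hE : ∫⁻ t in Ioo 0 T, sqInt (kerMeas γ) (gap fun u => r' t u - rbar γ α β u) ≤ K := by
    refine lintegral_sqInt_le_of_tendsto_Ioo (Fn := fun n t => gap fun u => f n t u - rbar γ α β u)
      (fun n => measurable_gap_uncurry (hf n).measurable_sub_rbar) ?_ fun n => (hap n).1
    filter_upwards [hlim''] with t ht htT
    refine (kerMeas_ac γ).ae_le ?_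
    filter_upwards [Measure.quasiMeasurePreserving_fst.ae (ht htT),
      Measure.quasiMeasurePreserving_snd.ae (ht htT)] with p h3 h4
    exact (h3.sub_const _).sub (h4.sub_const _)
  have hV : ∫⁻ t in Ioo 0 T, sqInt (potMeas γ) (fun u => r' t u - rbar γ α β u)
      ≤ ENNReal.ofReal C * K := by
    refine lintegral_sqInt_le_of_tendsto_Ioo (Fn := fun n t u => f n t u - rbar γ α β u)
      (fun n => (hf n).measurable_sub_rbar) ?_ fun n => (hap n).2
    filter_upwards [hlim''] with t ht htT
    refine (potMeas_ac γ).ae_le ?_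
    filter_upwards [ht htT] with u hu using hu.sub_const _
  refine ⟨r, hprof, ?_, fun h => absurd h (lt_irrefl _), fun _ => ?_, fun t ht G hG =>
    weak_form_zero_of_tendsto hγ0 hγ' hT.le hκ1 hκlim (fun n => hρ (κ n) (hκ0 n)) hlim ht hG⟩
  · have hle : ∀ᵐ t ∂(volume.restrict (Icc (0 : ℝ) T)), sobolevNormSq γ (r t)
        ≤ 1 + (2 * sqInt (kerMeas γ) (gap fun u => r' t u - rbar γ α β u)
          + 2 * sqInt (kerMeas γ) (gap (rbar γ α β))) := by
      filter_upwards [hrr', ae_restrict_mem measurableSet_Icc] with t h1 h2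
      rw [sobolevNormSq, seminormSq_eq hγ0 (hprof.aemeasurable_slice t h2),
        sqInt_kerMeas_congr γ h1, l2NormSq_eq, sqInt_congr_ae h1]
      refine add_le_add ?_ ?_
      · have := sqInt_volI_le_of_abs_le (M := 1)
          (ae_of_all _ fun u => abs_le_one_of_mem_Icc (hr'mem t u))
        simpa using this
      · have := sqInt_gap_add_le γ (f := fun u => r' t u - rbar γ α β u) (g := rbar γ α β)
          (measurable_slice hmsub t)
        simpa only [sub_add_cancel] using this
    refine lt_of_le_of_lt (lintegral_mono_ae hle) ?_
    rw [lintegral_Icc_eq_Ioo, lintegral_add_left measurable_const,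
      lintegral_add_right _ measurable_const, lintegral_const_mul' _ _ (by simp),
      setLIntegral_const, setLIntegral_const, Real.volume_Ioo]
    refine ENNReal.add_lt_top.2 ⟨ENNReal.mul_lt_top (by simp) ENNReal.ofReal_lt_top,
      ENNReal.add_lt_top.2 ⟨ENNReal.mul_lt_top (by simp) (hE.trans_lt hKt), ENNReal.mul_lt_top
        (ENNReal.mul_lt_top (by simp) (sqInt_gap_rbar_lt_top hγ hγ')) ENNReal.ofReal_lt_top⟩⟩
  · have f1 := ae_lt_top (measurable_sqInt (measurable_gap_uncurry hmsub)) (hE.trans_lt hKt).ne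
    have f2 := ae_lt_top (measurable_sqInt hmsub) (hV.trans_lt hCK).ne
    rw [Measure.restrict_congr_set Ioo_ae_eq_Icc] at f1 f2
    filter_upwards [f1, f2, hrr'] with t h1 h2 h3
    obtain ⟨q, hq1, hq2, hq3⟩ := hasBoundaryValues_of_finite hγ hα hα' hβ hβ'
      (measurable_slice hr'm t) (hr'mem t) h1 h2
    exact ⟨q, hq1, h3.trans hq2, hq3⟩

/-- With equal parameters δ = 0, so the comparison estimate has a vanishing right side. -/
theorem IsWeakSolution.ae_eq (hγ : 1 < γ) (hγ' : γ < 2)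
    (hα : 0 ≤ α) (hα' : α ≤ 1) (hβ : 0 ≤ β) (hβ' : β ≤ 1) (hT : 0 < T) {κ : ℝ} (hκ : 0 ≤ κ)
    {r r' : ℝ → ℝ → ℝ} (H : IsWeakSolution γ α β T κ g r) (H' : IsWeakSolution γ α β T κ g r')
    {t : ℝ} (ht : t ∈ Icc 0 T) : r t =ᵐ[volI] r' t := by
  obtain ⟨C, hC0, hC⟩ := exists_hardy hγ
  obtain ⟨f, hf⟩ := H.exists_isBumpSolution hγ hγ' hα hα' hβ hβ' hκ
  obtain ⟨f', hf'⟩ := H'.exists_isBumpSolution hγ hγ' hα hα' hβ hβ' hκ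
  have h0 := (hf.compare hγ hγ' hα hα' hβ hβ' hT hκ hC0 hC hf' (K := 0) (by simp) (by simp)).2 t ht
  rw [mul_zero, nonpos_iff_eq_zero] at h0
  exact ae_eq_of_sqInt_sub_eq_zero (H.profile.aemeasurable_slice t ht)
    (H'.profile.aemeasurable_slice t ht) h0

/-- Comparison with the solution for κ' = 0 gives δ = κ, and the factor P is the distance of that
fixed solution to ρ̄, independent of κ. The squared norm is therefore O(κ²), and the whole family
converges, not only a sequence. -/
theorem tendsto_bochnerSobolevNormSq (hγ : 1 < γ) (hγ' : γ < 2)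
    (hα : 0 ≤ α) (hα' : α ≤ 1) (hβ : 0 ≤ β) (hβ' : β ≤ 1) (hT : 0 < T)
    (hρ : ∀ κ : ℝ, 0 < κ → IsWeakSolution γ α β T κ g (ρ κ)) {r : ℝ → ℝ → ℝ}
    (H : IsWeakSolution γ α β T 0 g r) :
    Tendsto (fun κ : ℝ => bochnerSobolevNormSq γ T (fun t u => ρ κ t u - r t u)) (𝓝[>] 0) (𝓝 0) := by
  have hγ0 : 0 < γ := by linarith
  obtain ⟨C, hC0, hC⟩ := exists_hardy hγ
  obtain ⟨f', hf'⟩ := H.exists_isBumpSolution hγ hγ' hα hα' hβ hβ' le_rfl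
  set P := ∫⁻ t in Ioo 0 T, sqInt (potMeas γ) (fun u => f' t u - rbar γ α β u) with hP
  have hbound : ∀ κ : ℝ, 0 < κ → bochnerSobolevNormSq γ T (fun t u => ρ κ t u - r t u)
      ≤ ENNReal.ofReal (κ ^ 2 * C) * ((ENNReal.ofReal T + 1) * (2 * P)) := by
    intro κ hκ
    obtain ⟨f, hf⟩ := (hρ κ hκ).exists_isBumpSolution hγ hγ' hα hα' hβ hβ' hκ.le
    obtain ⟨h1, h2⟩ := hf.compare hγ hγ' hα hα' hβ hβ' hT hκ.le hC0 hC hf'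
      (K := ENNReal.ofReal (κ ^ 2 * C) * P) (by rw [sub_zero])
      (ENNReal.mul_lt_top ENNReal.ofReal_lt_top hf'.pot)
    have hle : ∀ᵐ t ∂(volume.restrict (Icc (0 : ℝ) T)),
        sobolevNormSq γ (fun u => ρ κ t u - r t u) ≤ 2 * (ENNReal.ofReal (κ ^ 2 * C) * P)
          + sqInt (kerMeas γ) (gap fun u => f t u - f' t u) := by
      filter_upwards [hf.version, hf'.version, ae_restrict_mem measurableSet_Icc] with t v1 v2 ht
      have hm : AEMeasurable (fun u => ρ κ t u - r t u) volI :=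
        (hf.profile.aemeasurable_slice t ht).sub (hf'.profile.aemeasurable_slice t ht)
      rw [sobolevNormSq, seminormSq_eq hγ0 hm]
      refine add_le_add (h2 t ht) (le_of_eq (sqInt_kerMeas_congr γ ?_))
      filter_upwards [v1, v2] with u e1 e2
      simp only [e1, e2]
    refine (lintegral_mono_ae hle).trans ?_
    rw [lintegral_Icc_eq_Ioo, lintegral_add_left measurable_const, setLIntegral_const,
      Real.volume_Ioo, sub_zero]
    refine (add_le_add le_rfl h1).trans (le_of_eq ?_)
    ring
  have hfin : (ENNReal.ofReal T + 1) * (2 * P) ≠ ⊤ :=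
    (ENNReal.mul_lt_top (by simp) (ENNReal.mul_lt_top (by simp) hf'.pot)).ne
  have hlim : Tendsto (fun κ : ℝ => ENNReal.ofReal (κ ^ 2 * C) * ((ENNReal.ofReal T + 1) * (2 * P)))
      (𝓝[>] 0) (𝓝 0) := by
    have h1 : Tendsto (fun κ : ℝ => κ ^ 2 * C) (𝓝[>] 0) (𝓝 0) := by
      have : Tendsto (fun κ : ℝ => κ ^ 2 * C) (𝓝 0) (𝓝 ((0 : ℝ) ^ 2 * C)) :=
        (by fun_prop : Continuous fun κ : ℝ => κ ^ 2 * C).tendsto 0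
      simpa using this.mono_left nhdsWithin_le_nhds
    have h2 := ENNReal.Tendsto.mul_const (b := (ENNReal.ofReal T + 1) * (2 * P))
      (ENNReal.tendsto_ofReal h1) (Or.inr hfin)
    simpa using h2
  refine tendsto_of_tendsto_of_tendsto_of_le_of_le' tendsto_const_nhds hlim
    (Eventually.of_forall fun _ => zero_le) ?_
  filter_upwards [self_mem_nhdsWithin] with κ hκ using hbound κ hκ

end ZeroLimit

/-! ### The energy of the relaxation to the stationary profile -/

/-- For y ≤ x one has y^{s-1} ≥ x^{s-1}, so x^s - y^s = x^{s-1} x - y^{s-1} y ≤ x^{s-1}(x - y).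
Having the larger point in the singular factor is essential below. -/
lemma abs_rpow_sub_le {s u v : ℝ} (hs0 : 0 ≤ s) (hs : s ≤ 1) (hu : 0 < u) (hv : 0 < v) :
    |u ^ s - v ^ s| ≤ (max u v) ^ (s - 1) * |u - v| := by
  have key : ∀ x y : ℝ, 0 < y → y ≤ x → |x ^ s - y ^ s| ≤ x ^ (s - 1) * (x - y) := by
    intro x y hy hxy
    have hx : 0 < x := hy.trans_le hxy
    rw [abs_of_nonneg (sub_nonneg.2 (Real.rpow_le_rpow hy.le hxy hs0))]
    have e1 : x ^ s = x ^ (s - 1) * x := by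
      rw [← Real.rpow_add_one hx.ne', sub_add_cancel]
    have e2 : y ^ s = y ^ (s - 1) * y := by
      rw [← Real.rpow_add_one hy.ne', sub_add_cancel]
    have h : x ^ (s - 1) ≤ y ^ (s - 1) := Real.rpow_le_rpow_of_nonpos hy hxy (by linarith)
    rw [e1, e2]
    nlinarith
  rcases le_total v u with h | h
  · rw [max_eq_left h, abs_of_nonneg (sub_nonneg.2 h)]
    exact key u v hv h
  · rw [max_eq_right h, abs_sub_comm u v, abs_of_nonneg (sub_nonneg.2 h), abs_sub_comm]
    exact key v u hu h

/-- The power `γ / 2` has finite energy. -/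
lemma sqInt_gap_rpow_lt_top {γ : ℝ} (hγ : 0 < γ) (hγ' : γ < 2) :
    sqInt (kerMeas γ) (gap fun u => u ^ (γ / 2)) < ⊤ := by
  have hc := cGamma_pos hγ
  -- The squared increment produces max(u,v)^{γ-2} = max(u,v)^{-2θ}. One half is spent as |u|^{-θ}
  -- and the other as |u - v|^{-θ}, which leaves |u - v|^{θ-1}; both singularities are integrable
  -- for 0 < θ < 1.
  set θ : ℝ := (2 - γ) / 2 with hθ
  have hθ0 : 0 < θ := by rw [hθ]; linarith
  have hθ1 : θ < 1 := by rw [hθ]; linarith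
  set J : ℝ≥0∞ := ∫⁻ z in Ioo (-1 : ℝ) 1, ENNReal.ofReal (|z| ^ (θ - 1)) with hJ
  have hJfin : J < ⊤ := by
    have h := (integrableOn_abs_rpow (r := θ - 1) (by linarith) 1).2
    rw [hasFiniteIntegral_iff_ofReal (ae_of_all _ fun z => by positivity)] at h
    exact h
  have hIfin : ∫⁻ u, ENNReal.ofReal (|u| ^ (-θ)) ∂volI < ⊤ := by
    have h := ((integrableOn_abs_rpow (r := -θ) (by linarith) 1).mono_set
      (Ioo_subset_Ioo_left (by norm_num : (-1 : ℝ) ≤ 0))).2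
    rw [hasFiniteIntegral_iff_ofReal (ae_of_all _ fun z => by positivity)] at h
    exact h
  have hmeas : Measurable fun p : ℝ × ℝ => ENNReal.ofReal (cGamma γ / 2 * |p.1| ^ (-θ))
      * ENNReal.ofReal (|p.1 - p.2| ^ (θ - 1)) := by
    fun_prop
  calc sqInt (kerMeas γ) (gap fun u => u ^ (γ / 2))
      ≤ ∫⁻ p, ENNReal.ofReal (cGamma γ / 2 * |p.1| ^ (-θ))
          * ENNReal.ofReal (|p.1 - p.2| ^ (θ - 1)) ∂(volI.prod volI) := by
        rw [sqInt_kerMeas]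
        refine lintegral_mono_ae ?_
        filter_upwards [Measure.quasiMeasurePreserving_fst.ae ae_mem_volI,
          Measure.quasiMeasurePreserving_snd.ae ae_mem_volI] with p h1 h2
        rw [← ENNReal.ofReal_mul (kerDens_nonneg hγ p), ← ENNReal.ofReal_mul (by positivity)]
        refine ENNReal.ofReal_le_ofReal ?_
        rcases eq_or_ne p.1 p.2 with h | h
        · simp only [gap, h, sub_self, ne_eq, OfNat.ofNat_ne_zero, not_false_eq_true, zero_pow,
            mul_zero]
          positivity
        have hpos : 0 < |p.1 - p.2| := abs_pos.2 (sub_ne_zero.2 h)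
        set m := max p.1 p.2 with hm
        have hm0 : 0 < m := h1.1.trans_le (le_max_left _ _)
        have hmd : |p.1 - p.2| ≤ m := by
          rw [abs_le]
          constructor <;> linarith [le_max_left p.1 p.2, le_max_right p.1 p.2, h1.1, h2.1]
        have hg : gap (fun u => u ^ (γ / 2)) p ^ 2 ≤ (m ^ (γ / 2 - 1) * |p.1 - p.2|) ^ 2 := by
          rw [← sq_abs]
          exact pow_le_pow_left₀ (abs_nonneg _) (abs_rpow_sub_le (by linarith) (by linarith) h1.1
            h2.1) 2
        have hm2 : (m ^ (γ / 2 - 1)) ^ 2 ≤ |p.1| ^ (-θ) * |p.1 - p.2| ^ (-θ) := by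
          have e : (m ^ (γ / 2 - 1)) ^ 2 = m ^ (-θ) * m ^ (-θ) := by
            rw [sq, show γ / 2 - 1 = -θ by rw [hθ]; ring]
          rw [e, abs_of_pos h1.1]
          exact mul_le_mul (Real.rpow_le_rpow_of_nonpos h1.1 (le_max_left _ _) (by linarith))
            (Real.rpow_le_rpow_of_nonpos hpos hmd (by linarith)) (by positivity)
            (Real.rpow_nonneg h1.1.le _)
        have hpow : |p.1 - p.2| ^ (θ - 1)
            = |p.1 - p.2| ^ (-θ) * |p.1 - p.2| ^ (2 : ℕ) / |p.1 - p.2| ^ (1 + γ) := by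
          rw [← Real.rpow_natCast, ← Real.rpow_add hpos, ← Real.rpow_sub hpos]
          congr 1; rw [hθ]; push_cast; ring
        rw [hpow, kerDens]
        calc _ ≤ cGamma γ / 2 / |p.1 - p.2| ^ (1 + γ)
                * (|p.1| ^ (-θ) * |p.1 - p.2| ^ (-θ) * |p.1 - p.2| ^ (2 : ℕ)) := by
              refine mul_le_mul_of_nonneg_left (hg.trans ?_) (by positivity)
              rw [mul_pow]
              exact mul_le_mul_of_nonneg_right hm2 (by positivity)
          _ = _ := by ring
    _ = ∫⁻ u, ∫⁻ v, ENNReal.ofReal (cGamma γ / 2 * |u| ^ (-θ))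
          * ENNReal.ofReal (|u - v| ^ (θ - 1)) ∂volI ∂volI := lintegral_prod _ hmeas.aemeasurable
    _ ≤ ∫⁻ u, ENNReal.ofReal (cGamma γ / 2) * (ENNReal.ofReal (|u| ^ (-θ)) * J) ∂volI := by
        refine lintegral_mono_ae ?_
        filter_upwards [ae_mem_volI] with u hu
        rw [lintegral_const_mul' _ _ ENNReal.ofReal_ne_top, ENNReal.ofReal_mul (by positivity),
          mul_assoc]
        gcongr
        rw [hJ, ← lintegral_indicator measurableSet_Ioo, ← lintegral_indicator measurableSet_Ioo,
          ← lintegral_sub_left_eq_self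
            ((Ioo (-1 : ℝ) 1).indicator fun z => ENNReal.ofReal (|z| ^ (θ - 1))) u]
        refine lintegral_mono fun v => ?_
        by_cases hv : v ∈ Ioo (0 : ℝ) 1
        · rw [indicator_of_mem hv, indicator_of_mem (show u - v ∈ Ioo (-1 : ℝ) 1 from
            ⟨by linarith [hu.1, hv.2], by linarith [hu.2, hv.1]⟩)]
        · rw [indicator_of_notMem hv]; exact zero_le
    _ < ⊤ := by
        rw [lintegral_const_mul' _ _ ENNReal.ofReal_ne_top, lintegral_mul_const' _ _ hJfin.ne]
        exact ENNReal.mul_lt_top ENNReal.ofReal_lt_top (ENNReal.mul_lt_top hIfin hJfin)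

lemma integral_exp_neg_Ioi {x : ℝ} (hx : 0 < x) :
    IntegrableOn (fun t => Real.exp (-x * t)) (Ioi 0) ∧
      ∫ t in Ioi (0 : ℝ), Real.exp (-x * t) = 1 / x := by
  refine ⟨integrableOn_exp_mul_Ioi (by linarith) 0, ?_⟩
  rw [integral_exp_mul_Ioi (by linarith) 0]
  simp [neg_div_neg_eq]

/-- Expanding the square leaves three exponential integrals, 1/(2x) - 2/(x+y) + 1/(2y). Integrating
in time first is what makes the energy of e^{-tV₁} tractable. -/
lemma lintegral_sq_exp_sub {x y : ℝ} (hx : 0 < x) (hy : 0 < y) :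
    ∫⁻ t in Ioi (0 : ℝ), ENNReal.ofReal ((Real.exp (-t * x) - Real.exp (-t * y)) ^ 2)
      = ENNReal.ofReal ((x - y) ^ 2 / (2 * (x * y * (x + y)))) := by
  obtain ⟨i1, e1⟩ := integral_exp_neg_Ioi (x := 2 * x) (by linarith)
  obtain ⟨i2, e2⟩ := integral_exp_neg_Ioi (x := x + y) (by linarith)
  obtain ⟨i3, e3⟩ := integral_exp_neg_Ioi (x := 2 * y) (by linarith)
  have e : ∀ t, (Real.exp (-t * x) - Real.exp (-t * y)) ^ 2 = Real.exp (-(2 * x) * t)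
      - 2 * Real.exp (-(x + y) * t) + Real.exp (-(2 * y) * t) := fun t => by
    have h1 : Real.exp (-(2 * x) * t) = Real.exp (-t * x) ^ 2 := by
      rw [sq, ← Real.exp_add]; congr 1; ring
    have h2 : Real.exp (-(2 * y) * t) = Real.exp (-t * y) ^ 2 := by
      rw [sq, ← Real.exp_add]; congr 1; ring
    have h3 : Real.exp (-(x + y) * t) = Real.exp (-t * x) * Real.exp (-t * y) := by
      rw [← Real.exp_add]; congr 1; ring
    rw [h1, h2, h3]; ring
  have i4 : IntegrableOn (fun t => 2 * Real.exp (-(x + y) * t)) (Ioi 0) := i2.const_mul 2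
  have i5 : IntegrableOn (fun t => Real.exp (-(2 * x) * t) - 2 * Real.exp (-(x + y) * t)) (Ioi 0) :=
    i1.sub i4
  have i6 : IntegrableOn (fun t => Real.exp (-(2 * x) * t) - 2 * Real.exp (-(x + y) * t)
      + Real.exp (-(2 * y) * t)) (Ioi 0) := i5.add i3
  have hnn : ∀ t, 0 ≤ Real.exp (-(2 * x) * t) - 2 * Real.exp (-(x + y) * t)
      + Real.exp (-(2 * y) * t) := fun t => by rw [← e]; positivity
  simp only [e]
  rw [← ofReal_integral_eq_lintegral_ofReal i6 (ae_of_all _ hnn), integral_add i5 i3,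
    integral_sub i1 i4, integral_const_mul, e1, e2, e3]
  congr 1
  field_simp
  ring

/-- This separates the contributions of the two end points to V₁: the numerator splits by (p + q)² ≤
2p² + 2q², and each denominator only decreases when the other end is discarded. -/
lemma sq_sub_div_le {x₁ x₂ y₁ y₂ : ℝ} (h1 : 0 < x₁) (h2 : 0 < x₂) (h3 : 0 < y₁) (h4 : 0 < y₂) :
    (x₁ + x₂ - (y₁ + y₂)) ^ 2 / (2 * ((x₁ + x₂) * (y₁ + y₂) * (x₁ + x₂ + (y₁ + y₂))))
      ≤ (x₁ - y₁) ^ 2 / (x₁ * y₁ * (x₁ + y₁)) + (x₂ - y₂) ^ 2 / (x₂ * y₂ * (x₂ + y₂)) := by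
  have hD : 0 < (x₁ + x₂) * (y₁ + y₂) * (x₁ + x₂ + (y₁ + y₂)) := by positivity
  have d1 : x₁ * y₁ * (x₁ + y₁) ≤ (x₁ + x₂) * (y₁ + y₂) * (x₁ + x₂ + (y₁ + y₂)) := by
    gcongr <;> linarith
  have d2 : x₂ * y₂ * (x₂ + y₂) ≤ (x₁ + x₂) * (y₁ + y₂) * (x₁ + x₂ + (y₁ + y₂)) := by
    gcongr <;> linarith
  calc _ ≤ (2 * (x₁ - y₁) ^ 2 + 2 * (x₂ - y₂) ^ 2)
        / (2 * ((x₁ + x₂) * (y₁ + y₂) * (x₁ + x₂ + (y₁ + y₂)))) := by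
        gcongr
        nlinarith [sq_nonneg (x₁ - y₁ - (x₂ - y₂))]
    _ = (x₁ - y₁) ^ 2 / ((x₁ + x₂) * (y₁ + y₂) * (x₁ + x₂ + (y₁ + y₂)))
        + (x₂ - y₂) ^ 2 / ((x₁ + x₂) * (y₁ + y₂) * (x₁ + x₂ + (y₁ + y₂))) := by
        field_simp
    _ ≤ _ := by gcongr

/-- The left side equals (a² - b²)²/(k(a² + b²)), and (a + b)² ≤ 2(a² + b²). With a = u^{γ/2}, the
quantity k a⁻² is one of the two terms of V₁. -/
lemma sq_sub_div_inv_sq_le {k a b : ℝ} (hk : 0 < k) (ha : 0 < a) (hb : 0 < b) :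
    (k * (a ^ 2)⁻¹ - k * (b ^ 2)⁻¹) ^ 2
      / (k * (a ^ 2)⁻¹ * (k * (b ^ 2)⁻¹) * (k * (a ^ 2)⁻¹ + k * (b ^ 2)⁻¹))
      ≤ 2 / k * (a - b) ^ 2 := by
  have e : (k * (a ^ 2)⁻¹ - k * (b ^ 2)⁻¹) ^ 2
      / (k * (a ^ 2)⁻¹ * (k * (b ^ 2)⁻¹) * (k * (a ^ 2)⁻¹ + k * (b ^ 2)⁻¹))
      = (a ^ 2 - b ^ 2) ^ 2 / (k * (a ^ 2 + b ^ 2)) := by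
    field_simp
    ring
  rw [e, div_le_iff₀ (by positivity)]
  have : 2 / k * (a - b) ^ 2 * (k * (a ^ 2 + b ^ 2)) = 2 * (a - b) ^ 2 * (a ^ 2 + b ^ 2) := by
    field_simp
  rw [this]
  nlinarith [mul_nonneg (sq_nonneg (a - b)) (sq_nonneg (a - b))]

lemma rpow_half_sq {γ u : ℝ} (hu : 0 < u) : u ^ (-γ) = ((u ^ (γ / 2)) ^ 2)⁻¹ := by
  rw [Real.rpow_neg hu.le, ← Real.rpow_natCast, ← Real.rpow_mul hu.le]
  congr 2; push_cast; ring

/-- The time integral of the energy of `e ^ (-t V₁)` is finite. -/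
lemma lintegral_energy_exp_lt_top {γ : ℝ} (hγ : 0 < γ) (hγ' : γ < 2) (T : ℝ) :
    ∫⁻ t in Ioo 0 T, sqInt (kerMeas γ) (gap fun u => Real.exp (-t * V₁ γ u)) < ⊤ := by
  have hc := cGamma_pos hγ
  set k : ℝ := cGamma γ * γ⁻¹ with hk
  have hk0 : 0 < k := by positivity
  have hV := measurable_V₁ γ
  have hm : Measurable (Function.uncurry fun (t : ℝ) (p : ℝ × ℝ) =>
      ENNReal.ofReal (gap (fun u => Real.exp (-t * V₁ γ u)) p ^ 2)) := by
    simp only [gap, Function.uncurry_def]; fun_prop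
  have hfin := sqInt_gap_rpow_lt_top hγ hγ'
  have hmr : Measurable fun u : ℝ => u ^ (γ / 2) := by fun_prop
  have hfin' : sqInt (kerMeas γ) (gap fun u => (1 - u) ^ (γ / 2)) < ⊤ := by
    rw [sqInt_kerMeas_reflect γ hmr]; exact hfin
  unfold sqInt
  rw [lintegral_lintegral_swap hm.aemeasurable]
  refine lt_of_le_of_lt (lintegral_mono_ae (g := fun p => ENNReal.ofReal (2 / k)
    * (ENNReal.ofReal (gap (fun u => u ^ (γ / 2)) p ^ 2)
      + ENNReal.ofReal (gap (fun u => (1 - u) ^ (γ / 2)) p ^ 2))) ?_) ?_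
  · refine (kerMeas_ac γ).ae_le ?_
    filter_upwards [Measure.quasiMeasurePreserving_fst.ae ae_mem_volI,
      Measure.quasiMeasurePreserving_snd.ae ae_mem_volI] with p h1 h2
    have hp1 : 0 < 1 - p.1 := by linarith [h1.2]
    have hp2 : 0 < 1 - p.2 := by linarith [h2.2]
    -- Extending the time integral to the half-line makes it explicit, and removes T from the bound.
    refine (lintegral_mono_set (Ioo_subset_Ioi_self)).trans ?_
    simp only [gap]
    rw [lintegral_sq_exp_sub (V₁_pos hγ h1) (V₁_pos hγ h2),
      ← ENNReal.ofReal_add (sq_nonneg _) (sq_nonneg _), ← ENNReal.ofReal_mul (by positivity)]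
    refine ENNReal.ofReal_le_ofReal ?_
    rw [V₁, V₁]
    refine (sq_sub_div_le (rMinus_pos hγ h1.1) (rPlus_pos hγ h1.2) (rMinus_pos hγ h2.1)
      (rPlus_pos hγ h2.2)).trans ?_
    rw [mul_add (2 / k)]
    simp only [rMinus, rPlus, ← hk]
    rw [rpow_half_sq h1.1, rpow_half_sq h2.1, rpow_half_sq hp1, rpow_half_sq hp2]
    exact add_le_add
      (sq_sub_div_inv_sq_le hk0 (Real.rpow_pos_of_pos h1.1 _) (Real.rpow_pos_of_pos h2.1 _))
      (sq_sub_div_inv_sq_le hk0 (Real.rpow_pos_of_pos hp1 _) (Real.rpow_pos_of_pos hp2 _))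
  · rw [lintegral_const_mul' _ _ ENNReal.ofReal_ne_top, lintegral_add_left
      ((measurable_gap hmr).pow_const 2).ennreal_ofReal]
    exact ENNReal.mul_lt_top ENNReal.ofReal_lt_top (ENNReal.add_lt_top.2 ⟨hfin, hfin'⟩)

/-- The time integral of the `L²(V₁)` norm of `e ^ (-t V₁)` is finite. -/
lemma lintegral_pot_exp_lt_top {γ : ℝ} (hγ : 0 < γ) (T : ℝ) :
    ∫⁻ t in Ioo 0 T, sqInt (potMeas γ) (fun u => Real.exp (-t * V₁ γ u)) < ⊤ := by
  have hV := measurable_V₁ γ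
  have hm : Measurable (Function.uncurry fun (t : ℝ) (u : ℝ) =>
      ENNReal.ofReal (Real.exp (-t * V₁ γ u) ^ 2 * V₁ γ u)) := by
    simp only [Function.uncurry_def]; fun_prop
  simp only [← l2V₁NormSq_eq]
  unfold l2V₁NormSq
  rw [lintegral_lintegral_swap hm.aemeasurable]
  refine lt_of_le_of_lt (lintegral_mono_ae (g := fun _ => 1) ?_) (by simp)
  filter_upwards [ae_mem_volI] with u hu
  have h0 := V₁_pos hγ hu
  obtain ⟨i1, e1⟩ := integral_exp_neg_Ioi (x := 2 * V₁ γ u) (by linarith)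
  have e : ∀ t, Real.exp (-t * V₁ γ u) ^ 2 * V₁ γ u
      = V₁ γ u * Real.exp (-(2 * V₁ γ u) * t) := fun t => by
    rw [sq, ← Real.exp_add, mul_comm]; congr 2; ring
  simp only [e]
  refine (lintegral_mono_set Ioo_subset_Ioi_self).trans ?_
  rw [← ofReal_integral_eq_lintegral_ofReal (i1.const_mul _) (ae_of_all _ fun t => by positivity),
    integral_const_mul, e1]
  refine ENNReal.ofReal_le_one.2 ?_
  rw [mul_one_div, div_le_one (by linarith)]
  linarith

/-! ### The reaction equation -/

section Reaction

variable {γ α β T : ℝ} {g : ℝ → ℝ}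

lemma rMinus_nonneg (hγ : 0 < γ) {u : ℝ} (hu : 0 ≤ u) : 0 ≤ rMinus γ u := by
  have := cGamma_pos hγ
  unfold rMinus; positivity

lemma rPlus_nonneg (hγ : 0 < γ) {u : ℝ} (hu : u ≤ 1) : 0 ≤ rPlus γ u := by
  have := cGamma_pos hγ
  have : 0 ≤ 1 - u := by linarith
  unfold rPlus; positivity

lemma convex_exp_mem_Icc {x y s : ℝ} (hx : x ∈ Icc (0 : ℝ) 1) (hy : y ∈ Icc (0 : ℝ) 1)
    (hs : 0 ≤ s) : x + (y - x) * Real.exp (-s) ∈ Icc (0 : ℝ) 1 := by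
  have h0 := Real.exp_pos (-s)
  have h1 : Real.exp (-s) ≤ 1 := Real.exp_le_one_iff.2 (by linarith)
  have e : x + (y - x) * Real.exp (-s) = (1 - Real.exp (-s)) * x + Real.exp (-s) * y := by ring
  rw [e]
  constructor
  · have := mul_nonneg (sub_nonneg.2 h1) hx.1
    have := mul_nonneg h0.le hy.1
    linarith
  · have := mul_le_mul_of_nonneg_left hx.2 (sub_nonneg.2 h1)
    have := mul_le_mul_of_nonneg_left hy.2 h0.le
    linarith

lemma rhoInf_mem_Icc (hγ : 0 < γ) (hα : 0 ≤ α) (hα' : α ≤ 1) (hβ : 0 ≤ β) (hβ' : β ≤ 1)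
    (hg : ∀ u ∈ Icc (0 : ℝ) 1, g u ∈ Icc (0 : ℝ) 1) {t u : ℝ} (ht : 0 ≤ t)
    (hu : u ∈ Icc (0 : ℝ) 1) : rhoInf γ α β g t u ∈ Icc (0 : ℝ) 1 := by
  have h1 := rMinus_nonneg hγ hu.1
  have h2 := rPlus_nonneg hγ hu.2
  have hV : 0 ≤ V₁ γ u := add_nonneg h1 h2
  have hr : rhoBarInf γ α β u ∈ Icc (0 : ℝ) 1 := by
    refine ⟨div_nonneg (by unfold V₀; positivity) hV, div_le_one_of_le₀ ?_ hV⟩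
    rw [V₀, V₁]
    nlinarith
  rw [rhoInf, neg_mul]
  exact convex_exp_mem_Icc hr (hg u hu) (mul_nonneg ht hV)

lemma isProfile_rhoInf (hγ : 0 < γ) (hα : 0 ≤ α) (hα' : α ≤ 1) (hβ : 0 ≤ β) (hβ' : β ≤ 1)
    (hg : ∀ u ∈ Icc (0 : ℝ) 1, g u ∈ Icc (0 : ℝ) 1) (hgm : AEMeasurable g volI) :
    IsProfile T (rhoInf γ α β g) := by
  have hr := measurable_rhoBarInf γ α β
  have hV := measurable_V₁ γ
  refine ⟨fun t ht u hu => rhoInf_mem_Icc hγ hα hα' hβ hβ' hg ht.1 hu, ?_, fun t _ => ?_⟩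
  · have h1 : AEMeasurable (fun p : ℝ × ℝ => g p.2)
        ((volume.restrict (Icc (0 : ℝ) T)).prod volI) :=
      hgm.comp_quasiMeasurePreserving Measure.quasiMeasurePreserving_snd
    have h2 : Measurable fun p : ℝ × ℝ => rhoBarInf γ α β p.2 := hr.comp measurable_snd
    have h3 : Measurable fun p : ℝ × ℝ => Real.exp (-p.1 * V₁ γ p.2) := by fun_prop
    exact h2.aemeasurable.add ((h1.sub h2.aemeasurable).mul h3.aemeasurable)
  · have h3 : Measurable fun u : ℝ => Real.exp (-t * V₁ γ u) := by fun_prop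
    exact hr.aemeasurable.add ((hgm.sub hr.aemeasurable).mul h3.aemeasurable)

/-- By `boundary_density_eq` the density is, up to constants, (g - ρ̄)² e^{-2tV₁} V₁ plus a bounded
function, and the time integral of e^{-2tV₁} V₁ is at most 1/2. Any measurable datum with values in
[0,1] will do. -/
lemma boundaryEnergy_rhoInf_lt_top (hγ : 0 < γ) (hα : 0 ≤ α) (hα' : α ≤ 1) (hβ : 0 ≤ β)
    (hβ' : β ≤ 1) (hg : ∀ u ∈ Icc (0 : ℝ) 1, g u ∈ Icc (0 : ℝ) 1) :
    boundaryEnergy γ α β T (rhoInf γ α β g) < ⊤ := by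
  have hc := cGamma_pos hγ
  have hV := measurable_V₁ γ
  -- One of u and 1 - u is at least 1/2.
  have hd : ∀ u ∈ Ioo (0 : ℝ) 1, (1 / 2 : ℝ) ^ γ ≤ (1 - u) ^ γ + u ^ γ := fun u hu => by
    have h1 : 0 ≤ (1 - u) ^ γ := Real.rpow_nonneg (by linarith [hu.2]) _
    have h2 : 0 ≤ u ^ γ := Real.rpow_nonneg hu.1.le _
    rcases le_total (1 / 2) u with h | h
    · have := Real.rpow_le_rpow (by norm_num) h hγ.le
      linarith
    · have := Real.rpow_le_rpow (by norm_num) (show 1 / 2 ≤ 1 - u by linarith) hγ.le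
      linarith
  have hle : ∀ t, ∫⁻ u in Ioo (0 : ℝ) 1, ENNReal.ofReal ((α - rhoInf γ α β g t u) ^ 2 / u ^ γ
        + (β - rhoInf γ α β g t u) ^ 2 / (1 - u) ^ γ)
      ≤ ENNReal.ofReal (γ / cGamma γ) * sqInt (potMeas γ) (fun u => Real.exp (-t * V₁ γ u))
        + ENNReal.ofReal ((β - α) ^ 2 / (1 / 2 : ℝ) ^ γ) := fun t => by
    have hm : Measurable fun u => ENNReal.ofReal (Real.exp (-t * V₁ γ u) ^ 2 * V₁ γ u) := by
      fun_prop
    calc _ ≤ ∫⁻ u in Ioo (0 : ℝ) 1, (ENNReal.ofReal (γ / cGamma γ)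
            * ENNReal.ofReal (Real.exp (-t * V₁ γ u) ^ 2 * V₁ γ u)
            + ENNReal.ofReal ((β - α) ^ 2 / (1 / 2 : ℝ) ^ γ)) := by
          refine lintegral_mono_ae ?_
          filter_upwards [ae_mem_volI] with u hu
          have hV0 := V₁_pos hγ hu
          rw [← ENNReal.ofReal_mul (by positivity), ← ENNReal.ofReal_add (by positivity)
            (by positivity)]
          refine ENNReal.ofReal_le_ofReal ?_
          have e := boundary_density_eq (α := α) (β := β) hγ hu (rhoInf γ α β g t u)
          set X := (α - rhoInf γ α β g t u) ^ 2 / u ^ γ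
            + (β - rhoInf γ α β g t u) ^ 2 / (1 - u) ^ γ
          have e2 : X = γ / cGamma γ * ((rhoInf γ α β g t u - rbar γ α β u) ^ 2 * V₁ γ u)
              + (β - α) ^ 2 / ((1 - u) ^ γ + u ^ γ) := by
            have : X = γ / cGamma γ * (cGamma γ / γ * X) := by field_simp
            rw [this, e]; field_simp
          rw [e2]
          refine add_le_add (mul_le_mul_of_nonneg_left (mul_le_mul_of_nonneg_right ?_ hV0.le)
            (by positivity)) ?_
          · have e3 : rhoInf γ α β g t u - rbar γ α β u
                = (g u - rbar γ α β u) * Real.exp (-t * V₁ γ u) := by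
              rw [rhoInf, rbar_of_mem hu]; ring
            rw [e3, mul_pow]
            refine mul_le_of_le_one_left (sq_nonneg _) ?_
            rw [sq_le_one_iff_abs_le_one]
            exact abs_sub_le_one_of_mem_Icc (hg u (Ioo_subset_Icc_self hu))
              (rbar_mem_Icc hγ hα hα' hβ hβ' u)
          · exact div_le_div_of_nonneg_left (sq_nonneg _) (by positivity) (hd u hu)
      _ = _ := by
          rw [lintegral_add_right _ measurable_const, lintegral_const_mul' _ _
            ENNReal.ofReal_ne_top, ← l2V₁NormSq_eq, l2V₁NormSq]
          simp
  refine lt_of_le_of_lt (lintegral_mono hle) ?_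
  rw [lintegral_Icc_eq_Ioo, lintegral_add_right _ measurable_const, lintegral_const_mul' _ _
    ENNReal.ofReal_ne_top, setLIntegral_const, Real.volume_Ioo]
  exact ENNReal.add_lt_top.2 ⟨ENNReal.mul_lt_top ENNReal.ofReal_lt_top
    (lintegral_pot_exp_lt_top hγ T), ENNReal.mul_lt_top ENNReal.ofReal_lt_top ENNReal.ofReal_lt_top⟩

lemma hasDerivAt_rhoInf (hγ : 0 < γ) {u : ℝ} (hu : u ∈ Ioo (0 : ℝ) 1) (t : ℝ) :
    HasDerivAt (fun s => rhoInf γ α β g s u)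
      (V₀ γ α β u - rhoInf γ α β g t u * V₁ γ u) t := by
  have h1 : HasDerivAt (fun s : ℝ => Real.exp (-s * V₁ γ u))
      (Real.exp (-t * V₁ γ u) * (-1 * V₁ γ u)) t :=
    (((hasDerivAt_id t).neg).mul_const (V₁ γ u)).exp
  have h2 := (h1.const_mul (g u - rhoBarInf γ α β u)).const_add (rhoBarInf γ α β u)
  refine h2.congr_deriv ?_
  rw [← rbar_mul_V₁ hγ hu, rbar_of_mem hu, rhoInf]
  ring

lemma integrable_prod_of_bounded {t M : ℝ} {f : ℝ × ℝ → ℝ}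
    (hf : AEMeasurable f ((volume.restrict (Ioc 0 t)).prod volI))
    (hM : ∀ s ∈ Ioc 0 t, ∀ u ∈ Ioo (0 : ℝ) 1, |f (s, u)| ≤ M) :
    Integrable f ((volume.restrict (Ioc 0 t)).prod volI) := by
  refine Integrable.of_bound hf.aestronglyMeasurable M ?_
  filter_upwards [Measure.quasiMeasurePreserving_fst.ae (ae_restrict_mem measurableSet_Ioc),
    Measure.quasiMeasurePreserving_snd.ae ae_mem_volI] with p h1 h2
  exact hM p.1 h1 p.2 h2

/-- For each fixed u the equation is a linear ordinary differential equation in t, solved by the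
explicit formula. The weak form is the fundamental theorem of calculus for ρ G at fixed u, followed
by Fubini; V₁ is bounded on the support of G, so all the integrands are bounded. -/
theorem isReactionWeakSolution_rhoInf (hγ : 0 < γ) (hα : 0 ≤ α) (hα' : α ≤ 1) (hβ : 0 ≤ β)
    (hβ' : β ≤ 1) (hT : 0 ≤ T) (hg : ∀ u ∈ Icc (0 : ℝ) 1, g u ∈ Icc (0 : ℝ) 1)
    (hgm : AEMeasurable g volI) : IsReactionWeakSolution γ α β T 1 g (rhoInf γ α β g) := by
  have hprof : IsProfile T (rhoInf γ α β g) := isProfile_rhoInf hγ hα hα' hβ hβ' hg hgm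
  refine ⟨hprof, boundaryEnergy_rhoInf_lt_top hγ hα hα' hβ hβ' hg, fun t ht G hG => ?_⟩
  set R := rhoInf γ α β g with hR
  obtain ⟨B₀, hB₀⟩ := hG.exists_bound
  obtain ⟨B₁, hB₁⟩ := hG.exists_bound_timeDeriv
  obtain ⟨B₂, hB₂⟩ := hG.exists_bound_mul_V₁ hγ
  obtain ⟨D, hD, hDG⟩ := hG.exists_measurable_timeDeriv hT
  obtain ⟨F, hF, hFG⟩ := hG.exists_measurable hT
  have hsub : Ioc 0 t ⊆ Icc 0 T := fun s hs => ⟨hs.1.le, hs.2.trans ht.2⟩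
  have hle : (volume.restrict (Ioc 0 t)).prod volI
      ≤ (volume.restrict (Icc (0 : ℝ) T)).prod volI :=
    Measure.prod_mono (Measure.restrict_mono hsub le_rfl) le_rfl
  have hfst : ∀ᵐ p ∂((volume.restrict (Ioc 0 t)).prod volI), p.1 ∈ Ioc 0 t :=
    Measure.quasiMeasurePreserving_fst.ae (ae_restrict_mem measurableSet_Ioc)
  have hmR := hprof.aemeasurable.mono_measure hle
  have hmD : AEMeasurable (fun p : ℝ × ℝ => timeDeriv T G p.1 p.2)
      ((volume.restrict (Ioc 0 t)).prod volI) := ⟨D, hD, by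
    filter_upwards [hfst] with p hp using hDG _ (hsub hp) _⟩
  have hmG : AEMeasurable (fun p : ℝ × ℝ => G p.1 p.2)
      ((volume.restrict (Ioc 0 t)).prod volI) := ⟨F, hF, by
    filter_upwards [hfst] with p hp using hFG _ (hsub hp) _⟩
  have hmV : AEMeasurable (fun p : ℝ × ℝ => V₁ γ p.2)
      ((volume.restrict (Ioc 0 t)).prod volI) :=
    ((measurable_V₁ γ).comp measurable_snd).aemeasurable
  have hmV0 : AEMeasurable (fun p : ℝ × ℝ => V₀ γ α β p.2)
      ((volume.restrict (Ioc 0 t)).prod volI) :=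
    ((measurable_V₀ γ α β).comp measurable_snd).aemeasurable
  have hR1 : ∀ s ∈ Ioc 0 t, ∀ u ∈ Ioo (0 : ℝ) 1, |R s u| ≤ 1 := fun s hs u hu =>
    abs_le_one_of_mem_Icc (hprof.mem_Icc s (hsub hs) u (Ioo_subset_Icc_self hu))
  have j1 : Integrable (Function.uncurry fun s u => R s u * timeDeriv T G s u)
      ((volume.restrict (Ioc 0 t)).prod volI) := by
    refine integrable_prod_of_bounded (M := 1 * B₁) (hmR.mul hmD) fun s hs u hu => ?_
    simp only [Function.uncurry, abs_mul]
    exact mul_le_mul (hR1 s hs u hu) (hB₁ s (hsub hs) u) (abs_nonneg _) zero_le_one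
  have j2 : Integrable (Function.uncurry fun s u => R s u * G s u * V₁ γ u)
      ((volume.restrict (Ioc 0 t)).prod volI) := by
    refine integrable_prod_of_bounded (M := 1 * B₂) ((hmR.mul hmG).mul hmV) fun s hs u hu => ?_
    simp only [Function.uncurry]
    rw [mul_assoc, abs_mul]
    exact mul_le_mul (hR1 s hs u hu) (hB₂ s (hsub hs) u) (abs_nonneg _) zero_le_one
  have j3 : Integrable (Function.uncurry fun s u => G s u * V₀ γ α β u)
      ((volume.restrict (Ioc 0 t)).prod volI) := by
    refine integrable_prod_of_bounded (M := 1 * B₂) (hmG.mul hmV0) fun s hs u hu => ?_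
    simp only [Function.uncurry]
    rw [← rbar_mul_V₁ hγ hu, mul_left_comm, abs_mul]
    exact mul_le_mul (abs_le_one_of_mem_Icc (rbar_mem_Icc hγ hα hα' hβ hβ' u))
      (hB₂ s (hsub hs) u) (abs_nonneg _) zero_le_one
  have hftc : ∀ u ∈ Ioo (0 : ℝ) 1, (∫ s in Ioc 0 t, (R s u * timeDeriv T G s u
      - R s u * G s u * V₁ γ u + G s u * V₀ γ α β u)) = R t u * G t u - g u * G 0 u := by
    intro u hu
    have hcR : Continuous fun s => R s u :=
      continuous_iff_continuousAt.2 fun s => (hasDerivAt_rhoInf hγ hu s).continuousAt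
    have hsec : ContinuousOn (fun s : ℝ => (s, u)) (Icc 0 t) := by fun_prop
    have hmaps : MapsTo (fun s : ℝ => (s, u)) (Icc 0 t) (Icc (0 : ℝ) T ×ˢ univ) :=
      fun s hs => ⟨⟨hs.1, hs.2.trans ht.2⟩, mem_univ _⟩
    have hcG : ContinuousOn (fun s => G s u) (Icc 0 t) := hG.continuousOn.comp hsec hmaps
    have hcD : ContinuousOn (fun s => timeDeriv T G s u) (Icc 0 t) :=
      hG.continuous_time.comp hsec hmaps
    have hint : IntervalIntegrable (fun s => R s u * timeDeriv T G s u
        - R s u * G s u * V₁ γ u + G s u * V₀ γ α β u) volume 0 t := by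
      refine ContinuousOn.intervalIntegrable ?_
      rw [uIcc_of_le ht.1]
      exact ((hcR.continuousOn.mul hcD).sub ((hcR.continuousOn.mul hcG).mul continuousOn_const)).add
        (hcG.mul continuousOn_const)
    have hder : ∀ s ∈ Ioo 0 t, HasDerivAt (fun s => R s u * G s u) (R s u * timeDeriv T G s u
        - R s u * G s u * V₁ γ u + G s u * V₀ γ α β u) s := by
      intro s hs
      -- The derivative within [0, T] is a full derivative at interior times, and the fundamental
      -- theorem needs no more, by continuity at the ends.
      have hnh : Icc 0 T ∈ 𝓝 s := Icc_mem_nhds hs.1 (hs.2.trans_le ht.2)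
      have h1 := (hG.differentiable_time u s ⟨hs.1.le, hs.2.le.trans ht.2⟩).hasDerivWithinAt
      have h2 : HasDerivAt (fun s => G s u) (timeDeriv T G s u) s := h1.hasDerivAt hnh
      refine ((hasDerivAt_rhoInf (α := α) (β := β) (g := g) hγ hu s).mul h2).congr_deriv ?_
      simp only [hR]; ring
    have h := intervalIntegral.integral_eq_sub_of_hasDerivAt_of_le ht.1
      (hcR.continuousOn.mul hcG) hder hint
    rw [intervalIntegral.integral_of_le ht.1] at h
    rw [h]
    simp only [Pi.mul_apply]
    have : R 0 u = g u := by simp [hR, rhoInf]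
    rw [this]
  have e1 : ∫ s in Ioc 0 t, ∫ u, (R s u * timeDeriv T G s u - R s u * G s u * V₁ γ u
      + G s u * V₀ γ α β u) ∂volI = (∫ s in Ioc 0 t, ∫ u, R s u * timeDeriv T G s u ∂volI)
      - (∫ s in Ioc 0 t, ∫ u, R s u * G s u * V₁ γ u ∂volI)
      + ∫ s in Ioc 0 t, ∫ u, G s u * V₀ γ α β u ∂volI := by
    rw [integral_integral j1, integral_integral j2, integral_integral j3,
      integral_integral ((j1.sub j2).add j3)]
    exact (integral_add (j1.sub j2) j3).trans (congrArg (· + _) (integral_sub j1 j2))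
  have e2 : ∫ s in Ioc 0 t, ∫ u, (R s u * timeDeriv T G s u - R s u * G s u * V₁ γ u
      + G s u * V₀ γ α β u) ∂volI
      = (∫ u, R t u * G t u ∂volI) - ∫ u, g u * G 0 u ∂volI := by
    rw [integral_integral_swap ((j1.sub j2).add j3), ← integral_sub]
    · refine integral_congr_ae ?_
      filter_upwards [ae_mem_volI] with u hu using hftc u hu
    · refine Integrable.of_bound ((hprof.aemeasurable_slice t ht).mul
        (hG.isBump ht).measurable.aemeasurable).aestronglyMeasurable (1 * B₀) ?_
      filter_upwards [ae_mem_volI] with u hu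
      rw [Real.norm_eq_abs, abs_mul]
      exact mul_le_mul (abs_le_one_of_mem_Icc (hprof.mem_Icc t ht u (Ioo_subset_Icc_self hu)))
        (hB₀ t ht u) (abs_nonneg _) zero_le_one
    · have h0 : (0 : ℝ) ∈ Icc 0 T := ⟨le_rfl, hT⟩
      refine Integrable.of_bound (hgm.mul
        (hG.isBump h0).measurable.aemeasurable).aestronglyMeasurable (1 * B₀) ?_
      filter_upwards [ae_mem_volI] with u hu
      rw [Real.norm_eq_abs, abs_mul]
      exact mul_le_mul (abs_le_one_of_mem_Icc (hg u (Ioo_subset_Icc_self hu)))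
        (hB₀ 0 h0 u) (abs_nonneg _) zero_le_one
  simp only [intervalIntegral.integral_of_le ht.1, one_mul]
  rw [e1] at e2
  linarith

end Reaction

/-! ### Uniqueness for the reaction equation -/

section ReactionUnique

variable {γ α β T : ℝ} {g : ℝ → ℝ} {r r' R : ℝ → ℝ → ℝ}

lemma contDiffAt_V₁ (γ : ℝ) {u : ℝ} (hu : u ∈ Ioo (0 : ℝ) 1) : ContDiffAt ℝ ∞ (V₁ γ) u := by
  have h1 : ContDiffAt ℝ ∞ (fun u : ℝ => u ^ (-γ)) u :=
    contDiffAt_id.rpow_const_of_ne hu.1.ne'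
  have h2 : ContDiffAt ℝ ∞ (fun u : ℝ => (1 - u) ^ (-γ)) u :=
    (contDiffAt_const.sub contDiffAt_id).rpow_const_of_ne (sub_pos.2 hu.2).ne'
  exact (contDiffAt_const.mul h1).add (contDiffAt_const.mul h2)

/-- Multiplication by V₁ maps test functions to test functions with the same support. This is what
allows the weak equation to be iterated. -/
lemma contDiff_mul_V₁ (γ : ℝ) {φ : ℝ → ℝ} (hφ : ContDiff ℝ ∞ φ) {a b : ℝ} (ha : 0 < a)
    (hb : b < 1) (hs : ∀ u, u ∉ Icc a b → φ u = 0) : ContDiff ℝ ∞ fun u => φ u * V₁ γ u := by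
  rw [contDiff_iff_contDiffAt]
  intro u
  by_cases hu : u ∈ Icc a b
  · exact hφ.contDiffAt.mul (contDiffAt_V₁ γ ⟨ha.trans_le hu.1, hu.2.trans_lt hb⟩)
  · refine ContDiffAt.congr_of_eventuallyEq (contDiffAt_const (c := (0 : ℝ))) ?_
    filter_upwards [isClosed_Icc.isOpen_compl.mem_nhds hu] with v hv
    rw [hs v hv, zero_mul]

/-- The reaction equation tested against functions of the space variable. -/
lemma IsReactionWeakSolution.integral_eq (hγ : 0 < γ) (hα : 0 ≤ α) (hα' : α ≤ 1) (hβ : 0 ≤ β)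
    (hβ' : β ≤ 1) (H : IsReactionWeakSolution γ α β T 1 g r)
    (hm : Measurable (Function.uncurry r')) (hmem : ∀ t u, r' t u ∈ Icc (0 : ℝ) 1)
    (hver : ∀ᵐ t ∂(volume.restrict (Icc (0 : ℝ) T)), r t =ᵐ[volI] r' t) {t : ℝ}
    (ht : t ∈ Icc 0 T) {φ : ℝ → ℝ} (hφ : IsBump φ) :
    ∫ u, r t u * φ u ∂volI = (∫ u, g u * φ u ∂volI)
      - ∫ s in (0 : ℝ)..t, ∫ u, (r' s u - rbar γ α β u) * (φ u * V₁ γ u) ∂volI := by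
  have h1 := H.weak_form t ht (fun _ => φ) (hφ.isTestFunction T)
  obtain ⟨B₂, hB₂⟩ := hφ.exists_bound_mul_V₁ hγ
  have hm2 := hφ.measurable_mul_V₁ γ
  have hb : ∀ t u, |r' t u| ≤ 1 := fun t u => abs_le_one_of_mem_Icc (hmem t u)
  have hbr : ∀ u, |rbar γ α β u| ≤ 1 := fun u =>
    abs_le_one_of_mem_Icc (rbar_mem_Icc hγ hα hα' hβ hβ' u)
  have e0 : ∫ u in Ioo (0 : ℝ) 1, φ u * V₀ γ α β u = ∫ u, rbar γ α β u * (φ u * V₁ γ u) ∂volI := by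
    refine integral_congr_ae ?_
    filter_upwards [ae_mem_volI] with u hu
    rw [← rbar_mul_V₁ hγ hu]; ring
  have e1 : ∫ s in (0 : ℝ)..t, ∫ u in Ioo (0 : ℝ) 1, r s u * φ u * V₁ γ u
      = ∫ s in (0 : ℝ)..t, ∫ u, r' s u * (φ u * V₁ γ u) ∂volI := by
    refine intervalIntegral.integral_congr_ae ?_
    filter_upwards [(ae_restrict_iff' measurableSet_Icc).1 hver] with s hs hst
    rw [uIoc_of_le ht.1] at hst
    refine integral_congr_ae ?_
    filter_upwards [hs ⟨hst.1.le, hst.2.trans ht.2⟩] with u hu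
    rw [hu, mul_assoc]
  have e2 : ∫ s in (0 : ℝ)..t, ∫ u, (r' s u - rbar γ α β u) * (φ u * V₁ γ u) ∂volI
      = (∫ s in (0 : ℝ)..t, ∫ u, r' s u * (φ u * V₁ γ u) ∂volI)
        - ∫ s in (0 : ℝ)..t, ∫ u, rbar γ α β u * (φ u * V₁ γ u) ∂volI := by
    rw [← intervalIntegral.integral_sub (intervalIntegrable_pairing hm hb hm2 hB₂ 0 t)
      intervalIntegrable_const]
    refine intervalIntegral.integral_congr fun s _ => ?_
    simp only [sub_mul (r' s _)]
    exact integral_sub (integrable_mul_of_bounded (measurable_slice hm s) (hb s) hm2 hB₂)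
      (integrable_mul_of_bounded (measurable_rbar γ α β) hbr hm2 hB₂)
  simp only [timeDeriv, derivWithin_fun_const, mul_zero, integral_zero,
    intervalIntegral.integral_zero, sub_zero, one_mul, e0, e1, Pi.zero_apply] at h1
  rw [e2]
  linarith

lemma IsProfile.integrable_mul {f : ℝ → ℝ → ℝ} (hf : IsProfile T f) {t : ℝ} (ht : t ∈ Icc 0 T)
    {φ : ℝ → ℝ} (hφ : Measurable φ) {B : ℝ} (hB : ∀ u, |φ u| ≤ B) :
    Integrable (fun u => f t u * φ u) volI := by
  refine Integrable.of_bound ((hf.aemeasurable_slice t ht).mul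
    hφ.aemeasurable).aestronglyMeasurable (1 * B) ?_
  filter_upwards [ae_mem_volI] with u hu
  rw [Real.norm_eq_abs, abs_mul]
  exact mul_le_mul (abs_le_one_of_mem_Icc (hf.mem_Icc t ht u (Ioo_subset_Icc_self hu))) (hB u)
    (abs_nonneg _) zero_le_one

/-- Picard iteration for the difference of two solutions. -/
lemma IsReactionWeakSolution.abs_integral_sub_le (hγ : 0 < γ) (hα : 0 ≤ α) (hα' : α ≤ 1)
    (hβ : 0 ≤ β) (hβ' : β ≤ 1) (H : IsReactionWeakSolution γ α β T 1 g r)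
    (H' : IsReactionWeakSolution γ α β T 1 g R) {a b B : ℝ} (ha : 0 < a) (hb : b < 1)
    (hB0 : 0 < B) (hB : ∀ u ∈ Icc a b, 0 < V₁ γ u ∧ V₁ γ u ≤ B) (n : ℕ) :
    ∀ (φ : ℝ → ℝ) (C : ℝ), ContDiff ℝ ∞ φ → (∀ u, u ∉ Icc a b → φ u = 0) → (∀ u, |φ u| ≤ C) →
      ∀ t ∈ Icc 0 T, |∫ u, (r t u - R t u) * φ u ∂volI| ≤ C * ((B * t) ^ n / n.factorial) := by
  obtain ⟨r', hm, hmem, hver⟩ := H.profile.exists_version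
  obtain ⟨R', hm', hmem', hver'⟩ := H'.profile.exists_version
  induction n with
  | zero =>
    intro φ C hφ hs hC t ht
    have := norm_integral_le_of_norm_le_const (μ := volI) (f := fun u => (r t u - R t u) * φ u)
      (C := 1 * C) (by
        filter_upwards [ae_mem_volI] with u hu
        rw [Real.norm_eq_abs, abs_mul]
        exact mul_le_mul (abs_sub_le_one_of_mem_Icc
          (H.profile.mem_Icc t ht u (Ioo_subset_Icc_self hu))
          (H'.profile.mem_Icc t ht u (Ioo_subset_Icc_self hu))) (hC u) (abs_nonneg _) zero_le_one)
    simpa using this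
  | succ n ih =>
    intro φ C hφ hs hC t ht
    have hφb : IsBump φ := ⟨hφ, a, b, ha, hb, hs⟩
    have hC0 : 0 ≤ C := (abs_nonneg _).trans (hC 0)
    have hs' : ∀ u, u ∉ Icc a b → φ u * V₁ γ u = 0 := fun u hu => by rw [hs u hu, zero_mul]
    have hCB : ∀ u, |φ u * V₁ γ u| ≤ C * B := fun u => by
      by_cases hu : u ∈ Icc a b
      · rw [abs_mul, abs_of_pos (hB u hu).1]
        exact mul_le_mul (hC u) (hB u hu).2 (hB u hu).1.le hC0
      · rw [hs' u hu, abs_zero]; positivity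
    have hm2 := hφb.measurable_mul_V₁ γ
    have hsm := contDiff_mul_V₁ γ hφ ha hb hs
    have hbr : ∀ u, rbar γ α β u ∈ Icc (0 : ℝ) 1 := rbar_mem_Icc hγ hα hα' hβ hβ'
    have hmr := measurable_const_uncurry (measurable_rbar γ α β)
    have e : ∫ u, (r t u - R t u) * φ u ∂volI
        = ∫ s in (0 : ℝ)..t, ∫ u, (R' s u - r' s u) * (φ u * V₁ γ u) ∂volI := by
      simp only [sub_mul (r t _)]
      rw [integral_sub (H.profile.integrable_mul ht hφb.measurable hC)
        (H'.profile.integrable_mul ht hφb.measurable hC),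
        H.integral_eq hγ hα hα' hβ hβ' hm hmem hver ht hφb,
        H'.integral_eq hγ hα hα' hβ hβ' hm' hmem' hver' ht hφb, sub_sub_sub_cancel_left,
        ← intervalIntegral.integral_sub]
      · refine intervalIntegral.integral_congr fun s _ => ?_
        rw [← integral_sub (integrable_mul_of_bounded (M := 1)
            (f := fun u => R' s u - rbar γ α β u) ((measurable_slice hm' s).sub (measurable_rbar γ α β))
            (fun u => abs_sub_le_one_of_mem_Icc (hmem' s u) (hbr u)) hm2 hCB)
          (integrable_mul_of_bounded (M := 1)
            (f := fun u => r' s u - rbar γ α β u) ((measurable_slice hm s).sub (measurable_rbar γ α β))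
            (fun u => abs_sub_le_one_of_mem_Icc (hmem s u) (hbr u)) hm2 hCB)]
        refine integral_congr_ae (ae_of_all _ fun u => ?_)
        ring
      · exact intervalIntegrable_pairing (f := fun s u => R' s u - rbar γ α β u) (M := 1)
          (hm'.sub hmr) (fun s u => abs_sub_le_one_of_mem_Icc (hmem' s u) (hbr u)) hm2 hCB 0 t
      · exact intervalIntegrable_pairing (f := fun s u => r' s u - rbar γ α β u) (M := 1)
          (hm.sub hmr) (fun s u => abs_sub_le_one_of_mem_Icc (hmem s u) (hbr u)) hm2 hCB 0 t
    rw [e]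
    have h1 := intervalIntegral.norm_integral_le_of_norm_le (μ := volume) (a := 0) (b := t)
      (f := fun s => ∫ u, (R' s u - r' s u) * (φ u * V₁ γ u) ∂volI)
      (g := fun s => C * B * ((B * s) ^ n / n.factorial)) ht.1 (by
        filter_upwards [(ae_restrict_iff' measurableSet_Icc).1 hver,
          (ae_restrict_iff' measurableSet_Icc).1 hver'] with s hs1 hs2 hst
        have hsT : s ∈ Icc 0 T := ⟨hst.1.le, hst.2.trans ht.2⟩
        -- The induction hypothesis is used with φ V₁ in place of φ and C B in place of C. The
        -- support [a, b], and hence the bound B of V₁, is the same at every stage.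
        have h2 := ih _ _ hsm hs' hCB s hsT
        rw [Real.norm_eq_abs, ← abs_neg, ← integral_neg]
        refine le_trans (le_of_eq (congrArg _ (integral_congr_ae ?_))) h2
        filter_upwards [hs1 hsT, hs2 hsT] with u hu hu'
        rw [hu, hu']; ring) (by
        refine Continuous.intervalIntegrable ?_ _ _
        fun_prop)
    rw [Real.norm_eq_abs] at h1
    refine h1.trans (le_of_eq ?_)
    have e3 : (fun s : ℝ => C * B * ((B * s) ^ n / n.factorial))
        = fun s => C * B * B ^ n / n.factorial * s ^ n := by
      funext s; rw [mul_pow]; ring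
    rw [e3, intervalIntegral.integral_const_mul, integral_pow, Nat.factorial_succ]
    have : (n.factorial : ℝ) ≠ 0 := by positivity
    push_cast
    field_simp
    ring

/-- The pairing of the difference with a test function is at most C (Bt)ⁿ/n! for every n, hence
zero. -/
theorem IsReactionWeakSolution.ae_eq (hγ : 0 < γ) (hα : 0 ≤ α) (hα' : α ≤ 1) (hβ : 0 ≤ β)
    (hβ' : β ≤ 1) (H : IsReactionWeakSolution γ α β T 1 g r)
    (H' : IsReactionWeakSolution γ α β T 1 g R) {t : ℝ} (ht : t ∈ Icc 0 T) :
    r t =ᵐ[volI] R t := by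
  have hfin : ∀ {f : ℝ → ℝ → ℝ}, IsProfile T f → sqInt volI (f t) < ⊤ := fun hf =>
    (sqInt_volI_le_of_abs_le (M := 1) (by
      filter_upwards [ae_mem_volI] with u hu
      exact abs_le_one_of_mem_Icc (hf.mem_Icc t ht u (Ioo_subset_Icc_self hu)))).trans_lt
      ENNReal.ofReal_lt_top
  refine ae_eq_of_forall_bump (H.profile.aemeasurable_slice t ht)
    (H'.profile.aemeasurable_slice t ht) (hfin H.profile) (hfin H'.profile) fun φ hφ => ?_
  obtain ⟨a, b, ha, hb, hs⟩ := hφ.support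
  obtain ⟨B, hB0, hB⟩ := V₁_le_of_mem_Icc hγ ha hb
  obtain ⟨C, hC⟩ := hφ.exists_bound
  have h1 := fun n => H.abs_integral_sub_le hγ hα hα' hβ hβ' H' ha hb hB0 hB n φ C hφ.smooth hs hC t ht
  have h2 := (FloorSemiring.tendsto_pow_div_factorial_atTop (B * t)).const_mul C
  rw [mul_zero] at h2
  have h3 : |∫ u, (r t u - R t u) * φ u ∂volI| ≤ 0 := ge_of_tendsto' h2 h1
  have h4 := abs_nonpos_iff.1 h3
  simp only [sub_mul] at h4
  rw [integral_sub (H.profile.integrable_mul ht hφ.measurable hC)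
    (H'.profile.integrable_mul ht hφ.measurable hC)] at h4
  linarith

end ReactionUnique

/-! ### The limit of strong reservoirs -/

section Relax

variable {γ α β T : ℝ} {g : ℝ → ℝ}

/-- A version of the solution of the reaction equation that is defined for all times and
positions. -/
def relax (γ α β : ℝ) (g : ℝ → ℝ) (t u : ℝ) : ℝ :=
  rbar γ α β u + (g u - rbar γ α β u) * Real.exp (-(|t| * |V₁ γ u|))

lemma measurable_relax (γ α β : ℝ) (hg : Measurable g) :
    Measurable (Function.uncurry (relax γ α β g)) := by
  have h1 := (measurable_rbar γ α β).comp (measurable_snd : Measurable (Prod.snd : ℝ × ℝ → ℝ))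
  have h2 := hg.comp (measurable_snd : Measurable (Prod.snd : ℝ × ℝ → ℝ))
  have h3 := (measurable_V₁ γ).comp (measurable_snd : Measurable (Prod.snd : ℝ × ℝ → ℝ))
  have h4 : Measurable fun p : ℝ × ℝ => Real.exp (-(|p.1| * |V₁ γ p.2|)) :=
    (((measurable_fst (β := ℝ)).abs.mul h3.abs).neg).exp
  exact h1.add ((h2.sub h1).mul h4)

lemma relax_mem_Icc (hγ : 0 < γ) (hα : 0 ≤ α) (hα' : α ≤ 1) (hβ : 0 ≤ β) (hβ' : β ≤ 1)
    (hg : ∀ u, g u ∈ Icc (0 : ℝ) 1) (t u : ℝ) : relax γ α β g t u ∈ Icc (0 : ℝ) 1 :=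
  convex_exp_mem_Icc (rbar_mem_Icc hγ hα hα' hβ hβ' u) (hg u) (by positivity)

lemma exp_abs_ae_eq (hγ : 0 < γ) {t : ℝ} (ht : 0 ≤ t) :
    (fun u => Real.exp (-(|t| * |V₁ γ u|))) =ᵐ[volI] fun u => Real.exp (-t * V₁ γ u) := by
  filter_upwards [ae_mem_volI] with u hu
  rw [abs_of_nonneg ht, abs_of_pos (V₁_pos hγ hu), neg_mul]

lemma rhoInf_ae_eq_relax (hγ : 0 < γ) {g' : ℝ → ℝ} (hg : g =ᵐ[volI] g') {t : ℝ} (ht : 0 ≤ t) :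
    rhoInf γ α β g t =ᵐ[volI] relax γ α β g' t := by
  filter_upwards [ae_mem_volI, hg, exp_abs_ae_eq hγ ht] with u hu hu' he
  rw [relax, he, rhoInf, rbar_of_mem hu, hu']

/-- With f = g - ρ̄ and e = e^{-tV₁}, the increment of f e is f(u) - f(v) times e(u) plus f(v) times
e(u) - e(v), where |f| ≤ 1 and 0 < e ≤ 1. The energy is controlled by those of ρ̄, f and e. The
assumption that g - ρ̄ has finite energy enters the strong reservoir limit here alone. -/
lemma lintegral_energy_relax_lt_top (hγ : 1 < γ) (hγ' : γ < 2)
    (hα : 0 ≤ α) (hα' : α ≤ 1) (hβ : 0 ≤ β) (hβ' : β ≤ 1) (hgm : Measurable g)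
    (hg : ∀ u, g u ∈ Icc (0 : ℝ) 1)
    (hE : sqInt (kerMeas γ) (gap fun u => g u - rbar γ α β u) < ⊤) :
    ∫⁻ t in Ioo 0 T, sqInt (kerMeas γ) (gap (relax γ α β g t)) < ⊤ := by
  have hγ0 : 0 < γ := by linarith
  have hmV := measurable_V₁ γ
  have hEr := sqInt_gap_rbar_lt_top (α := α) (β := β) hγ hγ'
  set f : ℝ → ℝ := fun u => g u - rbar γ α β u with hf
  have hfm : Measurable f := hgm.sub (measurable_rbar γ α β)
  have hf1 : ∀ u, |f u| ≤ 1 := fun u =>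
    abs_sub_le_one_of_mem_Icc (hg u) (rbar_mem_Icc hγ0 hα hα' hβ hβ' u)
  have hle : ∀ t ∈ Ioo 0 T, sqInt (kerMeas γ) (gap (relax γ α β g t))
      ≤ 2 * sqInt (kerMeas γ) (gap (rbar γ α β)) + 2 * (2 * sqInt (kerMeas γ) (gap f)
        + 2 * sqInt (kerMeas γ) (gap fun u => Real.exp (-t * V₁ γ u))) := fun t ht => by
    refine (sqInt_gap_add_le γ (measurable_rbar γ α β)).trans (add_le_add le_rfl
      (mul_le_mul_right ?_ _))
    set e : ℝ → ℝ := fun u => Real.exp (-(|t| * |V₁ γ u|)) with he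
    have hem : Measurable e := by fun_prop
    have he1 : ∀ u, |e u| ≤ 1 := fun u => by
      rw [he, abs_of_pos (Real.exp_pos _)]
      exact Real.exp_le_one_iff.2 (neg_nonpos.2 (by positivity))
    rw [← sqInt_kerMeas_congr γ (exp_abs_ae_eq hγ0 ht.1.le)]
    have hsplit : (gap fun u => f u * e u) = fun p => gap f p * e p.1 + f p.2 * gap e p := by
      funext p; simp only [gap]; ring
    calc sqInt (kerMeas γ) (gap fun u => f u * e u)
        ≤ 2 * sqInt (kerMeas γ) (fun p => gap f p * e p.1)
          + 2 * sqInt (kerMeas γ) (fun p => f p.2 * gap e p) := by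
          rw [hsplit]
          exact sqInt_add_le ((measurable_gap hfm).mul (hem.comp measurable_fst)).aemeasurable
      _ ≤ _ := by
          refine add_le_add (mul_le_mul_right (sqInt_mono (ae_of_all _ fun p => ?_)) _)
            (mul_le_mul_right (sqInt_mono (ae_of_all _ fun p => ?_)) _)
          · rw [abs_mul]
            exact mul_le_of_le_one_right (abs_nonneg _) (he1 _)
          · rw [abs_mul]
            exact mul_le_of_le_one_left (abs_nonneg _) (hf1 _)
  refine lt_of_le_of_lt (setLIntegral_mono' measurableSet_Ioo hle) ?_
  rw [lintegral_add_left measurable_const, lintegral_const_mul' (2 : ℝ≥0∞) (fun t =>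
      2 * sqInt (kerMeas γ) (gap f)
        + 2 * sqInt (kerMeas γ) (gap fun u => Real.exp (-t * V₁ γ u))) (by simp),
    lintegral_add_left measurable_const, lintegral_const_mul' (2 : ℝ≥0∞) (fun t =>
      sqInt (kerMeas γ) (gap fun u => Real.exp (-t * V₁ γ u))) (by simp),
    setLIntegral_const, setLIntegral_const, Real.volume_Ioo]
  exact ENNReal.add_lt_top.2 ⟨ENNReal.mul_lt_top (ENNReal.mul_lt_top (by simp) hEr)
    ENNReal.ofReal_lt_top, ENNReal.mul_lt_top (by simp) (ENNReal.add_lt_top.2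
    ⟨ENNReal.mul_lt_top (ENNReal.mul_lt_top (by simp) hE) ENNReal.ofReal_lt_top,
      ENNReal.mul_lt_top (by simp) (lintegral_energy_exp_lt_top hγ0 hγ' T)⟩)⟩

lemma lintegral_pot_relax_lt_top (hγ : 0 < γ)
    (hα : 0 ≤ α) (hα' : α ≤ 1) (hβ : 0 ≤ β) (hβ' : β ≤ 1) (hg : ∀ u, g u ∈ Icc (0 : ℝ) 1) :
    ∫⁻ t in Ioo 0 T, sqInt (potMeas γ) (fun u => relax γ α β g t u - rbar γ α β u) < ⊤ := by
  refine lt_of_le_of_lt (setLIntegral_mono' measurableSet_Ioo fun t ht => ?_)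
    (lintegral_pot_exp_lt_top hγ T)
  rw [← sqInt_potMeas_congr γ (exp_abs_ae_eq hγ ht.1.le)]
  refine sqInt_mono (ae_of_all _ fun u => ?_)
  rw [relax, add_sub_cancel_left, abs_mul]
  exact mul_le_of_le_one_left (abs_nonneg _)
    (abs_sub_le_one_of_mem_Icc (hg u) (rbar_mem_Icc hγ hα hα' hβ hβ' u))

lemma lintegral_Ioo_comp_mul (F : ℝ → ℝ≥0∞) {κ : ℝ} (hκ : 0 < κ) (T : ℝ) :
    ∫⁻ s in Ioo 0 (T / κ), F (κ * s) = ENNReal.ofReal κ⁻¹ * ∫⁻ t in Ioo 0 T, F t := by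
  have hpre : (fun s => κ * s) ⁻¹' Ioo 0 T = Ioo 0 (T / κ) := by
    ext s
    simp only [mem_preimage, mem_Ioo, lt_div_iff₀ hκ, mul_comm s κ]
    constructor
    · rintro ⟨h1, h2⟩; exact ⟨(mul_pos_iff_of_pos_left hκ).1 h1, h2⟩
    · rintro ⟨h1, h2⟩; exact ⟨mul_pos hκ h1, h2⟩
  have hemb : MeasurableEmbedding fun s : ℝ => κ * s := measurableEmbedding_mulLeft₀ hκ.ne'
  have h := hemb.restrict_map (volume : Measure ℝ) (Ioo 0 T)
  rw [Real.map_volume_mul_left hκ.ne', hpre, Measure.restrict_smul, abs_of_pos (inv_pos.2 hκ)] at h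
  rw [← hemb.lintegral_map (μ := volume.restrict (Ioo 0 (T / κ))) F, ← h, lintegral_smul_measure,
    smul_eq_mul]

/-- The error of the rescaled solution solves an evolution equation with source `𝕃 ρ^∞`. -/
lemma IsBumpSolution.isEvolution_relax (hγ : 1 < γ) (hγ' : γ < 2)
    (hα : 0 ≤ α) (hα' : α ≤ 1) (hβ : 0 ≤ β) (hβ' : β ≤ 1) (hT : 0 ≤ T) {κ : ℝ} (hκ : 1 ≤ κ)
    {g' : ℝ → ℝ} {ρ ρ' : ℝ → ℝ → ℝ} (H : IsBumpSolution γ α β T κ g ρ ρ')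
    (HR : IsReactionWeakSolution γ α β T 1 g (rhoInf γ α β g))
    (hgg : g =ᵐ[volI] g') (hgm : Measurable g') (hg : ∀ u, g' u ∈ Icc (0 : ℝ) 1)
    (hE : ∫⁻ t in Ioo 0 T, sqInt (kerMeas γ) (gap (relax γ α β g' t)) < ⊤) :
    IsEvolution γ κ 0 0 (T / κ) 1 (fun s u => ρ' s u - relax γ α β g' (κ * s) u)
      (fun s => relax γ α β g' (κ * s)) (fun _ _ => 0) fun _ => 0 := by
  have hγ0 : 0 < γ := by linarith
  have hκ0 : 0 < κ := by linarith
  -- For κ ≥ 1 the time interval (0, T/κ) lies inside (0, T), where ρ is a solution.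
  have hTκ : T / κ ≤ T := div_le_self hT hκ
  have hmem := relax_mem_Icc hγ0 hα hα' hβ hβ' hg
  have hmR := measurable_relax γ α β hgm
  have hmσ : Measurable (Function.uncurry fun s => relax γ α β g' (κ * s)) :=
    hmR.comp ((measurable_fst.const_mul κ).prodMk measurable_snd)
  have hmr := measurable_const_uncurry (measurable_rbar γ α β)
  have hbr : ∀ u, rbar γ α β u ∈ Icc (0 : ℝ) 1 := rbar_mem_Icc hγ0 hα hα' hβ hβ'
  have hEσ : ∫⁻ s in Ioo 0 (T / κ), sqInt (kerMeas γ) (gap (relax γ α β g' (κ * s))) < ⊤ := by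
    rw [lintegral_Ioo_comp_mul (fun t => sqInt (kerMeas γ) (gap (relax γ α β g' t))) hκ0]
    exact ENNReal.mul_lt_top ENNReal.ofReal_lt_top hE
  have hPσ : ∫⁻ s in Ioo 0 (T / κ), sqInt (potMeas γ)
      (fun u => relax γ α β g' (κ * s) u - rbar γ α β u) < ⊤ := by
    rw [lintegral_Ioo_comp_mul (fun t => sqInt (potMeas γ)
      (fun u => relax γ α β g' t u - rbar γ α β u)) hκ0]
    exact ENNReal.mul_lt_top ENNReal.ofReal_lt_top
      (lintegral_pot_relax_lt_top hγ0 hα hα' hβ hβ' hg)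
  have hsub : Ioo 0 (T / κ) ⊆ Ioo 0 T := Ioo_subset_Ioo_right hTκ
  refine ⟨H.meas.sub hmσ, hmσ, measurable_const,
    fun t u => abs_sub_le_one_of_mem_Icc (H.mem_Icc t u) (hmem _ u),
    fun t u => abs_le_one_of_mem_Icc (hmem _ u), fun _ _ => by simp, ?_, ?_, hEσ,
    by simp [sqInt_zero], ?_⟩
  · refine lt_of_le_of_lt (lintegral_mono fun t => sqInt_gap_sub_le γ (measurable_slice H.meas t))
      ?_
    rw [lintegral_add_left ((measurable_sqInt (measurable_gap_uncurry H.meas)).const_mul 2),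
      lintegral_const_mul' _ _ (by simp), lintegral_const_mul' _ _ (by simp)]
    exact ENNReal.add_lt_top.2 ⟨ENNReal.mul_lt_top (by simp)
      ((lintegral_mono_set hsub).trans_lt H.energy), ENNReal.mul_lt_top (by simp) hEσ⟩
  · have : ∀ t, sqInt (potMeas γ) (fun u => ρ' t u - relax γ α β g' (κ * t) u)
        ≤ 2 * sqInt (potMeas γ) (fun u => ρ' t u - rbar γ α β u)
          + 2 * sqInt (potMeas γ) (fun u => relax γ α β g' (κ * t) u - rbar γ α β u) := fun t => by
      have := sqInt_sub_le (ν := potMeas γ) (f := fun u => ρ' t u - rbar γ α β u)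
        (g := fun u => relax γ α β g' (κ * t) u - rbar γ α β u)
        (measurable_slice H.measurable_sub_rbar t).aemeasurable
      simpa only [sub_sub_sub_cancel_right] using this
    refine lt_of_le_of_lt (lintegral_mono this) ?_
    rw [lintegral_add_left ((measurable_sqInt H.measurable_sub_rbar).const_mul 2),
      lintegral_const_mul' _ _ (by simp), lintegral_const_mul' _ _ (by simp)]
    exact ENNReal.add_lt_top.2 ⟨ENNReal.mul_lt_top (by simp)
      ((lintegral_mono_set hsub).trans_lt H.pot), ENNReal.mul_lt_top (by simp) hPσ⟩
  · filter_upwards [H.version_Ioo] with t hv ht φ hφ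
    obtain ⟨B₁, hB₁⟩ := hφ.exists_regLap_bound hγ0 hγ'
    obtain ⟨B₂, hB₂⟩ := hφ.exists_bound_mul_V₁ hγ0
    obtain ⟨B₃, hB₃⟩ := hφ.exists_bound
    have hm1 := hφ.measurable_regLap hγ0 hγ'
    have hm2 := hφ.measurable_mul_V₁ γ
    have hκt : κ * t ∈ Icc 0 T := by
      refine ⟨mul_nonneg hκ0.le ht.1.le, ?_⟩
      have := (lt_div_iff₀ hκ0).1 ht.2
      linarith
    have e1 := H.weak t (Ioo_subset_Icc_self (hsub ht)) φ hφ
    have e2 := HR.integral_eq hγ0 hα hα' hβ hβ' hmR hmem (by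
      filter_upwards [ae_restrict_mem measurableSet_Icc] with s hs
      exact rhoInf_ae_eq_relax hγ0 hgg hs.1) hκt hφ
    have e3 : ∫ u, ρ t u * φ u ∂volI = ∫ u, ρ' t u * φ u ∂volI := by
      refine integral_congr_ae ?_
      filter_upwards [hv (hsub ht)] with u hu
      rw [hu]
    have e4 : ∫ u, rhoInf γ α β g (κ * t) u * φ u ∂volI
        = ∫ u, relax γ α β g' (κ * t) u * φ u ∂volI := by
      refine integral_congr_ae ?_
      filter_upwards [rhoInf_ae_eq_relax (α := α) (β := β) hγ0 hgg hκt.1] with u hu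
      rw [hu]
    -- The change of variables turns the reaction term over (0, κt) into κ times an integral over
    -- (0, t), matching the rate κ in the equation of ρ. The two reaction terms combine into -κ V₁
    -- w, and only 𝕃(w + σ) remains.
    have e5 := intervalIntegral.mul_integral_comp_mul_left (a := 0) (b := t)
      (f := fun s => ∫ u, (relax γ α β g' s u - rbar γ α β u) * (φ u * V₁ γ u) ∂volI) κ
    rw [mul_zero] at e5
    have hb1 : ∀ s u, |ρ' s u - rbar γ α β u| ≤ 1 := fun s u =>
      abs_sub_le_one_of_mem_Icc (H.mem_Icc s u) (hbr u)
    have hb2 : ∀ s u, |relax γ α β g' (κ * s) u - rbar γ α β u| ≤ 1 := fun s u =>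
      abs_sub_le_one_of_mem_Icc (hmem _ u) (hbr u)
    have hmσr : Measurable (Function.uncurry fun s u => relax γ α β g' (κ * s) u - rbar γ α β u) :=
      hmσ.sub hmr
    simp only [sub_add_cancel, zero_mul, sub_zero, zero_add]
    simp only [sub_mul (ρ' t _)]
    rw [integral_sub (integrable_mul_of_bounded (measurable_slice H.meas t) (H.abs_le_one t)
        hφ.measurable hB₃) (integrable_mul_of_bounded (measurable_slice hmσ t)
        (fun u => abs_le_one_of_mem_Icc (hmem _ u)) hφ.measurable hB₃), ← e3, ← e4, e1, e2, ← e5,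
      add_sub_sub_cancel, add_comm, ← intervalIntegral.integral_const_mul,
      ← intervalIntegral.integral_add]
    · refine intervalIntegral.integral_congr fun s _ => ?_
      have j3 := integrable_mul_of_bounded (measurable_slice H.measurable_sub_rbar s) (hb1 s) hm2
        hB₂
      have j4 := integrable_mul_of_bounded (measurable_slice hmσr s) (hb2 s) hm2 hB₂
      have e6 : ∫ u, (ρ' s u - relax γ α β g' (κ * s) u) * (φ u * V₁ γ u) ∂volI
          = (∫ u, (ρ' s u - rbar γ α β u) * (φ u * V₁ γ u) ∂volI)
            - ∫ u, (relax γ α β g' (κ * s) u - rbar γ α β u) * (φ u * V₁ γ u) ∂volI := by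
        rw [← integral_sub j3 j4]
        refine integral_congr_ae (ae_of_all _ fun u => ?_)
        simp only; ring
      simp only [e6]; ring
    · exact (intervalIntegrable_pairing hmσr hb2 hm2 hB₂ 0 t).const_mul κ
    · exact (intervalIntegrable_pairing H.meas H.abs_le_one hm1 hB₁ 0 t).sub
        ((intervalIntegrable_pairing H.measurable_sub_rbar hb1 hm2 hB₂ 0 t).const_mul κ)

/-- The error w_s = ρ^κ_s - ρ^∞_{κs} starts from zero, so κ ∫ P(w_s) ds over (0, T/κ) is at most ∫
E(ρ^∞_{κs}) ds = J/κ. After the change of time t = κs the left side is the squared distance, the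
factor κ cancelling the Jacobian, and the rate is O(1/κ). -/
theorem tendsto_bochnerV₁NormSq (hγ : 1 < γ) (hγ' : γ < 2)
    (hα : 0 ≤ α) (hα' : α ≤ 1) (hβ : 0 ≤ β) (hβ' : β ≤ 1) (hT : 0 < T)
    (hg : ∀ u ∈ Icc (0 : ℝ) 1, g u ∈ Icc (0 : ℝ) 1) (hgm : AEMeasurable g volI)
    (hS : MemSobolev γ fun u => g u - rhoBarInf γ α β u) {ρ : ℝ → ℝ → ℝ → ℝ}
    (hρ : ∀ κ : ℝ, 0 < κ → IsWeakSolution γ α β T κ g (ρ κ)) :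
    Tendsto (fun κ : ℝ => bochnerV₁NormSq γ T
      fun t u => ρ κ (t / κ) u - rhoInf γ α β g t u) atTop (𝓝 0) := by
  have hγ0 : 0 < γ := by linarith
  obtain ⟨C, hC0, hC⟩ := exists_hardy hγ
  have HR := isReactionWeakSolution_rhoInf hγ0 hα hα' hβ hβ' hT.le hg hgm
  -- A Borel version of the datum with values in [0,1] on the whole line, as needed for the jointly
  -- measurable `relax`.
  obtain ⟨g', hgm', hg', hgg⟩ : ∃ g' : ℝ → ℝ, Measurable g' ∧ (∀ u, g' u ∈ Icc (0 : ℝ) 1) ∧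
      g =ᵐ[volI] g' := by
    refine ⟨fun u => max 0 (min 1 (hgm.mk g u)),
      measurable_const.max (measurable_const.min hgm.measurable_mk),
      fun u => ⟨le_max_left _ _, max_le zero_le_one (min_le_left _ _)⟩, ?_⟩
    filter_upwards [hgm.ae_eq_mk, ae_mem_volI] with u hu huI
    have h1 := hg u (Ioo_subset_Icc_self huI)
    rw [hu] at h1 ⊢
    rw [min_eq_right h1.2, max_eq_right h1.1]
  have hEf : sqInt (kerMeas γ) (gap fun u => g' u - rbar γ α β u) < ⊤ := by
    have h1 : (fun u => g' u - rbar γ α β u) =ᵐ[volI] fun u => g u - rhoBarInf γ α β u := by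
      filter_upwards [hgg, ae_mem_volI] with u hu huI
      rw [hu, rbar_of_mem huI]
    rw [sqInt_kerMeas_congr γ h1, ← seminormSq_eq hγ0 hS.1]
    exact lt_of_le_of_lt le_add_self hS.2
  have hE := lintegral_energy_relax_lt_top (T := T) hγ hγ' hα hα' hβ hβ' hgm' hg' hEf
  set J := ∫⁻ t in Ioo 0 T, sqInt (kerMeas γ) (gap (relax γ α β g' t)) with hJ
  have hlim : Tendsto (fun κ : ℝ => ENNReal.ofReal κ⁻¹ * J) atTop (𝓝 0) := by
    have h1 := ENNReal.tendsto_ofReal (tendsto_inv_atTop_zero (𝕜 := ℝ))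
    have h2 := ENNReal.Tendsto.mul_const h1 (Or.inr hE.ne)
    simpa using h2
  refine tendsto_of_tendsto_of_tendsto_of_le_of_le' tendsto_const_nhds hlim
    (Eventually.of_forall fun _ => zero_le) ?_
  filter_upwards [eventually_ge_atTop 1] with κ hκ
  have hκ0 : 0 < κ := by linarith
  obtain ⟨ρ', H⟩ := (hρ κ hκ0).exists_isBumpSolution hγ hγ' hα hα' hβ hβ' hκ0.le
  have hev := H.isEvolution_relax hγ hγ' hα hα' hβ hβ' hT.le hκ HR hgg hgm' hg' hE
  have hsc := lintegral_Ioo_comp_mul (fun t => sqInt (kerMeas γ) (gap (relax γ α β g' t))) hκ0 T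
  obtain ⟨-, -, h3⟩ := hev.energy_of_zero hγ hγ' hκ0.le hC0 hC (div_pos hT hκ0)
    (K := ENNReal.ofReal κ⁻¹ * J) (by
      rw [hsc]; simp [sqInt_zero, hJ])
  refine le_trans (le_of_eq ?_) h3
  have hsc' := lintegral_Ioo_comp_mul (fun t => l2V₁NormSq γ
    fun u => ρ κ (t / κ) u - rhoInf γ α β g t u) hκ0 T
  have e : ∫⁻ s in Ioo 0 (T / κ), l2V₁NormSq γ
        (fun u => ρ κ (κ * s / κ) u - rhoInf γ α β g (κ * s) u)
      = ∫⁻ s in Ioo 0 (T / κ), sqInt (potMeas γ)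
        (fun u => ρ' s u - relax γ α β g' (κ * s) u) := by
    refine setLIntegral_congr_fun_ae measurableSet_Ioo ?_
    filter_upwards [H.version_Ioo] with s hs hst
    have hsT : s ∈ Ioo 0 T := ⟨hst.1, hst.2.trans_le (div_le_self hT.le hκ)⟩
    rw [l2V₁NormSq_eq, mul_div_cancel_left₀ _ hκ0.ne']
    refine sqInt_potMeas_congr γ ?_
    filter_upwards [hs hsT, rhoInf_ae_eq_relax (α := α) (β := β) hγ0 hgg
      (mul_nonneg hκ0.le hst.1.le)] with u h1 h2
    rw [h1, h2]
  rw [e] at hsc'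
  rw [hsc', ← mul_assoc, ← ENNReal.ofReal_mul hκ0.le, mul_inv_cancel₀ hκ0.ne', ENNReal.ofReal_one,
    one_mul, bochnerV₁NormSq, lintegral_Icc_eq_Ioo]

end Relax

end RegionalFractional

end

/-! ### The main theorem -/

theorem mainTheorem2
    (γ : ℝ) (hγ : 1 < γ) (hγ' : γ < 2)
    (α β : ℝ) (hα : 0 < α) (hαβ : α ≤ β) (hβ : β < 1)
    (T : ℝ) (hT : 0 < T)
    (ρ₀ : ℝ → ℝ) (hρ₀ : ∀ u ∈ Set.Icc (0 : ℝ) 1, ρ₀ u ∈ Set.Icc (0 : ℝ) 1)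
    (hρ₀_meas : AEMeasurable ρ₀ (MeasureTheory.volume.restrict (Set.Ioo (0 : ℝ) 1)))
    (ρ : ℝ → ℝ → ℝ → ℝ)
    (hρ : ∀ κ : ℝ, 0 < κ → RegionalFractional.IsWeakSolution γ α β T κ ρ₀ (ρ κ)) :
    (∃ ρz : ℝ → ℝ → ℝ,
      RegionalFractional.IsWeakSolution γ α β T 0 ρ₀ ρz ∧
      (∀ r : ℝ → ℝ → ℝ, RegionalFractional.IsWeakSolution γ α β T 0 ρ₀ r →
        ∀ t ∈ Set.Icc (0 : ℝ) T,
          r t =ᵐ[MeasureTheory.volume.restrict (Set.Ioo (0 : ℝ) 1)] ρz t) ∧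
      Filter.Tendsto
        (fun κ : ℝ => RegionalFractional.bochnerSobolevNormSq γ T
          (fun t u => ρ κ t u - ρz t u))
        (nhdsWithin 0 (Set.Ioi 0)) (nhds 0)) ∧
    (RegionalFractional.MemSobolev γ
        (fun u => ρ₀ u - RegionalFractional.rhoBarInf γ α β u) →
      RegionalFractional.IsReactionWeakSolution γ α β T 1 ρ₀
        (RegionalFractional.rhoInf γ α β ρ₀) ∧
      (∀ r : ℝ → ℝ → ℝ, RegionalFractional.IsReactionWeakSolution γ α β T 1 ρ₀ r →
        ∀ t ∈ Set.Icc (0 : ℝ) T,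
          r t =ᵐ[MeasureTheory.volume.restrict (Set.Ioo (0 : ℝ) 1)]
            RegionalFractional.rhoInf γ α β ρ₀ t) ∧
      Filter.Tendsto
        (fun κ : ℝ => RegionalFractional.bochnerV₁NormSq γ T
          (fun t u => ρ κ (t / κ) u - RegionalFractional.rhoInf γ α β ρ₀ t u))
        Filter.atTop (nhds 0)) := by
  have hγ0 : 0 < γ := by linarith
  have hα' : α ≤ 1 := by linarith
  have hβ0 : 0 ≤ β := by linarith
  refine ⟨?_, fun hS => ?_⟩
  · obtain ⟨r, hr⟩ :=
      RegionalFractional.exists_isWeakSolution_zero hγ hγ' hα.le hα' hβ0 hβ.le hT hρ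
    exact ⟨r, hr, fun r' hr' t ht => hr'.ae_eq hγ hγ' hα.le hα' hβ0 hβ.le hT le_rfl hr ht,
      RegionalFractional.tendsto_bochnerSobolevNormSq hγ hγ' hα.le hα' hβ0 hβ.le hT hρ hr⟩
  · have HR := RegionalFractional.isReactionWeakSolution_rhoInf hγ0 hα.le hα' hβ0 hβ.le hT.le hρ₀
      hρ₀_meas
    exact ⟨HR, fun r hr t ht => hr.ae_eq hγ0 hα.le hα' hβ0 hβ.le HR ht,
      RegionalFractional.tendsto_bochnerV₁NormSq hγ hγ' hα.le hα' hβ0 hβ.le hT hρ₀ hρ₀_meas hS hρ⟩
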